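/- Let $d\ge 1$, let $\Omega$ be an open subset of $\mathbb R^d$ (possibly $\mathbb R^d$ itself) or the torus $\mathbb T^d$, and let $0<T<\infty$. Let $\rho,p\in L^\infty(\Omega\times(0,T))$, $u\in L^\infty(\Omega\times(0,T);\mathbb R^d)$, $f\in L^1(\Omega\times(0,T);\mathbb R^d)$ be a weak solution of the inhomogeneous incompressible Euler equations $$\partial_t(\rho u)+\operatorname{div}(\rho u\otimes u)+\nabla p=f,\qquad \partial_t\rho+\operatorname{div}(\rho u)=0,\qquad \operatorname{div}u=0,$$ that is, the first two equations hold in the sense of distributions on $\Omega\times(0,T)$, and $\operatorname{div}u_t=0$ in the sense of distributions on $\Omega$ for a.e. $t$. Assume that there is no vacuum: $\rho\ge c>0$ a.e. in $\Omega\times(0,T)$, for a constant $c$. Let $D[u]$ be the Duchon–Robert distribution on $\Omega\times(0,T)$, defined by $$\partial_t\Big(\rho\tfrac{|u|^2}{2}\Big)+\operatorname{div}\Big(\big(\rho\tfrac{|u|^2}{2}+p\big)u\Big)=-D[u]+f\cdot u .$$ Write $\mathcal M$ for finite Borel measures (scalar-, vector- or matrix-valued, with variation $|\cdot|$). For bounded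 measurable $g$ we say that $g\in L^1_tBV_x$ (respectively, for vector fields, $g\in L^1_tBD_x$) if for a.e. $t\in(0,T)$ the distributional gradient $\nabla g_t$ (respectively the symmetric gradient $Eg_t=\frac12(\nabla g_t+\nabla g_t^T)$) belongs to $\mathcal M(\Omega)$ and $\int_0^T|\nabla g_t|(\Omega)\,dt<\infty$ (respectively $\int_0^T|Eg_t|(\Omega)\,dt<\infty$). We say that $u\in BD_{x,t}$ if, with $U=(u,1)$, the space-time symmetric gradient $E_{x,t}U$ belongs to $\mathcal M(\Omega\times(0,T))$. (If $\Omega$ is unbounded, integrability of $g$ or $U$ over the whole domain is not required.) A superscript $s$ denotes the singular part with respect to Lebesgue measure, on $\Omega$ for $\nabla\rho_t$ and $Eu_t$, on $\Omega\times(0,T)$ for $E_{x,t}U$; and $\mu_t\otimes dt$ denotes the measure $A\mapsto\int_0^T\mu_t(\{x:(x,t)\in A\})\,dt$. Assume that $\rho\in L^1_tBV_x$. Then there is a constant $C$, depending only on $d$, on $c$ and on upper bounds for $\|\rho\|_{L^\infty}$, $\|u\|_{L^\infty}$ and $\|p\|_{L^\infty}$, such that the following hold. (i) If $u\in L^1_tBV_x$,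 then $D[u]\in\mathcal M(\Omega\times(0,T))$ and $|D[u]|\le C\,|\nabla^s\rho_t|\otimes dt$. (ii) If $u\in L^1_tBD_x$, then $D[u]\in\mathcal M(\Omega\times(0,T))$ and $|D[u]|\le C\big(|\nabla^s\rho_t|\otimes dt+|E^su_t|\otimes dt\big)$. (iii) If $u\in BD_{x,t}$, then $D[u]\in\mathcal M(\Omega\times(0,T))$ and $|D[u]|\le C\big(|\nabla^s\rho_t|\otimes dt+|E^s_{x,t}U|\big)$. All inequalities are between measures on $\Omega\times(0,T)$. -/

import Mathlib

open MeasureTheory Set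
open scoped NNReal ENNReal ContDiff RealInnerProductSpace

noncomputable section

namespace InhomEuler

/-! ### Finite vector-valued measures -/

section VectorMeasures

variable {X : Type*} [MeasurableSpace X] {ι : Type*} [Fintype ι]

/-- The `i`-th component of an `ℝ^ι`-valued finite measure. -/
def component (μ : VectorMeasure X (EuclideanSpace ℝ ι)) (i : ι) : SignedMeasure X :=
  let π : EuclideanSpace ℝ ι →L[ℝ] ℝ := EuclideanSpace.proj i
  μ.mapRange π.toLinearMap.toAddMonoidHom π.continuous

/-- The `ℝ^ι`-valued measure with given components. -/
def ofComponents (s : ι → SignedMeasure X) : VectorMeasure X (EuclideanSpace ℝ ι) where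
  measureOf' A := WithLp.toLp 2 fun i => s i A
  empty' := by ext i; simp
  not_measurable' A hA := by ext i; simp [VectorMeasure.not_measurable _ hA]
  m_iUnion' f hf hd := by
    have h : HasSum (fun n i => s i (f n)) (fun i => s i (⋃ n, f n)) :=
      Pi.hasSum.2 fun i => (s i).m_iUnion hf hd
    exact h.map (WithLp.linearEquiv 2 ℝ (ι → ℝ)).symm.toLinearMap.toAddMonoidHom
      (PiLp.continuous_toLp 2 _)

/-- The singular part `μˢ` in the Radon-Nikodym decomposition `μ = μᵃ + μˢ` of a vector-valued
measure `μ` with respect to `m`; it is taken component by component. -/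
def singularPart (μ : VectorMeasure X (EuclideanSpace ℝ ι)) (m : Measure X) :
    VectorMeasure X (EuclideanSpace ℝ ι) :=
  ofComponents fun i => (component μ i).singularPart m

end VectorMeasures

/-- The space `ℝ^d`. -/
abbrev E (d : ℕ) : Type := EuclideanSpace ℝ (Fin d)

/-- The `i`-th vector of the standard basis of `ℝ^d`. -/
def unitVec {d : ℕ} (i : Fin d) : E d := EuclideanSpace.single i 1

/-! ### The spatial domain and its test functions -/

/-- The spatial domain: an open subset of `ℝ^d` (possibly `ℝ^d` itself), or the flat torus
`𝕋^d = ℝ^d / ℤ^d`. -/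
inductive FlowDomain (d : ℕ) : Type
  | openSet (Ω : TopologicalSpace.Opens (E d))
  | torus

namespace FlowDomain

variable {d : ℕ}

/-- The set of points of the domain. The torus is represented by its fundamental cell `[0,1)^d`:
functions, measures and integrals on the torus are functions, measures and integrals on the cell.
(The periodicity is carried by the test functions.) -/
def cell : FlowDomain d → Set (E d)
  | openSet Ω => Ω
  | torus => {x | ∀ i, x i ∈ Ico (0 : ℝ) 1}

/-- The space-time region `Ω × (0,T)`. -/
def cyl (𝒟 : FlowDomain d) (T : ℝ) : Set (E d × ℝ) := 𝒟.cell ×ˢ Ioo 0 T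

/-- Scalar test functions on the domain: `C_c^∞(Ω)`, respectively `C^∞(𝕋^d)`, the latter being the
smooth functions on `ℝ^d` with period one in each coordinate. -/
def IsTest : FlowDomain d → (E d → ℝ) → Prop
  | openSet Ω, φ => ContDiff ℝ ∞ φ ∧ HasCompactSupport φ ∧ tsupport φ ⊆ (Ω : Set (E d))
  | torus, φ => ContDiff ℝ ∞ φ ∧ ∀ x i, φ (x + unitVec i) = φ x

/-- Test functions on space-time: `C_c^∞(Ω × (0,T); F)`. -/
def IsTimeTest {F : Type*} [NormedAddCommGroup F] [NormedSpace ℝ F] (T : ℝ) :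
    FlowDomain d → (E d × ℝ → F) → Prop
  | openSet Ω, φ => ContDiff ℝ ∞ φ ∧ HasCompactSupport φ ∧
      tsupport φ ⊆ (Ω : Set (E d)) ×ˢ Ioo 0 T
  | torus, φ => ContDiff ℝ ∞ φ ∧ (∀ x t i, φ (x + unitVec i, t) = φ (x, t)) ∧
      ∃ a b : ℝ, 0 < a ∧ b < T ∧ ∀ x t, t ∉ Icc a b → φ (x, t) = 0

end FlowDomain

/-! ### Distributional gradients that are finite measures -/

section Gradients

variable {X : Type*} [NormedAddCommGroup X] [NormedSpace ℝ X] [MeasureSpace X]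
  {ι : Type*} [Fintype ι]

/-- `G` is a finite `ℝ^ι`-valued measure on `Q` whose components are the distributional derivatives
of `f` in the directions `e i`, tested with the functions in the class `test`. -/
structure IsGradient (Q : Set X) (test : (X → ℝ) → Prop) (e : ι → X) (f : X → ℝ)
    (G : VectorMeasure X (EuclideanSpace ℝ ι)) : Prop where
  concentrated : G.variation Qᶜ = 0
  weak_eq : ∀ φ, test φ → ∀ i,
    (∫ᵛ x, φ x ∂•G) i = -∫ x in Q, f x * fderiv ℝ φ x (e i)

/-- `H` is a finite matrix-valued measure on `Q` that is the distributional symmetric gradient of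
the field `F = (F_i)`, `H_{ij} = (∂_i F_j + ∂_j F_i) / 2`, where `∂_i` is the derivative in the
direction `e i`. The variation of `H` is taken for the Frobenius norm of matrices. -/
structure IsSymGradient (Q : Set X) (test : (X → ℝ) → Prop) (e : ι → X) (F : X → ι → ℝ)
    (H : VectorMeasure X (EuclideanSpace ℝ (ι × ι))) : Prop where
  concentrated : H.variation Qᶜ = 0
  weak_eq : ∀ φ, test φ → ∀ i j,
    (∫ᵛ x, φ x ∂•H) (i, j) =
      -∫ x in Q, (F x j * fderiv ℝ φ x (e i) + F x i * fderiv ℝ φ x (e j)) / 2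

end Gradients

variable {d : ℕ}

/-- Integrability on all bounded parts of `Ω × (0,T)`. -/
def BddIntegrable {F : Type*} [NormedAddCommGroup F] (𝒟 : FlowDomain d) (T : ℝ)
    (g : E d × ℝ → F) : Prop :=
  ∀ R : ℝ, IntegrableOn g (𝒟.cyl T ∩ Metric.ball 0 R)

/-- `f` has spatial gradient `t ↦ ∇f_t = G t` in `L¹((0,T); 𝓜(Ω))`.

A function in `L¹((0,T); BV(Ω))` is one that has such a `G` and is in `L¹(Ω × (0,T))`. Here `f` is
asked to be integrable on bounded parts of `Ω × (0,T)` only: on a domain of infinite measure no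
density that is bounded below by a positive constant is integrable. -/
structure IsGradientCurve (𝒟 : FlowDomain d) (T : ℝ) (f : E d × ℝ → ℝ)
    (G : ℝ → VectorMeasure (E d) (EuclideanSpace ℝ (Fin d))) : Prop where
  integrable : BddIntegrable 𝒟 T f
  gradient : ∀ᵐ t ∂volume.restrict (Ioo 0 T),
    IsGradient 𝒟.cell 𝒟.IsTest unitVec (fun x => f (x, t)) (G t)
  norm_integrable : ∫⁻ t in Ioo 0 T, (G t).variation univ < ⊤

/-- `u` has spatial symmetric gradient `t ↦ E u_t = H t` in `L¹((0,T); 𝓜(Ω))`; this is membership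
in `L¹((0,T); BD(Ω))`, with integrability of `u` on bounded parts of `Ω × (0,T)`. -/
structure IsSymGradientCurve (𝒟 : FlowDomain d) (T : ℝ) (u : E d × ℝ → E d)
    (H : ℝ → VectorMeasure (E d) (EuclideanSpace ℝ (Fin d × Fin d))) : Prop where
  integrable : BddIntegrable 𝒟 T u
  symGradient : ∀ᵐ t ∂volume.restrict (Ioo 0 T),
    IsSymGradient 𝒟.cell 𝒟.IsTest unitVec (fun x i => u (x, t) i) (H t)
  norm_integrable : ∫⁻ t in Ioo 0 T, (H t).variation univ < ⊤

/-- The `d + 1` coordinate directions of space-time. -/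
def stVec : Fin d ⊕ Unit → E d × ℝ
  | .inl i => (unitVec i, 0)
  | .inr _ => (0, 1)

/-- The space-time field `U = (u, 1)`. -/
def stField (u : E d × ℝ → E d) (z : E d × ℝ) : Fin d ⊕ Unit → ℝ
  | .inl i => u z i
  | .inr _ => 1

/-- The finite measure `K` on `Ω × (0,T)` is the space-time symmetric gradient `E_{x,t} U` of
`U = (u, 1)`; this is membership of `u` in `BD_{x,t}`, with integrability on bounded parts of
`Ω × (0,T)`. -/
structure IsSpaceTimeSymGradient (𝒟 : FlowDomain d) (T : ℝ) (u : E d × ℝ → E d)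
    (K : VectorMeasure (E d × ℝ) (EuclideanSpace ℝ ((Fin d ⊕ Unit) × (Fin d ⊕ Unit)))) : Prop where
  integrable : BddIntegrable 𝒟 T u
  symGradient : IsSymGradient (𝒟.cyl T) (𝒟.IsTimeTest T) stVec (stField u) K

/-- The space-time measure `μ_t ⊗ dt` on `ℝ^d × (0,T)`, that is `A ↦ ∫_0^T μ_t(A_t) dt`, where
`A_t = {x | (x, t) ∈ A}`. -/
def tensorTime (T : ℝ) (μ : ℝ → Measure (E d)) : Measure (E d × ℝ) :=
  (volume.restrict (Ioo 0 T)).bind fun t => (μ t).map fun x => (x, t)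

/-- The measure `|∇ˢρ_t| ⊗ dt` (or `|Eˢu_t| ⊗ dt`) for the curve `G t = ∇ρ_t` (or `G t = E u_t`);
the singular part is the one with respect to Lebesgue measure on `ℝ^d`. -/
def singTensorTime {ι : Type*} [Fintype ι] (T : ℝ)
    (G : ℝ → VectorMeasure (E d) (EuclideanSpace ℝ ι)) : Measure (E d × ℝ) :=
  tensorTime T fun t => (singularPart (G t) volume).variation

/-! ### Weak solutions and the Duchon-Robert distribution -/

/-- Bounded weak solutions, with force `f ∈ L¹(Ω × (0,T))`, of
`∂_t(ρu) + div(ρ u ⊗ u) + ∇p = f`, `∂_t ρ + div(ρu) = 0`, `div u = 0`. -/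
structure IsWeakSolution (𝒟 : FlowDomain d) (T : ℝ) (ρ : E d × ℝ → ℝ) (u : E d × ℝ → E d)
    (p : E d × ℝ → ℝ) (f : E d × ℝ → E d) : Prop where
  density_memLp : MemLp ρ ⊤ (volume.restrict (𝒟.cyl T))
  velocity_memLp : MemLp u ⊤ (volume.restrict (𝒟.cyl T))
  pressure_memLp : MemLp p ⊤ (volume.restrict (𝒟.cyl T))
  force_integrable : IntegrableOn f (𝒟.cyl T)
  momentum : ∀ φ : E d × ℝ → E d, 𝒟.IsTimeTest T φ →
    ∫ z in 𝒟.cyl T,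
      (ρ z * ⟪u z, fderiv ℝ φ z (0, 1)⟫
        + ρ z * ∑ i, ∑ j, u z i * u z j * (fderiv ℝ φ z (unitVec i, 0)) j
        + p z * ∑ i, (fderiv ℝ φ z (unitVec i, 0)) i
        + ⟪f z, φ z⟫) = 0
  transport : ∀ φ : E d × ℝ → ℝ, 𝒟.IsTimeTest T φ →
    ∫ z in 𝒟.cyl T, ρ z * (fderiv ℝ φ z (0, 1) + fderiv ℝ φ z (u z, 0)) = 0
  incompressible : ∀ᵐ t ∂volume.restrict (Ioo 0 T), ∀ φ : E d → ℝ, 𝒟.IsTest φ →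
    ∫ x in 𝒟.cell, fderiv ℝ φ x (u (x, t)) = 0

/-- The Duchon-Robert distribution `D[u]`, as a functional on space-time test functions; it is
defined by the local energy balance
`∂_t(ρ|u|²/2) + div((ρ|u|²/2 + p) u) = -D[u] + f · u` in the sense of distributions. -/
def duchonRobert (𝒟 : FlowDomain d) (T : ℝ) (ρ : E d × ℝ → ℝ) (u : E d × ℝ → E d)
    (p : E d × ℝ → ℝ) (f : E d × ℝ → E d) (φ : E d × ℝ → ℝ) : ℝ :=
  ∫ z in 𝒟.cyl T,
    (ρ z * (‖u z‖ ^ 2 / 2) * fderiv ℝ φ z (0, 1)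
      + (ρ z * (‖u z‖ ^ 2 / 2) + p z) * fderiv ℝ φ z (u z, 0)
      + ⟪f z, u z⟫ * φ z)

/-- The distribution `D` on `Ω × (0,T)` is (the integration against) the finite signed Borel
measure `δ` on `Ω × (0,T)`. -/
structure IsRepresentedBy (𝒟 : FlowDomain d) (T : ℝ) (D : (E d × ℝ → ℝ) → ℝ)
    (δ : SignedMeasure (E d × ℝ)) : Prop where
  concentrated : δ.variation (𝒟.cyl T)ᶜ = 0
  apply_eq : ∀ φ : E d × ℝ → ℝ, 𝒟.IsTimeTest T φ → D φ = ∫ᵛ z, φ z ∂•δ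

end InhomEuler

end

namespace InhomEuler
open Filter Topology ProbabilityTheory
set_option linter.unusedSectionVars false

/-! Regularization. For a kernel K let w = (ρu)_K / ρ_K be the velocity averaged with weight ρ.
Mollifying the continuity and momentum equations gives ρ_K (∂_t + u·∇) w_i = C_i - ∂_i p_K + (f_i)_K
with the commutator C_i(z) = ∫ ρ(y) (u_i(y) - w_i(z)) ∇K(z-y)·(u(z) - u(y)) dy
(`LocalSolution.mul_fderiv_favre`). The momentum equation is then tested with φ w_i. In the
resulting balance (`LocalSolution.energy_identity`) the transport and force terms converge to those
of twice the Duchon-Robert distribution. What remains are the pressure terms and the commutator.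

Pressure. Since div u = 0, every derivative that falls on p_K or on w can be traded for derivatives
of the density: the divergence of ρu is u·∇ρ, with an error controlled by |∇ˢρ|
(`enorm_integral_mul_fderiv_field_le`). The contributions of the absolutely continuous part of ∇ρ
cancel in the limit and leave the expected 2 ∫ p u·∇φ; the rest is at most a constant times |∇ˢρ|
(`LocalSolution.enorm_pressureTerm_sub_le`, `LocalSolution.tendsto_energy`).

Commutator. For a fixed kernel k rescaled by ε, C_i is an integral over h of a bounded factor
u_i(z-εh) - w_i(z) times the difference quotient of ∇k(h)·u along h. The bounded factor tends to
zero almost everywhere, so the absolutely continuous part of the derivative disappears and only the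
singular part of ∇k(h)·∂_h u survives (`LocalSolution.enorm_energyDefect_le_of_kernel`). The shape
of k decides which derivatives are seen: - for a radial k the vector ∇k(h) is parallel to h, so only
h·(Eu)h enters, which gives (ii) and (iii); in (ii) time is rescaled so much faster than space that
no time derivative is needed, while in (iii) the rescaling is isotropic and U = (u, 1) is used; -
for (i) the derivative of u is a trace free matrix density Q against a finite measure, and k is a
product kernel with spatial factor η. The commutator costs ∫ |∇η(x)·Qx| dx, and averaging a kernel
along the volume preserving flow of a trace free Q makes this arbitrarily small
(`exists_isMollifier_lintegral_lt`). The kernel cannot depend on the point, but the resulting bounds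
on a single functional can be combined point by point (`enorm_le_of_forall_density`), so the whole
velocity term drops out.

Conclusion. A functional dominated by the `L¹` norm of a finite measure is integration against a
density of modulus at most one (`exists_density_of_abs_le`), which turns the estimates into
statements about measures.

Two preparations surround this core. The gradients, given only for almost every time and only
through test functions, are shown to be measurable in time and to have a jointly measurable Lebesgue
decomposition (`exists_lebesgue_decomposition`, `exists_density_of_curve`). The problem is
transferred to a bounded open set of space-time, where everything can be extended to integrable
functions (the density after subtracting `c`); the torus is unfolded into a box with a partition of
unity (`Localization`). The constants do not depend on that set. -/

/-! ### Functionals dominated by a finite measure -/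

section Representation

variable {X : Type*} [MeasurableSpace X]

/-- A bounded functional on `L¹` of a finite measure is the integration against a bounded
function. -/
theorem exists_density_of_L1_dual (μ : Measure X) [IsFiniteMeasure μ]
    (g : StrongDual ℝ (Lp ℝ 1 μ)) (hg : ‖g‖ ≤ 1) :
    ∃ θ : X → ℝ, Measurable θ ∧ (∀ x, |θ x| ≤ 1) ∧
      ∀ f : X → ℝ, ∀ h1 : MemLp f 1 μ, MemLp f 2 μ → g (h1.toLp f) = ∫ x, f x * θ x ∂μ := by
  have hmem : ∀ f : Lp ℝ 2 μ, MemLp f 1 μ := fun f =>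
    (Lp.memLp f).mono_exponent (by norm_num)
  let T0 : Lp ℝ 2 μ →ₗ[ℝ] Lp ℝ 1 μ :=
    { toFun := fun f => (hmem f).toLp f
      map_add' := fun f f' => by
        rw [← MemLp.toLp_add]
        exact MemLp.toLp_congr _ _ (Lp.coeFn_add f f')
      map_smul' := fun c f => by
        simp only [RingHom.id_apply]
        rw [← MemLp.toLp_const_smul]
        exact MemLp.toLp_congr _ _ (Lp.coeFn_smul c f) }
  have hT0 : ∀ f, ‖T0 f‖ ≤ (μ univ ^ (1 / 2 : ℝ)).toReal * ‖f‖ := by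
    intro f
    have h1 : eLpNorm f 1 μ ≤ eLpNorm f 2 μ * μ univ ^ (1 / 2 : ℝ) := by
      have := eLpNorm_le_eLpNorm_mul_rpow_measure_univ (μ := μ) (f := f) (p := 1) (q := 2)
        (by norm_num) (Lp.aestronglyMeasurable f)
      convert this using 3
      norm_num
    change ‖(hmem f).toLp f‖ ≤ _
    rw [Lp.norm_toLp, Lp.norm_def, ← ENNReal.toReal_mul, mul_comm]
    refine ENNReal.toReal_mono ?_ h1
    exact ENNReal.mul_ne_top (Lp.memLp f).2.ne (by finiteness)
  let T : Lp ℝ 2 μ →L[ℝ] Lp ℝ 1 μ := T0.mkContinuous _ hT0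
  let θ0 : Lp ℝ 2 μ := (InnerProductSpace.toDual ℝ (Lp ℝ 2 μ)).symm (g.comp T)
  have hθ0 : ∀ f : X → ℝ, ∀ h1 : MemLp f 1 μ, MemLp f 2 μ →
      g (h1.toLp f) = ∫ x, f x * θ0 x ∂μ := by
    intro f h1 h2
    have e1 : (g.comp T) (h2.toLp f) = g (h1.toLp f) := by
      have : T (h2.toLp f) = h1.toLp f :=
        MemLp.toLp_congr (hmem _) h1 h2.coeFn_toLp
      simp [this]
    rw [← e1, ← InnerProductSpace.toDual_symm_apply, L2.inner_def]
    refine integral_congr_ae ?_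
    filter_upwards [h2.coeFn_toLp] with x hx
    rw [hx]; simp [θ0]
  have hint : Integrable θ0 μ := memLp_one_iff_integrable.1 (hmem θ0)
  -- Indicators as test functions bound the averages of `θ0` over all measurable sets by one; hence
  -- `|θ0| ≤ 1` almost everywhere.
  have hind : ∀ A, MeasurableSet A → |∫ x in A, θ0 x ∂μ| ≤ μ.real A := by
    intro A hA
    have hm : ∀ q, MemLp (A.indicator fun _ => (1 : ℝ)) q μ := fun q =>
      (memLp_const 1).indicator hA
    have e := hθ0 _ (hm 1) (hm 2)
    have e2 : ∫ x, A.indicator (fun _ => (1 : ℝ)) x * θ0 x ∂μ = ∫ x in A, θ0 x ∂μ := by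
      rw [← integral_indicator hA]
      congr 1; ext x; by_cases hx : x ∈ A <;> simp [hx]
    rw [← e2, ← e, ← Real.norm_eq_abs]
    refine (g.le_opNorm _).trans ?_
    refine (mul_le_of_le_one_left (norm_nonneg _) hg).trans ?_
    rw [Lp.norm_toLp, eLpNorm_indicator_const hA one_ne_zero ENNReal.one_ne_top]
    simp [measureReal_def]
  have hle : ∀ᵐ x ∂μ, θ0 x ≤ 1 := by
    refine ae_le_of_forall_setIntegral_le hint (integrable_const _) fun A hA _ => ?_
    simpa using (abs_le.1 (hind A hA)).2
  have hge : ∀ᵐ x ∂μ, -1 ≤ θ0 x := by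
    refine ae_le_of_forall_setIntegral_le (integrable_const _) hint fun A hA _ => ?_
    simpa using (abs_le.1 (hind A hA)).1
  -- The bound is wanted at every point, so a measurable representative is truncated; this alters it
  -- on a null set only.
  refine ⟨fun x => max (-1) (min 1 ((Lp.aestronglyMeasurable θ0).mk θ0 x)), ?_, ?_, ?_⟩
  · have := (Lp.aestronglyMeasurable θ0).stronglyMeasurable_mk.measurable
    fun_prop
  · intro x; rw [abs_le]; constructor
    · exact le_max_left _ _
    · exact max_le (by norm_num) (min_le_left _ _)
  · intro f h1 h2
    rw [hθ0 f h1 h2]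
    refine integral_congr_ae ?_
    filter_upwards [hle, hge, (Lp.aestronglyMeasurable θ0).ae_eq_mk] with x h1 h2 h3
    rw [← h3, min_eq_right h1, max_eq_right h2]

/-- A linear functional on a space of bounded functions which is dominated by the `L¹` norm of a
finite measure is the integration against a density of absolute value at most one. -/
theorem exists_density_of_abs_le (μ : Measure X) [IsFiniteMeasure μ] (P : (X → ℝ) → Prop)
    (L : (X → ℝ) → ℝ) (hadd : ∀ φ ψ, P φ → P ψ → P (φ + ψ) ∧ L (φ + ψ) = L φ + L ψ)
    (hsmul : ∀ (a : ℝ) φ, P φ → P (a • φ) ∧ L (a • φ) = a * L φ)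
    (hmeas : ∀ φ, P φ → Measurable φ) (hbdd : ∀ φ, P φ → ∃ C, ∀ x, |φ x| ≤ C)
    (hL : ∀ φ, P φ → |L φ| ≤ ∫ x, |φ x| ∂μ) :
    ∃ θ : X → ℝ, Measurable θ ∧ (∀ x, |θ x| ≤ 1) ∧ ∀ φ, P φ → L φ = ∫ x, φ x * θ x ∂μ := by
  by_cases hne : ∃ φ, P φ
  swap
  · exact ⟨0, measurable_const, by simp, fun φ hφ => (hne ⟨φ, hφ⟩).elim⟩
  have hmem : ∀ φ, P φ → ∀ q, MemLp φ q μ := fun φ hφ q => by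
    obtain ⟨C, hC⟩ := hbdd φ hφ
    exact MemLp.of_bound (hmeas φ hφ).aestronglyMeasurable C (ae_of_all _ hC)
  have hN : ∀ φ (hφ : P φ), ‖(hmem φ hφ 1).toLp φ‖ = ∫ x, |φ x| ∂μ := fun φ hφ => by
    rw [Lp.norm_toLp, eLpNorm_one_eq_lintegral_enorm, ← integral_norm_eq_lintegral_enorm
      (hmeas φ hφ).aestronglyMeasurable]
    simp
  let S : Submodule ℝ (X → ℝ) :=
    { carrier := {φ | P φ}
      add_mem' := fun ha hb => (hadd _ _ ha hb).1
      zero_mem' := by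
        obtain ⟨φ, hφ⟩ := hne
        simpa using (hsmul 0 φ hφ).1
      smul_mem' := fun a φ h => (hsmul a φ h).1 }
  let Φ : S →ₗ[ℝ] Lp ℝ 1 μ :=
    { toFun := fun φ => (hmem φ φ.2 1).toLp φ
      map_add' := fun φ ψ => MemLp.toLp_add _ _
      map_smul' := fun a φ => MemLp.toLp_const_smul _ _ }
  let L' : S →ₗ[ℝ] ℝ :=
    { toFun := fun φ => L φ
      map_add' := fun φ ψ => (hadd _ _ φ.2 ψ.2).2
      map_smul' := fun a φ => (hsmul a _ φ.2).2 }
  have hΦ : ∀ φ : S, ‖Φ φ‖ = ∫ x, |(φ : X → ℝ) x| ∂μ := fun φ => hN φ φ.2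
  have hker : ∀ φ : S, |L' φ| ≤ ‖Φ φ‖ := fun φ => by rw [hΦ]; exact hL φ φ.2
  have hex : ∀ y : LinearMap.range Φ, ∃ φ : S, Φ φ = y := fun y => y.2
  choose pre hpre using hex
  -- Domination by the norm forces `L` to agree on functions with the same class in `L¹`, so `L`
  -- descends to the range of `Φ`, whatever preimages are chosen.
  have hpre' : ∀ (y : LinearMap.range Φ) (φ : S), Φ φ = y → L' (pre y) = L' φ := by
    intro y φ h
    have := hker (pre y - φ)
    rw [map_sub, map_sub, hpre, h, sub_self, norm_zero] at this
    exact sub_eq_zero.1 (abs_eq_zero.1 (le_antisymm this (abs_nonneg _)))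
  let G0 : LinearMap.range Φ →ₗ[ℝ] ℝ :=
    { toFun := fun y => L' (pre y)
      map_add' := fun y z => by
        rw [hpre' (y + z) (pre y + pre z) (by simp [hpre]), map_add]
      map_smul' := fun a y => by
        rw [hpre' (a • y) (a • pre y) (by simp [hpre]), map_smul]; simp }
  let G1 : LinearMap.range Φ →L[ℝ] ℝ := G0.mkContinuous 1 fun y => by
    rw [one_mul]
    exact (hker (pre y)).trans_eq (congrArg norm (hpre y))
  -- Hahn-Banach: the functional on the classes of admissible functions extends to all of `L¹` with
  -- the same norm.
  obtain ⟨g, hg1, hg2⟩ := exists_extension_norm_eq (LinearMap.range Φ) G1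
  have hg : ‖g‖ ≤ 1 := by
    rw [hg2]; exact LinearMap.mkContinuous_norm_le _ zero_le_one _
  obtain ⟨θ, h1, h2, h3⟩ := exists_density_of_L1_dual μ g hg
  refine ⟨θ, h1, h2, fun φ hφ => ?_⟩
  rw [← h3 φ (hmem φ hφ 1) (hmem φ hφ 2)]
  have := hg1 ⟨Φ ⟨φ, hφ⟩, ⟨_, rfl⟩⟩
  change g (Φ ⟨φ, hφ⟩) = _ at this
  change _ = g (Φ ⟨φ, hφ⟩)
  rw [this]
  exact (hpre' _ ⟨φ, hφ⟩ rfl).symm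

end Representation

section

/-! ### Mollification -/

/-- Write `b n * g n = b n * g₀ + b n * (g n - g₀)`: dominated convergence handles the first term,
the uniform bound and the `L¹` convergence the second. All limits in the balance of energy are of
this type. -/
theorem tendsto_integral_mul_of_tendsto_ae {X : Type*} [MeasurableSpace X] {μ : Measure X}
    {b g : ℕ → X → ℝ} {b₀ g₀ : X → ℝ} {C : ℝ} (hbm : ∀ n, AEStronglyMeasurable (b n) μ)
    (hb : ∀ n z, |b n z| ≤ C) (hae : ∀ᵐ z ∂μ, Tendsto (fun n => b n z) atTop (𝓝 (b₀ z)))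
    (hg₀ : Integrable g₀ μ) (hgi : ∀ n, Integrable (g n) μ)
    (hg : Tendsto (fun n => ∫⁻ z, ‖g n z - g₀ z‖ₑ ∂μ) atTop (𝓝 0)) :
    Tendsto (fun n => ∫ z, b n z * g n z ∂μ) atTop (𝓝 (∫ z, b₀ z * g₀ z ∂μ)) := by
  have h1 : Tendsto (fun n => ∫ z, b n z * g₀ z ∂μ) atTop (𝓝 (∫ z, b₀ z * g₀ z ∂μ)) := by
    refine tendsto_integral_of_dominated_convergence (fun z => C * |g₀ z|)
      (fun n => (hbm n).mul hg₀.1) (hg₀.abs.const_mul C) (fun n => ae_of_all _ fun z => ?_) ?_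
    · rw [norm_mul, Real.norm_eq_abs, Real.norm_eq_abs]
      exact mul_le_mul_of_nonneg_right (hb n z) (abs_nonneg _)
    · filter_upwards [hae] with z hz using hz.mul_const _
  have h2 : Tendsto (fun n => ∫ z, b n z * (g n z - g₀ z) ∂μ) atTop (𝓝 0) := by
    rw [tendsto_zero_iff_enorm_tendsto_zero]
    refine tendsto_of_tendsto_of_tendsto_of_le_of_le tendsto_const_nhds
      (?_ : Tendsto (fun n => ENNReal.ofReal C * ∫⁻ z, ‖g n z - g₀ z‖ₑ ∂μ) atTop (𝓝 0))
      (fun n => zero_le) fun n => ?_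
    · simpa using ENNReal.Tendsto.const_mul hg (Or.inr ENNReal.ofReal_ne_top)
    · refine (enorm_integral_le_lintegral_enorm _).trans ?_
      rw [← lintegral_const_mul' _ _ ENNReal.ofReal_ne_top]
      refine lintegral_mono fun z => ?_
      rw [enorm_mul]
      gcongr
      rw [Real.enorm_eq_ofReal_abs]
      exact ENNReal.ofReal_le_ofReal (hb n z)
  have h3 : ∀ n, ∫ z, b n z * g n z ∂μ
      = ∫ z, b n z * g₀ z ∂μ + ∫ z, b n z * (g n z - g₀ z) ∂μ := by
    intro n
    rw [← integral_add]
    · congr 1; ext z; ring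
    · exact hg₀.bdd_mul (hbm n) (ae_of_all _ (hb n))
    · exact ((hgi n).sub hg₀).bdd_mul (hbm n) (ae_of_all _ (hb n))
  simp_rw [h3]
  simpa using h1.add h2

variable {Z : Type*} [NormedAddCommGroup Z] [NormedSpace ℝ Z] [FiniteDimensional ℝ Z]
  [MeasureSpace Z] [BorelSpace Z]

/-- The convolution of a function with a kernel. -/
noncomputable def mollify (K f : Z → ℝ) (z : Z) : ℝ := ∫ y, K (z - y) * f y

/-- The convolution of a positive measure with the absolute value of a kernel. -/
noncomputable def mollifyMeasure (K : Z → ℝ) (μ : Measure Z) (z : Z) : ℝ≥0∞ :=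
  ∫⁻ y, ‖K (z - y)‖ₑ ∂μ

/-- Smooth probability densities supported in the ball of radius `r`. -/
structure IsMollifier (K : Z → ℝ) (r : ℝ) : Prop where
  contDiff : ContDiff ℝ ∞ K
  nonneg : ∀ z, 0 ≤ K z
  integral_eq_one : ∫ z, K z = 1
  tsupport_subset : tsupport K ⊆ Metric.closedBall 0 r

/-- The test functions on the open set `O`. -/
def IsTestOn (O : Set Z) (ψ : Z → ℝ) : Prop :=
  ContDiff ℝ ∞ ψ ∧ HasCompactSupport ψ ∧ tsupport ψ ⊆ O

variable [(volume : Measure Z).IsAddHaarMeasure]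

/-- In `L¹`, composition with a measure preserving map depends continuously on the map; translations
are a continuous family of such maps. -/
theorem tendsto_lintegral_shift {f : Z → ℝ} (hf : Integrable f) :
    Tendsto (fun h => ∫⁻ z, ‖f (z - h) - f z‖ₑ) (𝓝 0) (𝓝 0) := by
  have hm : MemLp f 1 (volume : Measure Z) := memLp_one_iff_integrable.2 hf
  let g : Z → C(Z, Z) := fun h => ⟨fun z => z - h, by fun_prop⟩
  have hg : Continuous g := by
    have : Continuous fun a : Z × Z => a.2 - a.1 := by fun_prop
    exact (ContinuousMap.mk _ this).curry.continuous
  have hgm : ∀ h, MeasurePreserving (g h) (volume : Measure Z) volume := fun h =>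
    measurePreserving_sub_right _ h
  have := (continuous_const (y := hm.toLp f)).compMeasurePreservingLp hg hgm ENNReal.one_ne_top
  have h2 := this.tendsto 0
  rw [EMetric.tendsto_nhds] at h2
  rw [ENNReal.tendsto_nhds_zero]
  intro ε hε
  filter_upwards [h2 ε hε] with h hh
  have e : edist (Lp.compMeasurePreserving (g h) (hgm h) (hm.toLp f))
      (Lp.compMeasurePreserving (g 0) (hgm 0) (hm.toLp f)) = ∫⁻ z, ‖f (z - h) - f z‖ₑ := by
    rw [Lp.toLp_compMeasurePreserving, Lp.toLp_compMeasurePreserving, Lp.edist_toLp_toLp,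
      eLpNorm_one_eq_lintegral_enorm]
    simp [g]
  rw [← e]
  exact hh.le

namespace IsMollifier

variable {K : Z → ℝ} {r : ℝ} (hK : IsMollifier K r)
include hK

theorem hasCompactSupport : HasCompactSupport K :=
  (isCompact_closedBall (0 : Z) r).of_isClosed_subset (isClosed_tsupport K) hK.tsupport_subset

theorem eq_zero {z : Z} (hz : r < ‖z‖) : K z = 0 := by
  by_contra h
  have := hK.tsupport_subset (subset_tsupport K h)
  simp at this; linarith

theorem continuous : Continuous K := hK.contDiff.continuous

theorem integrable : Integrable K := hK.continuous.integrable_of_hasCompactSupport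
    hK.hasCompactSupport

theorem lintegral_eq_one : ∫⁻ z, ‖K z‖ₑ = 1 := by
  have := ofReal_integral_norm_eq_lintegral_enorm hK.integrable
  rw [← this]
  simp_rw [Real.norm_eq_abs, abs_of_nonneg (hK.nonneg _), hK.integral_eq_one]
  simp

theorem isTestOn {O : Set Z} {z : Z} (hz : Metric.closedBall z r ⊆ O) :
    IsTestOn O fun y => K (z - y) := by
  have hs : tsupport (fun y => K (z - y)) ⊆ Metric.closedBall z r := by
    refine closure_minimal (fun y hy => ?_) Metric.isClosed_closedBall
    have := hK.tsupport_subset (subset_tsupport K hy)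
    rw [mem_closedBall_zero_iff] at this
    rwa [Metric.mem_closedBall, dist_comm, dist_eq_norm]
  refine ⟨hK.contDiff.comp (by fun_prop), ?_, hs.trans hz⟩
  exact (isCompact_closedBall z r).of_isClosed_subset (isClosed_tsupport _) hs

theorem fderiv_reflect (z y h : Z) :
    fderiv ℝ (fun y => K (z - y)) y h = - fderiv ℝ K (z - y) h := by
  have h1 : HasFDerivAt K (fderiv ℝ K (z - y)) (z - y) :=
    (hK.contDiff.differentiable (by simp) _).hasFDerivAt
  have h2 : HasFDerivAt (fun y : Z => z - y) (-(ContinuousLinearMap.id ℝ Z)) y := by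
    simpa using (hasFDerivAt_id y).const_sub z
  have h3 : fderiv ℝ (fun y => K (z - y)) y = _ := (h1.comp y h2).fderiv
  rw [h3]
  simp

end IsMollifier

theorem mollify_eq (K f : Z → ℝ) (z : Z) : mollify K f z = ∫ h, K h * f (z - h) := by
  rw [mollify, ← integral_sub_left_eq_self _ volume z]
  simp

section
variable {K : Z → ℝ} {r : ℝ} (hK : IsMollifier K r)
include hK

theorem contDiff_mollify {f : Z → ℝ} (hf : LocallyIntegrable f) : ContDiff ℝ ∞ (mollify K f) := by
  have := hK.hasCompactSupport.contDiff_convolution_right (ContinuousLinearMap.mul ℝ ℝ) hf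
    hK.contDiff
  convert this using 1
  ext z
  simp [mollify, convolution_def, mul_comm]

theorem fderiv_mollify {f : Z → ℝ} (hf : LocallyIntegrable f) (z h : Z) :
    fderiv ℝ (mollify K f) z h = ∫ y, fderiv ℝ K (z - y) h * f y := by
  have := hK.hasCompactSupport.hasFDerivAt_convolution_right (ContinuousLinearMap.mul ℝ ℝ) hf
    (hK.contDiff.of_le (by simp)) z
  have e : mollify K f = convolution f K (ContinuousLinearMap.mul ℝ ℝ) volume := by
    ext z
    simp [mollify, convolution_def, mul_comm]
  rw [e, this.fderiv, convolution_def, ContinuousLinearMap.integral_apply]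
  · simp [mul_comm]
  · exact (hK.hasCompactSupport.fderiv ℝ).convolutionExists_right _ hf
      (hK.contDiff.continuous_fderiv (by simp)) z

theorem integrable_kernel_mul {f : Z → ℝ} (hf : LocallyIntegrable f) (z : Z) :
    Integrable fun y => K (z - y) * f y := by
  have := hK.hasCompactSupport.convolutionExists_right (ContinuousLinearMap.mul ℝ ℝ) hf
    hK.continuous z
  unfold ConvolutionExistsAt at this
  simpa [mul_comm] using this

theorem integrable_fderiv_kernel_mul {f : Z → ℝ} (hf : LocallyIntegrable f) (z h : Z) :
    Integrable fun y => fderiv ℝ K (z - y) h * f y := by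
  have h1 : HasCompactSupport fun y => fderiv ℝ K y h :=
    (hK.hasCompactSupport.fderiv ℝ).comp_left (g := fun l : Z →L[ℝ] ℝ => l h) rfl
  have := h1.convolutionExists_right (ContinuousLinearMap.mul ℝ ℝ) hf
    ((hK.contDiff.continuous_fderiv (by simp)).clm_apply continuous_const) z
  unfold ConvolutionExistsAt at this
  simpa [mul_comm] using this

theorem integral_kernel (z : Z) : ∫ y, K (z - y) = 1 := by
  rw [integral_sub_left_eq_self K volume z, hK.integral_eq_one]

theorem mollify_mem_Icc {f : Z → ℝ} (hf : LocallyIntegrable f) {a b : ℝ}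
    (hab : ∀ z, f z ∈ Icc a b) (z : Z) : mollify K f z ∈ Icc a b := by
  have hi : Integrable fun y => K (z - y) := hK.integrable.comp_sub_left z
  have ha : ∫ y, K (z - y) * a = a := by rw [integral_mul_const, integral_kernel hK, one_mul]
  have hb : ∫ y, K (z - y) * b = b := by rw [integral_mul_const, integral_kernel hK, one_mul]
  constructor
  · rw [← ha]
    exact integral_mono (hi.mul_const a) (integrable_kernel_mul hK hf z)
      fun y => mul_le_mul_of_nonneg_left (hab y).1 (hK.nonneg _)
  · rw [← hb]
    exact integral_mono (integrable_kernel_mul hK hf z) (hi.mul_const b)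
      fun y => mul_le_mul_of_nonneg_left (hab y).2 (hK.nonneg _)

theorem abs_mollify_le {f : Z → ℝ} (hf : LocallyIntegrable f) {C : ℝ}
    (hC : ∀ z, |f z| ≤ C) (z : Z) : |mollify K f z| ≤ C :=
  abs_le.2 (mollify_mem_Icc hK hf (fun z => abs_le.1 (hC z)) z)

/-- The kernel is a probability density, so by Fubini the error is an average of translation errors.
The additional shift `a` is needed because mollified functions are later evaluated along a segment
issuing from `z`. -/
theorem lintegral_mollify_sub_le {f : Z → ℝ} (hfm : Measurable f) (hf : LocallyIntegrable f)
    (a : Z) {τ : ℝ≥0∞} (hτ : ∀ h, ‖h‖ ≤ r → ∫⁻ z, ‖f (z - (a + h)) - f z‖ₑ ≤ τ) :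
    ∫⁻ z, ‖mollify K f (z - a) - f z‖ₑ ≤ τ := by
  have h1 : ∀ z, ‖mollify K f (z - a) - f z‖ₑ ≤ ∫⁻ h, ‖K h‖ₑ * ‖f (z - (a + h)) - f z‖ₑ := by
    intro z
    have : mollify K f (z - a) - f z = ∫ h, K h * (f (z - (a + h)) - f z) := by
      simp_rw [mul_sub]
      rw [mollify_eq, integral_sub, integral_mul_const, hK.integral_eq_one, one_mul]
      · simp_rw [sub_sub]
      · have := (integrable_kernel_mul hK hf (z - a)).comp_sub_left (z - a)
        convert this using 2 with t
        congr 2 <;> abel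
      · exact hK.integrable.mul_const _
    rw [this]
    refine (enorm_integral_le_lintegral_enorm _).trans (lintegral_mono fun h => ?_)
    rw [enorm_mul]
  refine (lintegral_mono h1).trans ?_
  rw [lintegral_lintegral_swap]
  · calc ∫⁻ h, ∫⁻ z, ‖K h‖ₑ * ‖f (z - (a + h)) - f z‖ₑ
        ≤ ∫⁻ h, ‖K h‖ₑ * τ := by
          refine lintegral_mono fun h => ?_
          rw [lintegral_const_mul' _ _ enorm_ne_top]
          by_cases hh : ‖h‖ ≤ r
          · gcongr; exact hτ h hh
          · rw [hK.eq_zero (not_le.1 hh)]; simp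
      _ = τ := by
          rw [lintegral_mul_const _ hK.continuous.measurable.enorm, hK.lintegral_eq_one, one_mul]
  · have := hK.continuous.measurable
    exact Measurable.aemeasurable (by fun_prop)

/-- Fubini moves the kernel from the measure to `φ`, and on the support of the kernel, shifted by
`a`, the values of `φ` change by at most `κ`. -/
theorem lintegral_mul_mollifyMeasure_le {φ : Z → ℝ} (hφ : Measurable φ) (μ : Measure Z) [SFinite μ]
    (a : Z) {κ : ℝ≥0∞} (hκ : ∀ y h, ‖h‖ ≤ r → ‖φ (y + (a + h))‖ₑ ≤ ‖φ y‖ₑ + κ) :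
    ∫⁻ z, ‖φ z‖ₑ * mollifyMeasure K μ (z - a) ≤ ∫⁻ y, (‖φ y‖ₑ + κ) ∂μ := by
  have hm := hK.continuous.measurable
  have h1 : ∀ z, ‖φ z‖ₑ * mollifyMeasure K μ (z - a) = ∫⁻ y, ‖φ z‖ₑ * ‖K (z - a - y)‖ₑ ∂μ :=
    fun z => (lintegral_const_mul' _ _ enorm_ne_top).symm
  simp_rw [h1]
  rw [lintegral_lintegral_swap (Measurable.aemeasurable (by fun_prop))]
  refine lintegral_mono fun y => ?_
  calc ∫⁻ z, ‖φ z‖ₑ * ‖K (z - a - y)‖ₑ = ∫⁻ h, ‖φ (y + (a + h))‖ₑ * ‖K h‖ₑ := by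
        rw [← lintegral_add_left_eq_self _ (y + a)]
        refine lintegral_congr fun h => ?_
        congr 3 <;> abel_nf
    _ ≤ ∫⁻ h, (‖φ y‖ₑ + κ) * ‖K h‖ₑ := by
        refine lintegral_mono fun h => ?_
        by_cases hh : ‖h‖ ≤ r
        · gcongr; exact hκ y h hh
        · rw [hK.eq_zero (not_le.1 hh)]; simp
    _ = ‖φ y‖ₑ + κ := by
        rw [lintegral_const_mul _ hm.enorm, hK.lintegral_eq_one, mul_one]

end

end

section

/-! ### Bounded measurable functions and sequences -/

section Sequences

variable {X : Type*} [MeasurableSpace X]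

/-- Bounded measurable functions. -/
structure BddMeas (b : X → ℝ) : Prop where
  measurable : Measurable b
  bdd : ∃ C, ∀ z, |b z| ≤ C

namespace BddMeas

theorem mul {a b : X → ℝ} (ha : BddMeas a) (hb : BddMeas b) : BddMeas fun z => a z * b z := by
  obtain ⟨C, hC⟩ := ha.bdd
  obtain ⟨C', hC'⟩ := hb.bdd
  refine ⟨ha.measurable.mul hb.measurable, C * C', fun z => ?_⟩
  rw [abs_mul]
  exact mul_le_mul (hC z) (hC' z) (abs_nonneg _) ((abs_nonneg _).trans (hC z))

theorem add {a b : X → ℝ} (ha : BddMeas a) (hb : BddMeas b) : BddMeas fun z => a z + b z := by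
  obtain ⟨C, hC⟩ := ha.bdd
  obtain ⟨C', hC'⟩ := hb.bdd
  exact ⟨ha.measurable.add hb.measurable, C + C', fun z =>
    (abs_add_le _ _).trans (add_le_add (hC z) (hC' z))⟩

theorem const (a : ℝ) : BddMeas fun _ : X => a := ⟨measurable_const, |a|, fun _ => le_rfl⟩

theorem sum {ι : Type*} (s : Finset ι) {a : ι → X → ℝ} (ha : ∀ i, BddMeas (a i)) :
    BddMeas fun z => ∑ i ∈ s, a i z := by
  classical
  induction s using Finset.induction_on with
  | empty => simpa using const 0
  | insert i s hi ih => simpa [Finset.sum_insert hi] using (ha i).add ih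

theorem inv {a : X → ℝ} (ha : Measurable a) {c : ℝ} (hc : 0 < c) (h : ∀ z, c ≤ a z) :
    BddMeas fun z => (a z)⁻¹ :=
  ⟨ha.inv, c⁻¹, fun z => by
    rw [abs_inv, abs_of_pos (hc.trans_le (h z))]
    exact inv_anti₀ hc (h z)⟩

theorem integrable_mul {μ : Measure X} {b g : X → ℝ} (hb : BddMeas b) (hg : Integrable g μ) :
    Integrable (fun z => b z * g z) μ := by
  obtain ⟨C, hC⟩ := hb.bdd
  exact hg.bdd_mul hb.measurable.aestronglyMeasurable (ae_of_all _ hC)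

end BddMeas

/-- Uniformly bounded sequences of measurable functions converging almost everywhere. -/
structure BddSeq (μ : Measure X) (b : ℕ → X → ℝ) (b₀ : X → ℝ) : Prop where
  measurable : ∀ n, Measurable (b n)
  bdd : ∃ C, ∀ n z, |b n z| ≤ C
  tendsto : ∀ᵐ z ∂μ, Tendsto (fun n => b n z) atTop (𝓝 (b₀ z))

/-- Sequences converging in `L¹`. -/
structure L1Seq (μ : Measure X) (g : ℕ → X → ℝ) (g₀ : X → ℝ) : Prop where
  integrable : ∀ n, Integrable (g n) μ
  integrable_limit : Integrable g₀ μ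
  tendsto : Tendsto (fun n => ∫⁻ z, ‖g n z - g₀ z‖ₑ ∂μ) atTop (𝓝 0)

theorem L1Seq.const {μ : Measure X} {g : X → ℝ} (hg : Integrable g μ) : L1Seq μ (fun _ => g) g :=
  ⟨fun _ => hg, hg, by simp⟩

namespace BddSeq

variable {μ : Measure X}

theorem const {b : X → ℝ} (h : BddMeas b) : BddSeq μ (fun _ => b) b :=
  ⟨fun _ => h.measurable, h.bdd.imp fun _ h _ z => h z, ae_of_all _ fun _ => tendsto_const_nhds⟩

theorem mul {a b : ℕ → X → ℝ} {a₀ b₀ : X → ℝ} (ha : BddSeq μ a a₀) (hb : BddSeq μ b b₀) :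
    BddSeq μ (fun n z => a n z * b n z) fun z => a₀ z * b₀ z := by
  obtain ⟨C, hC⟩ := ha.bdd
  obtain ⟨C', hC'⟩ := hb.bdd
  refine ⟨fun n => (ha.measurable n).mul (hb.measurable n), ⟨C * C', fun n z => ?_⟩, ?_⟩
  · rw [abs_mul]
    exact mul_le_mul (hC n z) (hC' n z) (abs_nonneg _) ((abs_nonneg _).trans (hC n z))
  · filter_upwards [ha.tendsto, hb.tendsto] with z h1 h2 using h1.mul h2

theorem inv {a : ℕ → X → ℝ} {a₀ : X → ℝ} (ha : BddSeq μ a a₀) {c : ℝ} (hc : 0 < c)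
    (h : ∀ n z, c ≤ a n z) (h₀ : ∀ z, c ≤ a₀ z) :
    BddSeq μ (fun n z => (a n z)⁻¹) fun z => (a₀ z)⁻¹ := by
  refine ⟨fun n => (ha.measurable n).inv, ⟨c⁻¹, fun n z => ?_⟩, ?_⟩
  · rw [abs_inv, abs_of_pos (hc.trans_le (h n z))]
    exact inv_anti₀ hc (h n z)
  · filter_upwards [ha.tendsto] with z hz using hz.inv₀ (hc.trans_le (h₀ z)).ne'

theorem tendsto_integral {b g : ℕ → X → ℝ} {b₀ g₀ : X → ℝ} (hb : BddSeq μ b b₀)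
    (hg : L1Seq μ g g₀) :
    Tendsto (fun n => ∫ z, b n z * g n z ∂μ) atTop (𝓝 (∫ z, b₀ z * g₀ z ∂μ)) := by
  obtain ⟨C, hC⟩ := hb.bdd
  exact tendsto_integral_mul_of_tendsto_ae (fun n => (hb.measurable n).aestronglyMeasurable) hC
    hb.tendsto hg.integrable_limit hg.integrable hg.tendsto

end BddSeq

end Sequences

variable {Z : Type*} [NormedAddCommGroup Z] [NormedSpace ℝ Z] [FiniteDimensional ℝ Z]
  [MeasureSpace Z] [BorelSpace Z]

/-! ### Moduli of continuity -/

/-- The `L¹` modulus of continuity under translations. -/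
noncomputable def shiftModulus (f : Z → ℝ) (r : ℝ) : ℝ≥0∞ :=
  ⨆ (h : Z) (_ : ‖h‖ ≤ r), ∫⁻ z, ‖f (z - h) - f z‖ₑ

/-- The uniform modulus of continuity. -/
noncomputable def supModulus (f : Z → ℝ) (r : ℝ) : ℝ≥0∞ :=
  ⨆ (y : Z) (h : Z) (_ : ‖h‖ ≤ r), ‖f (y + h) - f y‖ₑ

theorem le_shiftModulus (f : Z → ℝ) {r : ℝ} {h : Z} (hr : ‖h‖ ≤ r) :
    ∫⁻ z, ‖f (z - h) - f z‖ₑ ≤ shiftModulus f r :=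
  le_iSup₂ (f := fun (h : Z) (_ : ‖h‖ ≤ r) => ∫⁻ z, ‖f (z - h) - f z‖ₑ) h hr

theorem enorm_add_le_supModulus (f : Z → ℝ) {r : ℝ} (y : Z) {h : Z} (hr : ‖h‖ ≤ r) :
    ‖f (y + h)‖ₑ ≤ ‖f y‖ₑ + supModulus f r := by
  have h1 : ‖f (y + h) - f y‖ₑ ≤ supModulus f r :=
    (le_iSup₂ (f := fun (h : Z) (_ : ‖h‖ ≤ r) => ‖f (y + h) - f y‖ₑ) h hr).trans
      (le_iSup (fun y => ⨆ (h : Z) (_ : ‖h‖ ≤ r), ‖f (y + h) - f y‖ₑ) y)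
  calc ‖f (y + h)‖ₑ = ‖f y + (f (y + h) - f y)‖ₑ := by congr 1; ring
    _ ≤ ‖f y‖ₑ + ‖f (y + h) - f y‖ₑ := enorm_add_le _ _
    _ ≤ _ := by gcongr

theorem tendsto_supModulus {φ : Z → ℝ} (hφ : Continuous φ) (hs : HasCompactSupport φ) :
    Tendsto (supModulus φ) (𝓝 0) (𝓝 0) := by
  have hu := hs.uniformContinuous_of_continuous hφ
  rw [ENNReal.tendsto_nhds_zero]
  intro ε hε
  obtain ⟨δ, hδ, h⟩ := EMetric.uniformContinuous_iff.1 hu ε hε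
  have h2 : ∀ᶠ r : ℝ in 𝓝 0, ENNReal.ofReal r < δ := by
    have : Tendsto ENNReal.ofReal (𝓝 0) (𝓝 0) := by
      simpa using ENNReal.continuous_ofReal.tendsto 0
    exact this.eventually_lt_const hδ
  filter_upwards [h2] with r hr
  refine iSup_le fun y => iSup₂_le fun k hk => ?_
  rw [← edist_eq_enorm_sub]
  refine (h ?_).le
  rw [edist_eq_enorm_sub, add_sub_cancel_left, ← ofReal_norm]
  exact (ENNReal.ofReal_le_ofReal hk).trans_lt hr

variable [(volume : Measure Z).IsAddHaarMeasure]

/-- Constants do not contribute to differences. The constant `c` admits the density, which is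
integrable only after subtraction of its lower bound. -/
theorem tendsto_shiftModulus {f : Z → ℝ} {c : ℝ} (hf : Integrable fun z => f z - c) :
    Tendsto (shiftModulus f) (𝓝 0) (𝓝 0) := by
  have h1 := tendsto_lintegral_shift hf
  simp only [sub_sub_sub_cancel_right] at h1
  rw [ENNReal.tendsto_nhds_zero] at h1 ⊢
  intro ε hε
  obtain ⟨δ, hδ, h⟩ := Metric.eventually_nhds_iff.1 (h1 ε hε)
  filter_upwards [Iio_mem_nhds hδ] with r hr
  refine iSup₂_le fun k hk => h ?_
  rw [dist_zero_right]
  exact hk.trans_lt hr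

theorem exists_isMollifier {r : ℝ} (hr : 0 < r) : ∃ K : Z → ℝ, IsMollifier K r := by
  let f : ContDiffBump (0 : Z) := ⟨r / 2, r, by positivity, by linarith⟩
  refine ⟨f.normed volume, f.contDiff_normed, f.nonneg_normed, f.integral_normed, ?_⟩
  rw [f.tsupport_normed_eq]

theorem locallyIntegrable_of_bddMeas {f : Z → ℝ} (hf : BddMeas f) : LocallyIntegrable f := by
  obtain ⟨C, hC⟩ := hf.bdd
  exact (locallyIntegrable_const C).mono hf.measurable.aestronglyMeasurable
    (ae_of_all _ fun z => (hC z).trans (le_abs_self C))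

theorem lintegral_mollify_sub_le_modulus {K : Z → ℝ} {r : ℝ} (hK : IsMollifier K r) {f : Z → ℝ}
    (hfm : Measurable f) (hf : LocallyIntegrable f) :
    ∫⁻ z, ‖mollify K f z - f z‖ₑ ≤ shiftModulus f r := by
  simpa using lintegral_mollify_sub_le hK hfm hf 0 (τ := shiftModulus f r)
    (fun h hh => by simpa using le_shiftModulus f hh)

theorem IsTestOn.fderiv_bddMeas {O : Set Z} {ψ : Z → ℝ} (h : IsTestOn O ψ) (e : Z) :
    BddMeas fun z => fderiv ℝ ψ z e := by
  have hc : Continuous fun z => fderiv ℝ ψ z e :=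
    (h.1.continuous_fderiv (by simp)).clm_apply continuous_const
  have hs : HasCompactSupport fun z => fderiv ℝ ψ z e :=
    (h.2.1.fderiv ℝ).comp_left (g := fun l : Z →L[ℝ] ℝ => l e) rfl
  exact ⟨hc.measurable, hs.exists_bound_of_continuous hc⟩

theorem IsTestOn.fderiv_integrable {O : Set Z} {ψ : Z → ℝ} (h : IsTestOn O ψ) (e : Z) :
    Integrable fun z => fderiv ℝ ψ z e := by
  have hc : Continuous fun z => fderiv ℝ ψ z e :=
    (h.1.continuous_fderiv (by simp)).clm_apply continuous_const
  have hs : HasCompactSupport fun z => fderiv ℝ ψ z e :=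
    (h.2.1.fderiv ℝ).comp_left (g := fun l : Z →L[ℝ] ℝ => l e) rfl
  exact hc.integrable_of_hasCompactSupport hs

theorem IsTestOn.bddMeas {O : Set Z} {ψ : Z → ℝ} (h : IsTestOn O ψ) : BddMeas ψ :=
  ⟨h.1.continuous.measurable, h.2.1.exists_bound_of_continuous h.1.continuous⟩

theorem IsTestOn.integrable {O : Set Z} {ψ : Z → ℝ} (h : IsTestOn O ψ) : Integrable ψ :=
  h.1.continuous.integrable_of_hasCompactSupport h.2.1

theorem IsTestOn.mul_smooth {O : Set Z} {ψ g : Z → ℝ} (h : IsTestOn O ψ) (hg : ContDiff ℝ ∞ g) :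
    IsTestOn O fun z => ψ z * g z :=
  ⟨h.1.mul hg, h.2.1.mul_right, (closure_mono fun z hz => by
    simp only [Function.mem_support] at hz ⊢; exact left_ne_zero_of_mul hz).trans h.2.2⟩

/-- A neighbourhood of fixed radius of the support of a test function stays in the domain. -/
theorem IsTestOn.exists_radius {O : Set Z} (hO : IsOpen O) {ψ : Z → ℝ} (h : IsTestOn O ψ) :
    ∃ r₀ > 0, ∀ z ∈ tsupport ψ, Metric.closedBall z r₀ ⊆ O := by
  obtain ⟨δ, hδ, h'⟩ := h.2.1.isCompact.exists_cthickening_subset_open hO h.2.2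
  exact ⟨δ, hδ, fun z hz => (Metric.closedBall_subset_cthickening hz δ).trans h'⟩

/-! ### Weak directional derivatives up to a measure -/

/-- The derivative of `F` in the direction `l` is `b`, up to a measure of variation at most
`μ`. -/
def IsDerivUpTo (O : Set Z) (F : Z → ℝ) (l : Z) (b : Z → ℝ) (μ : Measure Z) : Prop :=
  ∀ ψ, IsTestOn O ψ → ‖(∫ z, F z * fderiv ℝ ψ z l) + ∫ z, ψ z * b z‖ₑ ≤ ∫⁻ z, ‖ψ z‖ₑ ∂μ

/-- The reflected kernel `y ↦ K (z - y)` is an admissible test function when its ball lies in `O`;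
with it the weak inequality becomes a pointwise bound for the mollified derivative. -/
theorem IsDerivUpTo.fderiv_mollify_sub {O : Set Z} {F : Z → ℝ} {l : Z} {b : Z → ℝ} {μ : Measure Z}
    (h : IsDerivUpTo O F l b μ) (hF : LocallyIntegrable F) {K : Z → ℝ} {r : ℝ}
    (hK : IsMollifier K r) {z : Z} (hz : Metric.closedBall z r ⊆ O) :
    ‖fderiv ℝ (mollify K F) z l - mollify K b z‖ₑ ≤ mollifyMeasure K μ z := by
  have := h _ (hK.isTestOn hz)
  rw [fderiv_mollify hK hF]
  simp_rw [hK.fderiv_reflect, mul_neg, integral_neg, mul_comm (F _)] at this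
  rw [← enorm_neg, mollify]
  refine le_trans (le_of_eq ?_) this
  congr 1; ring

/-- The field with components `v j` in the directions `e j`. -/
noncomputable def field {ι : Type*} [Fintype ι] (e : ι → Z) (v : ι → Z → ℝ) (z : Z) : Z :=
  ∑ j, v j z • e j

theorem clm_field {ι : Type*} [Fintype ι] (e : ι → Z) (v : ι → Z → ℝ) (z : Z) (L : Z →L[ℝ] ℝ) :
    L (field e v z) = ∑ j, v j z * L (e j) := by
  simp [field]

theorem mollifyMeasure_measurable {K : Z → ℝ} {r : ℝ} (hK : IsMollifier K r) (μ : Measure Z)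
    [SFinite μ] : Measurable (mollifyMeasure K μ) := by
  have := hK.continuous.measurable
  unfold mollifyMeasure
  exact Measurable.lintegral_prod_right' (f := fun p : Z × Z => ‖K (p.1 - p.2)‖ₑ) (by fun_prop)

/-- The chain rule `div (F V) = ∑ v_j ∂_j F` for divergence free fields, up to a measure. -/
theorem enorm_integral_mul_fderiv_field_le {ι : Type*} [Fintype ι] {O : Set Z} (hO : IsOpen O)
    {e : ι → Z} {v : ι → Z → ℝ} {M : ℝ} (hvm : ∀ j, Measurable (v j))
    (hv : ∀ j z, |v j z| ≤ M)
    (hdiv : ∀ ψ, IsTestOn O ψ → ∫ z, fderiv ℝ ψ z (field e v z) = 0)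
    {F : Z → ℝ} (hF : BddMeas F) {c : ℝ} (hFi : Integrable fun z => F z - c)
    {G : ι → Z → ℝ} (hGm : ∀ j, Measurable (G j)) (hG : ∀ j, Integrable (G j)) {μ : Measure Z}
    [IsFiniteMeasure μ] (hder : ∀ j, IsDerivUpTo O F (e j) (G j) μ) {ψ : Z → ℝ}
    (hψ : IsTestOn O ψ) :
    ‖(∫ z, F z * fderiv ℝ ψ z (field e v z)) + ∫ z, ψ z * ∑ j, v j z * G j z‖ₑ
      ≤ ENNReal.ofReal (Fintype.card ι * M) * ∫⁻ z, ‖ψ z‖ₑ ∂μ := by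
  obtain ⟨r₀, hr₀, hr₀O⟩ := hψ.exists_radius hO
  have hFl := locallyIntegrable_of_bddMeas hF
  have hvb : ∀ j, BddMeas (v j) := fun j => ⟨hvm j, M, hv j⟩
  have hDV : BddMeas fun z => fderiv ℝ ψ z (field e v z) := by
    simp_rw [clm_field]
    exact BddMeas.sum _ fun j => (hvb j).mul (hψ.fderiv_bddMeas _)
  have hDVi : Integrable fun z => fderiv ℝ ψ z (field e v z) := by
    simp_rw [clm_field]
    exact integrable_finsetSum _ fun j _ => (hvb j).integrable_mul (hψ.fderiv_integrable _)
  obtain ⟨C₁, hC₁⟩ := hDV.bdd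
  obtain ⟨C₂, hC₂⟩ := hψ.bddMeas.bdd
  have hC₂' : 0 ≤ C₂ := (abs_nonneg _).trans (hC₂ 0)
  -- Only `F` is mollified, not the field. The three errors come from `F - F_K`, from `G j - (G
  -- j)_K` and from the mollified measure; the first two vanish with `r`, and the last one returns
  -- `∫ |ψ| dμ`.
  have key : ∀ r, 0 < r → r ≤ r₀ →
      ‖(∫ z, F z * fderiv ℝ ψ z (field e v z)) + ∫ z, ψ z * ∑ j, v j z * G j z‖ₑ
      ≤ ENNReal.ofReal C₁ * shiftModulus F r
        + (∑ j, ENNReal.ofReal (C₂ * M) * shiftModulus (G j) r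
        + ENNReal.ofReal (Fintype.card ι * M) *
          (∫⁻ z, ‖ψ z‖ₑ ∂μ + supModulus ψ r * μ univ)) := by
    intro r hr hrr
    obtain ⟨K, hK⟩ := exists_isMollifier (Z := Z) hr
    have hsm := contDiff_mollify hK hFl
    have hFK : BddMeas (mollify K F) := by
      obtain ⟨C, hC⟩ := hF.bdd
      exact ⟨hsm.continuous.measurable, C, abs_mollify_le hK hFl hC⟩
    have hball : ∀ z ∈ tsupport ψ, Metric.closedBall z r ⊆ O := fun z hz =>
      (Metric.closedBall_subset_closedBall hrr).trans (hr₀O z hz)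
    have hi1 : Integrable fun z => mollify K F z * fderiv ℝ ψ z (field e v z) :=
      hFK.integrable_mul hDVi
    have hdiffc : ∀ j, Continuous fun z => fderiv ℝ (mollify K F) z (e j) := fun j =>
      (hsm.continuous_fderiv (by simp)).clm_apply continuous_const
    have hi2' : ∀ j, Integrable fun z => v j z * (ψ z * fderiv ℝ (mollify K F) z (e j)) :=
      fun j => (hvb j).integrable_mul
        ((hψ.1.continuous.mul (hdiffc j)).integrable_of_hasCompactSupport hψ.2.1.mul_right)
    have hi2 : Integrable fun z => ψ z * fderiv ℝ (mollify K F) z (field e v z) := by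
      simp_rw [clm_field, Finset.mul_sum]
      refine integrable_finsetSum _ fun j _ => ?_
      exact (hi2' j).congr (ae_of_all _ fun z => by beta_reduce; ring)
    -- For the smooth `F_K` the product `ψ F_K` is a test function, and the divergence constraint
    -- gives the exact chain rule.
    have hzero : (∫ z, mollify K F z * fderiv ℝ ψ z (field e v z))
        + ∫ z, ψ z * fderiv ℝ (mollify K F) z (field e v z) = 0 := by
      rw [← integral_add hi1 hi2, ← hdiv _ (hψ.mul_smooth hsm)]
      congr 1; ext z
      rw [fderiv_fun_mul (hψ.1.differentiable (by simp) z) (hsm.differentiable (by simp) z)]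
      simp only [add_apply, smul_apply, smul_eq_mul]
      ring
    have hi3 : Integrable fun z => F z * fderiv ℝ ψ z (field e v z) := hF.integrable_mul hDVi
    have hi4 : Integrable fun z => ψ z * ∑ j, v j z * G j z := by
      simp_rw [Finset.mul_sum]
      refine integrable_finsetSum _ fun j _ => ?_
      simp_rw [← mul_assoc]
      exact (hψ.bddMeas.mul (hvb j)).integrable_mul (hG j)
    have hsplit : (∫ z, F z * fderiv ℝ ψ z (field e v z)) + ∫ z, ψ z * ∑ j, v j z * G j z
        = (∫ z, (F z - mollify K F z) * fderiv ℝ ψ z (field e v z))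
          + ∫ z, ψ z * ∑ j, v j z * (G j z - fderiv ℝ (mollify K F) z (e j)) := by
      have e1 : ∫ z, (F z - mollify K F z) * fderiv ℝ ψ z (field e v z)
          = (∫ z, F z * fderiv ℝ ψ z (field e v z))
            - ∫ z, mollify K F z * fderiv ℝ ψ z (field e v z) := by
        rw [← integral_sub hi3 hi1]; congr 1; ext z; ring
      have e2 : ∫ z, ψ z * ∑ j, v j z * (G j z - fderiv ℝ (mollify K F) z (e j))
          = (∫ z, ψ z * ∑ j, v j z * G j z)
            - ∫ z, ψ z * fderiv ℝ (mollify K F) z (field e v z) := by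
        rw [← integral_sub hi4 hi2]; congr 1; ext z
        rw [clm_field, ← mul_sub, ← Finset.sum_sub_distrib]
        simp_rw [mul_sub]
      rw [e1, e2]; linarith
    rw [hsplit]
    refine (enorm_add_le _ _).trans (add_le_add ?_ ?_)
    · refine (enorm_integral_le_lintegral_enorm _).trans ?_
      calc ∫⁻ z, ‖(F z - mollify K F z) * fderiv ℝ ψ z (field e v z)‖ₑ
          ≤ ∫⁻ z, ENNReal.ofReal C₁ * ‖mollify K F z - F z‖ₑ := by
            refine lintegral_mono fun z => ?_
            rw [enorm_mul, enorm_sub_rev, mul_comm]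
            gcongr
            rw [Real.enorm_eq_ofReal_abs]
            exact ENNReal.ofReal_le_ofReal (hC₁ z)
        _ ≤ _ := by
            rw [lintegral_const_mul' _ _ ENNReal.ofReal_ne_top]
            gcongr
            exact lintegral_mollify_sub_le_modulus hK hF.measurable hFl
    · refine (enorm_integral_le_lintegral_enorm _).trans ?_
      -- On the support of `ψ` the derivative of `F_K` in each direction differs from `(G j)_K` by
      -- at most the mollified measure. Each of the `card ι` components of the field has size at
      -- most `M`.
      have hpt : ∀ z, ‖ψ z * ∑ j, v j z * (G j z - fderiv ℝ (mollify K F) z (e j))‖ₑ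
          ≤ (∑ j, ENNReal.ofReal (C₂ * M) * ‖mollify K (G j) z - G j z‖ₑ)
            + ENNReal.ofReal (Fintype.card ι * M) * (‖ψ z‖ₑ * mollifyMeasure K μ z) := by
        intro z
        by_cases hz : z ∈ tsupport ψ
        swap
        · rw [image_eq_zero_of_notMem_tsupport hz]; simp
        have hvj : ∀ j, ‖v j z‖ₑ ≤ ENNReal.ofReal M := fun j => by
          rw [Real.enorm_eq_ofReal_abs]; exact ENNReal.ofReal_le_ofReal (hv j z)
        have hψz : ‖ψ z‖ₑ ≤ ENNReal.ofReal C₂ := by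
          rw [Real.enorm_eq_ofReal_abs]; exact ENNReal.ofReal_le_ofReal (hC₂ z)
        have h1 : ∀ j, ‖G j z - fderiv ℝ (mollify K F) z (e j)‖ₑ
            ≤ ‖mollify K (G j) z - G j z‖ₑ + mollifyMeasure K μ z := by
          intro j
          have := (hder j).fderiv_mollify_sub hFl hK (hball z hz)
          calc _ = ‖-(mollify K (G j) z - G j z)
                + -(fderiv ℝ (mollify K F) z (e j) - mollify K (G j) z)‖ₑ := by congr 1; ring
            _ ≤ _ := (enorm_add_le _ _).trans (by rw [enorm_neg, enorm_neg]; gcongr)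
        rw [enorm_mul]
        calc ‖ψ z‖ₑ * ‖∑ j, v j z * (G j z - fderiv ℝ (mollify K F) z (e j))‖ₑ
            ≤ ‖ψ z‖ₑ * ∑ j, ENNReal.ofReal M *
              (‖mollify K (G j) z - G j z‖ₑ + mollifyMeasure K μ z) := by
              gcongr
              refine (enorm_sum_le _ _).trans (Finset.sum_le_sum fun j _ => ?_)
              rw [enorm_mul]
              exact mul_le_mul' (hvj j) (h1 j)
          _ = ‖ψ z‖ₑ * (∑ j, ENNReal.ofReal M * ‖mollify K (G j) z - G j z‖ₑ)
              + ENNReal.ofReal (Fintype.card ι * M) * (‖ψ z‖ₑ * mollifyMeasure K μ z) := by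
              simp_rw [mul_add, Finset.sum_add_distrib]
              rw [mul_add]
              congr 1
              rw [Finset.sum_const, Finset.card_univ, nsmul_eq_mul,
                ENNReal.ofReal_mul (by positivity), ENNReal.ofReal_natCast]
              ring
          _ ≤ _ := by
              gcongr
              rw [Finset.mul_sum]
              refine Finset.sum_le_sum fun j _ => ?_
              rw [ENNReal.ofReal_mul hC₂', mul_assoc]
              gcongr
      refine (lintegral_mono hpt).trans ?_
      have hmm := mollifyMeasure_measurable hK μ
      have hψm := hψ.bddMeas.measurable
      rw [lintegral_add_right _ (by fun_prop), lintegral_finsetSum]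
      · gcongr with j
        · rw [lintegral_const_mul' _ _ ENNReal.ofReal_ne_top]
          gcongr
          exact lintegral_mollify_sub_le_modulus hK (hGm j) (hG j).locallyIntegrable
        · rw [lintegral_const_mul' _ _ ENNReal.ofReal_ne_top]
          gcongr
          have := lintegral_mul_mollifyMeasure_le hK hψm μ 0 (κ := supModulus ψ r)
            (fun y h hh => by simpa using enorm_add_le_supModulus ψ y hh)
          rw [lintegral_add_right _ measurable_const, lintegral_const] at this
          simpa using this
      · intro j _
        have := (contDiff_mollify hK (hG j).locallyIntegrable).continuous.measurable
        have := hGm j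
        fun_prop
  have hlim : Tendsto (fun r => ENNReal.ofReal C₁ * shiftModulus F r
        + (∑ j, ENNReal.ofReal (C₂ * M) * shiftModulus (G j) r
        + ENNReal.ofReal (Fintype.card ι * M) *
          (∫⁻ z, ‖ψ z‖ₑ ∂μ + supModulus ψ r * μ univ))) (𝓝[>] 0)
      (𝓝 (ENNReal.ofReal C₁ * 0 + (∑ j : ι, ENNReal.ofReal (C₂ * M) * 0
        + ENNReal.ofReal (Fintype.card ι * M) * (∫⁻ z, ‖ψ z‖ₑ ∂μ + 0 * μ univ)))) := by
    refine Tendsto.mono_left ?_ nhdsWithin_le_nhds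
    refine (ENNReal.Tendsto.const_mul (tendsto_shiftModulus hFi)
      (Or.inr ENNReal.ofReal_ne_top)).add ((tendsto_finsetSum _ fun j _ =>
        ENNReal.Tendsto.const_mul (tendsto_shiftModulus (c := 0) (by simpa using hG j))
        (Or.inr ENNReal.ofReal_ne_top)).add ?_)
    refine ENNReal.Tendsto.const_mul (tendsto_const_nhds.add
      (ENNReal.Tendsto.mul_const (tendsto_supModulus hψ.1.continuous hψ.2.1)
        (Or.inr (measure_ne_top _ _)))) (Or.inr ENNReal.ofReal_ne_top)
  simp only [mul_zero, zero_mul, add_zero, Finset.sum_const_zero, zero_add] at hlim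
  refine ge_of_tendsto hlim ?_
  filter_upwards [Ioc_mem_nhdsGT hr₀] with r hr using key r hr.1 hr.2

end

section

variable {d : ℕ}
variable {Z : Type*} [NormedAddCommGroup Z] [NormedSpace ℝ Z] [FiniteDimensional ℝ Z]
  [MeasureSpace Z] [BorelSpace Z] [(volume : Measure Z).IsAddHaarMeasure]

/-! ### Weak solutions on an open subset of space-time -/

/-- Weak solutions of the inhomogeneous incompressible Euler equations on the open set `O`, where
`e i` are the spatial directions and `τ` is the time direction. -/
structure LocalSolution (O : Set Z) (c M : ℝ) (e : Fin d → Z) (τ : Z) (ρ p : Z → ℝ)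
    (v f : Fin d → Z → ℝ) : Prop where
  isOpen : IsOpen O
  c_pos : 0 < c
  density_measurable : Measurable ρ
  velocity_measurable : ∀ i, Measurable (v i)
  pressure_measurable : Measurable p
  force_measurable : ∀ i, Measurable (f i)
  density_mem : ∀ z, ρ z ∈ Icc c M
  velocity_le : ∀ i z, |v i z| ≤ M
  pressure_le : ∀ z, |p z| ≤ M
  density_integrable : Integrable fun z => ρ z - c
  velocity_integrable : ∀ i, Integrable (v i)
  pressure_integrable : Integrable p
  force_integrable : ∀ i, Integrable (f i)
  momentum : ∀ i ψ, IsTestOn O ψ → ∫ z, (ρ z * v i z * fderiv ℝ ψ z (field e v z + τ)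
    + p z * fderiv ℝ ψ z (e i) + f i z * ψ z) = 0
  transport : ∀ ψ, IsTestOn O ψ → ∫ z, ρ z * fderiv ℝ ψ z (field e v z + τ) = 0
  incompressible : ∀ ψ, IsTestOn O ψ → ∫ z, fderiv ℝ ψ z (field e v z) = 0

/-- Twice the Duchon-Robert distribution. -/
noncomputable def energyDefect (e : Fin d → Z) (τ : Z) (ρ p : Z → ℝ) (v f : Fin d → Z → ℝ)
    (φ : Z → ℝ) : ℝ :=
  (∑ i, ∫ z, (ρ z * v i z * v i z) * fderiv ℝ φ z (field e v z + τ))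
    + 2 * (∫ z, p z * fderiv ℝ φ z (field e v z)) + 2 * ∑ i, ∫ z, (φ z * v i z) * f i z

/-- The velocity mollified with the weight `ρ`. -/
noncomputable def favre (K ρ : Z → ℝ) (v : Fin d → Z → ℝ) (i : Fin d) (z : Z) : ℝ :=
  mollify K (fun y => ρ y * v i y) z / mollify K ρ z

/-- The commutator of the transport by the velocity field with the mollification. -/
noncomputable def commutator (K : Z → ℝ) (e : Fin d → Z) (ρ : Z → ℝ) (v : Fin d → Z → ℝ)
    (i : Fin d) (z : Z) : ℝ :=
  ∫ y, (ρ y * (v i y - favre K ρ v i z)) * fderiv ℝ K (z - y) (field e v z - field e v y)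

namespace LocalSolution

variable {O : Set Z} {c M : ℝ} {e : Fin d → Z} {τ : Z} {ρ p : Z → ℝ} {v f : Fin d → Z → ℝ}
  (hS : LocalSolution O c M e τ ρ p v f) {K : Z → ℝ} {r : ℝ} (hK : IsMollifier K r)

section Basic
include hS

theorem c_le_M : c ≤ M := (hS.density_mem 0).1.trans (hS.density_mem 0).2

theorem M_pos : 0 < M := hS.c_pos.trans_le hS.c_le_M

theorem abs_density_le (z : Z) : |ρ z| ≤ M :=
  abs_le.2 ⟨by linarith [(hS.density_mem z).1, hS.c_pos, hS.M_pos], (hS.density_mem z).2⟩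

theorem density_bddMeas : BddMeas ρ := ⟨hS.density_measurable, M, hS.abs_density_le⟩

theorem velocity_bddMeas (i : Fin d) : BddMeas (v i) :=
  ⟨hS.velocity_measurable i, M, hS.velocity_le i⟩

theorem pressure_bddMeas : BddMeas p := ⟨hS.pressure_measurable, M, hS.pressure_le⟩

theorem momentum_bddMeas (i : Fin d) : BddMeas fun z => ρ z * v i z :=
  hS.density_bddMeas.mul (hS.velocity_bddMeas i)

theorem abs_momentum_le (i : Fin d) (z : Z) : |ρ z * v i z| ≤ M * M := by
  rw [abs_mul]
  exact mul_le_mul (hS.abs_density_le z) (hS.velocity_le i z) (abs_nonneg _) hS.M_pos.le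

theorem integrable_mul_clm_field {ψ : Z → ℝ} (hψ : IsTestOn O ψ) {b : Z → ℝ} (hb : BddMeas b) :
    Integrable fun z => b z * fderiv ℝ ψ z (field e v z) := by
  simp_rw [clm_field]
  exact hb.integrable_mul (integrable_finsetSum _ fun j _ =>
    (hS.velocity_bddMeas j).integrable_mul (hψ.fderiv_integrable _))

theorem integrable_mul_clm_field_add {ψ : Z → ℝ} (hψ : IsTestOn O ψ) {b : Z → ℝ}
    (hb : BddMeas b) : Integrable fun z => b z * fderiv ℝ ψ z (field e v z + τ) := by
  simp_rw [map_add, mul_add]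
  exact (hS.integrable_mul_clm_field hψ hb).add (hb.integrable_mul (hψ.fderiv_integrable _))

include hK

theorem contDiff_density : ContDiff ℝ ∞ (mollify K ρ) :=
  contDiff_mollify hK (locallyIntegrable_of_bddMeas hS.density_bddMeas)

theorem mollify_density_mem (z : Z) : mollify K ρ z ∈ Icc c M :=
  mollify_mem_Icc hK (locallyIntegrable_of_bddMeas hS.density_bddMeas) hS.density_mem z

theorem mollify_density_pos (z : Z) : 0 < mollify K ρ z :=
  hS.c_pos.trans_le (hS.mollify_density_mem hK z).1

theorem contDiff_momentum (i : Fin d) : ContDiff ℝ ∞ (mollify K fun y => ρ y * v i y) :=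
  contDiff_mollify hK (locallyIntegrable_of_bddMeas (hS.momentum_bddMeas i))

theorem contDiff_favre (i : Fin d) : ContDiff ℝ ∞ (favre K ρ v i) :=
  (hS.contDiff_momentum hK i).div (hS.contDiff_density hK)
    fun z => (hS.mollify_density_pos hK z).ne'

theorem contDiff_pressure : ContDiff ℝ ∞ (mollify K p) :=
  contDiff_mollify hK (locallyIntegrable_of_bddMeas hS.pressure_bddMeas)

theorem density_inv_bddMeas : BddMeas fun z => (mollify K ρ z)⁻¹ :=
  BddMeas.inv (hS.contDiff_density hK).continuous.measurable hS.c_pos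
    fun z => (hS.mollify_density_mem hK z).1

theorem mollify_density_bddMeas : BddMeas (mollify K ρ) :=
  ⟨(hS.contDiff_density hK).continuous.measurable, M, abs_mollify_le hK
    (locallyIntegrable_of_bddMeas hS.density_bddMeas) hS.abs_density_le⟩

theorem mollify_pressure_le (z : Z) : |mollify K p z| ≤ M := abs_mollify_le hK
    (locallyIntegrable_of_bddMeas hS.pressure_bddMeas) hS.pressure_le z

theorem mollify_pressure_bddMeas : BddMeas (mollify K p) :=
  ⟨(hS.contDiff_pressure hK).continuous.measurable, M, hS.mollify_pressure_le hK⟩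

theorem abs_favre_le (i : Fin d) (z : Z) : |favre K ρ v i z| ≤ M * M / c := by
  rw [favre, abs_div, abs_of_pos (hS.mollify_density_pos hK z)]
  exact div_le_div₀ (mul_nonneg hS.M_pos.le hS.M_pos.le)
    (abs_mollify_le hK (locallyIntegrable_of_bddMeas (hS.momentum_bddMeas i))
    (hS.abs_momentum_le i) z) hS.c_pos (hS.mollify_density_mem hK z).1

theorem favre_bddMeas (i : Fin d) : BddMeas (favre K ρ v i) :=
  ⟨(hS.contDiff_favre hK i).continuous.measurable, _, hS.abs_favre_le hK i⟩

/-- Leibniz rule for `ρ_K w = (ρ v)_K`, kept multiplied by `ρ_K` so that no quotient has to be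
differentiated. -/
theorem fderiv_favre (i : Fin d) (z h : Z) : mollify K ρ z * fderiv ℝ (favre K ρ v i) z h
    = fderiv ℝ (mollify K fun y => ρ y * v i y) z h
      - favre K ρ v i z * fderiv ℝ (mollify K ρ) z h := by
  have hne := (hS.mollify_density_pos hK z).ne'
  have e : (mollify K fun y => ρ y * v i y) = fun z => mollify K ρ z * favre K ρ v i z := by
    ext z
    rw [favre, mul_div_cancel₀ _ (hS.mollify_density_pos hK z).ne']
  rw [e, fderiv_fun_mul ((hS.contDiff_density hK).differentiable (by simp) z)
    ((hS.contDiff_favre hK i).differentiable (by simp) z)]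
  simp only [add_apply, smul_apply, smul_eq_mul]
  ring

theorem integrable_kernel_field {g : Z → ℝ} (hg : BddMeas g) (z : Z) :
    Integrable fun y => g y * fderiv ℝ K (z - y) (field e v y) := by
  simp_rw [clm_field, Finset.mul_sum]
  refine integrable_finsetSum _ fun j _ => ?_
  exact (integrable_fderiv_kernel_mul hK (locallyIntegrable_of_bddMeas
    (hg.mul (hS.velocity_bddMeas j))) z (e j)).congr (ae_of_all _ fun y => by beta_reduce; ring)

theorem integrable_kernel_const {g : Z → ℝ} (hg : BddMeas g) (z h : Z) :
    Integrable fun y => g y * fderiv ℝ K (z - y) h := by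
  exact (integrable_fderiv_kernel_mul hK (locallyIntegrable_of_bddMeas hg) z h).congr
    (ae_of_all _ fun y => by beta_reduce; ring)

/-- The mollified continuity equation at `z`, obtained by testing with the reflected kernel. Only
the kernel carries derivatives, so no regularity of the solution is involved. -/
theorem integral_kernel_field_density {z : Z} (hz : Metric.closedBall z r ⊆ O) :
    ∫ y, ρ y * fderiv ℝ K (z - y) (field e v y + τ) = 0 := by
  have := hS.transport _ (hK.isTestOn hz)
  simp_rw [hK.fderiv_reflect, mul_neg, integral_neg] at this
  linarith

theorem integral_kernel_field_momentum (i : Fin d) {z : Z} (hz : Metric.closedBall z r ⊆ O) :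
    ∫ y, (ρ y * v i y) * fderiv ℝ K (z - y) (field e v y + τ)
      = - fderiv ℝ (mollify K p) z (e i) + mollify K (f i) z := by
  have := hS.momentum i _ (hK.isTestOn hz)
  have i1 : Integrable fun y => (ρ y * v i y) * fderiv ℝ K (z - y) (field e v y + τ) := by
    simp_rw [map_add, mul_add]
    exact (hS.integrable_kernel_field hK (hS.momentum_bddMeas i) z).add
      (hS.integrable_kernel_const hK (hS.momentum_bddMeas i) z τ)
  have i2 := hS.integrable_kernel_const hK hS.pressure_bddMeas z (e i)
  have i3 : Integrable fun y => f i y * K (z - y) :=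
    (integrable_kernel_mul hK (hS.force_integrable i).locallyIntegrable z).congr
      (ae_of_all _ fun y => by beta_reduce; ring)
  simp_rw [hK.fderiv_reflect, mul_neg] at this
  rw [integral_add (i1.fun_neg.fun_add i2.fun_neg) i3, integral_add i1.fun_neg i2.fun_neg] at this
  rw [integral_neg, integral_neg] at this
  rw [fderiv_mollify hK (locallyIntegrable_of_bddMeas hS.pressure_bddMeas), mollify]
  have e1 : ∫ y, p y * fderiv ℝ K (z - y) (e i) = ∫ y, fderiv ℝ K (z - y) (e i) * p y := by
    simp_rw [mul_comm]
  have e2 : ∫ y, f i y * K (z - y) = ∫ y, K (z - y) * f i y := by simp_rw [mul_comm]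
  linarith

/-- The evolution of the weighted average. The derivative is taken along the velocity at `z`, while
the mollified equations contain the velocity at `y` under the integral; the difference is the
commutator. Subtracting `w` times the continuity equation is what produces the increment `v i y - w
i z` instead of `v i y`, and this second increment is what makes the commutator small. -/
theorem mul_fderiv_favre (i : Fin d) {z : Z} (hz : Metric.closedBall z r ⊆ O) :
    mollify K ρ z * fderiv ℝ (favre K ρ v i) z (field e v z + τ)
      = commutator K e ρ v i z - fderiv ℝ (mollify K p) z (e i) + mollify K (f i) z := by
  rw [hS.fderiv_favre hK]
  have h1 := hS.integral_kernel_field_density hK hz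
  have h2 := hS.integral_kernel_field_momentum hK i hz
  set w := favre K ρ v i z with hw
  set U := field e v z with hU
  have a1 := hS.integrable_kernel_field hK hS.density_bddMeas z
  have a2 := hS.integrable_kernel_const hK hS.density_bddMeas z τ
  have a3 := hS.integrable_kernel_field hK (hS.momentum_bddMeas i) z
  have a4 := hS.integrable_kernel_const hK (hS.momentum_bddMeas i) z τ
  have a5 := hS.integrable_kernel_const hK hS.density_bddMeas z U
  have a6 := hS.integrable_kernel_const hK (hS.momentum_bddMeas i) z U
  -- The commutator is expanded into four integrals, with the velocity frozen at `z` or taken at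
  -- `y`.
  have hc : commutator K e ρ v i z
      = ((∫ y, (ρ y * v i y) * fderiv ℝ K (z - y) U)
          - ∫ y, (ρ y * v i y) * fderiv ℝ K (z - y) (field e v y))
        - w * ((∫ y, ρ y * fderiv ℝ K (z - y) U)
          - ∫ y, ρ y * fderiv ℝ K (z - y) (field e v y)) := by
    have s1 : Integrable fun y => (ρ y * v i y) * fderiv ℝ K (z - y) U
      - (ρ y * v i y) * fderiv ℝ K (z - y) (field e v y) := a6.sub a3
    have s2 : Integrable fun y => ρ y * fderiv ℝ K (z - y) U
      - ρ y * fderiv ℝ K (z - y) (field e v y) := a5.sub a1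
    rw [← integral_sub a6 a3, ← integral_sub a5 a1, ← integral_const_mul, ← integral_sub
      s1 (s2.const_mul _), commutator]
    congr 1; ext y
    rw [map_sub, ← hw, ← hU]; ring
  rw [fderiv_mollify hK (locallyIntegrable_of_bddMeas hS.density_bddMeas),
    fderiv_mollify hK (locallyIntegrable_of_bddMeas (hS.momentum_bddMeas i))]
  simp_rw [map_add, mul_add] at h1 h2 ⊢
  rw [integral_add a1 a2] at h1
  rw [integral_add a3 a4] at h2
  have b5 : Integrable fun y => fderiv ℝ K (z - y) U * ρ y := by simpa [mul_comm] using a5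
  have b2 : Integrable fun y => fderiv ℝ K (z - y) τ * ρ y := by simpa [mul_comm] using a2
  have b6 : Integrable fun y => fderiv ℝ K (z - y) U * (ρ y * v i y) := by
    simpa [mul_comm] using a6
  have b4 : Integrable fun y => fderiv ℝ K (z - y) τ * (ρ y * v i y) := by
    simpa [mul_comm] using a4
  simp_rw [add_mul]
  rw [integral_add b5 b2, integral_add b6 b4, hc]
  have e1 : ∀ (h : Z) (g : Z → ℝ), ∫ y, fderiv ℝ K (z - y) h * g y
      = ∫ y, g y * fderiv ℝ K (z - y) h := fun h g => by simp_rw [mul_comm]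
  rw [e1 U ρ, e1 τ ρ, e1 U fun y => ρ y * v i y, e1 τ fun y => ρ y * v i y]
  -- Momentum equation minus `w` times continuity equation: this eliminates the integrals with the
  -- velocity at `y` and those with the time direction.
  linear_combination h2 - w * h1

end Basic

end LocalSolution

end

/-! ### The balance of energy for the mollified solution -/

section

variable {d : ℕ}
variable {Z : Type*} [NormedAddCommGroup Z] [NormedSpace ℝ Z] [FiniteDimensional ℝ Z]
  [MeasureSpace Z] [BorelSpace Z] [(volume : Measure Z).IsAddHaarMeasure]

theorem IsTestOn.integrable_mul_continuous {O : Set Z} {φ : Z → ℝ} (hφ : IsTestOn O φ)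
    {g : Z → ℝ} (hg : Continuous g) : Integrable fun z => φ z * g z :=
  (hφ.1.continuous.mul hg).integrable_of_hasCompactSupport hφ.2.1.mul_right

theorem IsTestOn.integrable_mul_fderiv {O : Set Z} {φ : Z → ℝ} (hφ : IsTestOn O φ)
    {g : Z → ℝ} (hg : ContDiff ℝ ∞ g) (h : Z) : Integrable fun z => φ z * fderiv ℝ g z h :=
  hφ.integrable_mul_continuous ((hg.continuous_fderiv (by simp)).clm_apply continuous_const)

namespace LocalSolution

variable {O : Set Z} {c M : ℝ} {e : Fin d → Z} {τ : Z} {ρ p : Z → ℝ} {v f : Fin d → Z → ℝ}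
  (hS : LocalSolution O c M e τ ρ p v f) {K : Z → ℝ} {r : ℝ} (hK : IsMollifier K r)
  {φ : Z → ℝ} (hφ : IsTestOn O φ) (hr : ∀ z ∈ tsupport φ, Metric.closedBall z r ⊆ O)

/-- The pressure terms in the balance of energy. -/
noncomputable def pressureTerm (K : Z → ℝ) (e : Fin d → Z) (ρ p : Z → ℝ) (v : Fin d → Z → ℝ)
    (φ : Z → ℝ) : ℝ :=
  -(∑ i, ∫ z, (ρ z * v i z * (mollify K ρ z)⁻¹) * (φ z * fderiv ℝ (mollify K p) z (e i)))
    + (∑ i, ∫ z, p z * (φ z * fderiv ℝ (favre K ρ v i) z (e i)))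
    + ∑ i, ∫ z, (p z * favre K ρ v i z) * fderiv ℝ φ z (e i)

section
include hS hK hφ

theorem integrable_mul_fderiv_favre (i : Fin d) :
    Integrable fun z => φ z * fderiv ℝ (favre K ρ v i) z (field e v z + τ) := by
  have h : ∀ h, Integrable fun z => φ z * fderiv ℝ (favre K ρ v i) z h :=
    hφ.integrable_mul_fderiv (hS.contDiff_favre hK i)
  simp_rw [map_add, mul_add, clm_field, Finset.mul_sum]
  refine (integrable_finsetSum _ fun j _ => ?_).fun_add (h τ)
  exact ((hS.velocity_bddMeas j).integrable_mul (h (e j))).congr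
    (ae_of_all _ fun z => by beta_reduce; ring)

include hr

/-- Off the support of `φ` both sides vanish; on it this is the evolution of the weighted average.
Since the right side is visibly integrable, the integrability of the commutator term follows without
any estimate. -/
theorem mul_commutator_eq (i : Fin d) (z : Z) : φ z * commutator K e ρ v i z
    = mollify K ρ z * (φ z * fderiv ℝ (favre K ρ v i) z (field e v z + τ))
      + φ z * fderiv ℝ (mollify K p) z (e i) - φ z * mollify K (f i) z := by
  by_cases hz : z ∈ tsupport φ
  · linear_combination (-φ z) * hS.mul_fderiv_favre hK i (hr z hz)
  · rw [image_eq_zero_of_notMem_tsupport hz]; ring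

theorem integrable_mul_commutator (i : Fin d) :
    Integrable fun z => φ z * commutator K e ρ v i z := by
  simp_rw [hS.mul_commutator_eq hK hφ hr i]
  exact (((hS.mollify_density_bddMeas hK).integrable_mul
    (hS.integrable_mul_fderiv_favre hK hφ i)).fun_add
    (hφ.integrable_mul_fderiv (hS.contDiff_pressure hK) (e i))).sub
    (hφ.integrable_mul_continuous (contDiff_mollify hK
      (hS.force_integrable i).locallyIntegrable).continuous)

/-- The balance of energy at the level of the mollification. -/
theorem energy_identity :
    (∑ i, ∫ z, (ρ z * v i z * favre K ρ v i z) * fderiv ℝ φ z (field e v z + τ))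
    + (∑ i, ∫ z, (ρ z * v i z * (mollify K ρ z)⁻¹) * (φ z * commutator K e ρ v i z))
    + ((∑ i, ∫ z, (ρ z * v i z * (mollify K ρ z)⁻¹ * φ z) * mollify K (f i) z)
      + ∑ i, ∫ z, (favre K ρ v i z * φ z) * f i z)
    + pressureTerm K e ρ p v φ = 0 := by
  rw [pressureTerm, ← Finset.sum_neg_distrib]
  simp only [← Finset.sum_add_distrib]
  refine Finset.sum_eq_zero fun i _ => ?_
  have hw := hS.contDiff_favre hK i
  have hRi := hS.density_inv_bddMeas hK
  have hRpos := hS.mollify_density_pos hK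
  -- The momentum equation is tested in its original form, with `φ w_i`; only one of the two
  -- velocity factors of the energy is regularized.
  have hmom := hS.momentum i _ (hφ.mul_smooth hw)
  have hb1 := hS.momentum_bddMeas i
  have hb2 := hb1.mul hRi
  have i1 := hS.integrable_mul_clm_field_add hφ (hb1.mul (hS.favre_bddMeas hK i))
  have i2 := hb2.integrable_mul (hS.integrable_mul_commutator hK hφ hr i)
  have i3 : Integrable fun z => (ρ z * v i z * (mollify K ρ z)⁻¹ * φ z) * mollify K (f i) z :=
    (hb2.integrable_mul (hφ.integrable_mul_continuous (contDiff_mollify hK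
      (hS.force_integrable i).locallyIntegrable).continuous)).congr
      (ae_of_all _ fun z => by beta_reduce; ring)
  have i4 := ((hS.favre_bddMeas hK i).mul hφ.bddMeas).integrable_mul (hS.force_integrable i)
  have i5 := hb2.integrable_mul (hφ.integrable_mul_fderiv (hS.contDiff_pressure hK) (e i))
  have i6 := hS.pressure_bddMeas.integrable_mul (hφ.integrable_mul_fderiv hw (e i))
  have i7 := (hS.pressure_bddMeas.mul (hS.favre_bddMeas hK i)).integrable_mul
    (hφ.fderiv_integrable (e i))
  rw [← integral_neg, ← integral_add i1 i2, ← integral_add i3 i4, ← integral_add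
    (i1.fun_add i2) (i3.fun_add i4), ← integral_add i5.fun_neg i6,
    ← integral_add (i5.fun_neg.fun_add i6) i7, ← integral_add
    ((i1.fun_add i2).fun_add (i3.fun_add i4)) ((i5.fun_neg.fun_add i6).fun_add i7), ← hmom]
  congr 1; ext z
  rw [fderiv_fun_mul (hφ.1.differentiable (by simp) z) (hw.differentiable (by simp) z)]
  simp only [add_apply, smul_apply, smul_eq_mul]
  have h1 := hS.mul_commutator_eq hK hφ hr i z
  have h2 : (mollify K ρ z)⁻¹ * mollify K ρ z = 1 := inv_mul_cancel₀ (hRpos z).ne'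
  linear_combination (ρ z * v i z * (mollify K ρ z)⁻¹) * h1
    + (ρ z * v i z * φ z * fderiv ℝ (favre K ρ v i) z (field e v z + τ)) * h2

end

/-- The part of the pressure terms that passes to the limit. -/
noncomputable def pressureMain (K : Z → ℝ) (e : Fin d → Z) (ρ p : Z → ℝ) (v G : Fin d → Z → ℝ)
    (φ : Z → ℝ) : ℝ :=
  -(∫ z, (φ z * mollify K p z * (mollify K ρ z)⁻¹) * ∑ j, v j z * G j z) * (-1)
    + (∫ z, (ρ z * mollify K p z * (mollify K ρ z)⁻¹) * fderiv ℝ φ z (field e v z))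
    + (∑ i, ∫ z, (p z * favre K ρ v i z) * fderiv ℝ φ z (e i))
    - (∑ j, ∫ z, (ρ z * φ z * mollify K p z * v j z * (mollify K ρ z)⁻¹ * (mollify K ρ z)⁻¹)
        * mollify K (G j) z)
    + (∫ z, (p z * φ z * (mollify K ρ z)⁻¹) * mollify K (fun y => ∑ j, v j y * G j y) z)
    - ∑ i, ∫ z, (p z * φ z * favre K ρ v i z * (mollify K ρ z)⁻¹) * mollify K (G i) z

/-- The constant in front of `∫ |φ| dμ`. -/
noncomputable def chainConst (d : ℕ) (c M : ℝ) : ℝ≥0∞ :=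
  ENNReal.ofReal (d * M) * ENNReal.ofReal (M * c⁻¹)

/-- The constant in front of the mollified measure. -/
noncomputable def kernelConst (d : ℕ) (c M : ℝ) : ℝ≥0∞ :=
  (d * ENNReal.ofReal (M * M * M * c⁻¹ * c⁻¹) + ENNReal.ofReal (M * c⁻¹) * ENNReal.ofReal (d * M))
    + d * ENNReal.ofReal (M * (M * M / c) * c⁻¹)

theorem enorm_integral_mul_le {φ s : Z → ℝ} {m : Z → ℝ≥0∞} {b : Z → ℝ} {C : ℝ} {D : ℝ≥0∞}
    (hD : D ≠ ⊤) (hb : ∀ z, |b z| ≤ C) (hs : ∀ z ∈ tsupport φ, ‖s z‖ₑ ≤ D * m z) :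
    ‖∫ z, b z * (φ z * s z)‖ₑ ≤ ENNReal.ofReal C * D * ∫⁻ z, ‖φ z‖ₑ * m z := by
  refine (enorm_integral_le_lintegral_enorm _).trans ?_
  rw [← lintegral_const_mul' _ _ (ENNReal.mul_ne_top ENNReal.ofReal_ne_top hD)]
  refine lintegral_mono fun z => ?_
  rw [enorm_mul, enorm_mul]
  have h1 : ‖b z‖ₑ ≤ ENNReal.ofReal C := by
    rw [Real.enorm_eq_ofReal_abs]; exact ENNReal.ofReal_le_ofReal (hb z)
  by_cases hz : z ∈ tsupport φ
  · calc _ ≤ ENNReal.ofReal C * (‖φ z‖ₑ * (D * m z)) := by gcongr; exact hs z hz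
      _ = _ := by ring
  · rw [image_eq_zero_of_notMem_tsupport hz]; simp

variable {G : Fin d → Z → ℝ} (hGm : ∀ j, Measurable (G j)) (hG : ∀ j, Integrable (G j))
  {μ : Measure Z} [IsFiniteMeasure μ] (hder : ∀ j, IsDerivUpTo O ρ (e j) (G j) μ)

include hS hK hφ hr hGm hG hder in
-- Derivatives of pressure and velocity are traded for derivatives of the density. The term `φ ∂_i
-- p_K / ρ_K` is the derivative of `ψ = φ p_K / ρ_K` up to terms where the derivative falls on `φ`
-- or on `1 / ρ_K`; against `ρ V`, the derivative of `ψ` is given by the chain rule. The divergence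
-- of `w = (ρ V)_K / ρ_K` is treated with the quotient rule, its numerator again by the chain rule.
-- The chain rule tested with `ψ`, where `|ψ| ≤ (M / c) |φ|`, produces `chainConst`; the errors of
-- mollified derivatives produce `kernelConst`.
theorem enorm_pressureTerm_sub_le :
    ‖pressureTerm K e ρ p v φ - pressureMain K e ρ p v G φ‖ₑ ≤
      chainConst d c M * ∫⁻ z, ‖φ z‖ₑ ∂μ
        + kernelConst d c M * ∫⁻ z, ‖φ z‖ₑ * mollifyMeasure K μ z := by
  have hRi := hS.density_inv_bddMeas hK
  have hRpos := hS.mollify_density_pos hK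
  have hRR := hS.mollify_density_mem hK
  have hR := hS.contDiff_density hK
  have hp := hS.contDiff_pressure hK
  have hpb := hS.mollify_pressure_bddMeas hK
  have hRc : ContDiff ℝ ∞ fun z => (mollify K ρ z)⁻¹ := hR.inv fun z => (hRpos z).ne'
  have hρl := locallyIntegrable_of_bddMeas hS.density_bddMeas
  have hc := hS.c_pos
  have hM := hS.M_pos
  have hRi_le : ∀ z, |(mollify K ρ z)⁻¹| ≤ c⁻¹ := fun z => by
    rw [abs_inv, abs_of_pos (hRpos z)]; exact inv_anti₀ hc (hRR z).1
  have hgi : Integrable fun z => ∑ j, v j z * G j z :=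
    integrable_finsetSum _ fun j _ => (hS.velocity_bddMeas j).integrable_mul (hG j)
  set g : Z → ℝ := fun z => ∑ j, v j z * G j z with hg
  -- the test function `φ p_K / ρ_K`
  have hψ : IsTestOn O fun z => φ z * (mollify K p z * (mollify K ρ z)⁻¹) :=
    hφ.mul_smooth (hp.mul hRc)
  set ψ : Z → ℝ := fun z => φ z * (mollify K p z * (mollify K ρ z)⁻¹) with hψd
  have hDψ : ∀ z h, fderiv ℝ ψ z h = mollify K p z * (mollify K ρ z)⁻¹ * fderiv ℝ φ z h
      + φ z * fderiv ℝ (mollify K p) z h * (mollify K ρ z)⁻¹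
      - φ z * mollify K p z * fderiv ℝ (mollify K ρ) z h
        * (mollify K ρ z)⁻¹ * (mollify K ρ z)⁻¹ := by
    intro z h
    have e0 : (fun z => mollify K p z) = fun z => mollify K ρ z *
        (mollify K p z * (mollify K ρ z)⁻¹) := by
      ext z; field_simp [(hRpos z).ne']
    have e1 : fderiv ℝ (mollify K p) z h = mollify K ρ z *
        fderiv ℝ (fun z => mollify K p z * (mollify K ρ z)⁻¹) z h
        + (mollify K p z * (mollify K ρ z)⁻¹) * fderiv ℝ (mollify K ρ) z h := by
      conv_lhs => rw [show mollify K p = fun z => mollify K ρ z *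
        (mollify K p z * (mollify K ρ z)⁻¹) from e0]
      rw [fderiv_fun_mul (hR.differentiable (by simp) z)
        ((hp.mul hRc).differentiable (by simp) z)]
      simp only [add_apply, smul_apply, smul_eq_mul]
    rw [hψd, fderiv_fun_mul (hφ.1.differentiable (by simp) z)
        ((hp.mul hRc).differentiable (by simp) z)]
    simp only [add_apply, smul_apply, smul_eq_mul]
    have h2 : (mollify K ρ z)⁻¹ * mollify K ρ z = 1 := inv_mul_cancel₀ (hRpos z).ne'
    rw [e1]
    linear_combination (-φ z * fderiv ℝ (fun z => mollify K p z * (mollify K ρ z)⁻¹) z h) * h2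
  -- remainders
  set s : Fin d → Z → ℝ := fun j z => fderiv ℝ (mollify K ρ) z (e j) - mollify K (G j) z with hs
  set q : Z → ℝ := fun z => (∑ i, fderiv ℝ (mollify K fun y => ρ y * v i y) z (e i))
    - mollify K g z with hq
  have hs_le : ∀ j, ∀ z ∈ tsupport φ, ‖s j z‖ₑ ≤ 1 * mollifyMeasure K μ z := fun j z hz => by
    rw [one_mul]; exact (hder j).fderiv_mollify_sub hρl hK (hr z hz)
  have hT := fun ψ (hψ : IsTestOn O ψ) => enorm_integral_mul_fderiv_field_le hS.isOpen
    hS.velocity_measurable hS.velocity_le hS.incompressible hS.density_bddMeas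
    hS.density_integrable hGm hG hder hψ
  rw [Fintype.card_fin] at hT
  -- The divergence of `(ρ V)_K` at `z` is, up to sign, the chain rule tested with the reflected
  -- kernel, which explains the factor `d * M`.
  have hq_le : ∀ z ∈ tsupport φ, ‖q z‖ₑ ≤ ENNReal.ofReal (d * M) * mollifyMeasure K μ z := by
    intro z hz
    refine le_trans (le_of_eq ?_) (hT _ (hK.isTestOn (hr z hz)))
    simp_rw [hK.fderiv_reflect, mul_neg, integral_neg, hq]
    rw [← enorm_neg]
    have : ∑ i, fderiv ℝ (mollify K fun y => ρ y * v i y) z (e i)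
        = ∫ y, ρ y * fderiv ℝ K (z - y) (field e v y) := by
      simp_rw [clm_field, Finset.mul_sum]
      rw [integral_finsetSum]
      · refine Finset.sum_congr rfl fun i _ => ?_
        rw [fderiv_mollify hK (locallyIntegrable_of_bddMeas (hS.momentum_bddMeas i))]
        congr 1; ext y; ring
      · intro i _
        exact (hS.integrable_kernel_const hK (hS.momentum_bddMeas i) z (e i)).congr
          (ae_of_all _ fun y => by beta_reduce; ring)
    rw [this, mollify]
    congr 1; ring
  -- integrability
  have hφR : ∀ j, Integrable fun z => φ z * fderiv ℝ (mollify K ρ) z (e j) := fun j =>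
    hφ.integrable_mul_fderiv hR (e j)
  have hφG : ∀ j, Integrable fun z => φ z * mollify K (G j) z := fun j =>
    hφ.integrable_mul_continuous (contDiff_mollify hK (hG j).locallyIntegrable).continuous
  have hφg : Integrable fun z => φ z * mollify K g z :=
    hφ.integrable_mul_continuous (contDiff_mollify hK hgi.locallyIntegrable).continuous
  have hφs : ∀ j, Integrable fun z => φ z * s j z := fun j => by
    refine ((hφR j).sub (hφG j)).congr (ae_of_all _ fun z => ?_)
    simp only [hs, Pi.sub_apply]; ring
  have hφm : Integrable fun z => φ z * ∑ i, fderiv ℝ (mollify K fun y => ρ y * v i y) z (e i) := by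
    simp_rw [Finset.mul_sum]
    exact integrable_finsetSum _ fun i _ =>
      hφ.integrable_mul_fderiv (hS.contDiff_momentum hK i) (e i)
  have hφq : Integrable fun z => φ z * q z := by
    refine (hφm.sub hφg).congr (ae_of_all _ fun z => ?_)
    simp only [hq, Pi.sub_apply]; ring
  -- first group
  have hA : ∑ i, ∫ z, (ρ z * v i z * (mollify K ρ z)⁻¹) * (φ z * fderiv ℝ (mollify K p) z (e i))
      = (∫ z, ρ z * fderiv ℝ ψ z (field e v z))
        - (∫ z, (ρ z * mollify K p z * (mollify K ρ z)⁻¹) * fderiv ℝ φ z (field e v z))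
        + ((∑ j, ∫ z, (ρ z * φ z * mollify K p z * v j z * (mollify K ρ z)⁻¹
            * (mollify K ρ z)⁻¹) * mollify K (G j) z)
          + ∑ j, ∫ z, (ρ z * mollify K p z * v j z * (mollify K ρ z)⁻¹ * (mollify K ρ z)⁻¹)
            * (φ z * s j z)) := by
    have b1 : ∀ j, BddMeas fun z => ρ z * mollify K p z * v j z * (mollify K ρ z)⁻¹
        * (mollify K ρ z)⁻¹ := fun j =>
      (((hS.density_bddMeas.mul hpb).mul (hS.velocity_bddMeas j)).mul hRi).mul hRi
    have j1 : ∀ j, Integrable fun z => (ρ z * φ z * mollify K p z * v j z * (mollify K ρ z)⁻¹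
            * (mollify K ρ z)⁻¹) * mollify K (G j) z := fun j =>
      ((b1 j).integrable_mul (hφG j)).congr (ae_of_all _ fun z => by beta_reduce; ring)
    have j2 := fun j => (b1 j).integrable_mul (hφs j)
    have j3 := hS.integrable_mul_clm_field hψ hS.density_bddMeas
    have j4 := hS.integrable_mul_clm_field hφ ((hS.density_bddMeas.mul hpb).mul hRi)
    rw [← integral_finsetSum _ fun j _ => j1 j, ← integral_finsetSum _ fun j _ => j2 j,
      ← integral_finsetSum, ← integral_sub j3 j4, ← integral_add
      (integrable_finsetSum _ fun j _ => j1 j) (integrable_finsetSum _ fun j _ => j2 j)]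
    · have j5 : Integrable fun z => ρ z * fderiv ℝ ψ z (field e v z)
        - ρ z * mollify K p z * (mollify K ρ z)⁻¹ * fderiv ℝ φ z (field e v z) := j3.sub j4
      rw [← integral_add j5 ((integrable_finsetSum _ fun j _ => j1 j).fun_add
        (integrable_finsetSum _ fun j _ => j2 j))]
      congr 1; ext z
      rw [clm_field, clm_field, ← Finset.sum_add_distrib, Finset.mul_sum, Finset.mul_sum,
        ← Finset.sum_sub_distrib, ← Finset.sum_add_distrib]
      refine Finset.sum_congr rfl fun j _ => ?_
      rw [hDψ, hs]; ring
    · intro i _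
      exact ((hS.momentum_bddMeas i).mul hRi).integrable_mul (hφ.integrable_mul_fderiv hp (e i))
  -- second group
  have hB : ∑ i, ∫ z, p z * (φ z * fderiv ℝ (favre K ρ v i) z (e i))
      = (∫ z, (p z * φ z * (mollify K ρ z)⁻¹) * mollify K g z)
        + (∫ z, (p z * (mollify K ρ z)⁻¹) * (φ z * q z))
        - ((∑ i, ∫ z, (p z * φ z * favre K ρ v i z * (mollify K ρ z)⁻¹) * mollify K (G i) z)
          + ∑ i, ∫ z, (p z * favre K ρ v i z * (mollify K ρ z)⁻¹) * (φ z * s i z)) := by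
    have b1 : ∀ i, BddMeas fun z => p z * favre K ρ v i z * (mollify K ρ z)⁻¹ := fun i =>
      (hS.pressure_bddMeas.mul (hS.favre_bddMeas hK i)).mul hRi
    have b2 := hS.pressure_bddMeas.mul hRi
    have j1 : ∀ i, Integrable fun z => (p z * φ z * favre K ρ v i z * (mollify K ρ z)⁻¹)
        * mollify K (G i) z := fun i =>
      ((b1 i).integrable_mul (hφG i)).congr (ae_of_all _ fun z => by beta_reduce; ring)
    have j2 := fun j => (b1 j).integrable_mul (hφs j)
    have j3 : Integrable fun z => (p z * φ z * (mollify K ρ z)⁻¹) * mollify K g z :=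
      (b2.integrable_mul hφg).congr (ae_of_all _ fun z => by beta_reduce; ring)
    have j4 := b2.integrable_mul hφq
    rw [← integral_finsetSum _ fun j _ => j1 j, ← integral_finsetSum _ fun j _ => j2 j,
      ← integral_finsetSum, ← integral_add j3 j4, ← integral_add
      (integrable_finsetSum _ fun j _ => j1 j) (integrable_finsetSum _ fun j _ => j2 j),
      ← integral_sub (j3.fun_add j4) ((integrable_finsetSum _ fun j _ => j1 j).fun_add
        (integrable_finsetSum _ fun j _ => j2 j))]
    · congr 1; ext z
      have e1 : ∀ i, fderiv ℝ (favre K ρ v i) z (e i) = (mollify K ρ z)⁻¹ *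
          (fderiv ℝ (mollify K fun y => ρ y * v i y) z (e i)
            - favre K ρ v i z * fderiv ℝ (mollify K ρ) z (e i)) := fun i => by
        rw [← hS.fderiv_favre hK, inv_mul_cancel_left₀ (hRpos z).ne']
      simp_rw [e1, hq, hs]
      rw [← Finset.sum_add_distrib]
      have e2 : p z * φ z * (mollify K ρ z)⁻¹ * mollify K g z + p z * (mollify K ρ z)⁻¹ * (φ z *
          ((∑ i, fderiv ℝ (mollify K fun y => ρ y * v i y) z (e i)) - mollify K g z))
          = ∑ i, p z * (mollify K ρ z)⁻¹ * φ z *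
            fderiv ℝ (mollify K fun y => ρ y * v i y) z (e i) := by
        rw [← Finset.mul_sum]; ring
      rw [e2, ← Finset.sum_sub_distrib]
      refine Finset.sum_congr rfl fun i _ => ?_
      ring
    · intro i _
      exact hS.pressure_bddMeas.integrable_mul
        (hφ.integrable_mul_fderiv (hS.contDiff_favre hK i) (e i))
  have hψg : ∫ z, (φ z * mollify K p z * (mollify K ρ z)⁻¹) * g z = ∫ z, ψ z * g z := by
    congr 1; ext z; rw [hψd]; ring
  have hmain : pressureTerm K e ρ p v φ - pressureMain K e ρ p v G φ
      = -((∫ z, ρ z * fderiv ℝ ψ z (field e v z)) + ∫ z, ψ z * g z)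
        + ((-(∑ j, ∫ z, (ρ z * mollify K p z * v j z * (mollify K ρ z)⁻¹ * (mollify K ρ z)⁻¹)
            * (φ z * s j z)) + ∫ z, (p z * (mollify K ρ z)⁻¹) * (φ z * q z))
          + -(∑ i, ∫ z, (p z * favre K ρ v i z * (mollify K ρ z)⁻¹) * (φ z * s i z))) := by
    rw [pressureTerm, pressureMain, hA, hB, hψg]
    ring
  rw [hmain]
  refine (enorm_add_le _ _).trans (add_le_add ?_ ?_)
  · rw [enorm_neg]
    refine (hT _ hψ).trans ?_
    rw [chainConst, mul_assoc]
    refine mul_le_mul' le_rfl ?_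
    rw [← lintegral_const_mul' _ _ ENNReal.ofReal_ne_top]
    refine lintegral_mono fun z => ?_
    beta_reduce
    rw [enorm_mul, mul_comm]
    refine mul_le_mul' ?_ le_rfl
    rw [Real.enorm_eq_ofReal_abs, abs_mul]
    exact ENNReal.ofReal_le_ofReal (mul_le_mul (hS.mollify_pressure_le hK z) (hRi_le z)
      (abs_nonneg _) hM.le)
  · rw [kernelConst, add_mul, add_mul]
    refine (enorm_add_le _ _).trans (add_le_add ((enorm_add_le _ _).trans (add_le_add ?_ ?_)) ?_)
    · rw [enorm_neg]
      refine (enorm_sum_le _ _).trans ?_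
      have : ∀ j ∈ Finset.univ, ‖∫ z, (ρ z * mollify K p z * v j z * (mollify K ρ z)⁻¹
          * (mollify K ρ z)⁻¹) * (φ z * s j z)‖ₑ ≤ ENNReal.ofReal (M * M * M * c⁻¹ * c⁻¹)
          * 1 * ∫⁻ z, ‖φ z‖ₑ * mollifyMeasure K μ z := fun j _ =>
        enorm_integral_mul_le ENNReal.one_ne_top (fun z => by
          simp only [abs_mul]
          gcongr
          · exact hS.abs_density_le z
          · exact hS.mollify_pressure_le hK z
          · exact hS.velocity_le j z
          · exact hRi_le z
          · exact hRi_le z) (hs_le j)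
      refine (Finset.sum_le_sum this).trans (le_of_eq ?_)
      rw [Finset.sum_const, Finset.card_univ, Fintype.card_fin, nsmul_eq_mul]; ring
    · exact enorm_integral_mul_le ENNReal.ofReal_ne_top (fun z => by
          simp only [abs_mul]
          gcongr
          · exact hS.pressure_le z
          · exact hRi_le z) hq_le
    · rw [enorm_neg]
      refine (enorm_sum_le _ _).trans ?_
      have : ∀ j ∈ Finset.univ, ‖∫ z, (p z * favre K ρ v j z * (mollify K ρ z)⁻¹)
          * (φ z * s j z)‖ₑ ≤ ENNReal.ofReal (M * (M * M / c) * c⁻¹)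
          * 1 * ∫⁻ z, ‖φ z‖ₑ * mollifyMeasure K μ z := fun j _ =>
        enorm_integral_mul_le ENNReal.one_ne_top (fun z => by
          simp only [abs_mul]
          gcongr
          · exact hS.pressure_le z
          · exact hS.abs_favre_le hK j z
          · exact hRi_le z) (hs_le j)
      refine (Finset.sum_le_sum this).trans (le_of_eq ?_)
      rw [Finset.sum_const, Finset.card_univ, Fintype.card_fin, nsmul_eq_mul]; ring

end LocalSolution

end

/-! ### Passage to the limit in the balance of energy -/

section

variable {d : ℕ}
variable {Z : Type*} [NormedAddCommGroup Z] [NormedSpace ℝ Z] [FiniteDimensional ℝ Z]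
  [MeasureSpace Z] [BorelSpace Z] [(volume : Measure Z).IsAddHaarMeasure]

theorem limsup_add_le_of_tendsto {X Y : ℕ → ℝ≥0∞} {y : ℝ≥0∞} (hY : Tendsto Y atTop (𝓝 y)) :
    limsup (fun n => Y n + X n) atTop ≤ y + limsup X atTop := by
  refine ENNReal.le_of_forall_pos_le_add fun ε hε hlt => ?_
  have hy : y ≠ ⊤ := (le_self_add.trans_lt hlt).ne
  have hev : ∀ᶠ n in atTop, Y n ≤ y + ε :=
    hY.eventually_le_const (ENNReal.lt_add_right hy (by simpa using hε.ne'))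
  calc limsup (fun n => Y n + X n) atTop ≤ limsup (fun n => (y + ε) + X n) atTop := by
        refine limsup_le_limsup ?_
        filter_upwards [hev] with n hn
        gcongr
    _ = (y + ε) + limsup X atTop := by
        apply limsup_const_add <;> isBoundedDefault
    _ = _ := by abel

theorem tendsto_lintegral_mollify_sub {K : ℕ → Z → ℝ} {r : ℕ → ℝ}
    (hK : ∀ n, IsMollifier (K n) (r n)) (hr : Tendsto r atTop (𝓝 0)) {F : Z → ℝ}
    (hFm : Measurable F) (hF : LocallyIntegrable F) {c : ℝ} (hFc : Integrable fun z => F z - c) :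
    Tendsto (fun n => ∫⁻ z, ‖mollify (K n) F z - F z‖ₑ) atTop (𝓝 0) :=
  tendsto_of_tendsto_of_tendsto_of_le_of_le tendsto_const_nhds
    ((tendsto_shiftModulus hFc).comp hr) (fun _ => zero_le)
    fun n => lintegral_mollify_sub_le_modulus (hK n) hFm hF

theorem integrable_mollify {K : Z → ℝ} {r : ℝ} (hK : IsMollifier K r) {F : Z → ℝ}
    (hF : Integrable F) : Integrable (mollify K F) := by
  have := hF.integrable_convolution (ContinuousLinearMap.mul ℝ ℝ) hK.integrable
  convert this using 1
  ext z
  simp [mollify, convolution_def, mul_comm]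

theorem L1Seq.mollify {K : ℕ → Z → ℝ} {r : ℕ → ℝ}
    (hK : ∀ n, IsMollifier (K n) (r n)) (hr : Tendsto r atTop (𝓝 0)) {F : Z → ℝ}
    (hFm : Measurable F) (hF : Integrable F) :
    L1Seq volume (fun n => InhomEuler.mollify (K n) F) F :=
  ⟨fun n => integrable_mollify (hK n) hF, hF, tendsto_lintegral_mollify_sub hK hr hFm
    hF.locallyIntegrable (c := 0) (by simpa using hF)⟩

/-- Along a subsequence, finitely many mollified functions converge almost everywhere. -/
theorem exists_subseq_tendsto_mollify {ι : Type*} [Fintype ι] {K : ℕ → Z → ℝ} {r : ℕ → ℝ}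
    (hK : ∀ n, IsMollifier (K n) (r n)) (hr : Tendsto r atTop (𝓝 0)) {F : ι → Z → ℝ}
    (hFm : ∀ i, Measurable (F i)) (hF : ∀ i, LocallyIntegrable (F i)) {c : ι → ℝ}
    (hFc : ∀ i, Integrable fun z => F i z - c i) :
    ∃ ns : ℕ → ℕ, StrictMono ns ∧ ∀ i, ∀ᵐ z,
      Tendsto (fun n => mollify (K (ns n)) (F i) z) atTop (𝓝 (F i z)) := by
  have hm : ∀ n i, Measurable (mollify (K n) (F i)) := fun n i =>
    (contDiff_mollify (hK n) (hF i)).continuous.measurable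
  -- The sum of all errors is one function that tends to zero in `L¹`, hence in measure, so a single
  -- subsequence serves all indices.
  have h1 : Tendsto (fun n => eLpNorm ((fun z => ∑ i, ‖mollify (K n) (F i) z - F i z‖) - 0) 1
      volume) atTop (𝓝 0) := by
    have h2 := tendsto_finsetSum Finset.univ fun i _ =>
      tendsto_lintegral_mollify_sub hK hr (hFm i) (hF i) (hFc i)
    rw [Finset.sum_const_zero] at h2
    refine h2.congr fun n => ?_
    have h3 : ∀ i ∈ Finset.univ, Measurable fun z => ‖mollify (K n) (F i) z - F i z‖ₑ :=
      fun i _ => ((hm n i).sub (hFm i)).enorm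
    rw [← lintegral_finsetSum _ h3, sub_zero, eLpNorm_one_eq_lintegral_enorm]
    refine lintegral_congr fun z => ?_
    rw [Real.enorm_eq_ofReal (Finset.sum_nonneg fun i _ => norm_nonneg _),
      ENNReal.ofReal_sum_of_nonneg fun i _ => norm_nonneg _]
    simp_rw [ofReal_norm]
  have h2 := tendstoInMeasure_of_tendsto_eLpNorm one_ne_zero (fun n =>
    (Finset.measurable_fun_sum _ fun i _ => ((hm n i).sub (hFm i)).norm).aestronglyMeasurable)
    aestronglyMeasurable_const h1
  obtain ⟨ns, hns, hae⟩ := h2.exists_seq_tendsto_ae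
  refine ⟨ns, hns, fun i => ?_⟩
  filter_upwards [hae] with z hz
  rw [tendsto_iff_norm_sub_tendsto_zero]
  refine squeeze_zero (fun _ => norm_nonneg _) (fun n => ?_) hz
  exact Finset.single_le_sum (f := fun i => ‖mollify (K (ns n)) (F i) z - F i z‖)
    (fun i _ => norm_nonneg _) (Finset.mem_univ i)

/-- Mollifiers along which density, pressure and velocity converge almost everywhere. -/
structure Mollifiers (K : ℕ → Z → ℝ) (r : ℕ → ℝ) (ρ p : Z → ℝ) (v : Fin d → Z → ℝ) : Prop where
  isMollifier : ∀ n, IsMollifier (K n) (r n)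
  radius : Tendsto r atTop (𝓝 0)
  density : ∀ᵐ z, Tendsto (fun n => mollify (K n) ρ z) atTop (𝓝 (ρ z))
  pressure : ∀ᵐ z, Tendsto (fun n => mollify (K n) p z) atTop (𝓝 (p z))
  velocity : ∀ i, ∀ᵐ z, Tendsto (fun n => favre (K n) ρ v i z) atTop (𝓝 (v i z))

namespace LocalSolution

variable {O : Set Z} {c M : ℝ} {e : Fin d → Z} {τ : Z} {ρ p : Z → ℝ} {v f : Fin d → Z → ℝ}
  (hS : LocalSolution O c M e τ ρ p v f)

include hS

theorem momentum_integrable (i : Fin d) : Integrable fun z => ρ z * v i z :=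
  hS.density_bddMeas.integrable_mul (hS.velocity_integrable i)

theorem exists_mollifiers {K : ℕ → Z → ℝ} {r : ℕ → ℝ}
    (hK : ∀ n, IsMollifier (K n) (r n)) (hr : Tendsto r atTop (𝓝 0)) :
    ∃ ns : ℕ → ℕ, StrictMono ns ∧ Mollifiers (fun n => K (ns n)) (fun n => r (ns n)) ρ p v := by
  obtain ⟨ns, hns, h⟩ := exists_subseq_tendsto_mollify hK hr
    (F := Sum.elim (fun i z => ρ z * v i z) fun b : Bool => if b then ρ else p)
    (c := Sum.elim (fun _ => 0) fun b : Bool => if b then c else 0) (by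
      rintro (i | _ | _)
      exacts [(hS.momentum_bddMeas i).measurable, hS.pressure_measurable, hS.density_measurable])
    (by
      rintro (i | _ | _)
      exacts [locallyIntegrable_of_bddMeas (hS.momentum_bddMeas i),
        locallyIntegrable_of_bddMeas hS.pressure_bddMeas,
        locallyIntegrable_of_bddMeas hS.density_bddMeas])
    (by
      rintro (i | _ | _)
      exacts [by simpa using hS.momentum_integrable i, by simpa using hS.pressure_integrable,
        by simpa using hS.density_integrable])
  have hρ := h (.inr true)
  have hp := h (.inr false)
  simp only [Sum.elim_inr, if_true, Bool.false_eq_true, if_false] at hρ hp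
  refine ⟨ns, hns, fun n => hK _, hr.comp hns.tendsto_atTop, hρ, hp, fun i => ?_⟩
  -- The weighted average is a quotient whose denominator has a limit bounded below by `c`; it
  -- converges to `ρ v_i / ρ`.
  filter_upwards [hρ, h (.inl i)] with z h1 h2
  have hz : ρ z ≠ 0 := (hS.c_pos.trans_le (hS.density_mem z).1).ne'
  have := h2.div h1 hz
  simp only [Sum.elim_inl] at this
  rw [mul_div_cancel_left₀ _ hz] at this
  exact this

variable {K : ℕ → Z → ℝ} {r : ℕ → ℝ} (hK : Mollifiers K r ρ p v)
include hK

theorem density_bddSeq : BddSeq volume (fun n => mollify (K n) ρ) ρ :=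
  ⟨fun n => (hS.mollify_density_bddMeas (hK.isMollifier n)).measurable,
    ⟨M, fun n => abs_mollify_le (hK.isMollifier n)
      (locallyIntegrable_of_bddMeas hS.density_bddMeas) hS.abs_density_le⟩, hK.density⟩

theorem density_inv_bddSeq : BddSeq volume (fun n z => (mollify (K n) ρ z)⁻¹) fun z => (ρ z)⁻¹ :=
  (hS.density_bddSeq hK).inv hS.c_pos
    (fun n z => (hS.mollify_density_mem (hK.isMollifier n) z).1) fun z => (hS.density_mem z).1

theorem pressure_bddSeq : BddSeq volume (fun n => mollify (K n) p) p :=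
  ⟨fun n => (hS.mollify_pressure_bddMeas (hK.isMollifier n)).measurable,
    ⟨M, fun n => hS.mollify_pressure_le (hK.isMollifier n)⟩, hK.pressure⟩

theorem favre_bddSeq (i : Fin d) : BddSeq volume (fun n => favre (K n) ρ v i) (v i) :=
  ⟨fun n => (hS.favre_bddMeas (hK.isMollifier n) i).measurable,
    ⟨_, fun n => hS.abs_favre_le (hK.isMollifier n) i⟩, hK.velocity i⟩

variable {φ : Z → ℝ} (hφ : IsTestOn O φ)
  {G : Fin d → Z → ℝ} (hGm : ∀ j, Measurable (G j)) (hG : ∀ j, Integrable (G j))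
include hφ hGm hG

/-- Every integral pairs a bounded sequence converging almost everywhere with a sequence converging
in `L¹`. In the limit of `pressureMain` four terms equal `± ∫ (φ p / ρ) ∑ v_j G_j` and cancel in
pairs, and the two remaining ones are each `∫ p Dφ(V)`; together they are the pressure part of the
energy defect. -/
theorem tendsto_energy : Tendsto (fun n =>
    (∑ i, ∫ z, (ρ z * v i z * favre (K n) ρ v i z) * fderiv ℝ φ z (field e v z + τ))
    + ((∑ i, ∫ z, (ρ z * v i z * (mollify (K n) ρ z)⁻¹ * φ z) * mollify (K n) (f i) z)
      + ∑ i, ∫ z, (favre (K n) ρ v i z * φ z) * f i z)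
    + pressureMain (K n) e ρ p v G φ) atTop (𝓝 (energyDefect e τ ρ p v f φ)) := by
  have hρ := BddSeq.const (μ := volume) hS.density_bddMeas
  have hp := BddSeq.const (μ := volume) hS.pressure_bddMeas
  have hv := fun i => BddSeq.const (μ := volume) (hS.velocity_bddMeas i)
  have hφ' := BddSeq.const (μ := volume) hφ.bddMeas
  have hR := hS.density_inv_bddSeq hK
  have hpK := hS.pressure_bddSeq hK
  have hw := hS.favre_bddSeq hK
  have one : BddMeas fun _ : Z => (1 : ℝ) := BddMeas.const 1
  have hDU : Integrable fun z => fderiv ℝ φ z (field e v z + τ) := by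
    simpa using hS.integrable_mul_clm_field_add hφ one
  have hDV : Integrable fun z => fderiv ℝ φ z (field e v z) := by
    simpa using hS.integrable_mul_clm_field hφ one
  have hg : Integrable fun z => ∑ j, v j z * G j z :=
    integrable_finsetSum _ fun j _ => (hS.velocity_bddMeas j).integrable_mul (hG j)
  have hgm : Measurable fun z => ∑ j, v j z * G j z :=
    Finset.measurable_fun_sum _ fun j _ => (hS.velocity_measurable j).mul (hGm j)
  have hGK := fun j => L1Seq.mollify hK.isMollifier hK.radius (hGm j) (hG j)
  have hgK := L1Seq.mollify hK.isMollifier hK.radius hgm hg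
  have hfK := fun i => L1Seq.mollify hK.isMollifier hK.radius (hS.force_measurable i)
    (hS.force_integrable i)
  have t1 := tendsto_finsetSum Finset.univ fun i _ =>
    ((hρ.mul (hv i)).mul (hw i)).tendsto_integral (L1Seq.const hDU)
  have t2 := tendsto_finsetSum Finset.univ fun i _ =>
    (((hρ.mul (hv i)).mul hR).mul hφ').tendsto_integral (hfK i)
  have t3 := tendsto_finsetSum Finset.univ fun i _ =>
    ((hw i).mul hφ').tendsto_integral (L1Seq.const (hS.force_integrable i))
  have t4 := ((hφ'.mul hpK).mul hR).tendsto_integral (L1Seq.const hg)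
  have t5 := ((hρ.mul hpK).mul hR).tendsto_integral (L1Seq.const hDV)
  have t6 := tendsto_finsetSum Finset.univ fun i _ =>
    (hp.mul (hw i)).tendsto_integral (L1Seq.const (hφ.fderiv_integrable (e i)))
  have t7 := tendsto_finsetSum Finset.univ fun j _ =>
    (((((hρ.mul hφ').mul hpK).mul (hv j)).mul hR).mul hR).tendsto_integral (hGK j)
  have t8 := ((hp.mul hφ').mul hR).tendsto_integral hgK
  have t9 := tendsto_finsetSum Finset.univ fun i _ =>
    (((hp.mul hφ').mul (hw i)).mul hR).tendsto_integral (hGK i)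
  have hlim := (t1.add (t2.add t3)).add
    (((((t4.neg.mul_const (-1)).add t5).add t6).sub t7).add t8 |>.sub t9)
  have hne : ∀ z, ρ z * (ρ z)⁻¹ = 1 := fun z =>
    mul_inv_cancel₀ (hS.c_pos.trans_le (hS.density_mem z).1).ne'
  convert hlim using 1
  congr 1
  rw [energyDefect]
  have r2 : ∀ i, ∫ z, (ρ z * v i z * (ρ z)⁻¹ * φ z) * f i z = ∫ z, (φ z * v i z) * f i z :=
    fun i => by congr 1; ext z; linear_combination (v i z * φ z * f i z) * hne z
  have r3 : ∀ i, ∫ z, (v i z * φ z) * f i z = ∫ z, (φ z * v i z) * f i z :=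
    fun i => by congr 1; ext z; ring
  have r5 : ∫ z, (ρ z * p z * (ρ z)⁻¹) * fderiv ℝ φ z (field e v z)
      = ∫ z, p z * fderiv ℝ φ z (field e v z) := by
    congr 1; ext z; linear_combination (p z * fderiv ℝ φ z (field e v z)) * hne z
  have r6 : ∑ i, ∫ z, (p z * v i z) * fderiv ℝ φ z (e i)
      = ∫ z, p z * fderiv ℝ φ z (field e v z) := by
    rw [← integral_finsetSum]
    · congr 1; ext z; rw [clm_field, Finset.mul_sum]
      exact Finset.sum_congr rfl fun i _ => by ring
    · exact fun i _ => (hS.pressure_bddMeas.mul (hS.velocity_bddMeas i)).integrable_mul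
        (hφ.fderiv_integrable (e i))
  have hir := BddMeas.inv hS.density_measurable hS.c_pos fun z => (hS.density_mem z).1
  have r7 : ∑ j, ∫ z, (ρ z * φ z * p z * v j z * (ρ z)⁻¹ * (ρ z)⁻¹) * G j z
      = ∫ z, (φ z * p z * (ρ z)⁻¹) * ∑ j, v j z * G j z := by
    rw [← integral_finsetSum]
    · congr 1; ext z; rw [Finset.mul_sum]
      exact Finset.sum_congr rfl fun i _ => by
        linear_combination (φ z * p z * v i z * (ρ z)⁻¹ * G i z) * hne z
    · exact fun j _ => (((((hS.density_bddMeas.mul hφ.bddMeas).mul hS.pressure_bddMeas).mul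
        (hS.velocity_bddMeas j)).mul hir).mul hir).integrable_mul (hG j)
  have r8 : ∫ z, (p z * φ z * (ρ z)⁻¹) * ∑ j, v j z * G j z
      = ∫ z, (φ z * p z * (ρ z)⁻¹) * ∑ j, v j z * G j z := by
    congr 1; ext z; ring
  have r9 : ∑ i, ∫ z, (p z * φ z * v i z * (ρ z)⁻¹) * G i z
      = ∫ z, (φ z * p z * (ρ z)⁻¹) * ∑ j, v j z * G j z := by
    rw [← integral_finsetSum]
    · congr 1; ext z; rw [Finset.mul_sum]
      exact Finset.sum_congr rfl fun i _ => by ring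
    · exact fun j _ => (((hS.pressure_bddMeas.mul hφ.bddMeas).mul
        (hS.velocity_bddMeas j)).mul hir).integrable_mul (hG j)
  simp_rw [r2, r3]
  rw [r5, r6, r7, r8, r9]
  ring_nf

variable {μ : Measure Z} [IsFiniteMeasure μ] (hder : ∀ j, IsDerivUpTo O ρ (e j) (G j) μ)
include hder

/-- The energy defect is controlled by the singular part of the density gradient and the
commutators. -/
theorem enorm_energyDefect_le {X : ℕ → ℝ≥0∞} {L : ℝ≥0∞}
    (hX : ∀ᶠ n in atTop, ‖∑ i, ∫ z, (ρ z * v i z * (mollify (K n) ρ z)⁻¹) *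
      (φ z * commutator (K n) e ρ v i z)‖ₑ ≤ X n) (hL : limsup X atTop ≤ L) :
    ‖energyDefect e τ ρ p v f φ‖ₑ ≤ (chainConst d c M + kernelConst d c M) * ∫⁻ z, ‖φ z‖ₑ ∂μ
      + L := by
  obtain ⟨r₀, hr₀, hr₀O⟩ := hφ.exists_radius hS.isOpen
  have hk : kernelConst d c M ≠ ⊤ := by
    unfold kernelConst
    finiteness
  have hcc : chainConst d c M ≠ ⊤ := by
    unfold chainConst
    finiteness
  have hφμ : ∫⁻ z, ‖φ z‖ₑ ∂μ ≠ ⊤ :=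
    (hφ.1.continuous.integrable_of_hasCompactSupport hφ.2.1 (μ := μ)).2.ne
  set Y : ℕ → ℝ≥0∞ := fun n => chainConst d c M * ∫⁻ z, ‖φ z‖ₑ ∂μ
        + kernelConst d c M * (∫⁻ z, ‖φ z‖ₑ ∂μ + supModulus φ (r n) * μ univ) with hY
  have hYlim : Tendsto Y atTop (𝓝 ((chainConst d c M + kernelConst d c M) * ∫⁻ z, ‖φ z‖ₑ ∂μ)) := by
    have : Tendsto (fun n => supModulus φ (r n)) atTop (𝓝 0) :=
      (tendsto_supModulus hφ.1.continuous hφ.2.1).comp hK.radius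
    have h2 := (tendsto_const_nhds (x := chainConst d c M * ∫⁻ z, ‖φ z‖ₑ ∂μ)).add
      (ENNReal.Tendsto.const_mul ((tendsto_const_nhds (x := ∫⁻ z, ‖φ z‖ₑ ∂μ)).add
        (ENNReal.Tendsto.mul_const this (Or.inr (measure_ne_top μ univ)))) (Or.inr hk))
    simpa [add_mul] using h2
  have hev : ∀ᶠ n in atTop, ‖(∑ i, ∫ z, (ρ z * v i z * favre (K n) ρ v i z)
      * fderiv ℝ φ z (field e v z + τ))
    + ((∑ i, ∫ z, (ρ z * v i z * (mollify (K n) ρ z)⁻¹ * φ z) * mollify (K n) (f i) z)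
      + ∑ i, ∫ z, (favre (K n) ρ v i z * φ z) * f i z)
    + pressureMain (K n) e ρ p v G φ‖ₑ ≤ Y n + X n := by
    filter_upwards [hX, hK.radius.eventually_le_const hr₀] with n hn hrn
    have hr : ∀ z ∈ tsupport φ, Metric.closedBall z (r n) ⊆ O := fun z hz =>
      (Metric.closedBall_subset_closedBall hrn).trans (hr₀O z hz)
    have h1 := hS.energy_identity (hK.isMollifier n) hφ hr
    have h2 := hS.enorm_pressureTerm_sub_le (hK.isMollifier n) hφ hr hGm hG hder
    have h3 := lintegral_mul_mollifyMeasure_le (hK.isMollifier n) hφ.bddMeas.measurable μ 0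
      (κ := supModulus φ (r n)) (fun y h hh => by simpa using enorm_add_le_supModulus φ y hh)
    rw [lintegral_add_right _ measurable_const, lintegral_const] at h3
    simp only [sub_zero] at h3
    have h4 : ∀ {a b c P Q : ℝ}, a + b + c + P = 0 → a + c + Q = -(P - Q) + -b :=
      fun h => by linarith
    -- By the balance of energy, the convergent expression equals minus the pressure error minus the
    -- commutator term.
    rw [h4 h1 (Q := pressureMain (K n) e ρ p v G φ)]
    refine (enorm_add_le _ _).trans ?_
    rw [enorm_neg, enorm_neg]
    refine add_le_add (h2.trans ?_) hn
    exact add_le_add le_rfl (mul_le_mul' le_rfl h3)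
  have hlim := (hS.tendsto_energy hK hφ hGm hG).enorm
  have h1 : ‖energyDefect e τ ρ p v f φ‖ₑ ≤ limsup (fun n => Y n + X n) atTop := by
    rw [← hlim.limsup_eq]
    exact limsup_le_limsup hev
  exact h1.trans ((limsup_add_le_of_tendsto hYlim).trans (add_le_add le_rfl hL))

end LocalSolution

end

section

variable {Z : Type*} [NormedAddCommGroup Z] [NormedSpace ℝ Z] [FiniteDimensional ℝ Z]
  [MeasureSpace Z] [BorelSpace Z] [(volume : Measure Z).IsAddHaarMeasure]

/-! ### Difference quotients -/

theorem enorm_sub_shift_le {g : Z → ℝ} (hg : ContDiff ℝ ∞ g) (z l : Z) {ε : ℝ} (hε : 0 ≤ ε) :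
    ‖g z - g (z - ε • l)‖ₑ ≤ ∫⁻ s in Ioc 0 ε, ‖fderiv ℝ g (z - s • l) l‖ₑ := by
  have hd : ∀ s ∈ uIcc 0 ε, HasDerivAt (fun s : ℝ => g (z - s • l))
      (-fderiv ℝ g (z - s • l) l) s := by
    intro s _
    have h1 : HasDerivAt (fun s : ℝ => z - s • l) (-l) s := by
      simpa using ((hasDerivAt_id s).smul_const l).const_sub z
    have h2 := (hg.differentiable (by simp) (z - s • l)).hasFDerivAt.comp_hasDerivAt s h1
    rw [map_neg] at h2
    exact h2
  have hc : Continuous fun s : ℝ => -fderiv ℝ g (z - s • l) l :=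
    (((hg.continuous_fderiv (by simp)).comp (by fun_prop)).clm_apply continuous_const).neg
  have := intervalIntegral.integral_eq_sub_of_hasDerivAt hd (hc.intervalIntegrable _ _)
  rw [enorm_sub_rev, show g (z - ε • l) - g z
    = ∫ s in (0 : ℝ)..ε, -fderiv ℝ g (z - s • l) l by rw [this]; simp,
    intervalIntegral.integral_of_le hε]
  refine (enorm_integral_le_lintegral_enorm _).trans (le_of_eq ?_)
  simp

/-- Fundamental theorem of calculus for a function whose derivative along `l` is a density plus a
measure. `F` is mollified at a scale `δ`, the increment is integrated along the segment, and `δ`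
tends to zero with `ε` fixed. The weight `Θ` is merely bounded: it stays next to the density `b`,
but against the measure it has to be replaced by its bound `S`. This asymmetry is why only singular
parts survive later. -/
theorem lintegral_mul_sub_shift_le {O : Set Z} {F : Z → ℝ} (hFm : Measurable F)
    (hF : Integrable F) {l : Z} {b : Z → ℝ} (hbm : Measurable b) (hb : Integrable b)
    {μ : Measure Z} [IsFiniteMeasure μ] (h : IsDerivUpTo O F l b μ) {φ Θ : Z → ℝ}
    (hφm : Measurable φ) (hΘm : Measurable Θ) {S C : ℝ≥0∞} (hS : S ≠ ⊤) (hC : C ≠ ⊤)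
    (hΘ : ∀ z, ‖Θ z‖ₑ ≤ S) (hφ : ∀ z, ‖φ z‖ₑ ≤ C) {ε r : ℝ} (hε : 0 ≤ ε) (hr : ε * ‖l‖ < r)
    (hO : ∀ z ∈ tsupport φ, Metric.closedBall z r ⊆ O) :
    ∫⁻ z, ‖φ z‖ₑ * ‖Θ z‖ₑ * ‖F z - F (z - ε • l)‖ₑ ≤ ENNReal.ofReal ε *
      ((∫⁻ z, ‖φ z‖ₑ * ‖Θ z‖ₑ * ‖b z‖ₑ) + S * (C * shiftModulus b r
        + (∫⁻ z, ‖φ z‖ₑ ∂μ + supModulus φ r * μ univ))) := by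
  have key : ∀ δ, 0 < δ → δ ≤ r - ε * ‖l‖ →
      ∫⁻ z, ‖φ z‖ₑ * ‖Θ z‖ₑ * ‖F z - F (z - ε • l)‖ₑ ≤ C * S * (2 * shiftModulus F δ)
      + ENNReal.ofReal ε * ((∫⁻ z, ‖φ z‖ₑ * ‖Θ z‖ₑ * ‖b z‖ₑ) + S * (C * shiftModulus b r
        + (∫⁻ z, ‖φ z‖ₑ ∂μ + supModulus φ r * μ univ))) := by
    intro δ hδ hδr
    obtain ⟨K, hK⟩ := exists_isMollifier (Z := Z) hδ
    have hsm := contDiff_mollify hK hF.locallyIntegrable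
    have hsb := contDiff_mollify hK hb.locallyIntegrable
    have hm1 := hsm.continuous.measurable
    have hm2 := hsb.continuous.measurable
    have hm3 := mollifyMeasure_measurable hK μ
    have hsl : ∀ s ∈ Ioc 0 ε, ‖s • l‖ ≤ ε * ‖l‖ := fun s hs => by
      rw [norm_smul, Real.norm_eq_abs, abs_of_pos hs.1]
      exact mul_le_mul_of_nonneg_right hs.2 (norm_nonneg _)
    have hpt : ∀ z, ‖φ z‖ₑ * ‖Θ z‖ₑ * ‖F z - F (z - ε • l)‖ₑ ≤
        (C * S * ‖mollify K F z - F z‖ₑ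
          + C * S * ‖mollify K F (z - ε • l) - F (z - ε • l)‖ₑ)
        + ∫⁻ s in Ioc 0 ε, (‖φ z‖ₑ * ‖Θ z‖ₑ * ‖b z‖ₑ
          + (C * S * ‖mollify K b (z - s • l) - b z‖ₑ
            + S * (‖φ z‖ₑ * mollifyMeasure K μ (z - s • l)))) := by
      intro z
      by_cases hz : z ∈ tsupport φ
      swap
      · rw [image_eq_zero_of_notMem_tsupport hz]; simp
      have h1 : ‖mollify K F z - mollify K F (z - ε • l)‖ₑ ≤ ∫⁻ s in Ioc 0 ε, (‖b z‖ₑ +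
          (‖mollify K b (z - s • l) - b z‖ₑ + mollifyMeasure K μ (z - s • l))) := by
        refine (enorm_sub_shift_le hsm z l hε).trans ?_
        refine setLIntegral_mono' measurableSet_Ioc fun s hs => ?_
        -- The slack `δ ≤ r - ε * ‖l‖` keeps the ball around every point of the segment inside the
        -- ball of radius `r` around `z`.
        have hball : Metric.closedBall (z - s • l) δ ⊆ O := by
          refine (Metric.closedBall_subset_closedBall' ?_).trans (hO z hz)
          rw [dist_eq_norm, sub_sub_cancel_left, norm_neg]
          linarith [hsl s hs]
        have h2 := h.fderiv_mollify_sub hF.locallyIntegrable hK hball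
        calc ‖fderiv ℝ (mollify K F) (z - s • l) l‖ₑ
            = ‖b z + ((mollify K b (z - s • l) - b z)
              + (fderiv ℝ (mollify K F) (z - s • l) l - mollify K b (z - s • l)))‖ₑ := by
              congr 1; ring
          _ ≤ _ := (enorm_add_le _ _).trans (add_le_add le_rfl ((enorm_add_le _ _).trans
              (add_le_add le_rfl h2)))
      have h3 : ‖F z - F (z - ε • l)‖ₑ ≤ (‖mollify K F z - F z‖ₑ
          + ‖mollify K F (z - ε • l) - F (z - ε • l)‖ₑ)
          + ‖mollify K F z - mollify K F (z - ε • l)‖ₑ := by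
        calc _ = ‖(-(mollify K F z - F z) + (mollify K F (z - ε • l) - F (z - ε • l)))
            + (mollify K F z - mollify K F (z - ε • l))‖ₑ := by congr 1; ring
          _ ≤ _ := (enorm_add_le _ _).trans (add_le_add ((enorm_add_le _ _).trans
              (by rw [enorm_neg])) le_rfl)
      have hCS : ‖φ z‖ₑ * ‖Θ z‖ₑ ≤ C * S := mul_le_mul' (hφ z) (hΘ z)
      calc _ ≤ ‖φ z‖ₑ * ‖Θ z‖ₑ * ((‖mollify K F z - F z‖ₑ
          + ‖mollify K F (z - ε • l) - F (z - ε • l)‖ₑ)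
          + ∫⁻ s in Ioc 0 ε, (‖b z‖ₑ +
          (‖mollify K b (z - s • l) - b z‖ₑ + mollifyMeasure K μ (z - s • l)))) :=
            mul_le_mul' le_rfl (h3.trans (add_le_add le_rfl h1))
        _ = (‖φ z‖ₑ * ‖Θ z‖ₑ * ‖mollify K F z - F z‖ₑ
          + ‖φ z‖ₑ * ‖Θ z‖ₑ * ‖mollify K F (z - ε • l) - F (z - ε • l)‖ₑ)
          + ∫⁻ s in Ioc 0 ε, ‖φ z‖ₑ * ‖Θ z‖ₑ * (‖b z‖ₑ +
          (‖mollify K b (z - s • l) - b z‖ₑ + mollifyMeasure K μ (z - s • l))) := by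
            rw [lintegral_const_mul' _ _ (ENNReal.mul_ne_top enorm_ne_top enorm_ne_top)]
            ring
        _ ≤ _ := by
            refine add_le_add (add_le_add (mul_le_mul' hCS le_rfl) (mul_le_mul' hCS le_rfl))
              (lintegral_mono fun s => ?_)
            rw [mul_add, mul_add]
            refine add_le_add le_rfl (add_le_add (mul_le_mul' hCS le_rfl) ?_)
            calc _ = ‖Θ z‖ₑ * (‖φ z‖ₑ * mollifyMeasure K μ (z - s • l)) := by ring
              _ ≤ _ := mul_le_mul' (hΘ z) le_rfl
    refine (lintegral_mono hpt).trans ?_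
    have hCS : C * S ≠ ⊤ := ENNReal.mul_ne_top hC hS
    rw [lintegral_add_left (by fun_prop), lintegral_add_left (by fun_prop),
      lintegral_const_mul' _ _ hCS, lintegral_const_mul' _ _ hCS]
    refine add_le_add ?_ ?_
    · have h1 := lintegral_mollify_sub_le_modulus hK hFm hF.locallyIntegrable
      rw [lintegral_sub_right_eq_self (fun z => ‖mollify K F z - F z‖ₑ) (ε • l), two_mul, mul_add]
      exact add_le_add (mul_le_mul' le_rfl h1) (mul_le_mul' le_rfl h1)
    · rw [lintegral_lintegral_swap (by
        refine Measurable.aemeasurable ?_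
        simp only [Function.uncurry_def]
        fun_prop)]
      calc _ ≤ ∫⁻ s in Ioc 0 ε, ((∫⁻ z, ‖φ z‖ₑ * ‖Θ z‖ₑ * ‖b z‖ₑ) + S * (C * shiftModulus b r
          + (∫⁻ z, ‖φ z‖ₑ ∂μ + supModulus φ r * μ univ))) := by
            refine setLIntegral_mono' measurableSet_Ioc fun s hs => ?_
            have hnorm : ∀ h : Z, ‖h‖ ≤ δ → ‖s • l + h‖ ≤ r := fun h hh =>
              (norm_add_le _ _).trans (by linarith [hsl s hs])
            have h1 := lintegral_mollify_sub_le hK hbm hb.locallyIntegrable (s • l)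
              (τ := shiftModulus b r) fun h hh => le_shiftModulus b (hnorm h hh)
            have h2 := lintegral_mul_mollifyMeasure_le hK hφm μ (s • l) (κ := supModulus φ r)
              fun y h hh => enorm_add_le_supModulus φ y (hnorm h hh)
            rw [lintegral_add_right _ measurable_const, lintegral_const] at h2
            rw [lintegral_add_left (by fun_prop), lintegral_add_left (by fun_prop),
              lintegral_const_mul' _ _ hCS, lintegral_const_mul' _ _ hS, mul_add, ← mul_assoc,
              mul_comm S C]
            exact add_le_add le_rfl (add_le_add (mul_le_mul' le_rfl h1) (mul_le_mul' le_rfl h2))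
        _ = _ := by
            rw [setLIntegral_const, Real.volume_Ioc, sub_zero, mul_comm]
  have hlim : Tendsto (fun δ => C * S * (2 * shiftModulus F δ)
      + ENNReal.ofReal ε * ((∫⁻ z, ‖φ z‖ₑ * ‖Θ z‖ₑ * ‖b z‖ₑ) + S * (C * shiftModulus b r
        + (∫⁻ z, ‖φ z‖ₑ ∂μ + supModulus φ r * μ univ)))) (𝓝[>] 0)
      (𝓝 (C * S * (2 * 0) + ENNReal.ofReal ε * ((∫⁻ z, ‖φ z‖ₑ * ‖Θ z‖ₑ * ‖b z‖ₑ)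
        + S * (C * shiftModulus b r + (∫⁻ z, ‖φ z‖ₑ ∂μ + supModulus φ r * μ univ))))) := by
    refine Tendsto.mono_left ?_ nhdsWithin_le_nhds
    refine Tendsto.add_const _ (ENNReal.Tendsto.const_mul (ENNReal.Tendsto.const_mul
      (tendsto_shiftModulus (c := 0) (by simpa using hF)) (Or.inr (by simp)))
      (Or.inr (ENNReal.mul_ne_top hC hS)))
  simp only [mul_zero, zero_add] at hlim
  refine ge_of_tendsto hlim ?_
  filter_upwards [Ioc_mem_nhdsGT (sub_pos.2 hr)] with δ hδ using key δ hδ.1 hδ.2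

/-- The differences of a bounded function and an approximation of it vanish in `L¹`, even after a
small translation. -/
theorem tendsto_lintegral_shift_sub_mul {b v : Z → ℝ} (hbm : Measurable b) (hb : Integrable b)
    (hv : BddMeas v) {w : ℕ → Z → ℝ} (hw : BddSeq volume w v) {a : ℕ → Z}
    (ha : Tendsto a atTop (𝓝 0)) :
    Tendsto (fun n => ∫⁻ z, ‖v (z - a n) - w n z‖ₑ * ‖b z‖ₑ) atTop (𝓝 0) := by
  obtain ⟨C, hC⟩ := hv.bdd
  have hvb : Integrable fun z => v z * b z := hv.integrable_mul hb
  have hvm := hv.measurable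
  have hwm := hw.measurable
  have h1 : Tendsto (fun n => ∫⁻ z, ‖v (z - a n) * b (z - a n) - v z * b z‖ₑ) atTop (𝓝 0) :=
    (tendsto_lintegral_shift hvb).comp ha
  have h2 : Tendsto (fun n => ENNReal.ofReal C * ∫⁻ z, ‖b (z - a n) - b z‖ₑ) atTop (𝓝 0) := by
    simpa using ENNReal.Tendsto.const_mul ((tendsto_lintegral_shift hb).comp ha)
      (Or.inr ENNReal.ofReal_ne_top)
  have h3 : Tendsto (fun n => ∫⁻ z, ‖(v z - w n z) * b z‖ₑ) atTop (𝓝 0) := by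
    obtain ⟨C', hC'⟩ := hw.bdd
    have := tendsto_lintegral_of_dominated_convergence (μ := volume)
      (F := fun n z => ‖(v z - w n z) * b z‖ₑ) (f := fun _ => 0)
      (fun z => ENNReal.ofReal (C + C') * ‖b z‖ₑ)
      (fun n => ((hvm.sub (hwm n)).mul hbm).enorm) (fun n => ae_of_all _ fun z => by
        beta_reduce
        rw [enorm_mul]
        gcongr
        rw [Real.enorm_eq_ofReal_abs]
        refine ENNReal.ofReal_le_ofReal ((abs_sub _ _).trans (add_le_add (hC z) (hC' n z))))
      (by rw [lintegral_const_mul' _ _ ENNReal.ofReal_ne_top]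
          exact ENNReal.mul_ne_top ENNReal.ofReal_ne_top hb.2.ne) (by
        filter_upwards [hw.tendsto] with z hz
        have : Tendsto (fun n => ‖(v z - w n z) * b z‖ₑ) atTop (𝓝 ‖(v z - v z) * b z‖ₑ) :=
          ((hz.const_sub (v z)).mul_const (b z)).enorm
        simpa using this)
    simpa using this
  refine tendsto_of_tendsto_of_tendsto_of_le_of_le tendsto_const_nhds
    (by simpa using (h1.add h2).add h3) (fun _ => zero_le) fun n => ?_
  rw [← lintegral_const_mul' _ _ ENNReal.ofReal_ne_top, ← lintegral_add_left (by fun_prop),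
    ← lintegral_add_left (by fun_prop)]
  refine lintegral_mono fun z => ?_
  calc ‖v (z - a n) - w n z‖ₑ * ‖b z‖ₑ = ‖(v (z - a n) - w n z) * b z‖ₑ := (enorm_mul _ _).symm
    -- Translates of `v` need not converge almost everywhere, but those of the integrable functions
    -- `v * b` and `b` converge in `L¹`; the product `v (z - a n) * b z` is therefore compared with
    -- `v z * b z` through them.
    _ = ‖((v (z - a n) * b (z - a n) - v z * b z) + -(v (z - a n) * (b (z - a n) - b z)))
        + (v z - w n z) * b z‖ₑ := by congr 1; ring
    _ ≤ _ := by
      refine (enorm_add_le _ _).trans (add_le_add ((enorm_add_le _ _).trans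
        (add_le_add le_rfl ?_)) (enorm_mul _ _).le)
      rw [enorm_neg, enorm_mul]
      gcongr
      rw [Real.enorm_eq_ofReal_abs]
      exact ENNReal.ofReal_le_ofReal (hC _)

/-! ### Anisotropic rescaling of a kernel -/

/-- The kernel `k` rescaled by the linear map `A`. -/
noncomputable def scaleKernel (A : Z ≃L[ℝ] Z) (k : Z → ℝ) (z : Z) : ℝ :=
  |(A : Z →L[ℝ] Z).det|⁻¹ * k (A.symm z)

theorem abs_det_pos (A : Z ≃L[ℝ] Z) : 0 < |(A : Z →L[ℝ] Z).det| := by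
  rw [abs_pos]
  exact (LinearEquiv.isUnit_det' A.toLinearEquiv).ne_zero

theorem integral_eq_abs_det_mul (A : Z ≃L[ℝ] Z) (g : Z → ℝ) :
    ∫ z, g z = |(A : Z →L[ℝ] Z).det| * ∫ h, g (A h) := by
  have := integral_image_eq_integral_abs_det_fderiv_smul (volume : Measure Z) MeasurableSet.univ
    (f := A) (f' := fun _ => (A : Z →L[ℝ] Z))
    (fun x _ => A.hasFDerivAt.hasFDerivWithinAt) A.injective.injOn g
  rw [image_univ, A.surjective.range_eq] at this
  simpa [integral_const_mul] using this

theorem fderiv_scaleKernel (A : Z ≃L[ℝ] Z) {k : Z → ℝ} (hk : ContDiff ℝ ∞ k) (z h : Z) :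
    fderiv ℝ (scaleKernel A k) z h
      = |(A : Z →L[ℝ] Z).det|⁻¹ * fderiv ℝ k (A.symm z) (A.symm h) := by
  have h1 : HasFDerivAt (fun z => k (A.symm z)) _ z :=
    (hk.differentiable (by simp) (A.symm z)).hasFDerivAt.comp z A.symm.hasFDerivAt
  have h2 : HasFDerivAt (scaleKernel A k) _ z := h1.const_mul (|(A : Z →L[ℝ] Z).det|⁻¹)
  rw [h2.fderiv]
  simp

theorem IsMollifier.scale {k : Z → ℝ} {R : ℝ} (hk : IsMollifier k R) {A : Z ≃L[ℝ] Z} {r : ℝ}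
    (hA : ∀ h, ‖h‖ ≤ R → ‖A h‖ ≤ r) : IsMollifier (scaleKernel A k) r := by
  refine ⟨contDiff_const.mul (hk.contDiff.comp A.symm.contDiff), fun z =>
    mul_nonneg (inv_nonneg.2 (abs_nonneg _)) (hk.nonneg _), ?_, ?_⟩
  · unfold scaleKernel
    rw [integral_const_mul, integral_eq_abs_det_mul A]
    simp only [ContinuousLinearEquiv.symm_apply_apply, hk.integral_eq_one, mul_one]
    exact inv_mul_cancel₀ (abs_det_pos A).ne'
  · refine closure_minimal (fun z hz => ?_) Metric.isClosed_closedBall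
    have h1 : k (A.symm z) ≠ 0 := right_ne_zero_of_mul hz
    have h2 : ‖A.symm z‖ ≤ R := not_lt.1 fun h => h1 (hk.eq_zero h)
    simpa using hA _ h2

end

/-! ### The commutator and difference quotients of the velocity -/

section

variable {d : ℕ}
variable {Z : Type*} [NormedAddCommGroup Z] [NormedSpace ℝ Z] [FiniteDimensional ℝ Z]
  [MeasureSpace Z] [BorelSpace Z] [(volume : Measure Z).IsAddHaarMeasure]

/-- The product of the increments of two functions in the commutator, at the displacement `h` of
the reference kernel. -/
noncomputable def increments (A : Z ≃L[ℝ] Z) (φ v w F : Z → ℝ) (ε : ℝ) (h : Z) : ℝ≥0∞ :=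
  ENNReal.ofReal ε⁻¹ * ∫⁻ z, ‖φ z‖ₑ * ‖v (z - A h) - w z‖ₑ * ‖F z - F (z - A h)‖ₑ

/-- The displacement `A k` is replaced by `ε • l`, for which the difference quotient is controlled.
The replacement costs the translation modulus of `F` at scale `σ`, divided by `ε`; this is the
quantity required to vanish in `Rescaling`. -/
theorem increments_le {O : Set Z} {F : Z → ℝ} (hFm : Measurable F)
    (hF : Integrable F) {l : Z} {b : Z → ℝ} (hbm : Measurable b) (hb : Integrable b)
    {μ : Measure Z} [IsFiniteMeasure μ] (h : IsDerivUpTo O F l b μ) {φ v w : Z → ℝ}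
    (hφm : Measurable φ) (hvm : Measurable v) (hwm : Measurable w) {S C : ℝ≥0∞} (hS : S ≠ ⊤)
    (hC : C ≠ ⊤) (hvw : ∀ z y, ‖v y - w z‖ₑ ≤ S) (hφ : ∀ z, ‖φ z‖ₑ ≤ C) {ε r : ℝ} (hε : 0 < ε)
    (hr : ε * ‖l‖ < r) (hO : ∀ z ∈ tsupport φ, Metric.closedBall z r ⊆ O) (A : Z ≃L[ℝ] Z) (k : Z)
    {σ : ℝ} (hσ : ‖A k - ε • l‖ ≤ σ) :
    increments A φ v w F ε k ≤ (C * (∫⁻ z, ‖v (z - A k) - w z‖ₑ * ‖b z‖ₑ) + S * (C * shiftModulus b r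
        + (∫⁻ z, ‖φ z‖ₑ ∂μ + supModulus φ r * μ univ)))
        + C * S * (ENNReal.ofReal ε⁻¹ * shiftModulus F σ) := by
  have hCS : C * S ≠ ⊤ := ENNReal.mul_ne_top hC hS
  set Θ : Z → ℝ := fun z => v (z - A k) - w z with hΘ
  have hΘm : Measurable Θ := (hvm.comp (measurable_id.sub_const _)).sub hwm
  have h1 := lintegral_mul_sub_shift_le hFm hF hbm hb h hφm hΘm hS hC (fun z => hvw z _) hφ hε.le
    hr hO
  have h2 : ∫⁻ z, ‖F (z - ε • l) - F (z - A k)‖ₑ ≤ shiftModulus F σ := by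
    have := lintegral_sub_right_eq_self (μ := (volume : Measure Z))
      (fun z => ‖F (z - (A k - ε • l)) - F z‖ₑ) (ε • l)
    rw [show (∫⁻ z, ‖F (z - ε • l) - F (z - A k)‖ₑ)
      = ∫⁻ z, ‖F (z - ε • l - (A k - ε • l)) - F (z - ε • l)‖ₑ by
        refine lintegral_congr fun z => ?_
        rw [enorm_sub_rev]; congr 3; abel, this]
    exact le_shiftModulus F hσ
  have h3 : ∫⁻ z, ‖φ z‖ₑ * ‖Θ z‖ₑ * ‖F z - F (z - A k)‖ₑ
      ≤ (∫⁻ z, ‖φ z‖ₑ * ‖Θ z‖ₑ * ‖F z - F (z - ε • l)‖ₑ) + C * S * shiftModulus F σ := by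
    refine le_trans ?_ (add_le_add le_rfl (mul_le_mul' le_rfl h2))
    rw [← lintegral_const_mul' _ _ hCS, ← lintegral_add_left (by fun_prop)]
    refine lintegral_mono fun z => ?_
    calc _ = ‖φ z‖ₑ * ‖Θ z‖ₑ * ‖(F z - F (z - ε • l)) + (F (z - ε • l) - F (z - A k))‖ₑ := by
          congr 2; ring
      _ ≤ ‖φ z‖ₑ * ‖Θ z‖ₑ * (‖F z - F (z - ε • l)‖ₑ + ‖F (z - ε • l) - F (z - A k)‖ₑ) :=
          mul_le_mul' le_rfl (enorm_add_le _ _)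
      _ ≤ _ := by
          rw [mul_add]
          exact add_le_add le_rfl (mul_le_mul' (mul_le_mul' (hφ z) (hvw z _)) le_rfl)
  have h4 : ∫⁻ z, ‖φ z‖ₑ * ‖Θ z‖ₑ * ‖b z‖ₑ ≤ C * ∫⁻ z, ‖Θ z‖ₑ * ‖b z‖ₑ := by
    rw [← lintegral_const_mul' _ _ hC]
    refine lintegral_mono fun z => ?_
    beta_reduce
    rw [mul_assoc]
    exact mul_le_mul' (hφ z) le_rfl
  have h5 : ENNReal.ofReal ε⁻¹ * ENNReal.ofReal ε = 1 := by
    rw [← ENNReal.ofReal_mul (inv_nonneg.2 hε.le), inv_mul_cancel₀ hε.ne', ENNReal.ofReal_one]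
  unfold increments
  refine (mul_le_mul' le_rfl (h3.trans (add_le_add h1 le_rfl))).trans ?_
  rw [mul_add, ← mul_assoc, h5, one_mul]
  refine add_le_add (add_le_add h4 le_rfl) (le_of_eq (by ring))

theorem shiftModulus_sum_le {ι : Type*} [Fintype ι] {f : ι → Z → ℝ} (hf : ∀ i, Measurable (f i))
    (a : ι → ℝ) (r : ℝ) : shiftModulus (fun z => ∑ i, f i z * a i) r
      ≤ ∑ i, ‖a i‖ₑ * shiftModulus (f i) r := by
  refine iSup₂_le fun h hh => ?_
  calc ∫⁻ z, ‖(∑ i, f i (z - h) * a i) - ∑ i, f i z * a i‖ₑ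
      ≤ ∫⁻ z, ∑ i, ‖a i‖ₑ * ‖f i (z - h) - f i z‖ₑ := by
        refine lintegral_mono fun z => ?_
        rw [← Finset.sum_sub_distrib]
        refine (enorm_sum_le _ _).trans (Finset.sum_le_sum fun i _ => ?_)
        rw [← sub_mul, enorm_mul, mul_comm]
    _ ≤ _ := by
        have hm : ∀ i ∈ Finset.univ, Measurable fun z => ‖a i‖ₑ * ‖f i (z - h) - f i z‖ₑ :=
          fun i _ => by have := hf i; fun_prop
        rw [lintegral_finsetSum _ hm]
        refine Finset.sum_le_sum fun i _ => ?_
        rw [lintegral_const_mul' _ _ enorm_ne_top]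
        exact mul_le_mul' le_rfl (le_shiftModulus (f i) hh)

/-- The constant in front of the commutator contribution. -/
noncomputable def commConst (d : ℕ) (c M : ℝ) : ℝ≥0∞ :=
  d * (ENNReal.ofReal (M * M * c⁻¹ * M) * ENNReal.ofReal (M + M * M / c))

/-- Anisotropic rescalings `A n` acting as `ε n` on the directions `e j`, and as `ε n • B` up to
`σ n`. -/
structure Rescaling (e : Fin d → Z) (v : Fin d → Z → ℝ) (B : Z →L[ℝ] Z) (R : ℝ)
    (A : ℕ → Z ≃L[ℝ] Z) (ε σ : ℕ → ℝ) : Prop where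
  pos : ∀ n, 0 < ε n
  tendsto : Tendsto ε atTop (𝓝 0)
  error_nonneg : ∀ n, 0 ≤ σ n
  tendsto_error : Tendsto σ atTop (𝓝 0)
  apply_direction : ∀ n j, A n (e j) = ε n • e j
  apply_sub_le : ∀ n h, ‖h‖ ≤ R → ‖A n h - ε n • B h‖ ≤ σ n
  tendsto_shift : ∀ j, Tendsto (fun n => ENNReal.ofReal (ε n)⁻¹ * shiftModulus (v j) (σ n)) atTop
    (𝓝 0)

theorem Rescaling.comp {e : Fin d → Z} {v : Fin d → Z → ℝ} {B : Z →L[ℝ] Z} {R : ℝ}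
    {A : ℕ → Z ≃L[ℝ] Z} {ε σ : ℕ → ℝ} (h : Rescaling e v B R A ε σ) {ns : ℕ → ℕ}
    (hns : StrictMono ns) :
    Rescaling e v B R (fun n => A (ns n)) (fun n => ε (ns n)) fun n => σ (ns n) :=
  ⟨fun _ => h.pos _, h.tendsto.comp hns.tendsto_atTop, fun _ => h.error_nonneg _,
    h.tendsto_error.comp hns.tendsto_atTop, fun _ => h.apply_direction _,
    fun _ => h.apply_sub_le _, fun j => (h.tendsto_shift j).comp hns.tendsto_atTop⟩

namespace LocalSolution

variable {O : Set Z} {c M : ℝ} {e : Fin d → Z} {τ : Z} {ρ p : Z → ℝ} {v f : Fin d → Z → ℝ}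
  (hS : LocalSolution O c M e τ ρ p v f) {k : Z → ℝ} {R : ℝ} (hk : IsMollifier k R)

section
include hS

theorem field_measurable_clm (L : Z →L[ℝ] ℝ) : Measurable fun z => L (field e v z) := by
  simp_rw [clm_field]
  exact Finset.measurable_fun_sum _ fun j _ => (hS.velocity_measurable j).mul_const _

theorem field_integrable_clm (L : Z →L[ℝ] ℝ) : Integrable fun z => L (field e v z) := by
  simp_rw [clm_field]
  exact integrable_finsetSum _ fun j _ => (hS.velocity_integrable j).mul_const _

include hk

/-- Substitute `y = z - A h`: the Jacobian cancels the normalization of the kernel. The velocity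
only has components along the `e j`, on which `A` acts as multiplication by `ε`, so differentiating
the rescaled kernel produces exactly one factor `ε⁻¹`, even if `A` contracts time much faster. -/
theorem enorm_commutator_le {A : Z ≃L[ℝ] Z} {ε : ℝ} (hε : 0 < ε) (hA : ∀ j, A (e j) = ε • e j)
    (i : Fin d) (z : Z) : ‖commutator (scaleKernel A k) e ρ v i z‖ₑ ≤ ENNReal.ofReal M *
      ∫⁻ h, ENNReal.ofReal ε⁻¹ * (‖v i (z - A h) - favre (scaleKernel A k) ρ v i z‖ₑ *
        ‖fderiv ℝ k h (field e v z) - fderiv ℝ k h (field e v (z - A h))‖ₑ) := by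
  have hAs : ∀ y, A.symm (field e v y) = ε⁻¹ • field e v y := by
    intro y
    rw [field, map_sum, Finset.smul_sum]
    refine Finset.sum_congr rfl fun j _ => ?_
    have : A.symm (e j) = ε⁻¹ • e j := by
      rw [ContinuousLinearEquiv.symm_apply_eq, map_smul, hA, smul_smul, inv_mul_cancel₀ hε.ne',
        one_smul]
    rw [map_smul, this, smul_comm]
  unfold commutator
  set w := favre (scaleKernel A k) ρ v i z
  have hdet := (abs_det_pos A).ne'
  have h1 : ∫ y, ρ y * (v i y - w) *
      fderiv ℝ (scaleKernel A k) (z - y) (field e v z - field e v y)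
      = ∫ h, ρ (z - A h) * (v i (z - A h) - w) *
        (ε⁻¹ * (fderiv ℝ k h (field e v z) - fderiv ℝ k h (field e v (z - A h)))) := by
    rw [← integral_sub_left_eq_self _ volume z, integral_eq_abs_det_mul A, ← integral_const_mul]
    congr 1; ext h
    rw [fderiv_scaleKernel A hk.contDiff, sub_sub_cancel, map_sub, hAs, hAs, A.symm_apply_apply,
      ← smul_sub, map_smul, map_sub, smul_eq_mul]
    field_simp
  rw [h1]
  refine (enorm_integral_le_lintegral_enorm _).trans ?_
  rw [← lintegral_const_mul' _ _ ENNReal.ofReal_ne_top]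
  refine lintegral_mono fun h => ?_
  beta_reduce
  rw [enorm_mul, enorm_mul, enorm_mul, Real.enorm_of_nonneg (inv_nonneg.2 hε.le)]
  have : ‖ρ (z - A h)‖ₑ ≤ ENNReal.ofReal M := by
    rw [Real.enorm_eq_ofReal_abs]; exact ENNReal.ofReal_le_ofReal (hS.abs_density_le _)
  calc _ ≤ ENNReal.ofReal M * ‖v i (z - A h) - w‖ₑ * (ENNReal.ofReal ε⁻¹ *
      ‖fderiv ℝ k h (field e v z) - fderiv ℝ k h (field e v (z - A h))‖ₑ) := by gcongr
    _ = _ := by ring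

theorem increments_measurable (A : Z ≃L[ℝ] Z) {φ w : Z → ℝ} (hφ : Measurable φ)
    (hw : Measurable w) (ε : ℝ) (i : Fin d) : Measurable fun h =>
      increments A φ (v i) w (fun z => fderiv ℝ k h (field e v z)) ε h := by
  unfold increments
  simp_rw [clm_field]
  have h1 : ∀ j, Measurable fun h => fderiv ℝ k h (e j) := fun j =>
    ((hk.contDiff.continuous_fderiv (by simp)).clm_apply continuous_const).measurable
  have h2 := hS.velocity_measurable
  have hA : Measurable A := A.continuous.measurable
  refine Measurable.const_mul (Measurable.lintegral_prod_right' (f := fun p : Z × Z =>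
    ‖φ p.2‖ₑ * ‖v i (p.2 - A p.1) - w p.2‖ₑ * ‖(∑ j, v j p.2 * fderiv ℝ k p.1 (e j))
      - ∑ j, v j (p.2 - A p.1) * fderiv ℝ k p.1 (e j)‖ₑ) ?_) _
  fun_prop

theorem enorm_commutator_term_le {A : Z ≃L[ℝ] Z} {r : ℝ} (hKA : IsMollifier (scaleKernel A k) r)
    {ε : ℝ} (hε : 0 < ε)
    (hA : ∀ j, A (e j) = ε • e j) {φ : Z → ℝ} (hφ : Measurable φ) :
    ‖∑ i, ∫ z, (ρ z * v i z * (mollify (scaleKernel A k) ρ z)⁻¹) *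
      (φ z * commutator (scaleKernel A k) e ρ v i z)‖ₑ
      ≤ ENNReal.ofReal (M * M * c⁻¹ * M) * ∑ i, ∫⁻ h,
        increments A φ (v i) (favre (scaleKernel A k) ρ v i) (fun z => fderiv ℝ k h (field e v z))
          ε h := by
  rw [Finset.mul_sum]
  refine (enorm_sum_le _ _).trans (Finset.sum_le_sum fun i _ => ?_)
  have hM := hS.M_pos
  have hc := hS.c_pos
  have hwm := (hS.favre_bddMeas hKA i).measurable
  set w := favre (scaleKernel A k) ρ v i
  refine (enorm_integral_le_lintegral_enorm _).trans ?_
  have hpt : ∀ z, ‖(ρ z * v i z * (mollify (scaleKernel A k) ρ z)⁻¹) *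
      (φ z * commutator (scaleKernel A k) e ρ v i z)‖ₑ ≤ ENNReal.ofReal (M * M * c⁻¹ * M) *
      ∫⁻ h, ENNReal.ofReal ε⁻¹ * (‖φ z‖ₑ * ‖v i (z - A h) - w z‖ₑ *
        ‖fderiv ℝ k h (field e v z) - fderiv ℝ k h (field e v (z - A h))‖ₑ) := by
    intro z
    -- The weight `ρ v_i / ρ_K` is at most `M * M * c⁻¹`; the last factor `M` of the constant is the
    -- density inside the commutator.
    have h1 : ‖ρ z * v i z * (mollify (scaleKernel A k) ρ z)⁻¹‖ₑ ≤ ENNReal.ofReal (M * M * c⁻¹) := by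
      rw [Real.enorm_eq_ofReal_abs, abs_mul, abs_mul, abs_inv,
        abs_of_pos (hS.mollify_density_pos hKA z)]
      refine ENNReal.ofReal_le_ofReal ?_
      have := inv_anti₀ hc (hS.mollify_density_mem hKA z).1
      have h0 := (inv_pos.2 (hS.mollify_density_pos hKA z)).le
      gcongr
      · exact hS.abs_density_le z
      · exact hS.velocity_le i z
    rw [enorm_mul _ (φ z * _), enorm_mul (φ z)]
    calc _ ≤ ENNReal.ofReal (M * M * c⁻¹) * (‖φ z‖ₑ * (ENNReal.ofReal M *
        ∫⁻ h, ENNReal.ofReal ε⁻¹ * (‖v i (z - A h) - w z‖ₑ *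
        ‖fderiv ℝ k h (field e v z) - fderiv ℝ k h (field e v (z - A h))‖ₑ))) :=
          mul_le_mul' h1 (mul_le_mul' le_rfl (hS.enorm_commutator_le hk hε hA i z))
      _ = ENNReal.ofReal (M * M * c⁻¹ * M) * (‖φ z‖ₑ *
        ∫⁻ h, ENNReal.ofReal ε⁻¹ * (‖v i (z - A h) - w z‖ₑ *
        ‖fderiv ℝ k h (field e v z) - fderiv ℝ k h (field e v (z - A h))‖ₑ)) := by
          rw [ENNReal.ofReal_mul (p := M * M * c⁻¹) (by positivity)]
          generalize ∫⁻ h, ENNReal.ofReal ε⁻¹ * (‖v i (z - A h) - w z‖ₑ *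
            ‖fderiv ℝ k h (field e v z) - fderiv ℝ k h (field e v (z - A h))‖ₑ) = I
          ring
      _ = _ := by
          rw [← lintegral_const_mul' _ _ enorm_ne_top]
          congr 1
          refine lintegral_congr fun h => ?_
          generalize ‖v i (z - A h) - w z‖ₑ = x
          generalize ‖fderiv ℝ k h (field e v z) - fderiv ℝ k h (field e v (z - A h))‖ₑ = y
          ring
  refine (lintegral_mono hpt).trans ?_
  rw [lintegral_const_mul' _ _ ENNReal.ofReal_ne_top]
  refine mul_le_mul' le_rfl (le_of_eq ?_)
  have h1 : ∀ j, Measurable fun h => fderiv ℝ k h (e j) := fun j =>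
    ((hk.contDiff.continuous_fderiv (by simp)).clm_apply continuous_const).measurable
  have h2 := hS.velocity_measurable
  have hAm : Measurable A := A.continuous.measurable
  rw [lintegral_lintegral_swap]
  · unfold increments
    refine lintegral_congr fun h => ?_
    rw [lintegral_const_mul' _ _ ENNReal.ofReal_ne_top]
  · refine Measurable.aemeasurable ?_
    simp only [Function.uncurry_def]
    simp_rw [clm_field]
    fun_prop

end

variable {φ : Z → ℝ} (hφ : IsTestOn O φ)
  {G : Fin d → Z → ℝ} (hGm : ∀ j, Measurable (G j)) (hG : ∀ j, Integrable (G j))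
  {μ : Measure Z} [IsFiniteMeasure μ] (hder : ∀ j, IsDerivUpTo O ρ (e j) (G j) μ)
  {B : Z →L[ℝ] Z} {A : ℕ → Z ≃L[ℝ] Z} {ε σ : ℕ → ℝ} (hA : Rescaling e v B R A ε σ)
  {b : Z → Z → ℝ} (hbm : ∀ h, Measurable (b h)) (hb : ∀ h, Integrable (b h))
  {m : Z → Measure Z} (hFder : ∀ h, IsDerivUpTo O (fun z => fderiv ℝ k h (field e v z)) (B h)
    (b h) (m h)) {Cb Cm : ℝ≥0∞} (hCb : Cb ≠ ⊤) (hCm : Cm ≠ ⊤) (hbC : ∀ h, ∫⁻ z, ‖b h z‖ₑ ≤ Cb)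
  (hmC : ∀ h, m h univ ≤ Cm)

include hS hk hφ hGm hG hder hA hbm hb hFder hCb hCm hbC hmC

/-- The energy defect is controlled by the singular parts of the density gradient and of the
directional derivatives of the velocity. -/
theorem enorm_energyDefect_le_of_kernel :
    ‖energyDefect e τ ρ p v f φ‖ₑ ≤ (chainConst d c M + kernelConst d c M) * ∫⁻ z, ‖φ z‖ₑ ∂μ
      + commConst d c M * ∫⁻ h, ∫⁻ z, ‖φ z‖ₑ ∂(m h) := by
  obtain ⟨r₀, hr₀, hr₀O⟩ := hφ.exists_radius hS.isOpen
  have hmf : ∀ h, IsFiniteMeasure (m h) := fun h => ⟨(hmC h).trans_lt hCm.lt_top⟩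
  have hM := hS.M_pos
  have hc := hS.c_pos
  -- mollifiers
  have hmoll : ∀ n, IsMollifier (scaleKernel (A n) k) (ε n * (‖B‖ * R) + σ n) := fun n =>
    hk.scale fun h hh => by
      have h1 := hA.apply_sub_le n h hh
      have h2 : ‖ε n • B h‖ ≤ ε n * (‖B‖ * R) := by
        rw [norm_smul, Real.norm_eq_abs, abs_of_pos (hA.pos n)]
        have := B.le_opNorm h
        have := (hA.pos n).le
        gcongr
        exact (B.le_opNorm h).trans (by gcongr)
      calc ‖A n h‖ = ‖ε n • B h + (A n h - ε n • B h)‖ := by congr 1; abel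
        _ ≤ _ := (norm_add_le _ _).trans (add_le_add h2 h1)
  have hrad : Tendsto (fun n => ε n * (‖B‖ * R) + σ n) atTop (𝓝 0) := by
    simpa using (hA.tendsto.mul_const (‖B‖ * R)).add hA.tendsto_error
  obtain ⟨ns, hns, hK⟩ := hS.exists_mollifiers hmoll hrad
  replace hA := hA.comp hns
  generalize hA' : (fun n => A (ns n)) = A' at hA
  generalize hε' : (fun n => ε (ns n)) = ε' at hA
  generalize hσ' : (fun n => σ (ns n)) = σ' at hA
  have e1 : ∀ n, A (ns n) = A' n := fun n => by rw [← hA']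
  have e2 : ∀ n, ε (ns n) = ε' n := fun n => by rw [← hε']
  have e3 : ∀ n, σ (ns n) = σ' n := fun n => by rw [← hσ']
  simp only [e1, e2, e3] at hK
  clear hmoll hrad hA' hε' hσ' e1 e2 e3
  clear A ε σ
  obtain ⟨Cφ, hCφ⟩ := hφ.bddMeas.bdd
  set C : ℝ≥0∞ := ENNReal.ofReal Cφ with hCdef
  have hC : C ≠ ⊤ := ENNReal.ofReal_ne_top
  have hφC : ∀ z, ‖φ z‖ₑ ≤ C := fun z => by
    rw [Real.enorm_eq_ofReal_abs]; exact ENNReal.ofReal_le_ofReal (hCφ z)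
  set S : ℝ≥0∞ := ENNReal.ofReal (M + M * M / c) with hSdef
  have hSt : S ≠ ⊤ := ENNReal.ofReal_ne_top
  set w : ℕ → Fin d → Z → ℝ := fun n i => favre (scaleKernel (A' n) k) ρ v i with hw
  have hvw : ∀ n i z y, ‖v i y - w n i z‖ₑ ≤ S := fun n i z y => by
    rw [Real.enorm_eq_ofReal_abs]
    exact ENNReal.ofReal_le_ofReal ((abs_sub _ _).trans (add_le_add (hS.velocity_le i y)
      (hS.abs_favre_le (hK.isMollifier n) i z)))
  have hwb := fun i => hS.favre_bddSeq hK i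
  set F : Z → Z → ℝ := fun h z => fderiv ℝ k h (field e v z) with hF
  set J : ℕ → Fin d → Z → ℝ≥0∞ := fun n i h => increments (A' n) φ (v i) (w n i) (F h) (ε' n) h
    with hJ
  have hJm : ∀ n i, Measurable (J n i) := fun n i =>
    hS.increments_measurable hk (A' n) hφ.bddMeas.measurable ((hwb i).measurable n) _ i
  -- the radius in the estimate of difference quotients
  set r : ℕ → ℝ := fun n => ε' n * (‖B‖ * R) + ε' n with hrdef
  have hr : Tendsto r atTop (𝓝 0) := by
    simpa using (hA.tendsto.mul_const (‖B‖ * R)).add hA.tendsto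
  have hsup : Tendsto (fun n => supModulus φ (r n)) atTop (𝓝 0) :=
    (tendsto_supModulus hφ.1.continuous hφ.2.1).comp hr
  set L : Z → Fin d → ℝ≥0∞ := fun h j => ‖fderiv ℝ k h (e j)‖ₑ with hL
  obtain ⟨N, hN⟩ : ∃ N : ℝ≥0∞, N ≠ ⊤ ∧ ∀ h j, L h j ≤ N := by
    have h1 : ∀ j, ∃ N : ℝ, ∀ h, ‖fderiv ℝ k h (e j)‖ ≤ N := fun j => by
      have hc : Continuous fun z => fderiv ℝ k z (e j) :=
        (hk.contDiff.continuous_fderiv (by simp)).clm_apply continuous_const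
      have hs : HasCompactSupport fun z => fderiv ℝ k z (e j) :=
        (hk.hasCompactSupport.fderiv ℝ).comp_left (g := fun l : Z →L[ℝ] ℝ => l (e j)) rfl
      exact hs.exists_bound_of_continuous hc
    choose N hN using h1
    refine ⟨∑ j, ENNReal.ofReal (N j), by simp, fun h j => ?_⟩
    calc L h j ≤ ENNReal.ofReal (N j) := by
          simp only [hL]; rw [← ofReal_norm]; exact ENNReal.ofReal_le_ofReal (hN j h)
      _ ≤ _ := Finset.single_le_sum (f := fun j => ENNReal.ofReal (N j)) (fun _ _ => zero_le)
          (Finset.mem_univ j)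
  have hJle : ∀ᶠ n in atTop, ∀ i h, ‖h‖ ≤ R → J n i h ≤
      (C * (∫⁻ z, ‖v i (z - A' n h) - w n i z‖ₑ * ‖b h z‖ₑ) + S * (C * shiftModulus (b h) (r n)
        + (∫⁻ z, ‖φ z‖ₑ ∂(m h) + supModulus φ (r n) * m h univ)))
        + C * S * (∑ j, L h j * (ENNReal.ofReal (ε' n)⁻¹ * shiftModulus (v j) (σ' n))) := by
    filter_upwards [hr.eventually_le_const hr₀] with n hn i h hh
    -- The extra summand `ε' n` in the radius makes the inequality strict, as the estimate of
    -- difference quotients requires.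
    have hlt : ε' n * ‖B h‖ < r n := by
      have h1 : ε' n * ‖B h‖ ≤ ε' n * (‖B‖ * R) := by
        have := (hA.pos n).le
        gcongr
        exact (B.le_opNorm h).trans (by gcongr)
      have := hA.pos n
      simp only [hrdef]; linarith
    refine (increments_le (hS.field_measurable_clm _) (hS.field_integrable_clm _) (hbm h) (hb h)
      (hFder h) hφ.bddMeas.measurable (hS.velocity_measurable i) ((hwb i).measurable n) hSt hC
      (hvw n i) hφC (hA.pos n) hlt (fun z hz =>
        (Metric.closedBall_subset_closedBall hn).trans (hr₀O z hz)) (A' n) h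
      (hA.apply_sub_le n h hh)).trans ?_
    refine add_le_add le_rfl (mul_le_mul' le_rfl ?_)
    have h2 : shiftModulus (fun z => fderiv ℝ k h (field e v z)) (σ' n)
        ≤ ∑ j, L h j * shiftModulus (v j) (σ' n) := by
      simp_rw [clm_field]
      exact shiftModulus_sum_le hS.velocity_measurable _ _
    refine (mul_le_mul' le_rfl h2).trans (le_of_eq ?_)
    rw [Finset.mul_sum]
    exact Finset.sum_congr rfl fun j _ => by ring
  have hJzero : ∀ n i h, R < ‖h‖ → J n i h = 0 := by
    intro n i h hh
    have h0 : fderiv ℝ k h = 0 := by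
      by_contra h1
      have h2 := hk.tsupport_subset (support_fderiv_subset ℝ h1)
      rw [mem_closedBall_zero_iff] at h2
      linarith
    simp [hJ, increments, hF, h0]
  have hsh : ∀ᶠ n in atTop, ∀ j, ENNReal.ofReal (ε' n)⁻¹ * shiftModulus (v j) (σ' n) ≤ 1 :=
    eventually_all.2 fun j => (hA.tendsto_shift j).eventually_le_const one_pos
  -- uniform bound
  set D : ℝ≥0∞ := (C * (S * Cb) + S * (C * (2 * Cb) + (C * Cm + 1 * Cm)))
    + C * S * (∑ _j : Fin d, N * 1) with hD
  have hDt : D ≠ ⊤ := by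
    have := hN.1
    rw [hD]
    refine ENNReal.add_ne_top.2 ⟨by finiteness, ENNReal.mul_ne_top (by finiteness)
      (ENNReal.sum_ne_top.2 fun _ _ => by finiteness)⟩
  have hbound : ∀ᶠ n in atTop, ∀ i, ∀ h, J n i h ≤ (Metric.closedBall (0 : Z) R).indicator
      (fun _ => D) h := by
    filter_upwards [hJle, hsh, hsup.eventually_le_const one_pos] with n h1 h2 h3 i h
    by_cases hh : ‖h‖ ≤ R
    swap
    · rw [hJzero n i h (not_le.1 hh)]; exact zero_le
    rw [indicator_of_mem (by simpa using hh)]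
    refine (h1 i h hh).trans ?_
    have hb1 : ∫⁻ z, ‖v i (z - A' n h) - w n i z‖ₑ * ‖b h z‖ₑ ≤ S * Cb := by
      calc _ ≤ ∫⁻ z, S * ‖b h z‖ₑ := lintegral_mono fun z => mul_le_mul' (hvw n i z _) le_rfl
        _ ≤ _ := by rw [lintegral_const_mul' _ _ hSt]; exact mul_le_mul' le_rfl (hbC h)
    have hb2 : shiftModulus (b h) (r n) ≤ 2 * Cb := by
      refine iSup₂_le fun y _ => ?_
      calc ∫⁻ z, ‖b h (z - y) - b h z‖ₑ ≤ ∫⁻ z, (‖b h (z - y)‖ₑ + ‖b h z‖ₑ) :=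
            lintegral_mono fun z => enorm_sub_le
        _ = (∫⁻ z, ‖b h z‖ₑ) + ∫⁻ z, ‖b h z‖ₑ := by
            have := hbm h
            rw [lintegral_add_left (by fun_prop),
              lintegral_sub_right_eq_self (fun z => ‖b h z‖ₑ) y]
        _ ≤ _ := by rw [two_mul]; exact add_le_add (hbC h) (hbC h)
    have hb3 : ∫⁻ z, ‖φ z‖ₑ ∂(m h) ≤ C * Cm := by
      calc _ ≤ ∫⁻ z, C ∂(m h) := lintegral_mono hφC
        _ ≤ _ := by rw [lintegral_const]; exact mul_le_mul' le_rfl (hmC h)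
    rw [hD]
    exact add_le_add (add_le_add (mul_le_mul' le_rfl hb1) (mul_le_mul' le_rfl (add_le_add
      (mul_le_mul' le_rfl hb2) (add_le_add hb3 (mul_le_mul' h3 (hmC h))))))
      (mul_le_mul' le_rfl (Finset.sum_le_sum fun j _ => mul_le_mul' (hN.2 h j) (h2 j)))
  -- pointwise limit
  have hlim : ∀ h, limsup (fun n => ∑ i, J n i h) atTop
      ≤ ∑ _i : Fin d, S * ∫⁻ z, ‖φ z‖ₑ ∂(m h) := by
    intro h
    by_cases hh : ‖h‖ ≤ R
    swap
    · simp [hJzero _ _ h (not_le.1 hh)]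
    have ha : Tendsto (fun n => A' n h) atTop (𝓝 0) := by
      have h1 : Tendsto (fun n => A' n h - ε' n • B h) atTop (𝓝 0) :=
        squeeze_zero_norm (fun n => hA.apply_sub_le n h hh) hA.tendsto_error
      have h2 : Tendsto (fun n => ε' n • B h) atTop (𝓝 0) := by
        simpa using hA.tendsto.smul_const (B h)
      simpa using h1.add h2
    -- Both the translated velocity and the weighted average approach the velocity, so the integral
    -- against the density `b h` disappears; only `m h` remains in the limit.
    have t1 := fun i => tendsto_lintegral_shift_sub_mul (hbm h) (hb h) (hS.velocity_bddMeas i) (hwb i) ha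
    have t2 : Tendsto (fun n => shiftModulus (b h) (r n)) atTop (𝓝 0) :=
      (tendsto_shiftModulus (c := 0) (by simpa using hb h)).comp hr
    have t3 : Tendsto (fun n => ∑ j, L h j * (ENNReal.ofReal (ε' n)⁻¹ * shiftModulus (v j) (σ' n)))
        atTop (𝓝 (∑ j, L h j * 0)) := tendsto_finsetSum _ fun j _ =>
      ENNReal.Tendsto.const_mul (hA.tendsto_shift j)
        (Or.inr (ne_top_of_le_ne_top hN.1 (hN.2 h j)))
    have t4 := tendsto_finsetSum Finset.univ fun i _ => ((ENNReal.Tendsto.const_mul (t1 i) (Or.inr hC)).add (ENNReal.Tendsto.const_mul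
      ((ENNReal.Tendsto.const_mul t2 (Or.inr hC)).add ((tendsto_const_nhds
        (x := ∫⁻ z, ‖φ z‖ₑ ∂(m h))).add (ENNReal.Tendsto.mul_const hsup
          (Or.inr (measure_ne_top (m h) univ))))) (Or.inr hSt))).add (ENNReal.Tendsto.const_mul t3
          (Or.inr (ENNReal.mul_ne_top hC hSt)))
    simp only [mul_zero, zero_add, zero_mul, add_zero, Finset.sum_const_zero] at t4
    rw [← t4.limsup_eq]
    exact limsup_le_limsup (hJle.mono fun n hn => Finset.sum_le_sum fun i _ => hn i h hh)
  refine hS.enorm_energyDefect_le hK hφ hGm hG hder (X := fun n =>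
    ENNReal.ofReal (M * M * c⁻¹ * M) * ∑ i, ∫⁻ h, J n i h) (Eventually.of_forall fun n =>
      hS.enorm_commutator_term_le hk (hK.isMollifier n) (hA.pos n) (hA.apply_direction n)
      hφ.bddMeas.measurable) ?_
  -- the limit of the commutators
  obtain ⟨n₀, hn₀⟩ := eventually_atTop.1 hbound
  have hJi : limsup (fun n => ∑ i, ∫⁻ h, J n i h) atTop
      ≤ (∑ _i : Fin d, S) * ∫⁻ h, ∫⁻ z, ‖φ z‖ₑ ∂(m h) := by
    simp_rw [← lintegral_finsetSum Finset.univ fun i _ => hJm _ i]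
    -- The dominating function is available from the index `n₀` on, so the sequence is shifted
    -- before the reverse Fatou lemma is applied in the variable `h`.
    rw [← Filter.limsup_nat_add _ n₀]
    refine (limsup_lintegral_le (fun h => ∑ _i : Fin d,
      (Metric.closedBall (0 : Z) R).indicator (fun _ => D) h)
      (fun n => Finset.measurable_fun_sum _ fun i _ => hJm _ i) (fun n => ae_of_all _ fun h =>
        Finset.sum_le_sum fun i _ => hn₀ (n + n₀) (by omega) i h) ?_).trans ?_
    · rw [lintegral_finsetSum _ fun i _ =>
        measurable_const.indicator Metric.isClosed_closedBall.measurableSet]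
      refine ENNReal.sum_ne_top.2 fun i _ => ?_
      rw [lintegral_indicator Metric.isClosed_closedBall.measurableSet, setLIntegral_const]
      exact ENNReal.mul_ne_top hDt (isCompact_closedBall (0 : Z) R).measure_lt_top.ne
    · rw [← lintegral_const_mul' _ _ (ENNReal.sum_ne_top.2 fun _ _ => hSt)]
      refine lintegral_mono fun h => ?_
      rw [Filter.limsup_nat_add (fun n => ∑ i, J n i h) n₀, Finset.sum_mul]
      exact hlim h
  calc limsup (fun n => ENNReal.ofReal (M * M * c⁻¹ * M) * ∑ i, ∫⁻ h, J n i h) atTop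
      = ENNReal.ofReal (M * M * c⁻¹ * M) * limsup (fun n => ∑ i, ∫⁻ h, J n i h) atTop :=
        ENNReal.limsup_const_mul_of_ne_top ENNReal.ofReal_ne_top
    _ ≤ ENNReal.ofReal (M * M * c⁻¹ * M) * ((∑ _i : Fin d, S) * ∫⁻ h, ∫⁻ z, ‖φ z‖ₑ ∂(m h)) :=
        mul_le_mul' le_rfl hJi
    _ = _ := by
        rw [Finset.sum_const, Finset.card_univ, Fintype.card_fin, nsmul_eq_mul, commConst]
        ring

end LocalSolution

end

section

/-! ### Longitudinal derivatives from symmetrized derivatives -/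

section SymmetricDerivatives

variable {Z : Type*} [NormedAddCommGroup Z] [NormedSpace ℝ Z] [FiniteDimensional ℝ Z]
  [MeasureSpace Z] [BorelSpace Z] [(volume : Measure Z).IsAddHaarMeasure]

theorem IsTestOn.integral_fderiv_eq_zero {O : Set Z} {ψ : Z → ℝ} (hψ : IsTestOn O ψ) (l : Z) :
    ∫ z, fderiv ℝ ψ z l = 0 := by
  have := integral_mul_fderiv_eq_neg_fderiv_mul_of_integrable (μ := (volume : Measure Z))
    (f := fun _ : Z => (1 : ℝ)) (g := ψ) (v := l) (by simp) (by simpa using hψ.fderiv_integrable l)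
    (by simpa using hψ.integrable) (fun _ _ => differentiableAt_const _)
    (fun z _ => hψ.1.differentiable (by simp) z)
  simpa using this

/-- The symmetrized derivatives of the components `U a` in the directions `dir b` are `S a b`, up
to a measure of variation at most `μ`. -/
def IsSymDerivUpTo {ι : Type*} (O : Set Z) (dir : ι → Z) (U : ι → Z → ℝ) (S : ι → ι → Z → ℝ)
    (μ : Measure Z) : Prop :=
  ∀ ψ, IsTestOn O ψ → ∀ a b, ‖(∫ z, (U b z * fderiv ℝ ψ z (dir a) + U a z * fderiv ℝ ψ z (dir b)) / 2)
    + ∫ z, ψ z * S a b z‖ₑ ≤ ∫⁻ z, ‖ψ z‖ₑ ∂μ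

/-- The longitudinal derivatives of a field are controlled by its symmetrized derivatives. -/
theorem IsSymDerivUpTo.isDerivUpTo {ι : Type*} [Fintype ι] {O : Set Z} {dir : ι → Z}
    {U : ι → Z → ℝ} (hU : ∀ a, BddMeas (U a)) {S : ι → ι → Z → ℝ} (hS : ∀ a b, Integrable (S a b))
    {μ : Measure Z} (h : IsSymDerivUpTo O dir U S μ) (x : ι → ℝ) (g c : ℝ) :
    IsDerivUpTo O (fun z => g * (∑ a, x a * U a z) - c) (∑ a, x a • dir a)
      (fun z => ∑ a, ∑ b, g * x a * x b * S a b z)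
      ((∑ a, ∑ b, ‖g * x a * x b‖ₑ) • μ) := by
  intro ψ hψ
  have i1 : ∀ a b, Integrable fun z => U a z * fderiv ℝ ψ z (dir b) := fun a b =>
    (hU a).integrable_mul (hψ.fderiv_integrable _)
  have i2 : ∀ a b, Integrable fun z => ψ z * S a b z := fun a b => hψ.bddMeas.integrable_mul (hS a b)
  have e1 : ∫ z, (g * (∑ a, x a * U a z) - c) * fderiv ℝ ψ z (∑ a, x a • dir a)
      = ∑ a, ∑ b, g * x a * x b * ∫ z, U a z * fderiv ℝ ψ z (dir b) := by
    have h1 : ∀ z, (g * (∑ a, x a * U a z) - c) * fderiv ℝ ψ z (∑ a, x a • dir a)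
        = (∑ a, ∑ b, g * x a * x b * (U a z * fderiv ℝ ψ z (dir b)))
          - c * fderiv ℝ ψ z (∑ a, x a • dir a) := by
      intro z
      rw [sub_mul, map_sum, mul_assoc, Finset.sum_mul_sum, Finset.mul_sum]
      congr 1
      refine Finset.sum_congr rfl fun a _ => ?_
      rw [Finset.mul_sum]
      refine Finset.sum_congr rfl fun b _ => ?_
      rw [map_smul, smul_eq_mul]; ring
    simp_rw [h1]
    -- The constant `c` drops out because derivatives of test functions have integral zero.
    rw [integral_sub, integral_const_mul, hψ.integral_fderiv_eq_zero, mul_zero, sub_zero,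
      integral_finsetSum]
    · refine Finset.sum_congr rfl fun a _ => ?_
      rw [integral_finsetSum _ fun b _ => (i1 a b).const_mul _]
      simp_rw [integral_const_mul]
    · exact fun a _ => integrable_finsetSum _ fun b _ => (i1 a b).const_mul _
    · exact integrable_finsetSum _ fun a _ => integrable_finsetSum _ fun b _ => (i1 a b).const_mul _
    · exact (hψ.fderiv_integrable _).const_mul _
  have e2 : ∫ z, ψ z * ∑ a, ∑ b, g * x a * x b * S a b z
      = ∑ a, ∑ b, g * x a * x b * ∫ z, ψ z * S a b z := by
    have h1 : ∀ z, ψ z * (∑ a, ∑ b, g * x a * x b * S a b z)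
        = ∑ a, ∑ b, g * x a * x b * (ψ z * S a b z) := by
      intro z
      rw [Finset.mul_sum]
      refine Finset.sum_congr rfl fun a _ => ?_
      rw [Finset.mul_sum]
      refine Finset.sum_congr rfl fun b _ => ?_
      ring
    simp_rw [h1]
    rw [integral_finsetSum]
    · refine Finset.sum_congr rfl fun a _ => ?_
      rw [integral_finsetSum _ fun b _ => (i2 a b).const_mul _]
      simp_rw [integral_const_mul]
    · exact fun a _ => integrable_finsetSum _ fun b _ => (i2 a b).const_mul _
  -- The coefficients `x a * x b` are symmetric in `a` and `b`, so only the symmetric part of the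
  -- derivative contributes.
  have e3 : ∑ a, ∑ b, g * x a * x b * ∫ z, U a z * fderiv ℝ ψ z (dir b)
      = ∑ a, ∑ b, g * x a * x b *
        ∫ z, (U b z * fderiv ℝ ψ z (dir a) + U a z * fderiv ℝ ψ z (dir b)) / 2 := by
    have h1 : ∀ a b, ∫ z, (U b z * fderiv ℝ ψ z (dir a) + U a z * fderiv ℝ ψ z (dir b)) / 2
        = ((∫ z, U b z * fderiv ℝ ψ z (dir a)) + ∫ z, U a z * fderiv ℝ ψ z (dir b)) / 2 := by
      intro a b
      rw [integral_div, integral_add (i1 b a) (i1 a b)]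
    have h2 : ∑ a, ∑ b, g * x a * x b * ∫ z, U b z * fderiv ℝ ψ z (dir a)
        = ∑ a, ∑ b, g * x a * x b * ∫ z, U a z * fderiv ℝ ψ z (dir b) := by
      rw [Finset.sum_comm]
      refine Finset.sum_congr rfl fun a _ => Finset.sum_congr rfl fun b _ => by ring
    have h3 : ∀ a b, g * x a * x b *
        (((∫ z, U b z * fderiv ℝ ψ z (dir a)) + ∫ z, U a z * fderiv ℝ ψ z (dir b)) / 2)
        = (g * x a * x b * ∫ z, U b z * fderiv ℝ ψ z (dir a)) / 2
          + (g * x a * x b * ∫ z, U a z * fderiv ℝ ψ z (dir b)) / 2 := fun a b => by ring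
    simp_rw [h1, h3, Finset.sum_add_distrib, ← Finset.sum_div]
    rw [h2]; ring
  rw [e1, e3, e2, ← Finset.sum_add_distrib, lintegral_smul_measure, smul_eq_mul, Finset.sum_mul]
  refine (enorm_sum_le _ _).trans (Finset.sum_le_sum fun a _ => ?_)
  rw [← Finset.sum_add_distrib, Finset.sum_mul]
  refine (enorm_sum_le _ _).trans (Finset.sum_le_sum fun b _ => ?_)
  rw [← mul_add, enorm_mul]
  exact mul_le_mul' le_rfl (h ψ hψ a b)

end SymmetricDerivatives

/-! ### Rescalings -/

variable {d : ℕ}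

instance : (volume : Measure (E d × ℝ)).IsAddHaarMeasure :=
  inferInstanceAs ((volume : Measure (E d)).prod (volume : Measure ℝ)).IsAddHaarMeasure

/-- The spatial directions in space-time. -/
noncomputable def spaceDir (j : Fin d) : E d × ℝ := (unitVec j, 0)

/-- The rescaling by `a` in space and by `b` in time. -/
noncomputable def stScale (a b : ℝ) (ha : a ≠ 0) (hb : b ≠ 0) : (E d × ℝ) ≃L[ℝ] (E d × ℝ) :=
  (ContinuousLinearEquiv.smulLeft (Units.mk0 a ha)).prodCongr
    (ContinuousLinearEquiv.smulLeft (Units.mk0 b hb))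

theorem stScale_apply (a b : ℝ) (ha : a ≠ 0) (hb : b ≠ 0) (h : E d × ℝ) :
    stScale a b ha hb h = (a • h.1, b • h.2) := rfl

/-- With equal factors in space and time the rescaling is exactly `ε` times the identity: the error
radius is zero and the condition on the translation modulus is void. -/
theorem exists_isotropic_rescaling {v : Fin d → E d × ℝ → ℝ} (R : ℝ) :
    ∃ A ε σ, Rescaling spaceDir v (ContinuousLinearMap.id ℝ (E d × ℝ)) R A ε σ := by
  have hp : ∀ n : ℕ, (0 : ℝ) < 1 / ((n : ℝ) + 1) := fun n => by positivity
  refine ⟨fun n => stScale _ _ (hp n).ne' (hp n).ne', fun n => 1 / ((n : ℝ) + 1), fun _ => 0, hp,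
    tendsto_one_div_add_atTop_nhds_zero_nat, fun _ => le_rfl, tendsto_const_nhds, fun n j => ?_,
    fun n h _ => ?_, fun j => ?_⟩
  · simp [stScale_apply, spaceDir]
  · rw [stScale_apply]
    simp [Prod.smul_def]
  · have : shiftModulus (v j) 0 = 0 := by
      refine le_antisymm (iSup₂_le fun h hh => ?_) zero_le
      rw [norm_le_zero_iff] at hh
      simp [hh]
    simp [this]

/-- Time is contracted so strongly that, at the scale of the error, translations move the velocity
by less than `ε²` in `L¹`. After division by `ε` the time increment still vanishes, and only spatial
derivatives are seen. -/
theorem exists_anisotropic_rescaling {v : Fin d → E d × ℝ → ℝ} (hv : ∀ j, Integrable (v j)) {R : ℝ}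
    (hR : 0 < R) : ∃ A ε σ, Rescaling spaceDir v
      ((ContinuousLinearMap.inl ℝ (E d) ℝ).comp (ContinuousLinearMap.fst ℝ (E d) ℝ)) R A ε σ := by
  have hp : ∀ n : ℕ, (0 : ℝ) < 1 / ((n : ℝ) + 1) := fun n => by positivity
  -- The error `s` comes from continuity of translations in `L¹`. The time factor will be `s / R`,
  -- so that times up to `R` are displaced by at most `s`.
  have hex : ∀ n : ℕ, ∃ s : ℝ, 0 < s ∧ s ≤ 1 / ((n : ℝ) + 1) ∧
      ∀ j, shiftModulus (v j) s ≤ ENNReal.ofReal ((1 / ((n : ℝ) + 1)) ^ 2) := by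
    intro n
    have h1 : ∀ᶠ s in 𝓝[>] (0 : ℝ), ∀ j,
        shiftModulus (v j) s ≤ ENNReal.ofReal ((1 / ((n : ℝ) + 1)) ^ 2) :=
      eventually_all.2 fun j => ((tendsto_shiftModulus (c := 0) (by simpa using hv j)).mono_left
        nhdsWithin_le_nhds).eventually_le_const (ENNReal.ofReal_pos.2 (by have := hp n; positivity))
    obtain ⟨s, hs1, hs2⟩ := (h1.and (Ioc_mem_nhdsGT (hp n))).exists
    exact ⟨s, hs2.1, hs2.2, hs1⟩
  choose s hs0 hs1 hs2 using hex
  have ht := tendsto_one_div_add_atTop_nhds_zero_nat (𝕜 := ℝ)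
  refine ⟨fun n => stScale _ (s n / R) (hp n).ne' (div_pos (hs0 n) hR).ne',
    fun n => 1 / ((n : ℝ) + 1), s, hp, ht, fun n => (hs0 n).le,
    squeeze_zero (fun n => (hs0 n).le) hs1 ht, fun n j => ?_, fun n h hh => ?_, fun j => ?_⟩
  · simp [stScale_apply, spaceDir]
  · have : stScale (1 / ((n : ℝ) + 1)) (s n / R) (hp n).ne' (div_pos (hs0 n) hR).ne' h
      - (1 / ((n : ℝ) + 1)) • ((ContinuousLinearMap.inl ℝ (E d) ℝ).comp
        (ContinuousLinearMap.fst ℝ (E d) ℝ)) h = (0, s n / R * h.2) := by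
      rw [stScale_apply]; simp
    rw [this, Prod.norm_mk, norm_zero, max_eq_right (norm_nonneg _), norm_mul,
      Real.norm_of_nonneg (div_pos (hs0 n) hR).le]
    calc s n / R * ‖h.2‖ ≤ s n / R * R := by
          have := (div_pos (hs0 n) hR).le
          gcongr
          exact (norm_snd_le h).trans hh
      _ = s n := div_mul_cancel₀ _ hR.ne'
  · refine tendsto_of_tendsto_of_tendsto_of_le_of_le tendsto_const_nhds
      (?_ : Tendsto (fun n : ℕ => ENNReal.ofReal (1 / ((n : ℝ) + 1))) atTop (𝓝 0))
      (fun _ => zero_le) fun n => ?_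
    · simpa using ENNReal.tendsto_ofReal ht
    · refine (mul_le_mul' le_rfl (hs2 n j)).trans (le_of_eq ?_)
      rw [← ENNReal.ofReal_mul (inv_nonneg.2 (hp n).le)]
      congr 1
      have := (hp n).ne'
      field_simp

/-! ### The radial kernel -/

/-- The Euclidean quadratic form on space-time. -/
noncomputable def stQuad (z : E d × ℝ) : ℝ := ⟪z.1, z.1⟫ + z.2 * z.2

/-- The unnormalized radial kernel. -/
noncomputable def radialBump (z : E d × ℝ) : ℝ := Real.smoothTransition (1 - stQuad z)

/-- The normalized radial kernel. -/
noncomputable def radialKernel (z : E d × ℝ) : ℝ := (∫ y, radialBump (d := d) y)⁻¹ * radialBump z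

/-- The radial profile of the derivative of the radial kernel. -/
noncomputable def radialSlope (z : E d × ℝ) : ℝ :=
  (∫ y, radialBump (d := d) y)⁻¹ * (deriv Real.smoothTransition (1 - stQuad z) * (-2))

theorem norm_le_one_of_stQuad {z : E d × ℝ} (h : stQuad z ≤ 1) : ‖z‖ ≤ 1 := by
  unfold stQuad at h
  rw [real_inner_self_eq_norm_mul_norm] at h
  rw [Prod.norm_def]
  refine max_le ?_ ?_
  · nlinarith [mul_self_nonneg z.2, norm_nonneg z.1]
  · rw [Real.norm_eq_abs, ← abs_one, ← sq_le_sq]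
    nlinarith [mul_self_nonneg ‖z.1‖]

theorem radialBump_support : Function.support (radialBump (d := d)) ⊆ Metric.closedBall 0 1 := by
  intro z hz
  rw [mem_closedBall_zero_iff]
  refine norm_le_one_of_stQuad (not_lt.1 fun h => hz ?_)
  exact Real.smoothTransition.zero_of_nonpos (by linarith)

theorem stQuad_contDiff : ContDiff ℝ ∞ (stQuad (d := d)) := by
  unfold stQuad
  exact (contDiff_fst.inner ℝ contDiff_fst).add (contDiff_snd.mul contDiff_snd)

theorem radialBump_contDiff : ContDiff ℝ ∞ (radialBump (d := d)) :=
  Real.smoothTransition.contDiff.comp (contDiff_const.sub stQuad_contDiff)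

theorem radialBump_hasCompactSupport : HasCompactSupport (radialBump (d := d)) :=
  (isCompact_closedBall _ _).of_isClosed_subset (isClosed_tsupport _)
    (closure_minimal radialBump_support Metric.isClosed_closedBall)

theorem integral_radialBump_pos : 0 < ∫ y, radialBump (d := d) y := by
  refine radialBump_contDiff.continuous.integral_pos_of_hasCompactSupport_nonneg_nonzero
    radialBump_hasCompactSupport (fun z => Real.smoothTransition.nonneg _) (x := 0) ?_
  simp [radialBump, stQuad]

theorem radialKernel_isMollifier : IsMollifier (radialKernel (d := d)) 1 := by
  refine ⟨contDiff_const.mul radialBump_contDiff, fun z => mul_nonneg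
    (inv_nonneg.2 integral_radialBump_pos.le) (Real.smoothTransition.nonneg _), ?_, ?_⟩
  · unfold radialKernel
    rw [integral_const_mul, inv_mul_cancel₀ integral_radialBump_pos.ne']
  · refine closure_minimal (fun z hz => radialBump_support ?_) Metric.isClosed_closedBall
    exact right_ne_zero_of_mul hz

/-- The kernel depends on the Euclidean quadratic form alone, so its derivative at `z` is parallel
to `z`. Applied to the velocity increment along `z` it is a longitudinal increment, which only
involves the symmetric gradient. -/
theorem fderiv_radialKernel (z h : E d × ℝ) :
    fderiv ℝ radialKernel z h = radialSlope z * (⟪z.1, h.1⟫ + z.2 * h.2) := by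
  have h1 : HasFDerivAt (stQuad (d := d)) ((2 : ℝ) • ((innerSL ℝ z.1).comp
      (ContinuousLinearMap.fst ℝ (E d) ℝ)) + (2 * z.2) • ContinuousLinearMap.snd ℝ (E d) ℝ) z := by
    have a1 := (hasFDerivAt_fst (𝕜 := ℝ) (p := z)).inner ℝ (hasFDerivAt_fst (𝕜 := ℝ) (p := z))
    have a2 := (hasFDerivAt_snd (𝕜 := ℝ) (p := z)).mul (hasFDerivAt_snd (𝕜 := ℝ) (p := z))
    refine (a1.add a2).congr_fderiv ?_
    ext y
    · simp [real_inner_comm, two_mul]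
    · simp; ring
  have h2 : HasDerivAt Real.smoothTransition (deriv Real.smoothTransition (1 - stQuad z))
      (1 - stQuad z) :=
    ((Real.smoothTransition.contDiff (n := 1)).differentiable (by simp) _).hasDerivAt
  have h3 : HasFDerivAt (radialKernel (d := d)) _ z :=
    (h2.comp_hasFDerivAt z (h1.const_sub 1)).const_mul (∫ y, radialBump (d := d) y)⁻¹
  rw [h3.fderiv, radialSlope]
  simp
  ring

theorem radialSlope_continuous : Continuous (radialSlope (d := d)) := by
  unfold radialSlope
  have : Continuous (deriv Real.smoothTransition) :=
    (Real.smoothTransition.contDiff (n := 1)).continuous_deriv le_rfl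
  exact continuous_const.mul ((this.comp (continuous_const.sub stQuad_contDiff.continuous)).mul
    continuous_const)

theorem radialSlope_eq_zero {z : E d × ℝ} (hz : 1 < ‖z‖) : radialSlope z = 0 := by
  have h1 : 1 < stQuad z := not_le.1 fun h => by linarith [norm_le_one_of_stQuad h]
  have h2 : Real.smoothTransition =ᶠ[𝓝 (1 - stQuad z)] fun _ => 0 := by
    filter_upwards [Iio_mem_nhds (show 1 - stQuad z < 0 by linarith)] with s hs
    exact Real.smoothTransition.zero_of_nonpos hs.le
  rw [radialSlope, h2.deriv_eq]
  simp

theorem radialSlope_hasCompactSupport : HasCompactSupport (radialSlope (d := d)) :=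
  HasCompactSupport.intro (isCompact_closedBall 0 1) fun z hz => radialSlope_eq_zero (by
    simpa using hz)

/-- The contribution of the radial kernel to the constant. -/
noncomputable def radialConst (d : ℕ) : ℝ≥0∞ :=
  (∫⁻ z : E d × ℝ, ‖radialSlope z‖ₑ) * (d + 1) ^ 2

theorem radialConst_ne_top : radialConst d ≠ ⊤ := by
  have := (radialSlope_continuous (d := d)).integrable_of_hasCompactSupport (μ := volume)
    radialSlope_hasCompactSupport
  exact ENNReal.mul_ne_top this.2.ne (by finiteness)

namespace LocalSolution

variable {O : Set (E d × ℝ)} {c M : ℝ} {ρ p : E d × ℝ → ℝ} {v f : Fin d → E d × ℝ → ℝ}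
  (hS : LocalSolution O c M spaceDir (0, 1) ρ p v f) {φ : E d × ℝ → ℝ} (hφ : IsTestOn O φ)
  {G : Fin d → E d × ℝ → ℝ} (hGm : ∀ j, Measurable (G j)) (hG : ∀ j, Integrable (G j))
  {μ : Measure (E d × ℝ)} [IsFiniteMeasure μ] (hder : ∀ j, IsDerivUpTo O ρ (spaceDir j) (G j) μ)
include hS hφ hGm hG hder

/-- A common form for both deformation hypotheses: spatial fields with `B` the projection to space,
and space-time fields with `B` the identity. The function `t` depends on the displacement only; it
compensates the constant last component of `(u, 1)` and is invisible to derivatives in `z`. -/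
theorem enorm_energyDefect_le_of_isSymDerivUpTo {ι : Type*} [Fintype ι]
    (hι : Fintype.card ι ≤ d + 1) {dir : ι → E d × ℝ}
    {U : ι → E d × ℝ → ℝ} (hU : ∀ a, BddMeas (U a)) {S : ι → ι → E d × ℝ → ℝ}
    (hSm : ∀ a b, Measurable (S a b)) (hSi : ∀ a b, Integrable (S a b))
    {ν : Measure (E d × ℝ)} [IsFiniteMeasure ν] (hsym : IsSymDerivUpTo O dir U S ν)
    {x : ι → E d × ℝ → ℝ} (hx : ∀ a h, |x a h| ≤ ‖h‖) {B : (E d × ℝ) →L[ℝ] (E d × ℝ)}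
    (hB : ∀ h, B h = ∑ a, x a h • dir a) {t : E d × ℝ → ℝ}
    (hF : ∀ h z, ⟪h.1, (field spaceDir v z).1⟫ + h.2 * (field spaceDir v z).2
      = (∑ a, x a h * U a z) - t h)
    {A : ℕ → (E d × ℝ) ≃L[ℝ] (E d × ℝ)} {ε σ : ℕ → ℝ}
    (hA : Rescaling spaceDir v B 1 A ε σ) :
    ‖energyDefect spaceDir (0, 1) ρ p v f φ‖ₑ
      ≤ (chainConst d c M + kernelConst d c M) * ∫⁻ z, ‖φ z‖ₑ ∂μ
        + commConst d c M * radialConst d * ∫⁻ z, ‖φ z‖ₑ ∂ν := by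
  obtain ⟨Cg, hCg⟩ := radialSlope_hasCompactSupport.exists_bound_of_continuous
    (radialSlope_continuous (d := d))
  -- The radial profile vanishes for `‖h‖ > 1`, and elsewhere the coordinates of `h` are at most
  -- one.
  have hgx : ∀ h a b, ‖radialSlope h * x a h * x b h‖ₑ ≤ ‖radialSlope h‖ₑ := by
    intro h a b
    by_cases hh : ‖h‖ ≤ 1
    · have h1 : ∀ a, ‖x a h‖ₑ ≤ 1 := fun a => by
        rw [Real.enorm_eq_ofReal_abs]
        exact ENNReal.ofReal_le_one.2 ((hx a h).trans hh)
      rw [enorm_mul, enorm_mul]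
      calc _ ≤ ‖radialSlope h‖ₑ * 1 * 1 := mul_le_mul' (mul_le_mul' le_rfl (h1 a)) (h1 b)
        _ = _ := by ring
    · rw [radialSlope_eq_zero (not_le.1 hh)]; simp
  have hgx' : ∀ h a b, ‖radialSlope h * x a h * x b h‖ₑ ≤ ENNReal.ofReal Cg := fun h a b =>
    (hgx h a b).trans (by rw [← ofReal_norm]; exact ENNReal.ofReal_le_ofReal (hCg h))
  have hsum : ∀ h, (∑ a, ∑ b, ‖radialSlope h * x a h * x b h‖ₑ)
      ≤ ‖radialSlope h‖ₑ * (d + 1) ^ 2 := by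
    intro h
    calc _ ≤ ∑ a : ι, ∑ b : ι, ‖radialSlope h‖ₑ :=
          Finset.sum_le_sum fun a _ => Finset.sum_le_sum fun b _ => hgx h a b
      _ = ‖radialSlope h‖ₑ * (Fintype.card ι : ℝ≥0∞) ^ 2 := by
          simp only [Finset.sum_const, Finset.card_univ, nsmul_eq_mul]; ring
      _ ≤ _ := by
          gcongr
          exact_mod_cast hι
  have hk := radialKernel_isMollifier (d := d)
  have key := hS.enorm_energyDefect_le_of_kernel hk hφ hGm hG hder hA
    (b := fun h z => ∑ a, ∑ b, radialSlope h * x a h * x b h * S a b z)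
    (m := fun h => (∑ a, ∑ b, ‖radialSlope h * x a h * x b h‖ₑ) • ν)
    (Cb := ∑ a, ∑ b, ENNReal.ofReal Cg * ∫⁻ z, ‖S a b z‖ₑ)
    (Cm := (ENNReal.ofReal Cg * (d + 1) ^ 2) * ν univ)
    (fun h => Finset.measurable_fun_sum _ fun a _ => Finset.measurable_fun_sum _ fun b _ =>
      (hSm a b).const_mul _)
    (fun h => integrable_finsetSum _ fun a _ => integrable_finsetSum _ fun b _ =>
      (hSi a b).const_mul _)
    (fun h => by
      have := hsym.isDerivUpTo hU hSi (fun a => x a h) (radialSlope h) (radialSlope h * t h)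
      rw [← hB] at this
      convert this using 2 with z
      rw [fderiv_radialKernel, hF]; ring)
    (ENNReal.sum_ne_top.2 fun a _ => ENNReal.sum_ne_top.2 fun b _ =>
      ENNReal.mul_ne_top ENNReal.ofReal_ne_top (hSi a b).2.ne) (by finiteness)
    (fun h => by
      calc ∫⁻ z, ‖∑ a, ∑ b, radialSlope h * x a h * x b h * S a b z‖ₑ
          ≤ ∫⁻ z, ∑ a, ∑ b, ENNReal.ofReal Cg * ‖S a b z‖ₑ := by
            refine lintegral_mono fun z => (enorm_sum_le _ _).trans
              (Finset.sum_le_sum fun a _ => (enorm_sum_le _ _).trans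
              (Finset.sum_le_sum fun b _ => ?_))
            rw [enorm_mul]
            exact mul_le_mul' (hgx' h a b) le_rfl
        _ = _ := by
            rw [lintegral_finsetSum]
            · refine Finset.sum_congr rfl fun a _ => ?_
              rw [lintegral_finsetSum]
              · simp_rw [lintegral_const_mul' _ _ ENNReal.ofReal_ne_top]
              · intro b _; have := hSm a b; fun_prop
            · intro a _
              exact Finset.measurable_fun_sum _ fun b _ => by have := hSm a b; fun_prop)
    (fun h => by
      rw [Measure.smul_apply, smul_eq_mul]
      refine mul_le_mul' ((hsum h).trans (mul_le_mul' ?_ le_rfl)) le_rfl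
      rw [← ofReal_norm]; exact ENNReal.ofReal_le_ofReal (hCg h))
  refine key.trans (add_le_add le_rfl ?_)
  rw [mul_assoc]
  refine mul_le_mul' le_rfl ?_
  simp_rw [lintegral_smul_measure, smul_eq_mul]
  have hI : ∫⁻ z, ‖φ z‖ₑ ∂ν ≠ ⊤ :=
    (hφ.1.continuous.integrable_of_hasCompactSupport hφ.2.1 (μ := ν)).2.ne
  rw [lintegral_mul_const' _ _ hI]
  refine mul_le_mul' ?_ le_rfl
  rw [radialConst, ← lintegral_mul_const' _ _ (by finiteness)]
  exact lintegral_mono hsum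

end LocalSolution

end

section

/-! ### Kernels adapted to a trace free linear map -/

section Determinant

theorem contDiff_det {n : Type*} [Fintype n] [DecidableEq n] :
    ContDiff ℝ 1 fun A : n → n → ℝ => (Matrix.of A).det := by
  simp_rw [Matrix.det_apply]
  refine ContDiff.sum fun σ _ => ContDiff.const_smul _ (contDiff_prod fun i _ => ?_)
  simp only [Matrix.of_apply]
  fun_prop

/-- The derivative of the determinant at the identity is read off on the affine path, where the
determinant is a polynomial with linear coefficient the trace. The chain rule along the two tangent
paths then transfers it to `γ`. -/
theorem hasDerivAt_det_of_eq_one {n : Type*} [Fintype n] [DecidableEq n] {γ : ℝ → n → n → ℝ}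
    {M : n → n → ℝ} (h0 : Matrix.of (γ 0) = 1) (hγ : HasDerivAt γ M 0) :
    HasDerivAt (fun s => (Matrix.of (γ s)).det) (Matrix.of M).trace 0 := by
  have hd := ((contDiff_det (n := n)).differentiable one_ne_zero (γ 0)).hasFDerivAt
  have h1 := hd.comp_hasDerivAt (0 : ℝ) hγ
  have hγ2 : HasDerivAt (fun s : ℝ => γ 0 + s • M) M 0 := by
    simpa using ((hasDerivAt_id (0 : ℝ)).smul_const M).const_add (γ 0)
  have hd' : HasFDerivAt (fun A : n → n → ℝ => (Matrix.of A).det)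
      (fderiv ℝ (fun A : n → n → ℝ => (Matrix.of A).det) (γ 0)) (γ 0 + (0 : ℝ) • M) := by
    simpa using hd
  have h2 := hd'.comp_hasDerivAt (0 : ℝ) hγ2
  have h3 : HasDerivAt (fun s : ℝ => (Matrix.of (γ 0 + s • M)).det) (Matrix.of M).trace 0 := by
    have e : ∀ s : ℝ, (Matrix.of (γ 0 + s • M)).det = 1 + (Matrix.of M).trace * s
        + (Matrix.det (1 + (Polynomial.X : Polynomial ℝ) •
          (Matrix.of M).map Polynomial.C)).divX.divX.eval s * s ^ 2 := fun s => by
      rw [← Matrix.det_one_add_smul, ← h0]; rfl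
    simp_rw [e]
    have a1 := ((hasDerivAt_id (0 : ℝ)).const_mul (Matrix.of M).trace).const_add 1
    have a2 := ((Matrix.det (1 + (Polynomial.X : Polynomial ℝ) •
          (Matrix.of M).map Polynomial.C)).divX.divX.hasDerivAt (0 : ℝ)).fun_mul
            ((hasDerivAt_id (0 : ℝ)).fun_pow 2)
    exact (a1.fun_add a2).congr_deriv (by simp)
  rw [h3.unique h2]
  exact h1

variable {V : Type*} [NormedAddCommGroup V] [NormedSpace ℝ V] [FiniteDimensional ℝ V]

theorem exp_add_smul (L : V →L[ℝ] V) (s t : ℝ) :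
    NormedSpace.exp ((s + t) • L) = NormedSpace.exp (s • L) * NormedSpace.exp (t • L) := by
  let _ : NormedAlgebra ℚ (V →L[ℝ] V) := NormedAlgebra.restrictScalars ℚ ℝ (V →L[ℝ] V)
  rw [add_smul]
  exact NormedSpace.exp_add_of_commute (((Commute.refl L).smul_left s).smul_right t)

/-- Liouville's formula in the trace free case: the derivative at zero is the trace, and the group
property carries the vanishing derivative to every time. -/
theorem det_exp_smul {L : V →L[ℝ] V} (hL : LinearMap.trace ℝ V L.toLinearMap = 0) (s : ℝ) :
    (NormedSpace.exp (s • L)).det = 1 := by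
  let b := Module.finBasis ℝ V
  let n := Fin (Module.finrank ℝ V)
  -- the matrix of a continuous linear map
  let mat : (V →L[ℝ] V) →ₗ[ℝ] (n → n → ℝ) :=
    { toFun := fun A i j => LinearMap.toMatrix b b A.toLinearMap i j
      map_add' := fun A B => by ext i j; simp
      map_smul' := fun r A => by ext i j; simp }
  have hmat : ∀ A : V →L[ℝ] V, (Matrix.of (mat A)).det = A.det := fun A =>
    LinearMap.det_toMatrix b A.toLinearMap
  have hd0 : HasDerivAt (fun s : ℝ => (NormedSpace.exp (s • L)).det) 0 0 := by
    have h1 : HasDerivAt (fun s : ℝ => mat (NormedSpace.exp (s • L))) (mat L) 0 := by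
      have := hasDerivAt_exp_smul_const (𝕂 := ℝ) L 0
      rw [zero_smul, NormedSpace.exp_zero, one_mul] at this
      exact (LinearMap.toContinuousLinearMap mat).hasFDerivAt.comp_hasDerivAt (0 : ℝ) this
    have h2 := hasDerivAt_det_of_eq_one (by
      rw [zero_smul, NormedSpace.exp_zero]
      exact LinearMap.toMatrix_one b) h1
    simp_rw [hmat] at h2
    convert h2 using 1
    rw [← hL, LinearMap.trace_eq_matrix_trace ℝ b]
    rfl
  have hd : ∀ t : ℝ, HasDerivAt (fun s : ℝ => (NormedSpace.exp (s • L)).det) 0 t := by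
    intro t
    have e : ∀ s : ℝ, (NormedSpace.exp (s • L)).det
        = (NormedSpace.exp (t • L)).det * (NormedSpace.exp ((s - t) • L)).det := by
      intro s
      conv_lhs => rw [show s = t + (s - t) by ring, exp_add_smul]
      exact LinearMap.det_comp _ _
    have h1 : HasDerivAt (fun s : ℝ => (NormedSpace.exp ((s - t) • L)).det) 0 t := by
      have h3 : HasDerivAt (fun s : ℝ => (NormedSpace.exp (s • L)).det) 0 (t - t) := by
        rwa [sub_self]
      simpa using h3.comp_sub_const t t
    have h2 := h1.const_mul (NormedSpace.exp (t • L)).det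
    rw [mul_zero] at h2
    simpa only [← e] using h2
  have := is_const_of_deriv_eq_zero (fun t => (hd t).differentiableAt) (fun t => (hd t).deriv) s 0
  simp only [zero_smul, NormedSpace.exp_zero] at this
  rw [this]
  exact LinearMap.det_id

theorem contDiff_exp_smul_apply (L : V →L[ℝ] V) :
    ContDiff ℝ ∞ fun q : ℝ × V => NormedSpace.exp (q.1 • L) q.2 := by
  have h1 : ContDiff ℝ ∞ (NormedSpace.exp : (V →L[ℝ] V) → V →L[ℝ] V) :=
    contDiff_iff_contDiffAt.2 fun x => (NormedSpace.exp_analytic (𝕂 := ℝ) x).contDiffAt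
  exact (h1.comp (contDiff_fst.smul contDiff_const)).clm_apply contDiff_snd

end Determinant

variable {V : Type*} [NormedAddCommGroup V] [NormedSpace ℝ V] [FiniteDimensional ℝ V]
  [MeasureSpace V] [BorelSpace V] [(volume : Measure V).IsAddHaarMeasure]

theorem measurePreserving_exp_smul {L : V →L[ℝ] V} (hL : LinearMap.trace ℝ V L.toLinearMap = 0)
    (s : ℝ) : MeasurePreserving (NormedSpace.exp (s • L) : V →L[ℝ] V) (volume : Measure V) volume := by
  have hdet : LinearMap.det (NormedSpace.exp (s • L)).toLinearMap = 1 := det_exp_smul hL s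
  refine ⟨(NormedSpace.exp (s • L)).continuous.measurable, ?_⟩
  have := Measure.map_linearMap_addHaar_eq_smul_addHaar (volume : Measure V)
    (f := (NormedSpace.exp (s • L)).toLinearMap) (by rw [hdet]; exact one_ne_zero)
  rw [hdet] at this
  simpa using this

theorem exp_smul_apply_exp_neg (L : V →L[ℝ] V) (s : ℝ) (x : V) :
    NormedSpace.exp (s • L) (NormedSpace.exp ((-s) • L) x) = x := by
  have := exp_add_smul L s (-s)
  rw [add_neg_cancel, zero_smul, NormedSpace.exp_zero] at this
  exact (congrArg (fun A : V →L[ℝ] V => A x) this).symm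

/-- The average of a kernel along the flow of a linear map. -/
noncomputable def flowAverage (L : V →L[ℝ] V) (T : ℝ) (η : V → ℝ) (x : V) : ℝ :=
  T⁻¹ * ∫ s in (0 : ℝ)..T, η (NormedSpace.exp ((-s) • L) x)

section
variable {L : V →L[ℝ] V} {η : V → ℝ} {R T : ℝ} (hη : IsMollifier η R) (hT : 0 < T)
include hη hT

/-- The integral over `(0, T]` is the value at zero of the convolution of an indicator with `s ↦ χ s
* η (exp (s L) x)`, so smoothness in `x` follows from smoothness of convolutions with parameters.
The cutoff `χ` is one on `[-T, T]` and only serves to make the second factor compactly supported. -/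
theorem flowAverage_contDiff : ContDiff ℝ ∞ (flowAverage L T η) := by
  let χ : ContDiffBump (0 : ℝ) := ⟨T, T + 1, hT, by linarith⟩
  let g : V → ℝ → ℝ := fun x s => χ s * η (NormedSpace.exp (s • L) x)
  have hg : ContDiff ℝ ∞ (↿g : V × ℝ → ℝ) := by
    have h1 : ContDiff ℝ ∞ fun q : V × ℝ => η (NormedSpace.exp (q.2 • L) q.1) :=
      hη.contDiff.comp ((contDiff_exp_smul_apply L).comp (contDiff_snd.prodMk contDiff_fst))
    exact (χ.contDiff.comp contDiff_snd).mul h1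
  have hf : LocallyIntegrable (indicator (Ioc 0 T) fun _ : ℝ => (1 : ℝ)) volume := by
    refine Integrable.locallyIntegrable ?_
    rw [integrable_indicator_iff measurableSet_Ioc]
    exact integrableOn_const (by simp)
  have h := contDiffOn_convolution_right_with_param (𝕜 := ℝ) (n := ⊤) (μ := (volume : Measure ℝ))
    (f := indicator (Ioc 0 T) fun _ : ℝ => (1 : ℝ)) (ContinuousLinearMap.mul ℝ ℝ) (g := g)
    (s := univ) (k := Metric.closedBall 0 (T + 1)) isOpen_univ (isCompact_closedBall _ _)
    (fun x s _ hs => by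
      have : χ s = 0 := by
        by_contra h0
        have h1 : s ∈ Function.support χ := h0
        rw [χ.support_eq] at h1
        exact hs (Metric.ball_subset_closedBall h1)
      simp [g, this]) hf (by exact hg.contDiffOn)
  rw [univ_prod_univ, contDiffOn_univ] at h
  have h2 : ContDiff ℝ ∞ fun x : V => T⁻¹ * convolution (indicator (Ioc 0 T) fun _ : ℝ => (1 : ℝ))
      (g x) (ContinuousLinearMap.mul ℝ ℝ) volume 0 :=
    contDiff_const.mul (h.comp (contDiff_id.prodMk contDiff_const))
  convert h2 using 1
  ext x
  rw [flowAverage, convolution_def, intervalIntegral.integral_of_le hT.le,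
    ← integral_indicator measurableSet_Ioc]
  congr 2; ext s
  by_cases hs : s ∈ Ioc 0 T
  · have : χ (-s) = 1 := χ.one_of_mem_closedBall (by
      rw [mem_closedBall_zero_iff, norm_neg, Real.norm_of_nonneg hs.1.le]; exact hs.2)
    simp [indicator_of_mem hs, g, this]
  · simp [indicator_of_notMem hs]

/-- Differentiating along `L x` means moving with the flow, which merely shifts the window of
averaging; only the two end points contribute. -/
theorem flowAverage_fderiv (x : V) : fderiv ℝ (flowAverage L T η) x (L x)
    = T⁻¹ * (η x - η (NormedSpace.exp ((-T) • L) x)) := by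
  have hsm := flowAverage_contDiff (L := L) hη hT
  have h1 : HasDerivAt (fun r : ℝ => NormedSpace.exp (r • L) x) (L x) 0 := by
    have h2 := hasDerivAt_exp_smul_const (𝕂 := ℝ) L 0
    rw [zero_smul, NormedSpace.exp_zero, one_mul] at h2
    exact (ContinuousLinearMap.apply ℝ V x).hasFDerivAt.comp_hasDerivAt (0 : ℝ) h2
  have h2 : HasDerivAt (fun r : ℝ => flowAverage L T η (NormedSpace.exp (r • L) x))
      (fderiv ℝ (flowAverage L T η) x (L x)) 0 := by
    have h3 : HasFDerivAt (flowAverage L T η) (fderiv ℝ (flowAverage L T η) x)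
        (NormedSpace.exp ((0 : ℝ) • L) x) := by
      rw [zero_smul, NormedSpace.exp_zero]
      exact (hsm.differentiable (by simp) x).hasFDerivAt
    exact h3.comp_hasDerivAt (0 : ℝ) h1
  set q : ℝ → ℝ := fun u => η (NormedSpace.exp (u • L) x) with hq
  have hqc : Continuous q := hη.continuous.comp
    ((contDiff_exp_smul_apply L).continuous.comp (by fun_prop : Continuous fun u : ℝ => (u, x)))
  have h4 : ∀ r : ℝ, flowAverage L T η (NormedSpace.exp (r • L) x)
      = T⁻¹ * ((∫ u in (0 : ℝ)..r, q u) - ∫ u in (0 : ℝ)..(r - T), q u) := by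
    intro r
    rw [flowAverage, intervalIntegral.integral_interval_sub_left (hqc.intervalIntegrable _ _)
      (hqc.intervalIntegrable _ _)]
    have h5 : ∀ s : ℝ, NormedSpace.exp ((-s) • L) (NormedSpace.exp (r • L) x)
        = NormedSpace.exp ((r - s) • L) x := fun s => by
      rw [show r - s = -s + r by ring, exp_add_smul]; rfl
    simp_rw [h5]
    have := intervalIntegral.integral_comp_sub_left (a := 0) (b := T) q r
    rw [sub_zero] at this
    rw [← this]
  have h6 : HasDerivAt (fun r : ℝ => flowAverage L T η (NormedSpace.exp (r • L) x))
      (T⁻¹ * (q 0 - q (0 - T))) 0 := by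
    simp_rw [h4]
    have a1 := hqc.integral_hasStrictDerivAt 0 0 |>.hasDerivAt
    have a2 := (hqc.integral_hasStrictDerivAt 0 (0 - T)).hasDerivAt.comp_sub_const (0 : ℝ) T
    exact (a1.sub a2).const_mul _
  rw [h2.unique h6]
  simp [hq]

/-- The flow of a trace free map preserves volume, so by Fubini the average still has integral one.
The support stays bounded because the exponentials are bounded on `[0, T]`. -/
theorem flowAverage_isMollifier (hL : LinearMap.trace ℝ V L.toLinearMap = 0) :
    ∃ R', IsMollifier (flowAverage L T η) R' := by
  have hc : Continuous fun q : ℝ × V => η (NormedSpace.exp ((-q.1) • L) q.2) :=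
    hη.continuous.comp ((contDiff_exp_smul_apply L).continuous.comp
      (by fun_prop : Continuous fun q : ℝ × V => (-q.1, q.2)))
  obtain ⟨N, hN⟩ : ∃ N, ∀ s ∈ Icc 0 T, ‖NormedSpace.exp (s • L)‖ ≤ N := by
    refine (isCompact_Icc (a := (0 : ℝ)) (b := T)).exists_bound_of_continuousOn
      (Continuous.continuousOn ?_)
    exact continuous_iff_continuousAt.2 fun s =>
      (hasDerivAt_exp_smul_const (𝕂 := ℝ) L s).continuousAt
  have hN0 : 0 ≤ N := (norm_nonneg _).trans (hN 0 ⟨le_rfl, hT.le⟩)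
  refine ⟨N * R, flowAverage_contDiff hη hT, fun x => mul_nonneg (inv_nonneg.2 hT.le)
    (intervalIntegral.integral_nonneg hT.le fun s _ => hη.nonneg _), ?_, ?_⟩
  · unfold flowAverage
    have hmp := fun s : ℝ => measurePreserving_exp_smul hL (-s)
    have he : ∀ s : ℝ, MeasurableEmbedding (NormedSpace.exp ((-s) • L) : V →L[ℝ] V) := fun s => by
      refine (NormedSpace.exp ((-s) • L)).continuous.measurableEmbedding fun x y hxy => ?_
      have := exp_smul_apply_exp_neg L s x
      rw [hxy, exp_smul_apply_exp_neg L s y] at this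
      exact this.symm
    have h1 : ∀ s : ℝ, ∫ x, η (NormedSpace.exp ((-s) • L) x) = 1 := fun s => by
      rw [(hmp s).integral_comp (he s), hη.integral_eq_one]
    rw [integral_const_mul]
    simp_rw [intervalIntegral.integral_of_le hT.le]
    rw [integral_integral_swap]
    · simp_rw [h1]
      simp [hT.le, hT.ne']
    · have h2 : Integrable (fun q : ℝ × V => η (NormedSpace.exp ((-q.1) • L) q.2))
          ((volume.restrict (Ioc 0 T)).prod volume) := by
        rw [integrable_prod_iff hc.aestronglyMeasurable]
        refine ⟨ae_of_all _ fun s => (hmp s).integrable_comp_of_integrable hη.integrable, ?_⟩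
        simp_rw [Real.norm_of_nonneg (hη.nonneg _), h1]
        exact integrable_const _
      exact h2.swap
  · refine closure_minimal (fun x hx => ?_) Metric.isClosed_closedBall
    rw [mem_closedBall_zero_iff]
    by_contra hlt
    refine hx ?_
    rw [flowAverage, intervalIntegral.integral_congr (g := fun _ => 0)]
    · simp
    · intro s hs
      rw [uIcc_of_le hT.le] at hs
      refine hη.eq_zero (not_le.1 fun hle => hlt ?_)
      calc ‖x‖ = ‖NormedSpace.exp (s • L) (NormedSpace.exp ((-s) • L) x)‖ := by
            rw [exp_smul_apply_exp_neg]
        _ ≤ ‖NormedSpace.exp (s • L)‖ * ‖NormedSpace.exp ((-s) • L) x‖ :=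
            ContinuousLinearMap.le_opNorm _ _
        _ ≤ N * R := mul_le_mul (hN s hs) hle (norm_nonneg _) hN0

end

/-- For a trace free linear map there are kernels that are almost invariant under its flow. -/
theorem exists_isMollifier_lintegral_lt {L : V →L[ℝ] V}
    (hL : LinearMap.trace ℝ V L.toLinearMap = 0) {δ : ℝ≥0∞} (hδ : 0 < δ) :
    ∃ η R, IsMollifier η R ∧ ∫⁻ x, ‖fderiv ℝ η x (L x)‖ₑ < δ := by
  obtain ⟨η, hη⟩ := exists_isMollifier (Z := V) one_pos
  -- Averaging over time `n + 1` leaves two end point terms of total `L¹` norm at most `2 / (n +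
  -- 1)`, which is below `δ` once `n δ > 2`.
  obtain ⟨n, hn⟩ := ENNReal.exists_nat_mul_gt hδ.ne' (b := 2) (by simp)
  have hn0 : (0 : ℝ) < n + 1 := by positivity
  obtain ⟨R, hR⟩ := flowAverage_isMollifier hη hn0 hL
  refine ⟨_, R, hR, ?_⟩
  simp_rw [flowAverage_fderiv hη hn0]
  have h1 : ∫⁻ x, ‖((n : ℝ) + 1)⁻¹ * (η x - η (NormedSpace.exp ((-((n : ℝ) + 1)) • L) x))‖ₑ
      ≤ ENNReal.ofReal ((n : ℝ) + 1)⁻¹ * 2 := by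
    calc _ ≤ ∫⁻ x, ENNReal.ofReal ((n : ℝ) + 1)⁻¹ *
          (‖η x‖ₑ + ‖η (NormedSpace.exp ((-((n : ℝ) + 1)) • L) x)‖ₑ) := by
          refine lintegral_mono fun x => ?_
          beta_reduce
          rw [enorm_mul, Real.enorm_of_nonneg (inv_nonneg.2 hn0.le)]
          exact mul_le_mul' le_rfl enorm_sub_le
      _ = _ := by
          have hm := hη.continuous.measurable
          have h2 := (measurePreserving_exp_smul hL (-((n : ℝ) + 1))).lintegral_comp hm.enorm
          rw [lintegral_const_mul' _ _ ENNReal.ofReal_ne_top, lintegral_add_left hm.enorm, h2,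
            hη.lintegral_eq_one, one_add_one_eq_two]
  refine h1.trans_lt ?_
  rw [ENNReal.ofReal_inv_of_pos hn0, mul_comm, ← div_eq_mul_inv]
  refine ENNReal.div_lt_of_lt_mul ?_
  refine hn.trans_le ?_
  rw [mul_comm]
  gcongr
  rw [ENNReal.le_ofReal_iff_toReal_le (by simp) hn0.le]
  simp

end

/-! ### Comparison of measures by test functions -/

section Comparison

variable {Z : Type*} [NormedAddCommGroup Z] [NormedSpace ℝ Z] [FiniteDimensional ℝ Z]
  [MeasurableSpace Z] [BorelSpace Z]

theorem IsTestOn.add {O : Set Z} {φ ψ : Z → ℝ} (hφ : IsTestOn O φ) (hψ : IsTestOn O ψ) :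
    IsTestOn O (φ + ψ) :=
  ⟨hφ.1.add hψ.1, hφ.2.1.add hψ.2.1, (tsupport_add φ ψ).trans (union_subset hφ.2.2 hψ.2.2)⟩

theorem IsTestOn.smul {O : Set Z} {φ : Z → ℝ} (hφ : IsTestOn O φ) (a : ℝ) :
    IsTestOn O (a • φ) :=
  ⟨hφ.1.const_smul a, hφ.2.1.comp_left (g := fun x => a * x) (by simp),
    (closure_mono (Function.support_const_smul_subset a φ)).trans hφ.2.2⟩

theorem IsTestOn.exists_le {O : Set Z} {φ : Z → ℝ} (hφ : IsTestOn O φ) : ∃ C, ∀ z, |φ z| ≤ C :=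
  hφ.2.1.exists_bound_of_continuous hφ.1.continuous

theorem IsTestOn.integrable_measure {O : Set Z} {φ : Z → ℝ} (hφ : IsTestOn O φ) (μ : Measure Z)
    [IsFiniteMeasure μ] : Integrable φ μ :=
  hφ.1.continuous.integrable_of_hasCompactSupport hφ.2.1

theorem enorm_le_lintegral_iff {μ : Measure Z} {φ : Z → ℝ} (hφ : Integrable φ μ) (a : ℝ) :
    ‖a‖ₑ ≤ ∫⁻ z, ‖φ z‖ₑ ∂μ ↔ |a| ≤ ∫ z, |φ z| ∂μ := by
  have h := ofReal_integral_norm_eq_lintegral_enorm hφ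
  simp only [Real.norm_eq_abs] at h
  rw [← h, Real.enorm_eq_ofReal_abs, ENNReal.ofReal_le_ofReal_iff
    (integral_nonneg fun _ => abs_nonneg _)]

/-- A linear functional on test functions that is controlled by a finite measure has a bounded
density with respect to it. -/
theorem exists_density_of_isTestOn {O : Set Z} {μ : Measure Z} [IsFiniteMeasure μ]
    {L : (Z → ℝ) → ℝ} (hadd : ∀ φ ψ, IsTestOn O φ → IsTestOn O ψ → L (φ + ψ) = L φ + L ψ)
    (hsmul : ∀ (a : ℝ) φ, IsTestOn O φ → L (a • φ) = a * L φ)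
    (hL : ∀ φ, IsTestOn O φ → ‖L φ‖ₑ ≤ ∫⁻ z, ‖φ z‖ₑ ∂μ) :
    ∃ θ : Z → ℝ, Measurable θ ∧ (∀ z, |θ z| ≤ 1) ∧ ∀ φ, IsTestOn O φ → L φ = ∫ z, φ z * θ z ∂μ :=
  exists_density_of_abs_le μ (IsTestOn O) L (fun φ ψ h1 h2 => ⟨h1.add h2, hadd φ ψ h1 h2⟩)
    (fun a φ h => ⟨h.smul a, hsmul a φ h⟩) (fun _ h => h.1.continuous.measurable)
    (fun _ h => h.exists_le) fun φ h =>
      (enorm_le_lintegral_iff (h.integrable_measure μ) _).1 (hL φ h)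

/-- The estimate on test functions gives a bounded density of the same functional with respect to
`σ`. Expressed through `κ + σ` the two representations coincide almost everywhere on `O`, since test
functions determine integrable functions there; so the domination holds on every Borel subset of
`O`. -/
theorem setLIntegral_enorm_le_of_isTestOn {O : Set Z} (hO : IsOpen O) {κ σ : Measure Z}
    [IsFiniteMeasure κ] [IsFiniteMeasure σ] {θ : Z → ℝ} (hθm : Measurable θ)
    (hθ : ∀ z, |θ z| ≤ 1)
    (h : ∀ φ, IsTestOn O φ → ‖∫ z, φ z * θ z ∂κ‖ₑ ≤ ∫⁻ z, ‖φ z‖ₑ ∂σ) {A : Set Z}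
    (hA : MeasurableSet A) (hAO : A ⊆ O) : ∫⁻ z in A, ‖θ z‖ₑ ∂κ ≤ σ A := by
  have hint : ∀ (μ : Measure Z) [IsFiniteMeasure μ] φ θ, IsTestOn O φ →
      Measurable θ → (∀ z, |θ z| ≤ 1) → Integrable (fun z => φ z * θ z) μ :=
    fun μ _ φ θ hφ hm hb => (hφ.integrable_measure μ).mul_bdd (c := 1) hm.aestronglyMeasurable
      (ae_of_all _ hb)
  obtain ⟨θ', hθ'm, hθ', hrep⟩ := exists_density_of_isTestOn (O := O) (μ := σ)
    (L := fun φ => ∫ z, φ z * θ z ∂κ) (fun φ ψ h1 h2 => by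
      rw [← integral_add (hint κ φ θ h1 hθm hθ) (hint κ ψ θ h2 hθm hθ)]
      simp only [Pi.add_apply, add_mul]) (fun a φ h1 => by
      rw [← integral_const_mul]
      simp only [Pi.smul_apply, smul_eq_mul, mul_assoc]) h
  set m := κ + σ with hm
  have hκ : κ ≪ m := by
    refine Measure.absolutelyContinuous_of_le (Measure.le_add_right le_rfl)
  have hσ : σ ≪ m := by
    refine Measure.absolutelyContinuous_of_le (Measure.le_add_left le_rfl)
  set a : Z → ℝ := fun z => (κ.rnDeriv m z).toReal with ha
  set s : Z → ℝ := fun z => (σ.rnDeriv m z).toReal with hs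
  have hai : Integrable a m := Measure.integrable_toReal_rnDeriv
  have hsi : Integrable s m := Measure.integrable_toReal_rnDeriv
  have hgi : Integrable (fun z => a z * θ z - s z * θ' z) m :=
    (hai.mul_bdd (c := 1) hθm.aestronglyMeasurable (ae_of_all _ hθ)).sub
      (hsi.mul_bdd (c := 1) hθ'm.aestronglyMeasurable (ae_of_all _ hθ'))
  have hzero : ∀ᵐ z ∂m, z ∈ O → a z * θ z - s z * θ' z = 0 := by
    refine hO.ae_eq_zero_of_integral_contDiff_smul_eq_zero (hgi.locallyIntegrable.locallyIntegrableOn O)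
      fun φ h1 h2 h3 => ?_
    have hφ : IsTestOn O φ := ⟨h1, h2, h3⟩
    obtain ⟨C, hC⟩ := hφ.exists_le
    have hφb : ∀ {f : Z → ℝ}, Integrable f m → Integrable (fun z => φ z * f z) m := fun hf =>
      hf.bdd_mul (c := C) hφ.1.continuous.measurable.aestronglyMeasurable (ae_of_all _ hC)
    have e1 := integral_rnDeriv_smul (f := fun z => φ z * θ z) hκ
    have e2 := integral_rnDeriv_smul (f := fun z => φ z * θ' z) hσ
    simp only [smul_eq_mul] at e1 e2 ⊢
    simp_rw [mul_sub]
    rw [integral_sub (hφb (hai.mul_bdd (c := 1) hθm.aestronglyMeasurable (ae_of_all _ hθ)))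
      (hφb (hsi.mul_bdd (c := 1) hθ'm.aestronglyMeasurable (ae_of_all _ hθ')))]
    have e3 : ∫ z, φ z * (a z * θ z) ∂m = ∫ z, φ z * θ z ∂κ := by
      rw [← e1]; congr 1; ext z; simp only [ha]; ring
    have e4 : ∫ z, φ z * (s z * θ' z) ∂m = ∫ z, φ z * θ' z ∂σ := by
      rw [← e2]; congr 1; ext z; simp only [hs]; ring
    rw [e3, e4, hrep φ hφ, sub_self]
  have hκd : m.withDensity (κ.rnDeriv m) = κ := Measure.withDensity_rnDeriv_eq κ m hκ
  have hσd : m.withDensity (σ.rnDeriv m) = σ := Measure.withDensity_rnDeriv_eq σ m hσ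
  have hlt1 : ∀ᵐ z ∂m, κ.rnDeriv m z < ⊤ := Measure.rnDeriv_lt_top κ m
  have hlt2 : ∀ᵐ z ∂m, σ.rnDeriv m z < ⊤ := Measure.rnDeriv_lt_top σ m
  calc ∫⁻ z in A, ‖θ z‖ₑ ∂κ = ∫⁻ z in A, κ.rnDeriv m z * ‖θ z‖ₑ ∂m := by
        conv_lhs => rw [← hκd]
        rw [setLIntegral_withDensity_eq_setLIntegral_mul _ (Measure.measurable_rnDeriv κ m)
          hθm.enorm hA]
        rfl
    _ ≤ ∫⁻ z in A, σ.rnDeriv m z ∂m := by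
        refine lintegral_mono_ae ?_
        refine (ae_restrict_iff' hA).2 ?_
        filter_upwards [hzero, hlt1, hlt2] with z h1 h2 h3 hzA
        have h4 : a z * θ z = s z * θ' z := sub_eq_zero.1 (h1 (hAO hzA))
        have h5 : κ.rnDeriv m z = ‖a z‖ₑ := by
          rw [ha, Real.enorm_of_nonneg ENNReal.toReal_nonneg, ENNReal.ofReal_toReal h2.ne]
        have h6 : σ.rnDeriv m z = ‖s z‖ₑ := by
          rw [hs, Real.enorm_of_nonneg ENNReal.toReal_nonneg, ENNReal.ofReal_toReal h3.ne]
        rw [h5, h6, ← enorm_mul, h4, enorm_mul]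
        calc ‖s z‖ₑ * ‖θ' z‖ₑ ≤ ‖s z‖ₑ * 1 := by
              gcongr
              rw [Real.enorm_eq_ofReal_abs]; exact ENNReal.ofReal_le_one.2 (hθ' z)
          _ = _ := mul_one _
    _ = σ A := by
        conv_rhs => rw [← hσd]
        rw [withDensity_apply _ hA]

end Comparison

section

/-! ### Combining estimates with different kernels at different points -/

section Optimization

variable {Z : Type*} [NormedAddCommGroup Z] [NormedSpace ℝ Z] [FiniteDimensional ℝ Z]
  [MeasurableSpace Z] [BorelSpace Z]

theorem IsTestOn.eq_zero {O : Set Z} {φ : Z → ℝ} (hφ : IsTestOn O φ) {z : Z} (hz : z ∉ O) :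
    φ z = 0 := image_eq_zero_of_notMem_tsupport fun h => hz (hφ.2.2 h)

theorem IsTestOn.lintegral_restrict {O : Set Z} (hO : MeasurableSet O) {φ : Z → ℝ}
    (hφ : IsTestOn O φ) (μ : Measure Z) : ∫⁻ z in O, ‖φ z‖ₑ ∂μ = ∫⁻ z, ‖φ z‖ₑ ∂μ := by
  rw [← lintegral_indicator hO]
  refine lintegral_congr fun z => ?_
  by_cases hz : z ∈ O
  · rw [indicator_of_mem hz]
  · rw [indicator_of_notMem hz, hφ.eq_zero hz, enorm_zero]

/-- If a functional is controlled by `μ` and any of the densities `w` in a family that contains,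
locally, arbitrarily small ones, it is controlled by `μ`. -/
theorem enorm_le_of_forall_density {O : Set Z} (hO : IsOpen O) {μ ν : Measure Z}
    [IsFiniteMeasure μ] [IsFiniteMeasure ν]
    {L : (Z → ℝ) → ℝ} (hadd : ∀ φ ψ, IsTestOn O φ → IsTestOn O ψ → L (φ + ψ) = L φ + L ψ)
    (hsmul : ∀ (a : ℝ) φ, IsTestOn O φ → L (a • φ) = a * L φ) {W : Set (Z → ℝ≥0∞)}
    (hWm : ∀ w ∈ W, Measurable w) (hWb : ∀ w ∈ W, ∫⁻ z, w z ∂ν ≠ ⊤)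
    (hL : ∀ w ∈ W, ∀ φ, IsTestOn O φ → ‖L φ‖ₑ ≤ ∫⁻ z, ‖φ z‖ₑ ∂μ + ∫⁻ z, ‖φ z‖ₑ * w z ∂ν)
    (hW : ∀ ε : ℝ≥0∞, 0 < ε → ∃ w : ℕ → Z → ℝ≥0∞, (∀ n, w n ∈ W) ∧ ∀ z, ∃ n, w n z < ε)
    {φ : Z → ℝ} (hφ : IsTestOn O φ) : ‖L φ‖ₑ ≤ ∫⁻ z, ‖φ z‖ₑ ∂μ := by
  set s : (Z → ℝ≥0∞) → Measure Z := fun w => μ + ν.withDensity w with hs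
  have hfin : ∀ w ∈ W, IsFiniteMeasure (s w) := fun w hw => by
    have := isFiniteMeasure_withDensity (hWb w hw)
    infer_instance
  have hLs : ∀ w ∈ W, ∀ φ, IsTestOn O φ → ‖L φ‖ₑ ≤ ∫⁻ z, ‖φ z‖ₑ ∂(s w) := fun w hw φ hφ => by
    rw [hs, lintegral_add_measure, lintegral_withDensity_eq_lintegral_mul _ (hWm w hw)
      hφ.1.continuous.measurable.enorm]
    simpa only [Pi.mul_apply, mul_comm] using hL w hw φ hφ
  obtain ⟨w₀, hw₀⟩ : ∃ w, w ∈ W := by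
    obtain ⟨w, h, -⟩ := hW 1 one_pos
    exact ⟨w 0, h 0⟩
  have := hfin w₀ hw₀
  obtain ⟨θ, hθm, hθ, hrep⟩ := exists_density_of_isTestOn hadd hsmul (hLs w₀ hw₀)
  set m := (s w₀).withDensity fun z => ‖θ z‖ₑ with hm
  -- The measure `m` is the variation of the functional. It is one measure, dominated by `μ` plus
  -- `w` times `ν` for every `w` of the family, so a different `w` may be used on each Borel piece.
  have hle : ∀ ε : ℝ≥0∞, 0 < ε → m.restrict O ≤ μ + ε • ν := by
    intro ε hε
    obtain ⟨w, hwW, hw⟩ := hW ε hε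
    refine Measure.le_iff.2 fun B hB => ?_
    rw [Measure.restrict_apply hB]
    -- Disjoint pieces that cover the space, with one density of the family below `ε` on each.
    set D : ℕ → Set Z := disjointed fun n => {z | w n z < ε} with hD
    have hDm : ∀ n, MeasurableSet (D n) := fun n => MeasurableSet.disjointed
      (fun n => measurableSet_lt (hWm _ (hwW n)) measurable_const) n
    have hDu : ⋃ n, D n = univ := by
      rw [hD, iUnion_disjointed]
      exact eq_univ_of_forall fun z => mem_iUnion.2 (hw z)
    have hdis : Pairwise (Function.onFun Disjoint D) := disjoint_disjointed _
    have hsum : ∀ κ : Measure Z, ∑' n, κ (B ∩ O ∩ D n) = κ (B ∩ O) := fun κ => by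
      rw [← measure_iUnion (fun i j hij => (hdis hij).mono inter_subset_right inter_subset_right)
        fun n => (hB.inter hO.measurableSet).inter (hDm n), ← inter_iUnion, hDu, inter_univ]
    rw [← hsum m]
    calc ∑' n, m (B ∩ O ∩ D n) ≤ ∑' n, (μ + ε • ν) (B ∩ O ∩ D n) := by
          refine ENNReal.tsum_le_tsum fun n => ?_
          have hAm := (hB.inter hO.measurableSet).inter (hDm n)
          have := hfin _ (hwW n)
          rw [hm, withDensity_apply _ hAm]
          refine (setLIntegral_enorm_le_of_isTestOn hO hθm hθ (σ := s (w n)) (fun φ hφ => ?_) hAm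
            (inter_subset_left.trans inter_subset_right)).trans ?_
          · rw [← hrep φ hφ]; exact hLs _ (hwW n) φ hφ
          · rw [hs, Measure.add_apply, Measure.add_apply, withDensity_apply _ hAm]
            refine add_le_add le_rfl ?_
            rw [Measure.smul_apply, smul_eq_mul, ← setLIntegral_const]
            refine setLIntegral_mono measurable_const fun z hz => ?_
            exact (disjointed_subset (fun n => {z | w n z < ε}) n hz.2 : w n z < ε).le
      _ = (μ + ε • ν) (B ∩ O) := hsum _
      _ ≤ _ := measure_mono inter_subset_left
  have hφm := hφ.1.continuous.measurable
  have h1 : ‖L φ‖ₑ ≤ ∫⁻ z, ‖φ z‖ₑ ∂m := by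
    rw [hrep φ hφ]
    refine (enorm_integral_le_lintegral_enorm _).trans (le_of_eq ?_)
    rw [hm, lintegral_withDensity_eq_lintegral_mul _ hθm.enorm hφm.enorm]
    simp [enorm_mul, mul_comm]
  have h2 : ∀ ε : ℝ≥0∞, 0 < ε → ‖L φ‖ₑ ≤ ∫⁻ z, ‖φ z‖ₑ ∂μ + ε * ∫⁻ z, ‖φ z‖ₑ ∂ν := by
    intro ε hε
    refine h1.trans ?_
    rw [← hφ.lintegral_restrict hO.measurableSet m]
    refine (lintegral_mono' (hle ε hε) le_rfl).trans (le_of_eq ?_)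
    rw [lintegral_add_measure, lintegral_smul_measure, smul_eq_mul]
  have h3 : Tendsto (fun ε : ℝ≥0∞ => ∫⁻ z, ‖φ z‖ₑ ∂μ + ε * ∫⁻ z, ‖φ z‖ₑ ∂ν) (𝓝[>] 0)
      (𝓝 (∫⁻ z, ‖φ z‖ₑ ∂μ + 0 * ∫⁻ z, ‖φ z‖ₑ ∂ν)) :=
    (tendsto_const_nhds.add (ENNReal.Tendsto.mul_const tendsto_id
      (Or.inr (hφ.integrable_measure ν).2.ne))).mono_left nhdsWithin_le_nhds
  rw [zero_mul, add_zero] at h3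
  exact ge_of_tendsto h3 (by filter_upwards [self_mem_nhdsWithin] with ε hε using h2 ε hε)

end Optimization

/-! ### The smallness functional for kernels -/

section Flow

variable {V : Type*} [NormedAddCommGroup V] [NormedSpace ℝ V] [FiniteDimensional ℝ V]
  [MeasureSpace V] [BorelSpace V] [(volume : Measure V).IsAddHaarMeasure]

/-- The `L¹` norm of the derivative of a kernel along a linear vector field. -/
noncomputable def flowDefect (η : V → ℝ) (L : V →L[ℝ] V) : ℝ≥0∞ := ∫⁻ x, ‖fderiv ℝ η x (L x)‖ₑ

/-- A kernel that is good for one linear map is therefore good for all nearby ones. This allows a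
countable choice of kernels, and makes the defect measurable when the map varies with the point. -/
theorem continuous_flowDefect {η : V → ℝ} {R : ℝ} (hη : IsMollifier η R) :
    Continuous (flowDefect η) := by
  have hc : Continuous fun q : (V →L[ℝ] V) × V => fderiv ℝ η q.2 (q.1 q.2) :=
    ((hη.contDiff.continuous_fderiv (by simp)).comp continuous_snd).clm_apply
      (continuous_fst.clm_apply continuous_snd)
  have hz : ∀ (L : V →L[ℝ] V) x, x ∉ Metric.closedBall (0 : V) R → fderiv ℝ η x (L x) = 0 := by
    intro L x hx
    have : fderiv ℝ η x = 0 := by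
      by_contra h1
      exact hx (hη.tsupport_subset (support_fderiv_subset ℝ h1))
    simp [this]
  have h1 : ∀ L, flowDefect η L = ENNReal.ofReal (∫ x in Metric.closedBall 0 R, ‖fderiv ℝ η x (L x)‖) := by
    intro L
    rw [ofReal_integral_norm_eq_lintegral_enorm, flowDefect,
      ← lintegral_indicator Metric.isClosed_closedBall.measurableSet]
    · refine lintegral_congr fun x => ?_
      by_cases hx : x ∈ Metric.closedBall (0 : V) R
      · rw [indicator_of_mem hx]
      · rw [indicator_of_notMem hx, hz L x hx, enorm_zero]
    · exact (hc.comp (by fun_prop : Continuous fun x : V => (L, x))).continuousOn.integrableOn_compact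
        (isCompact_closedBall _ _)
  rw [show flowDefect η = _ from funext h1]
  refine ENNReal.continuous_ofReal.comp ?_
  exact continuous_parametric_integral_of_continuous (f := fun (L : V →L[ℝ] V) x => ‖fderiv ℝ η x (L x)‖)
    hc.norm (isCompact_closedBall _ _)

end Flow

/-! ### Velocities of bounded variation in space -/

variable {d : ℕ}

theorem IsMollifier.prod {η : E d → ℝ} {R : ℝ} (hη : IsMollifier η R) {θ : ℝ → ℝ} {r : ℝ}
    (hθ : IsMollifier θ r) : IsMollifier (fun z : E d × ℝ => η z.1 * θ z.2) (max R r) := by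
  refine ⟨(hη.contDiff.comp contDiff_fst).mul (hθ.contDiff.comp contDiff_snd),
    fun z => mul_nonneg (hη.nonneg _) (hθ.nonneg _), ?_, ?_⟩
  · have := integral_prod_mul (μ := (volume : Measure (E d))) (ν := (volume : Measure ℝ)) η θ
    rw [hη.integral_eq_one, hθ.integral_eq_one, mul_one] at this
    exact this
  · refine closure_minimal (fun z hz => ?_) Metric.isClosed_closedBall
    have h1 := hη.tsupport_subset (subset_tsupport _ (left_ne_zero_of_mul hz))
    have h2 := hθ.tsupport_subset (subset_tsupport _ (right_ne_zero_of_mul hz))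
    rw [mem_closedBall_zero_iff] at h1 h2 ⊢
    exact max_le_max h1 h2

theorem fderiv_prod_apply {η : E d → ℝ} {R : ℝ} (hη : IsMollifier η R) {θ : ℝ → ℝ} {r : ℝ}
    (hθ : IsMollifier θ r) (h : E d × ℝ) (y : E d) :
    fderiv ℝ (fun z : E d × ℝ => η z.1 * θ z.2) h (y, 0) = θ h.2 * fderiv ℝ η h.1 y := by
  have a1 : HasFDerivAt (fun z : E d × ℝ => η z.1) _ h :=
    ((hη.contDiff.differentiable (by simp)) h.1).hasFDerivAt.comp h hasFDerivAt_fst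
  have a2 : HasFDerivAt (fun z : E d × ℝ => θ z.2) _ h :=
    ((hθ.contDiff.differentiable (by simp)) h.2).hasFDerivAt.comp h hasFDerivAt_snd
  rw [(a1.fun_mul a2).fderiv]
  simp

/-- The linear map with matrix `Q`. -/
noncomputable def matMap (Q : Fin d → Fin d → ℝ) : E d →L[ℝ] E d :=
  ∑ j, ∑ l, Q j l • (EuclideanSpace.proj l : E d →L[ℝ] ℝ).smulRight (unitVec j)

theorem matMap_apply (Q : Fin d → Fin d → ℝ) (x : E d) :
    matMap Q x = ∑ j, ∑ l, (Q j l * x l) • unitVec j := by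
  simp [matMap, mul_smul]

theorem continuous_matMap : Continuous (matMap (d := d)) := by
  unfold matMap
  fun_prop

theorem trace_matMap (Q : Fin d → Fin d → ℝ) :
    LinearMap.trace ℝ (E d) (matMap Q).toLinearMap = ∑ j, Q j j := by
  have h : (matMap Q).toLinearMap = ∑ j, ∑ l, Q j l •
      ((EuclideanSpace.proj l : E d →L[ℝ] ℝ) : E d →ₗ[ℝ] ℝ).smulRight (unitVec j) := by
    ext x : 1
    simp [matMap]
  rw [h]
  simp [LinearMap.trace_smulRight, unitVec]

end

section

variable {d : ℕ}

namespace LocalSolution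

section Linear

variable {Z : Type*} [NormedAddCommGroup Z] [NormedSpace ℝ Z] [FiniteDimensional ℝ Z]
  [MeasureSpace Z] [BorelSpace Z] [(volume : Measure Z).IsAddHaarMeasure]
  {O : Set Z} {c M : ℝ} {e : Fin d → Z} {τ : Z} {ρ p : Z → ℝ} {v f : Fin d → Z → ℝ}
  (hS : LocalSolution O c M e τ ρ p v f)
include hS

theorem energyDefect_add {φ ψ : Z → ℝ} (hφ : IsTestOn O φ) (hψ : IsTestOn O ψ) :
    energyDefect e τ ρ p v f (φ + ψ)
      = energyDefect e τ ρ p v f φ + energyDefect e τ ρ p v f ψ := by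
  have hd : ∀ z, fderiv ℝ (φ + ψ) z = fderiv ℝ φ z + fderiv ℝ ψ z := fun z =>
    fderiv_add (hφ.1.differentiable (by simp) z) (hψ.1.differentiable (by simp) z)
  have i1 : ∀ {φ : Z → ℝ}, IsTestOn O φ → ∀ i, Integrable fun z =>
      (ρ z * v i z * v i z) * fderiv ℝ φ z (field e v z + τ) := fun hφ i =>
    hS.integrable_mul_clm_field_add hφ ((hS.momentum_bddMeas i).mul (hS.velocity_bddMeas i))
  have i2 : ∀ {φ : Z → ℝ}, IsTestOn O φ → Integrable fun z =>
      p z * fderiv ℝ φ z (field e v z) := fun hφ => hS.integrable_mul_clm_field hφ hS.pressure_bddMeas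
  have i3 : ∀ {φ : Z → ℝ}, IsTestOn O φ → ∀ i, Integrable fun z => (φ z * v i z) * f i z :=
    fun hφ i => (hφ.bddMeas.mul (hS.velocity_bddMeas i)).integrable_mul (hS.force_integrable i)
  unfold energyDefect
  simp_rw [hd, add_apply, Pi.add_apply, mul_add, add_mul]
  rw [integral_add (i2 hφ) (i2 hψ)]
  simp_rw [fun i => integral_add (i1 hφ i) (i1 hψ i), fun i => integral_add (i3 hφ i) (i3 hψ i),
    Finset.sum_add_distrib]
  ring

theorem energyDefect_smul (a : ℝ) {φ : Z → ℝ} (hφ : IsTestOn O φ) :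
    energyDefect e τ ρ p v f (a • φ) = a * energyDefect e τ ρ p v f φ := by
  have hd : ∀ z, fderiv ℝ (a • φ) z = a • fderiv ℝ φ z := fun z =>
    fderiv_const_smul (hφ.1.differentiable (by simp) z) a
  unfold energyDefect
  simp_rw [hd, smul_apply, Pi.smul_apply, smul_eq_mul]
  have e1 : ∀ i, ∫ z, ρ z * v i z * v i z * (a * fderiv ℝ φ z (field e v z + τ))
      = a * ∫ z, ρ z * v i z * v i z * fderiv ℝ φ z (field e v z + τ) := fun i => by
    rw [← integral_const_mul]; congr 1; ext z; ring
  have e2 : ∫ z, p z * (a * fderiv ℝ φ z (field e v z))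
      = a * ∫ z, p z * fderiv ℝ φ z (field e v z) := by
    rw [← integral_const_mul]; congr 1; ext z; ring
  have e3 : ∀ i, ∫ z, a * φ z * v i z * f i z = a * ∫ z, φ z * v i z * f i z := fun i => by
    rw [← integral_const_mul]; congr 1; ext z; ring
  simp_rw [e1, e2, e3, ← Finset.mul_sum]
  ring

end Linear

variable {O : Set (E d × ℝ)} {c M : ℝ} {ρ p : E d × ℝ → ℝ} {v f : Fin d → E d × ℝ → ℝ}
  (hS : LocalSolution O c M spaceDir (0, 1) ρ p v f)
include hS

/-- The distributional gradient of the velocity has trace free bounded densities. -/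
theorem exists_gradient_density {ν : Measure (E d × ℝ)} [IsFiniteMeasure ν]
    (hgrad : ∀ j l ψ, IsTestOn O ψ → ‖∫ z, v j z * fderiv ℝ ψ z (spaceDir l)‖ₑ ≤ ∫⁻ z, ‖ψ z‖ₑ ∂ν) :
    ∃ Q : E d × ℝ → Fin d → Fin d → ℝ, Measurable Q ∧ (∀ z j l, |Q z j l| ≤ 1) ∧
      (∀ z, ∑ j, Q z j j = 0) ∧ ∀ ψ, IsTestOn O ψ → ∀ j l,
        ∫ z, v j z * fderiv ℝ ψ z (spaceDir l) = ∫ z, ψ z * Q z j l ∂ν := by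
  have hi : ∀ {ψ : E d × ℝ → ℝ}, IsTestOn O ψ → ∀ j l, Integrable fun z =>
      v j z * fderiv ℝ ψ z (spaceDir l) := fun hψ j l =>
    (hS.velocity_bddMeas j).integrable_mul (hψ.fderiv_integrable _)
  have hex := fun j l => exists_density_of_isTestOn (O := O) (μ := ν)
    (L := fun ψ => ∫ z, v j z * fderiv ℝ ψ z (spaceDir l)) (fun φ ψ hφ hψ => by
      rw [← integral_add (hi hφ j l) (hi hψ j l)]
      congr 1; ext z
      rw [fderiv_add (hφ.1.differentiable (by simp) z) (hψ.1.differentiable (by simp) z),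
        add_apply, mul_add]) (fun a φ hφ => by
      rw [← integral_const_mul]
      congr 1; ext z
      rw [fderiv_const_smul (hφ.1.differentiable (by simp) z), smul_apply, smul_eq_mul]
      ring) (hgrad j l)
  choose q hqm hqb hq using hex
  have hqi : ∀ {ψ : E d × ℝ → ℝ}, IsTestOn O ψ → ∀ j l, Integrable (fun z => ψ z * q j l z) ν :=
    fun hψ j l => (hψ.integrable_measure ν).mul_bdd (c := 1) (hqm j l).aestronglyMeasurable
      (ae_of_all _ (hqb j l))
  have htm : Measurable fun z => ∑ j, q j j z := Finset.measurable_fun_sum _ fun j _ => hqm j j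
  have hint : Integrable (fun z => ∑ j, q j j z) ν := integrable_finsetSum _ fun j _ =>
    Integrable.of_bound (hqm j j).aestronglyMeasurable 1 (ae_of_all _ (hqb j j))
  -- The divergence constraint says that the sum of the diagonal densities integrates every test
  -- function to zero.
  have htr : ∀ᵐ z ∂ν, z ∈ O → ∑ j, q j j z = 0 := by
    refine hS.isOpen.ae_eq_zero_of_integral_contDiff_smul_eq_zero
      (hint.locallyIntegrable.locallyIntegrableOn O) fun ψ h1 h2 h3 => ?_
    have hψ : IsTestOn O ψ := ⟨h1, h2, h3⟩
    have := hS.incompressible ψ hψ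
    simp_rw [clm_field] at this
    rw [integral_finsetSum _ fun j _ => hi hψ j j] at this
    simp_rw [fun j => hq j j ψ hψ] at this
    rw [← integral_finsetSum _ fun j _ => hqi hψ j j] at this
    simpa only [smul_eq_mul, Finset.mul_sum] using this
  classical
  have hTm : MeasurableSet {z | ∑ j, q j j z = 0} := measurableSet_eq_fun htm measurable_const
  -- The matrix is set to zero where its trace does not vanish, so that it is trace free at every
  -- point. By `htr` this changes no integral of a test function supported in `O`.
  refine ⟨fun z j l => if ∑ j, q j j z = 0 then q j l z else 0, ?_, fun z j l => ?_, fun z => ?_,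
    fun ψ hψ j l => ?_⟩
  · exact measurable_pi_lambda _ fun j => measurable_pi_lambda _ fun l =>
      Measurable.ite hTm (hqm j l) measurable_const
  · beta_reduce
    split_ifs
    · exact hqb j l z
    · simp
  · by_cases h : ∑ j, q j j z = 0 <;> simp [h]
  · rw [hq j l ψ hψ]
    refine integral_congr_ae ?_
    filter_upwards [htr] with z hz
    by_cases hzO : z ∈ O
    · rw [if_pos (hz hzO)]
    · rw [hψ.eq_zero hzO, zero_mul, zero_mul]

variable {G : Fin d → E d × ℝ → ℝ} (hGm : ∀ j, Measurable (G j)) (hG : ∀ j, Integrable (G j))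
  {μ : Measure (E d × ℝ)} [IsFiniteMeasure μ] (hder : ∀ j, IsDerivUpTo O ρ (spaceDir j) (G j) μ)
include hGm hG hder

/-- With a product kernel and the anisotropic rescaling, the derivative entering the commutator at
displacement `h` is, up to sign, `θ h.2 * Dη(h.1)(Q h.1)` times `ν`. Integration over `h` gives the
flow defect of `Q`, because `θ` has integral one. -/
theorem enorm_energyDefect_le_flowDefect {ν : Measure (E d × ℝ)} [IsFiniteMeasure ν]
    {Q : E d × ℝ → Fin d → Fin d → ℝ} (hQm : Measurable Q) (hQ : ∀ z j l, |Q z j l| ≤ 1)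
    (hrep : ∀ ψ, IsTestOn O ψ → ∀ j l,
      ∫ z, v j z * fderiv ℝ ψ z (spaceDir l) = ∫ z, ψ z * Q z j l ∂ν)
    {η : E d → ℝ} {R : ℝ} (hη : IsMollifier η R) {φ : E d × ℝ → ℝ} (hφ : IsTestOn O φ) :
    ‖energyDefect spaceDir (0, 1) ρ p v f φ‖ₑ
      ≤ (chainConst d c M + kernelConst d c M) * ∫⁻ z, ‖φ z‖ₑ ∂μ
        + commConst d c M * ∫⁻ z, ‖φ z‖ₑ * flowDefect η (matMap (Q z)) ∂ν := by
  obtain ⟨θ, hθ⟩ := exists_isMollifier (Z := ℝ) one_pos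
  have hR : 0 < max R 1 := lt_max_of_lt_right one_pos
  obtain ⟨A, ε, σ, hA⟩ := exists_anisotropic_rescaling hS.velocity_integrable hR
  set w : E d × ℝ → E d × ℝ → ℝ := fun h z => θ h.2 * fderiv ℝ η h.1 (matMap (Q z) h.1) with hw
  have hwc : Continuous fun q : (E d × ℝ) × (Fin d → Fin d → ℝ) =>
      θ q.1.2 * fderiv ℝ η q.1.1 (matMap q.2 q.1.1) := by
    have h1 := hθ.continuous
    have h2 := hη.contDiff.continuous_fderiv (by simp)
    have h3 := continuous_matMap (d := d)
    exact (h1.comp (by fun_prop)).mul ((h2.comp (by fun_prop)).clm_apply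
      ((h3.comp (by fun_prop)).clm_apply (by fun_prop)))
  have hwm : Measurable fun q : (E d × ℝ) × (E d × ℝ) => w q.1 q.2 :=
    hwc.measurable.comp (measurable_fst.prodMk (hQm.comp measurable_snd))
  obtain ⟨N, hN⟩ : ∃ N, ∀ h z, |w h z| ≤ N := by
    obtain ⟨N, hN⟩ := ((isCompact_closedBall (0 : E d × ℝ) (max R 1)).prod
      (isCompact_closedBall (0 : Fin d → Fin d → ℝ) 1)).exists_bound_of_continuousOn
      hwc.continuousOn
    have hk := hη.prod hθ
    refine ⟨max N 0, fun h z => ?_⟩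
    by_cases hh : h ∈ Metric.closedBall (0 : E d × ℝ) (max R 1)
    · refine (hN (h, Q z) ⟨hh, ?_⟩).trans (le_max_left _ _)
      rw [mem_closedBall_zero_iff, pi_norm_le_iff_of_nonneg zero_le_one]
      exact fun j => (pi_norm_le_iff_of_nonneg zero_le_one).2 fun l => hQ z j l
    · have h0 : fderiv ℝ (fun z : E d × ℝ => η z.1 * θ z.2) h = 0 := by
        by_contra h1
        exact hh (hk.tsupport_subset (support_fderiv_subset ℝ h1))
      have : w h z = 0 := by
        rw [hw]; beta_reduce
        rw [← fderiv_prod_apply hη hθ, h0]; rfl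
      rw [this, abs_zero]
      exact le_max_right _ _
  have hwN : ∀ h z, ‖w h z‖ₑ ≤ ENNReal.ofReal N := fun h z => by
    rw [Real.enorm_eq_ofReal_abs]; exact ENNReal.ofReal_le_ofReal (hN h z)
  have hwh : ∀ h, Measurable fun z => ‖w h z‖ₑ := fun h =>
    (hwm.comp (measurable_const.prodMk measurable_id)).enorm
  have hmu : ∀ h, ν.withDensity (fun z => ‖w h z‖ₑ) univ ≤ ENNReal.ofReal N * ν univ := fun h => by
    rw [withDensity_apply _ MeasurableSet.univ, Measure.restrict_univ, ← lintegral_const]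
    exact lintegral_mono (hwN h)
  have hfin : ∀ h, IsFiniteMeasure (ν.withDensity fun z => ‖w h z‖ₑ) := fun h =>
    ⟨(hmu h).trans_lt (by finiteness)⟩
  have hφm := hφ.1.continuous.measurable.enorm
  -- The density `b` is taken to be zero: the whole gradient of the velocity, absolutely continuous
  -- part included, is treated as a measure, since the choice of the kernel will make its
  -- contribution small.
  have key := hS.enorm_energyDefect_le_of_kernel (hη.prod hθ) hφ hGm hG hder hA
    (b := fun _ _ => 0) (m := fun h => ν.withDensity fun z => ‖w h z‖ₑ) (Cb := 0)
    (Cm := ENNReal.ofReal N * ν univ) (fun _ => measurable_const) (fun _ => integrable_zero _ _ _)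
    (fun h ψ hψ => ?_) ENNReal.zero_ne_top (by finiteness) (by simp) hmu
  · refine key.trans (add_le_add le_rfl (mul_le_mul' le_rfl ?_))
    have e1 : ∀ h, ∫⁻ z, ‖φ z‖ₑ ∂(ν.withDensity fun z => ‖w h z‖ₑ) = ∫⁻ z, ‖φ z‖ₑ * ‖w h z‖ₑ ∂ν :=
      fun h => by
        rw [lintegral_withDensity_eq_lintegral_mul _ (hwh h) hφm]
        simp only [Pi.mul_apply, mul_comm]
    simp_rw [e1]
    rw [lintegral_lintegral_swap ((hφm.comp measurable_snd).mul hwm.enorm).aemeasurable]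
    refine le_of_eq (lintegral_congr fun z => ?_)
    rw [lintegral_const_mul' _ _ enorm_ne_top]
    congr 1
    have e2 : ∀ h : E d × ℝ, ‖w h z‖ₑ = ‖fderiv ℝ η h.1 (matMap (Q z) h.1)‖ₑ * ‖θ h.2‖ₑ :=
      fun h => by rw [hw, enorm_mul, mul_comm]
    simp_rw [e2]
    have hfm : Measurable fun x => ‖fderiv ℝ η x (matMap (Q z) x)‖ₑ :=
      ((hη.contDiff.continuous_fderiv (by simp)).clm_apply
        (matMap (Q z)).continuous).measurable.enorm
    have e3 := lintegral_prod_mul (μ := (volume : Measure (E d))) (ν := (volume : Measure ℝ))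
      hfm.aemeasurable hθ.continuous.measurable.enorm.aemeasurable
    rw [hθ.lintegral_eq_one, mul_one] at e3
    exact e3
  · have hfield : ∀ z, field spaceDir v z = (∑ j, v j z • unitVec j, 0) := fun z => by
      simp [field, spaceDir, Prod.ext_iff, Prod.fst_sum, Prod.snd_sum]
    have hB : ((ContinuousLinearMap.inl ℝ (E d) ℝ).comp (ContinuousLinearMap.fst ℝ (E d) ℝ)) h
        = ∑ l, h.1 l • spaceDir l := by
      have : h.1 = ∑ l, h.1 l • (unitVec l : E d) := by
        ext i; simp [unitVec, Pi.single_apply]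
      refine Prod.ext ?_ ?_
      · simpa [spaceDir, Prod.fst_sum] using this
      · simp [spaceDir, Prod.snd_sum]
    have hi : ∀ j l, Integrable fun z => v j z * fderiv ℝ ψ z (spaceDir l) := fun j l =>
      (hS.velocity_bddMeas j).integrable_mul (hψ.fderiv_integrable _)
    have hqi : ∀ j l, Integrable (fun z => ψ z * Q z j l) ν := fun j l =>
      (hψ.integrable_measure ν).mul_bdd (c := 1)
        ((measurable_pi_apply l).comp ((measurable_pi_apply j).comp hQm)).aestronglyMeasurable
        (ae_of_all _ fun z => hQ z j l)
    have e1 : ∫ z, fderiv ℝ (fun z : E d × ℝ => η z.1 * θ z.2) h (field spaceDir v z) * fderiv ℝ ψ z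
        (((ContinuousLinearMap.inl ℝ (E d) ℝ).comp (ContinuousLinearMap.fst ℝ (E d) ℝ)) h)
        = ∫ z, ψ z * w h z ∂ν := by
      have a1 : ∀ z, fderiv ℝ (fun z : E d × ℝ => η z.1 * θ z.2) h (field spaceDir v z) *
          fderiv ℝ ψ z (((ContinuousLinearMap.inl ℝ (E d) ℝ).comp
            (ContinuousLinearMap.fst ℝ (E d) ℝ)) h)
          = ∑ j, ∑ l, θ h.2 * fderiv ℝ η h.1 (unitVec j) * h.1 l *
            (v j z * fderiv ℝ ψ z (spaceDir l)) := fun z => by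
        rw [hfield, fderiv_prod_apply hη hθ, hB]
        simp only [map_sum, map_smul, smul_eq_mul, Finset.mul_sum, Finset.sum_mul]
        rw [Finset.sum_comm]
        refine Finset.sum_congr rfl fun j _ => Finset.sum_congr rfl fun l _ => by ring
      have a2 : ∀ z, ψ z * w h z
          = ∑ j, ∑ l, θ h.2 * fderiv ℝ η h.1 (unitVec j) * h.1 l * (ψ z * Q z j l) := fun z => by
        rw [hw]; beta_reduce
        rw [matMap_apply]
        simp only [map_sum, map_smul, smul_eq_mul, Finset.mul_sum]
        refine Finset.sum_congr rfl fun j _ => Finset.sum_congr rfl fun l _ => by ring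
      simp_rw [a1, a2]
      rw [integral_finsetSum _ fun j _ => integrable_finsetSum _ fun l _ => (hi j l).const_mul _,
        integral_finsetSum _ fun j _ => integrable_finsetSum _ fun l _ => (hqi j l).const_mul _]
      refine Finset.sum_congr rfl fun j _ => ?_
      rw [integral_finsetSum _ fun l _ => (hi j l).const_mul _,
        integral_finsetSum _ fun l _ => (hqi j l).const_mul _]
      refine Finset.sum_congr rfl fun l _ => ?_
      rw [integral_const_mul, integral_const_mul, hrep ψ hψ]
    rw [e1]
    simp only [mul_zero, integral_zero, add_zero]
    refine (enorm_integral_le_lintegral_enorm _).trans (le_of_eq ?_)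
    rw [lintegral_withDensity_eq_lintegral_mul _ (hwh h) hψ.1.continuous.measurable.enorm]
    simp only [Pi.mul_apply, enorm_mul, mul_comm]

/-- If the velocity has bounded variation in space, the energy defect is controlled by the part of
the density gradient which is not absolutely continuous. -/
theorem enorm_energyDefect_le_of_gradient {ν : Measure (E d × ℝ)} [IsFiniteMeasure ν]
    (hgrad : ∀ j l ψ, IsTestOn O ψ → ‖∫ z, v j z * fderiv ℝ ψ z (spaceDir l)‖ₑ ≤ ∫⁻ z, ‖ψ z‖ₑ ∂ν)
    {φ : E d × ℝ → ℝ} (hφ : IsTestOn O φ) :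
    ‖energyDefect spaceDir (0, 1) ρ p v f φ‖ₑ
      ≤ (chainConst d c M + kernelConst d c M) * ∫⁻ z, ‖φ z‖ₑ ∂μ := by
  obtain ⟨Q, hQm, hQ, htr, hrep⟩ := hS.exists_gradient_density hgrad
  have hct : chainConst d c M + kernelConst d c M ≠ ⊤ := by
    unfold chainConst kernelConst; finiteness
  have hkt : commConst d c M ≠ ⊤ := by unfold commConst; finiteness
  have hLm : Measurable fun z => matMap (Q z) := continuous_matMap.measurable.comp hQm
  have := Measure.smul_finite μ hct
  rw [← smul_eq_mul, ← lintegral_smul_measure]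
  refine enorm_le_of_forall_density hS.isOpen (ν := ν) (fun _ _ => hS.energyDefect_add)
    (fun a _ => hS.energyDefect_smul a)
    (W := {w | ∃ η R, IsMollifier η R ∧ w = fun z => commConst d c M * flowDefect η (matMap (Q z))})
    ?_ ?_ ?_ ?_ hφ
  · rintro w ⟨η, R, hη, rfl⟩
    exact ((continuous_flowDefect hη).measurable.comp hLm).const_mul _
  · rintro w ⟨η, R, hη, rfl⟩
    obtain ⟨B, hB, hBt⟩ : ∃ B : ℝ≥0∞, (∀ z, flowDefect η (matMap (Q z)) ≤ B) ∧ B ≠ ⊤ := by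
      obtain ⟨q, -, hq⟩ := (isCompact_closedBall (0 : Fin d → Fin d → ℝ) 1).exists_isMaxOn
        ⟨0, by simp⟩ ((continuous_flowDefect hη).comp continuous_matMap).continuousOn
      refine ⟨_, fun z => hq (a := Q z) ?_, ?_⟩
      · rw [mem_closedBall_zero_iff, pi_norm_le_iff_of_nonneg zero_le_one]
        exact fun j => (pi_norm_le_iff_of_nonneg zero_le_one).2 fun l => hQ z j l
      · have h1 : Continuous fun x => fderiv ℝ η x (matMap q x) :=
          (hη.contDiff.continuous_fderiv (by simp)).clm_apply (matMap q).continuous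
        have h2 : HasCompactSupport fun x => fderiv ℝ η x (matMap q x) := by
          refine HasCompactSupport.intro (isCompact_closedBall 0 R) fun x hx => ?_
          have : fderiv ℝ η x = 0 := by
            by_contra h1
            exact hx (hη.tsupport_subset (support_fderiv_subset ℝ h1))
          simp [this]
        exact (h1.integrable_of_hasCompactSupport h2).2.ne
    refine ne_top_of_le_ne_top (b := ∫⁻ _, commConst d c M * B ∂ν) ?_
      (lintegral_mono fun z => mul_le_mul' le_rfl (hB z))
    rw [lintegral_const]; finiteness
  · rintro w ⟨η, R, hη, rfl⟩ φ hφ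
    refine (hS.enorm_energyDefect_le_flowDefect hGm hG hder hQm hQ hrep hη hφ).trans (le_of_eq ?_)
    rw [lintegral_smul_measure, smul_eq_mul, ← lintegral_const_mul' _ _ hkt]
    congr 1
    exact lintegral_congr fun z => by ring
  · intro ε hε
    have hex : ∀ L : E d →L[ℝ] E d, ∃ η : E d → ℝ, ∃ R, IsMollifier η R ∧
        (LinearMap.trace ℝ (E d) L.toLinearMap = 0 → commConst d c M * flowDefect η L < ε) := by
      intro L
      by_cases hL : LinearMap.trace ℝ (E d) L.toLinearMap = 0
      -- One is added in the denominator so that `δ` is positive and well behaved also when the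
      -- constant vanishes.
      · obtain ⟨η, R, h1, h2⟩ := exists_isMollifier_lintegral_lt hL
          (δ := ε / (commConst d c M + 1)) (ENNReal.div_pos hε.ne' (by finiteness))
        refine ⟨η, R, h1, fun _ => ?_⟩
        have := ENNReal.mul_lt_of_lt_div h2
        refine lt_of_le_of_lt ?_ this
        rw [mul_comm]
        exact mul_le_mul' le_rfl le_self_add
      · obtain ⟨η, hη⟩ := exists_isMollifier (Z := E d) one_pos
        exact ⟨η, 1, hη, fun h => (hL h).elim⟩
    choose η R hη hlt using hex
    -- Lindelöf property of the trace free maps: countably many kernels suffice to make the defect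
    -- of every trace free map small.
    obtain ⟨t, hts, htc, hcov⟩ := TopologicalSpace.countable_cover_nhdsWithin
      (s := {L : E d →L[ℝ] E d | LinearMap.trace ℝ (E d) L.toLinearMap = 0})
      (f := fun L => {L' | commConst d c M * flowDefect (η L) L' < ε}) (fun L hL =>
        mem_nhdsWithin_of_mem_nhds ((isOpen_lt
          (ENNReal.continuous_const_mul hkt |>.comp (continuous_flowDefect (hη L)))
          continuous_const).mem_nhds (hlt L hL)))
    have hmem : ∀ z, matMap (Q z) ∈ {L : E d →L[ℝ] E d | LinearMap.trace ℝ (E d) L.toLinearMap = 0} :=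
      fun z => by rw [mem_ofPred_eq, trace_matMap, htr]
    have hne : t.Nonempty := by
      obtain ⟨L, hL, -⟩ := mem_iUnion₂.1 (hcov (hmem 0))
      exact ⟨L, hL⟩
    obtain ⟨g, hg⟩ := htc.exists_eq_range hne
    refine ⟨fun n z => commConst d c M * flowDefect (η (g n)) (matMap (Q z)),
      fun n => ⟨_, _, hη _, rfl⟩, fun z => ?_⟩
    obtain ⟨L, hL, hz⟩ := mem_iUnion₂.1 (hcov (hmem z))
    rw [hg] at hL
    obtain ⟨n, rfl⟩ := hL
    exact ⟨n, hz⟩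

end LocalSolution

end

/-! ### Vector measures with densities -/

section VectorIntegral

variable {X : Type*} [MeasurableSpace X]

/-- Indicators generate the simple functions, and every bounded measurable function is a pointwise
limit of uniformly bounded simple ones. This is used to identify integrals against a vector measure
with a density. -/
theorem BddMeas.induction {P : (X → ℝ) → Prop}
    (h_ind : ∀ A, MeasurableSet A → P (A.indicator fun _ => 1))
    (h_smul : ∀ (a : ℝ) f, BddMeas f → P f → P fun x => a * f x)
    (h_add : ∀ f g, BddMeas f → BddMeas g → P f → P g → P fun x => f x + g x)
    (h_lim : ∀ (F : ℕ → X → ℝ) (f : X → ℝ) (C : ℝ), (∀ n, Measurable (F n)) →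
      (∀ n x, |F n x| ≤ C) → (∀ x, Tendsto (fun n => F n x) atTop (𝓝 (f x))) →
      (∀ n, P (F n)) → P f) {f : X → ℝ} (hf : BddMeas f) : P f := by
  have hsimple : ∀ g : SimpleFunc X ℝ, P g ∧ BddMeas (g : X → ℝ) := by
    intro g
    induction g using SimpleFunc.induction with
    | @const c A hA =>
      have hi : BddMeas (A.indicator fun _ => (1 : ℝ)) :=
        ⟨measurable_const.indicator hA, 1, fun x => by
          by_cases hx : x ∈ A <;> simp [hx]⟩
      have h1 := h_smul c _ hi (h_ind _ hA)
      have h2 := (BddMeas.const c).mul hi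
      have e : (fun x => c * A.indicator (fun _ => (1 : ℝ)) x)
          = ⇑(SimpleFunc.piecewise A hA (SimpleFunc.const X c) (SimpleFunc.const X 0)) := by
        ext x
        by_cases hx : x ∈ A <;> simp [hx]
      rw [e] at h1 h2
      exact ⟨h1, h2⟩
    | add _ hf hg => exact ⟨h_add _ _ hf.2 hg.2 hf.1 hg.1, hf.2.add hg.2⟩
  obtain ⟨C, hC⟩ := hf.bdd
  have hs := hf.measurable.stronglyMeasurable
  exact h_lim (fun n => hs.approxBounded C n) f C (fun n => (hs.approxBounded C n).measurable)
    (fun n x => hs.norm_approxBounded_le (by rcases isEmpty_or_nonempty X with h | ⟨⟨y⟩⟩; exact h.elim x; exact (abs_nonneg _).trans (hC y)) n x)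
    (fun x => hs.tendsto_approxBounded_of_norm_le (hC x)) fun n => (hsimple _).1

variable {V : Type*} [NormedAddCommGroup V] [NormedSpace ℝ V] [CompleteSpace V]

theorem BddMeas.integrable {f : X → ℝ} (hf : BddMeas f) (μ : Measure X) [IsFiniteMeasure μ] :
    Integrable f μ := by
  obtain ⟨C, hC⟩ := hf.bdd
  exact Integrable.of_bound hf.measurable.aestronglyMeasurable C (ae_of_all _ hC)

theorem isFiniteMeasure_variation_withDensity {μ : Measure X} {g : X → V} (hg : Integrable g μ) :
    IsFiniteMeasure (μ.withDensityᵥ g).variation := by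
  rw [Measure.variation_withDensityᵥ hg]
  exact ⟨by rw [withDensity_apply _ MeasurableSet.univ, Measure.restrict_univ]; exact hg.2⟩

theorem vectorIntegral_indicator (Γ : VectorMeasure X V) [IsFiniteMeasure Γ.variation] {A : Set X}
    (hA : MeasurableSet A) : ∫ᵛ x, A.indicator (fun _ => (1 : ℝ)) x ∂•Γ = Γ A := by
  rw [show (fun x => A.indicator (fun _ => (1 : ℝ)) x) = A.indicator fun _ => (1 : ℝ) from rfl]
  simp [VectorMeasure.integral_indicator_const _ hA]

theorem vectorIntegral_withDensity {μ : Measure X} {g : X → V} (hg : Integrable g μ) {φ : X → ℝ}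
    (hφ : BddMeas φ) : ∫ᵛ x, φ x ∂•(μ.withDensityᵥ g) = ∫ x, φ x • g x ∂μ := by
  have := isFiniteMeasure_variation_withDensity hg
  have hi : ∀ {f : X → ℝ}, BddMeas f → Integrable (fun x => f x • g x) μ := fun hf => by
    obtain ⟨C, hC⟩ := hf.bdd
    exact hg.bdd_smul C hf.measurable.aestronglyMeasurable (ae_of_all _ hC)
  refine BddMeas.induction (P := fun φ => ∫ᵛ x, φ x ∂•(μ.withDensityᵥ g) = ∫ x, φ x • g x ∂μ)
    (fun A hA => ?_) (fun a f hf h => ?_) (fun f g hf hg' h1 h2 => ?_)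
    (fun F f C hF hC hlim h => ?_) hφ
  · rw [vectorIntegral_indicator _ hA, withDensityᵥ_apply hg hA, ← integral_indicator hA]
    congr 1; ext x
    by_cases hx : x ∈ A <;> simp [hx]
  · have := VectorMeasure.integral_fun_smul (μ := μ.withDensityᵥ g)
      (B := ContinuousLinearMap.lsmul ℝ ℝ) a f
    simp only [smul_eq_mul] at this
    rw [this, h, ← integral_smul]
    simp only [smul_smul]
  · rw [VectorMeasure.integral_fun_add (hf.integrable _) (hg'.integrable _), h1, h2,
      ← integral_add (hi hf) (hi hg')]
    simp only [add_smul]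
  · have t1 : Tendsto (fun n => ∫ᵛ x, F n x ∂•(μ.withDensityᵥ g)) atTop
        (𝓝 (∫ᵛ x, f x ∂•(μ.withDensityᵥ g))) :=
      VectorMeasure.tendsto_integral_filter_of_norm_le_const (Eventually.of_forall fun n => (hF n).aestronglyMeasurable)
      ⟨C, Eventually.of_forall fun n => ae_of_all _ (hC n)⟩ (ae_of_all _ hlim)
    have t2 : Tendsto (fun n => ∫ x, F n x • g x ∂μ) atTop (𝓝 (∫ x, f x • g x ∂μ)) := by
      refine tendsto_integral_of_dominated_convergence (fun x => C * ‖g x‖)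
        (fun n => ((hF n).aestronglyMeasurable.smul hg.1)) (hg.norm.const_mul C)
        (fun n => ae_of_all _ fun x => ?_) (ae_of_all _ fun x => (hlim x).smul_const _)
      rw [norm_smul]
      exact mul_le_mul_of_nonneg_right (hC n x) (norm_nonneg _)
    simp_rw [h] at t1
    exact tendsto_nhds_unique t1 t2

theorem enorm_vectorIntegral_le (Γ : VectorMeasure X V) (φ : X → ℝ) :
    ‖∫ᵛ x, φ x ∂•Γ‖ₑ ≤ ∫⁻ x, ‖φ x‖ₑ ∂Γ.variation := by
  rcases subsingleton_or_nontrivial V with h | h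
  · simp [Subsingleton.elim (∫ᵛ x, φ x ∂•Γ) 0]
  · simpa using VectorMeasure.enorm_integral_le_lintegral_enorm_transpose (μ := Γ) (f := φ)
      (B := ContinuousLinearMap.lsmul ℝ ℝ)

/-- The integral against a vector measure differs from the integral against its absolutely
continuous part by the integral against its singular part. -/
theorem enorm_vectorIntegral_sub_le {Γ Γs : VectorMeasure X V} [IsFiniteMeasure Γs.variation]
    {μ : Measure X} {g : X → V} (hg : Integrable g μ) (hΓ : Γ = Γs + μ.withDensityᵥ g) {φ : X → ℝ}
    (hφ : BddMeas φ) :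
    ‖∫ᵛ x, φ x ∂•Γ - ∫ x, φ x • g x ∂μ‖ₑ ≤ ∫⁻ x, ‖φ x‖ₑ ∂Γs.variation := by
  have := isFiniteMeasure_variation_withDensity hg
  rw [hΓ, VectorMeasure.integral_add_vectorMeasure (hφ.integrable _) (hφ.integrable _),
    vectorIntegral_withDensity hg hφ, add_sub_cancel_right]
  exact enorm_vectorIntegral_le Γs φ

end VectorIntegral

/-! ### Components and singular parts of vector measures -/

section Components

variable {X : Type*} [MeasurableSpace X] {ι : Type*} [Fintype ι]

theorem component_apply (Γ : VectorMeasure X (EuclideanSpace ℝ ι)) (i : ι) (A : Set X) :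
    component Γ i A = Γ A i := rfl

theorem vectorMeasure_ext {Γ Γ' : VectorMeasure X (EuclideanSpace ℝ ι)}
    (h : ∀ i, component Γ i = component Γ' i) : Γ = Γ' := by
  ext A hA i
  exact congrArg (fun s : SignedMeasure X => s A) (h i)

/-- The norm of a vector is at most the sum of the absolute values of its coordinates, so the
variation is dominated by the finite total variations of the components. -/
instance (Γ : VectorMeasure X (EuclideanSpace ℝ ι)) : IsFiniteMeasure Γ.variation := by
  refine isFiniteMeasure_of_le (∑ i, (component Γ i).totalVariation)
    (VectorMeasure.variation_le_of_forall_enorm_le fun A hA => ?_)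
  classical
  rw [Measure.finsetSum_apply]
  calc ‖Γ A‖ₑ = ‖∑ i, EuclideanSpace.single i (Γ A i)‖ₑ := by
        congr 1; ext j; simp [Pi.single_apply]
    _ ≤ ∑ i, ‖EuclideanSpace.single i (Γ A i)‖ₑ := enorm_sum_le _ _
    _ ≤ _ := by
        refine Finset.sum_le_sum fun i _ => ?_
        refine le_trans (le_of_eq ?_) (SignedMeasure.enorm_le_totalVariation (component Γ i) A)
        rw [component_apply, ← ofReal_norm, ← ofReal_norm, PiLp.norm_single]

theorem component_withDensity {μ : Measure X} {g : X → EuclideanSpace ℝ ι} (hg : Integrable g μ)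
    (i : ι) : component (μ.withDensityᵥ g) i = μ.withDensityᵥ fun x => g x i := by
  have hgi : Integrable (fun x => g x i) μ := by
    simpa using (EuclideanSpace.proj i : EuclideanSpace ℝ ι →L[ℝ] ℝ).integrable_comp hg
  ext A hA
  rw [component_apply, withDensityᵥ_apply hg hA, withDensityᵥ_apply hgi hA]
  exact ((EuclideanSpace.proj i : EuclideanSpace ℝ ι →L[ℝ] ℝ).integral_comp_comm
    hg.integrableOn).symm

theorem integrable_toLp {μ : Measure X} {g : ι → X → ℝ} (hg : ∀ i, Integrable (g i) μ) :
    Integrable (fun x => WithLp.toLp 2 fun i => g i x : X → EuclideanSpace ℝ ι) μ := by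
  have h := Integrable.of_eval (μ := μ) (f := fun x i => g i x) hg
  exact ((PiLp.continuousLinearEquiv 2 ℝ fun _ : ι => ℝ).symm :
    (ι → ℝ) →L[ℝ] EuclideanSpace ℝ ι).integrable_comp h

theorem signedMeasure_mutuallySingular_restrict {κ m : Measure X} {f : X → ℝ} (hf : Integrable f κ)
    {S : Set X} (hS : MeasurableSet S) (hm : m S = 0) :
    ((κ.restrict S).withDensityᵥ f) ⟂ᵥ m.toENNRealVectorMeasure := by
  rw [SignedMeasure.mutuallySingular_ennreal_iff, SignedMeasure.totalVariation_eq_variation,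
    Measure.variation_withDensityᵥ hf.restrict, VectorMeasure.ennrealToMeasure_toENNRealVectorMeasure]
  refine ⟨Sᶜ, hS.compl, ?_, by rwa [compl_compl]⟩
  rw [withDensity_apply _ hS.compl, Measure.restrict_restrict hS.compl, compl_inter_self,
    Measure.restrict_empty, lintegral_zero_measure]

/-- The singular part of a measure that is given by densities. -/
theorem singularPart_eq_of_component {Γ : VectorMeasure X (EuclideanSpace ℝ ι)} {κ m : Measure X}
    {θ g : ι → X → ℝ} (hθ : ∀ i, Integrable (θ i) κ) (hg : ∀ i, Integrable (g i) m) {S : Set X}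
    (hS : MeasurableSet S) (hm : m S = 0)
    (h : ∀ i, component Γ i = (κ.restrict S).withDensityᵥ (θ i) + m.withDensityᵥ (g i)) :
    singularPart Γ m = (κ.restrict S).withDensityᵥ (fun x => WithLp.toLp 2 fun i => θ i x) ∧
      Γ = singularPart Γ m + m.withDensityᵥ (fun x => WithLp.toLp 2 fun i => g i x) := by
  have h1 : singularPart Γ m = (κ.restrict S).withDensityᵥ (fun x => WithLp.toLp 2 fun i => θ i x) := by
    refine vectorMeasure_ext fun i => ?_
    rw [component_withDensity (integrable_toLp hθ).restrict]
    exact (SignedMeasure.eq_singularPart _ (g i)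
      (signedMeasure_mutuallySingular_restrict (hθ i) hS hm) (h i)).symm
  refine ⟨h1, vectorMeasure_ext fun i => ?_⟩
  rw [h1, h i]
  ext A hA
  have e1 := congrArg (fun s : SignedMeasure X => s A)
    (component_withDensity (integrable_toLp hθ).restrict (μ := κ.restrict S) i)
  have e2 := congrArg (fun s : SignedMeasure X => s A)
    (component_withDensity (integrable_toLp hg) i)
  beta_reduce at e1 e2
  rw [_root_.add_apply, component_apply, _root_.add_apply, PiLp.add_apply, ← component_apply, ← component_apply,
    e1, e2]

theorem variation_singularPart_eq {Γ : VectorMeasure X (EuclideanSpace ℝ ι)} {κ m : Measure X}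
    {θ g : ι → X → ℝ} (hθ : ∀ i, Integrable (θ i) κ) (hg : ∀ i, Integrable (g i) m) {S : Set X}
    (hS : MeasurableSet S) (hm : m S = 0)
    (h : ∀ i, component Γ i = (κ.restrict S).withDensityᵥ (θ i) + m.withDensityᵥ (g i)) :
    (singularPart Γ m).variation
      = (κ.restrict S).withDensity fun x => ‖(WithLp.toLp 2 fun i => θ i x : EuclideanSpace ℝ ι)‖ₑ := by
  rw [(singularPart_eq_of_component hθ hg hS hm h).1,
    Measure.variation_withDensityᵥ (integrable_toLp hθ).restrict]

end Components

/-! ### Measurable families of signed measures -/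

section Families

variable {X : Type*} [MeasurableSpace X]

theorem abs_signedMeasure_sub_le (s : SignedMeasure X) {U V : Set X} (hU : MeasurableSet U)
    (hV : MeasurableSet V) : |s U - s V| ≤ s.totalVariation.real (symmDiff U V) := by
  rw [s.apply_eq_posPart_real_sub_negPart_real hU, s.apply_eq_posPart_real_sub_negPart_real hV,
    SignedMeasure.totalVariation, measureReal_add_apply]
  have h1 := abs_measureReal_sub_le_measureReal_symmDiff (μ := s.toJordanDecomposition.posPart)
    hU.nullMeasurableSet hV.nullMeasurableSet
  have h2 := abs_measureReal_sub_le_measureReal_symmDiff (μ := s.toJordanDecomposition.negPart)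
    hU.nullMeasurableSet hV.nullMeasurableSet
  rw [abs_le] at h1 h2 ⊢
  constructor <;> linarith [h1.1, h1.2, h2.1, h2.2]

/-- A Hahn set attains the supremum over all measurable sets, and it can be approximated in measure
by members of the dense family. For a countable family this makes the total variation a countable
supremum of values of `s`, hence measurable in a parameter. -/
theorem totalVariation_eq_iSup (s : SignedMeasure X) {𝒜 : Set (Set X)}
    (h𝒜 : s.totalVariation.MeasureDense 𝒜) {A : Set X} (hA : MeasurableSet A) :
    s.totalVariation A = ⨆ B : 𝒜, ENNReal.ofReal (s (A ∩ B) - s (A \ B)) := by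
  have htv : s.totalVariation A = ENNReal.ofReal (s.totalVariation.real A) := by
    rw [measureReal_def, ENNReal.ofReal_toReal (measure_ne_top _ _)]
  refine le_antisymm ?_ (iSup_le fun B => ?_)
  · obtain ⟨Q, hQ, hpos, hneg⟩ := s.toJordanDecomposition.mutuallySingular
    have hval : s (A ∩ Qᶜ) - s (A ∩ Q) = s.totalVariation.real A := by
      rw [s.apply_eq_posPart_real_sub_negPart_real (hA.inter hQ.compl),
        s.apply_eq_posPart_real_sub_negPart_real (hA.inter hQ),
        SignedMeasure.totalVariation, measureReal_add_apply,
        ← measureReal_inter_add_sdiff (μ := s.toJordanDecomposition.posPart) (s := A) hQ,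
        ← measureReal_inter_add_sdiff (μ := s.toJordanDecomposition.negPart) (s := A) hQ,
        sdiff_eq]
      have e1 : s.toJordanDecomposition.posPart.real (A ∩ Q) = 0 := by
        rw [measureReal_def, measure_mono_null inter_subset_right hpos, ENNReal.toReal_zero]
      have e2 : s.toJordanDecomposition.negPart.real (A ∩ Qᶜ) = 0 := by
        rw [measureReal_def, measure_mono_null inter_subset_right hneg, ENNReal.toReal_zero]
      rw [e1, e2]; ring
    rw [htv]
    refine ENNReal.le_of_forall_pos_le_add fun ε hε _ => ?_
    obtain ⟨B, hB, hlt⟩ := h𝒜.approx Qᶜ hQ.compl (measure_ne_top _ _) (ε / 2) (by positivity)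
    have hBm := h𝒜.measurable B hB
    have hlt' : s.totalVariation.real (symmDiff Qᶜ B) < ε / 2 := by
      rw [measureReal_def]
      exact (ENNReal.lt_ofReal_iff_toReal_lt (measure_ne_top _ _)).1 hlt
    have h1 : |s (A ∩ Qᶜ) - s (A ∩ B)| ≤ s.totalVariation.real (symmDiff Qᶜ B) := by
      refine (abs_signedMeasure_sub_le s (hA.inter hQ.compl) (hA.inter hBm)).trans
        (measureReal_mono ?_)
      rintro x (⟨⟨h1, h2⟩, h3⟩ | ⟨⟨h1, h2⟩, h3⟩)
      · exact Or.inl ⟨h2, fun h => h3 ⟨h1, h⟩⟩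
      · exact Or.inr ⟨h2, fun h => h3 ⟨h1, h⟩⟩
    have h2 : |s (A ∩ Q) - s (A \ B)| ≤ s.totalVariation.real (symmDiff Qᶜ B) := by
      refine (abs_signedMeasure_sub_le s (hA.inter hQ) (hA.diff hBm)).trans (measureReal_mono ?_)
      rintro x (⟨⟨h1, h2⟩, h3⟩ | ⟨⟨h1, h2⟩, h3⟩)
      · exact Or.inr ⟨not_not.1 fun h => h3 ⟨h1, h⟩, fun h => h h2⟩
      · exact Or.inl ⟨fun h => h3 ⟨h1, h⟩, h2⟩
    have h3 : s.totalVariation.real A ≤ (s (A ∩ B) - s (A \ B)) + ε := by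
      rw [← hval]
      linarith [(abs_le.1 h1).1, (abs_le.1 h1).2, (abs_le.1 h2).1, (abs_le.1 h2).2]
    calc ENNReal.ofReal (s.totalVariation.real A)
        ≤ ENNReal.ofReal (s (A ∩ B) - s (A \ B)) + ε :=
          (ENNReal.ofReal_le_ofReal h3).trans (ENNReal.ofReal_add_le.trans (by simp))
      _ ≤ _ := by
          gcongr
          exact le_iSup (fun B : 𝒜 => ENNReal.ofReal (s (A ∩ B) - s (A \ B))) ⟨B, hB⟩
  · have hB := h𝒜.measurable B B.2
    rw [htv]
    refine ENNReal.ofReal_le_ofReal ?_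
    rw [← measureReal_inter_add_sdiff (μ := s.totalVariation) (s := A) hB]
    have h1 := s.norm_le_totalVariation (A ∩ B)
    have h2 := s.norm_le_totalVariation (A \ B)
    rw [Real.norm_eq_abs, abs_le] at h1 h2
    linarith [h1.2, h2.1]

variable {α : Type*} [MeasurableSpace α]

section Countable

variable [MeasurableSpace.CountablyGenerated X]

theorem measurable_totalVariation {s : α → SignedMeasure X}
    (hs : ∀ A, MeasurableSet A → Measurable fun t => s t A) : Measurable fun t => (s t).totalVariation := by
  have hgen := (generateFrom_generateSetAlgebra_eq (𝒜 := MeasurableSpace.countableGeneratingSet X)).trans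
    (MeasurableSpace.generateFrom_countableGeneratingSet)
  have hc : (generateSetAlgebra (MeasurableSpace.countableGeneratingSet X)).Countable :=
    countable_generateSetAlgebra MeasurableSpace.countable_countableGeneratingSet
  have := hc.to_subtype
  have hd : ∀ t, (s t).totalVariation.MeasureDense
      (generateSetAlgebra (MeasurableSpace.countableGeneratingSet X)) := fun t =>
    Measure.MeasureDense.of_generateFrom_isSetAlgebra_finite _ isSetAlgebra_generateSetAlgebra
      hgen.symm
  refine Measure.measurable_of_measurable_coe _ fun A hA => ?_
  simp_rw [fun t => totalVariation_eq_iSup (s t) (hd t) hA]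
  refine Measurable.iSup fun B => ENNReal.measurable_ofReal.comp ?_
  rcases isEmpty_or_nonempty α with h | ⟨⟨t⟩⟩
  · exact measurable_of_empty _
  have hB := (hd t).measurable B B.2
  exact (hs _ (hA.inter hB)).sub (hs _ (hA.diff hB))

theorem measurable_posPart {s : α → SignedMeasure X}
    (hs : ∀ A, MeasurableSet A → Measurable fun t => s t A) :
    Measurable fun t => (s t).toJordanDecomposition.posPart := by
  refine Measure.measurable_of_measurable_coe _ fun A hA => ?_
  have e : ∀ t, (s t).toJordanDecomposition.posPart A
      = ENNReal.ofReal (((s t).totalVariation A).toReal / 2 + s t A / 2) := by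
    intro t
    rw [(s t).apply_eq_posPart_real_sub_negPart_real hA, ← measureReal_def,
      SignedMeasure.totalVariation, measureReal_add_apply]
    rw [show ∀ a b : ℝ, (a + b) / 2 + (a - b) / 2 = a from fun a b => by ring, measureReal_def,
      ENNReal.ofReal_toReal (measure_ne_top _ _)]
  simp_rw [e]
  have h1 := (Measure.measurable_coe hA).comp (measurable_totalVariation hs)
  have h2 := hs A hA
  have h3 : Measurable fun t => (s t).totalVariation A := h1
  fun_prop

theorem measurable_negPart {s : α → SignedMeasure X}
    (hs : ∀ A, MeasurableSet A → Measurable fun t => s t A) :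
    Measurable fun t => (s t).toJordanDecomposition.negPart := by
  have h := measurable_posPart (s := fun t => -s t) fun A hA => by
    have e : (fun t => (-s t) A) = fun t => -(s t A) := rfl
    rw [e]
    exact (hs A hA).neg
  simpa [SignedMeasure.toJordanDecomposition_neg] using h

/-- A measurable family of signed measures has jointly measurable densities with respect to a
finite kernel. -/
theorem exists_kernel_density {ι : Type*} [Fintype ι] {s : ι → α → SignedMeasure X}
    (hs : ∀ i A, MeasurableSet A → Measurable fun t => s i t A) :
    ∃ (κ : Kernel α X) (θ : ι → α → X → ℝ), IsFiniteKernel κ ∧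
      (∀ i, Measurable fun q : α × X => θ i q.1 q.2) ∧
      ∀ t i, Integrable (θ i t) (κ t) ∧ s i t = (κ t).withDensityᵥ (θ i t) := by
  -- A finite kernel needs a bound of the masses uniform in `t`. All measures are therefore divided
  -- by `b t`, and the factor is restored in the densities; the summand one keeps `b` away from
  -- zero.
  set b : α → ℝ := fun t => 1 + ∑ i, (s i t).totalVariation.real univ with hb
  have hb1 : ∀ t, 1 ≤ b t := fun t => le_add_of_nonneg_right
    (Finset.sum_nonneg fun _ _ => measureReal_nonneg)
  have hb0 : ∀ t, 0 < b t := fun t => one_pos.trans_le (hb1 t)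
  have hbm : Measurable b := by
    refine measurable_const.add (Finset.measurable_fun_sum _ fun i _ => ?_)
    exact ((Measure.measurable_coe MeasurableSet.univ).comp
      (measurable_totalVariation (hs i))).ennreal_toReal
  have hsmul : ∀ {μ : α → Measure X}, Measurable μ →
      Measurable fun t => ENNReal.ofReal (b t)⁻¹ • μ t := fun hμ =>
    Measure.measurable_of_measurable_coe _ fun A hA => by
      have := (Measure.measurable_coe hA).comp hμ
      simp only [Measure.smul_apply, smul_eq_mul]
      exact (hbm.inv.ennreal_ofReal).mul this
  have hsum : Measurable fun t => ∑ i, (s i t).totalVariation :=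
    Measure.measurable_of_measurable_coe _ fun A hA => by
      simp only [Measure.finsetSum_apply]
      exact Finset.measurable_fun_sum _ fun i _ =>
        (Measure.measurable_coe hA).comp (measurable_totalVariation (hs i))
  set κ : Kernel α X := ⟨_, hsmul hsum⟩ with hκ
  set P : ι → Kernel α X := fun i => ⟨_, hsmul (measurable_posPart (hs i))⟩ with hP
  set N : ι → Kernel α X := fun i => ⟨_, hsmul (measurable_negPart (hs i))⟩ with hN
  have hκt : ∀ t, κ t = ENNReal.ofReal (b t)⁻¹ • ∑ i, (s i t).totalVariation := fun t => rfl
  have hPt : ∀ i t, P i t = ENNReal.ofReal (b t)⁻¹ • (s i t).toJordanDecomposition.posPart :=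
    fun _ _ => rfl
  have hNt : ∀ i t, N i t = ENNReal.ofReal (b t)⁻¹ • (s i t).toJordanDecomposition.negPart :=
    fun _ _ => rfl
  have htv : ∀ i t, (s i t).totalVariation ≤ ∑ i, (s i t).totalVariation := fun i t => by
    refine Measure.le_iff.2 fun A _ => ?_
    rw [Measure.finsetSum_apply]
    exact Finset.single_le_sum (f := fun i => (s i t).totalVariation A) (fun _ _ => zero_le)
      (Finset.mem_univ i)
  have hPκ : ∀ i t, P i t ≤ κ t := fun i t => by
    rw [hκt, hPt]
    gcongr
    exact (Measure.le_add_right le_rfl : _ ≤ (s i t).totalVariation).trans (htv i t)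
  have hNκ : ∀ i t, N i t ≤ κ t := fun i t => by
    rw [hκt, hNt]
    gcongr
    exact (Measure.le_add_left le_rfl : _ ≤ (s i t).totalVariation).trans (htv i t)
  have hκ1 : ∀ t, κ t univ ≤ 1 := fun t => by
    rw [hκt, Measure.smul_apply, Measure.finsetSum_apply, smul_eq_mul]
    have : ∑ i, (s i t).totalVariation univ = ENNReal.ofReal (∑ i, (s i t).totalVariation.real univ) := by
      rw [ENNReal.ofReal_sum_of_nonneg fun _ _ => measureReal_nonneg]
      exact Finset.sum_congr rfl fun i _ => by
        rw [measureReal_def, ENNReal.ofReal_toReal (measure_ne_top _ _)]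
    rw [this, ← ENNReal.ofReal_mul (inv_nonneg.2 (hb0 t).le), ← ENNReal.ofReal_one]
    refine ENNReal.ofReal_le_ofReal ?_
    rw [inv_mul_le_one₀ (hb0 t)]
    simp [hb]
  have hκf : IsFiniteKernel κ := ⟨1, ENNReal.one_lt_top, hκ1⟩
  have hPf : ∀ i, IsFiniteKernel (P i) := fun i =>
    ⟨1, ENNReal.one_lt_top, fun t => (hPκ i t univ).trans (hκ1 t)⟩
  have hNf : ∀ i, IsFiniteKernel (N i) := fun i =>
    ⟨1, ENNReal.one_lt_top, fun t => (hNκ i t univ).trans (hκ1 t)⟩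
  have hint : ∀ (K : Kernel α X) [IsFiniteKernel K] t,
      Integrable (fun x => (K.rnDeriv κ t x).toReal) (κ t) := fun K _ t =>
    (Measure.integrable_toReal_rnDeriv (μ := K t) (ν := κ t)).congr
      ((Kernel.rnDeriv_eq_rnDeriv_measure (κ := K) (η := κ) (a := t)).mono
        fun x hx => by simp only [hx])
  refine ⟨κ, fun i t x => b t * (((P i).rnDeriv κ t x).toReal - ((N i).rnDeriv κ t x).toReal), hκf,
    fun i => ?_, fun t i => ?_⟩
  · have h1 := (Kernel.measurable_rnDeriv (P i) κ).ennreal_toReal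
    have h2 := (Kernel.measurable_rnDeriv (N i) κ).ennreal_toReal
    exact (hbm.comp measurable_fst).mul (h1.sub h2)
  · have hi : Integrable (fun x => b t * (((P i).rnDeriv κ t x).toReal
        - ((N i).rnDeriv κ t x).toReal)) (κ t) := ((hint (P i) t).sub (hint (N i) t)).const_mul (b t)
    refine ⟨hi, ?_⟩
    ext A hA
    have hval : ∀ (K : Kernel α X) [IsFiniteKernel K], K t ≤ κ t →
        ∫ x in A, (K.rnDeriv κ t x).toReal ∂(κ t) = (K t).real A := fun K _ hK => by
      rw [← Measure.setIntegral_toReal_rnDeriv (Measure.absolutelyContinuous_of_le hK) A]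
      exact integral_congr_ae (ae_restrict_of_ae
        ((Kernel.rnDeriv_eq_rnDeriv_measure (κ := K) (η := κ) (a := t)).mono
          fun x hx => by simp only [hx]))
    change _ = (κ t).withDensityᵥ (fun x => b t * (((P i).rnDeriv κ t x).toReal
      - ((N i).rnDeriv κ t x).toReal)) A
    rw [withDensityᵥ_apply hi hA, integral_const_mul,
      integral_sub (hint (P i) t).integrableOn (hint (N i) t).integrableOn, hval _ (hPκ i t),
      hval _ (hNκ i t), hPt, hNt, (s i t).apply_eq_posPart_real_sub_negPart_real hA]
    simp only [measureReal_ennreal_smul_apply, ENNReal.toReal_ofReal (inv_nonneg.2 (hb0 t).le)]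
    have := (hb0 t).ne'
    field_simp

end Countable
end Families

/-! ### Measurable families of vector measures and their singular parts -/

section Families

variable {X : Type*} [MeasurableSpace X] {α : Type*} [MeasurableSpace α]
  {ι : Type*} [Fintype ι]

theorem withDensityᵥ_withDensity {m : Measure X} {r : X → ℝ≥0∞} (hr : Measurable r)
    (hr' : ∀ᵐ x ∂m, r x < ⊤) {f : X → ℝ} (hf : Integrable f (m.withDensity r)) :
    Integrable (fun x => (r x).toReal * f x) m ∧
      (m.withDensity r).withDensityᵥ f = m.withDensityᵥ fun x => (r x).toReal * f x := by
  have h1 : Integrable (fun x => (r x).toReal * f x) m := by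
    simpa using (integrable_withDensity_iff_integrable_smul₀' hr.aemeasurable hr').1 hf
  refine ⟨h1, ?_⟩
  ext A hA
  rw [withDensityᵥ_apply hf hA, withDensityᵥ_apply h1 hA,
    setIntegral_withDensity_eq_setIntegral_toReal_smul₀ hr.aemeasurable.restrict
      (ae_restrict_of_ae hr') _ hA]
  simp

variable [MeasurableSpace.CountablyGenerated X]

/-- The components have jointly measurable densities with respect to one finite kernel, and the
kernel has a jointly measurable Lebesgue decomposition. Splitting the kernel thus splits all
components at once, along a single singular set for each parameter, and yields both the variation of
the singular part and a jointly measurable absolutely continuous density. -/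
theorem exists_lebesgue_decomposition {Γ : α → VectorMeasure X (EuclideanSpace ℝ ι)}
    (hΓ : ∀ i A, MeasurableSet A → Measurable fun t => Γ t A i) (m : Measure X) [SigmaFinite m] :
    (Measurable fun t => (singularPart (Γ t) m).variation) ∧
    (∀ t, (singularPart (Γ t) m).variation ≤ (Γ t).variation) ∧
    ∃ g : ι → α × X → ℝ, (∀ i, Measurable (g i)) ∧ ∀ t,
      (∀ i, Integrable (fun x => g i (t, x)) m) ∧
      Γ t = singularPart (Γ t) m + m.withDensityᵥ (fun x => WithLp.toLp 2 fun i => g i (t, x)) ∧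
      m.withDensity (fun x => ‖(WithLp.toLp 2 fun i => g i (t, x) : EuclideanSpace ℝ ι)‖ₑ)
        ≤ (Γ t).variation := by
  obtain ⟨κ, θ, hκ, hθm, hθ⟩ := exists_kernel_density (s := fun i t => component (Γ t) i) hΓ
  -- The decomposition of kernels is applied to finite kernels, so `m` is replaced by an equivalent
  -- finite measure; the factor `q` converts densities back to `m`.
  set η : Kernel α X := Kernel.const α m.toFinite with hη
  have hηt : ∀ t, η t = m.toFinite := fun t => rfl
  set S : α → Set X := fun t => Kernel.mutuallySingularSetSlice κ η t with hS
  have hSm : ∀ t, MeasurableSet (S t) := fun t =>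
    Kernel.measurableSet_mutuallySingularSetSlice κ η t
  have hS0 : ∀ t, m (S t) = 0 := fun t => by
    have := Kernel.measure_mutuallySingularSetSlice κ η t
    rwa [hηt, toFinite_apply_eq_zero_iff] at this
  set q := m.toFinite.rnDeriv m with hq
  set r : α × X → ℝ≥0∞ := fun z => q z.2 * Kernel.rnDeriv κ η z.1 z.2 with hr
  have hqm : Measurable q := Measure.measurable_rnDeriv _ _
  have hrm : Measurable r := (hqm.comp measurable_snd).mul (Kernel.measurable_rnDeriv κ η)
  have hrt : ∀ t, Measurable fun x => r (t, x) := fun t => hrm.comp measurable_prodMk_left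
  -- Off the singular set the kernel has density `r` with respect to `m`; on the singular set, which
  -- is null for `m`, the density part has no mass.
  have hcompl : ∀ t, (κ t).restrict (S t)ᶜ = m.withDensity fun x => r (t, x) := by
    intro t
    have h1 : m.withDensity (fun x => r (t, x)) = η.withDensity (Kernel.rnDeriv κ η) t := by
      rw [Kernel.withDensity_apply _ (Kernel.measurable_rnDeriv κ η), hηt]
      conv_rhs => rw [← Measure.withDensity_rnDeriv_eq _ _ (toFinite_absolutelyContinuous m)]
      rw [← withDensity_mul _ hqm (Kernel.measurable_rnDeriv_right κ η t)]
      rfl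
    rw [h1]
    ext A hA
    rw [Measure.restrict_apply hA, ← Kernel.withDensity_rnDeriv_of_subset_compl_mutuallySingularSetSlice
      (hA.inter (hSm t).compl) (inter_subset_right (s := A)),
      ← measure_inter_add_sdiff (μ := (η.withDensity (κ.rnDeriv η)) t) A (hSm t),
      Kernel.withDensity_rnDeriv_of_subset_mutuallySingularSetSlice
      (inter_subset_right (s := A)), zero_add, Set.sdiff_eq]
  have hrfin : ∀ t, ∀ᵐ x ∂m, r (t, x) < ⊤ := fun t => by
    refine ae_lt_top (hrt t) ?_
    have h2 := congrArg (fun μ : Measure X => μ univ) (hcompl t)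
    simp only [withDensity_apply _ MeasurableSet.univ, Measure.restrict_univ] at h2
    rw [← h2]
    exact measure_ne_top _ _
  set g : ι → α × X → ℝ := fun i z => (r z).toReal * θ i z.1 z.2 with hg
  have hθc : ∀ t i, Integrable (θ i t) (m.withDensity fun x => r (t, x)) := fun t i =>
    hcompl t ▸ (hθ t i).1.restrict
  have hgi : ∀ t i, Integrable (fun x => g i (t, x)) m := fun t i =>
    (withDensityᵥ_withDensity (hrt t) (hrfin t) (hθc t i)).1
  have hθS : ∀ t i, Integrable (θ i t) ((κ t).restrict (S t)) := fun t i => (hθ t i).1.restrict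
  have hdec : ∀ t i, component (Γ t) i
      = ((κ t).restrict (S t)).withDensityᵥ (θ i t) + m.withDensityᵥ (fun x => g i (t, x)) := by
    intro t i
    rw [(hθ t i).2]
    have := (withDensityᵥ_withDensity (hrt t) (hrfin t) (hθc t i)).2
    rw [← show (m.withDensity fun x => r (t, x)).withDensityᵥ (θ i t)
      = m.withDensityᵥ (fun x => g i (t, x)) from this, ← hcompl]
    ext A hA
    rw [_root_.add_apply, withDensityᵥ_apply (hθ t i).1 hA,
      withDensityᵥ_apply (hθS t i) hA,
      withDensityᵥ_apply (hθ t i).1.restrict hA, Measure.restrict_restrict hA,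
      Measure.restrict_restrict hA, ← Set.sdiff_eq, integral_inter_add_sdiff (hSm t) (hθ t i).1.integrableOn]
  set Θ : α → X → EuclideanSpace ℝ ι := fun t x => WithLp.toLp 2 fun i => θ i t x with hΘ
  have hΘi : ∀ t, Integrable (Θ t) (κ t) := fun t => integrable_toLp fun i => (hθ t i).1
  have hΘm : Measurable fun z : α × X => ‖Θ z.1 z.2‖ₑ :=
    ((PiLp.continuous_toLp 2 fun _ : ι => ℝ).measurable.comp (measurable_pi_iff.2 hθm)).enorm
  have hvar : ∀ t, (singularPart (Γ t) m).variation
      = ((κ t).restrict (S t)).withDensity fun x => ‖Θ t x‖ₑ := fun t =>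
    variation_singularPart_eq (fun i => (hθ t i).1) (hgi t) (hSm t) (hS0 t) (hdec t)
  have hΓv : ∀ t, (Γ t).variation = (κ t).withDensity fun x => ‖Θ t x‖ₑ := fun t => by
    rw [← Measure.variation_withDensityᵥ (hΘi t)]
    congr 1
    refine vectorMeasure_ext fun i => ?_
    rw [component_withDensity (hΘi t)]
    exact (hθ t i).2
  refine ⟨?_, fun t => ?_, g, fun i => hrm.ennreal_toReal.mul (hθm i), fun t => ⟨hgi t, ?_, ?_⟩⟩
  · refine Measure.measurable_of_measurable_coe _ fun A hA => ?_
    have hMS := Kernel.measurableSet_mutuallySingularSet κ η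
    have : ∀ t, (singularPart (Γ t) m).variation A
        = ∫⁻ x, ((Kernel.mutuallySingularSet κ η) ∩ (Prod.snd ⁻¹' A)).indicator
            (fun z => ‖Θ z.1 z.2‖ₑ) (t, x) ∂(κ t) := fun t => by
      rw [hvar, withDensity_apply _ hA, Measure.restrict_restrict hA,
        ← lintegral_indicator (hA.inter (hSm t))]
      refine lintegral_congr fun x => ?_
      have : (x ∈ A ∩ S t) ↔ ((t, x) ∈ Kernel.mutuallySingularSet κ η ∩ (Prod.snd ⁻¹' A)) := by
        rw [inter_comm]; rfl
      by_cases hx : x ∈ A ∩ S t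
      · rw [indicator_of_mem hx, indicator_of_mem (this.1 hx)]
      · rw [indicator_of_notMem hx, indicator_of_notMem (mt this.2 hx)]
    simp_rw [this]
    exact Measurable.lintegral_kernel_prod_right'
      (hΘm.indicator (hMS.inter (measurable_snd hA)))
  · rw [hvar, hΓv, ← restrict_withDensity (hSm t)]
    exact Measure.restrict_le_self
  · exact (singularPart_eq_of_component (fun i => (hθ t i).1) (hgi t) (hSm t) (hS0 t) (hdec t)).2
  · have h3 : m.withDensityᵥ (fun x => (WithLp.toLp 2 fun i => g i (t, x) : EuclideanSpace ℝ ι))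
        = ((κ t).restrict (S t)ᶜ).withDensityᵥ (Θ t) := by
      refine vectorMeasure_ext fun i => ?_
      rw [component_withDensity (integrable_toLp (hgi t)), component_withDensity (hΘi t).restrict,
        hcompl]
      exact (withDensityᵥ_withDensity (hrt t) (hrfin t) (hθc t i)).2.symm
    rw [← Measure.variation_withDensityᵥ (integrable_toLp (hgi t)), h3,
      Measure.variation_withDensityᵥ (hΘi t).restrict, hΓv,
      ← restrict_withDensity (hSm t).compl]
    exact Measure.restrict_le_self

end Families

/-! ### Curves of vector measures -/

section Curves

variable {d : ℕ} {ι : Type*} [Fintype ι]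

/-- The masses need not be bounded uniformly in `t`; dividing by `1 + μ t univ` gives a finite
kernel, for which the measure of the sections of a measurable set is measurable. -/
theorem measurable_map_prodMk {X : Type*} [MeasurableSpace X] {μ : ℝ → Measure X}
    (hμ : Measurable μ) [∀ t, IsFiniteMeasure (μ t)] :
    Measurable fun t => (μ t).map fun x => (x, t) := by
  have hu : Measurable fun t => μ t univ := (Measure.measurable_coe MeasurableSet.univ).comp hμ
  set b : ℝ → ℝ≥0∞ := fun t => 1 + μ t univ with hb
  have hbm : Measurable b := measurable_const.add hu
  have hb0 : ∀ t, b t ≠ 0 := fun t => by simp [hb]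
  have hbt : ∀ t, b t ≠ ⊤ := fun t => by simp [hb]
  have hκm : Measurable fun t => (b t)⁻¹ • μ t :=
    Measure.measurable_of_measurable_coe _ fun A hA => by
      simp only [Measure.smul_apply, smul_eq_mul]
      exact hbm.inv.mul ((Measure.measurable_coe hA).comp hμ)
  set κ : Kernel ℝ X := ⟨_, hκm⟩ with hκ
  have hκt : ∀ t, κ t = (b t)⁻¹ • μ t := fun t => rfl
  have hκf : IsFiniteKernel κ := ⟨1, ENNReal.one_lt_top, fun t => by
    rw [hκt, Measure.smul_apply, smul_eq_mul]
    rw [mul_comm, ← div_eq_mul_inv]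
    exact ENNReal.div_le_of_le_mul (by rw [one_mul]; exact le_add_self)⟩
  refine Measure.measurable_of_measurable_coe _ fun A hA => ?_
  have hA' : MeasurableSet (Prod.swap ⁻¹' A : Set (ℝ × X)) := measurable_swap hA
  have e : ∀ t, (μ t).map (fun x => (x, t)) A = b t * κ t (Prod.mk t ⁻¹' (Prod.swap ⁻¹' A)) := by
    intro t
    rw [Measure.map_apply measurable_prodMk_right hA, hκt, Measure.smul_apply, smul_eq_mul,
      ← mul_assoc, ENNReal.mul_inv_cancel (hb0 t) (hbt t), one_mul]
    rfl
  simp_rw [e]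
  exact hbm.mul (Kernel.measurable_kernel_prodMk_left hA')

theorem lintegral_tensorTime {T : ℝ} {μ : ℝ → Measure (E d)} (hμ : Measurable μ)
    [∀ t, IsFiniteMeasure (μ t)] {f : E d × ℝ → ℝ≥0∞} (hf : Measurable f) :
    ∫⁻ z, f z ∂(tensorTime T μ) = ∫⁻ t in Ioo 0 T, ∫⁻ x, f (x, t) ∂(μ t) := by
  rw [tensorTime, Measure.lintegral_bind (measurable_map_prodMk hμ).aemeasurable hf.aemeasurable]
  exact lintegral_congr fun t => lintegral_map hf measurable_prodMk_right

theorem tensorTime_congr {T : ℝ} {μ μ' : ℝ → Measure (E d)}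
    (h : μ =ᵐ[volume.restrict (Ioo 0 T)] μ') : tensorTime T μ = tensorTime T μ' := by
  refine Measure.bind_congr_right (h.mono fun t ht => ?_)
  simp only [ht]

/-- A family of vector measures that is almost everywhere measurable agrees off a null set with a
measurable one. -/
theorem exists_measurable_modification {X : Type*} [MeasurableSpace X]
    [MeasurableSpace.CountablyGenerated X] {m : Measure ℝ}
    {Γ : ℝ → VectorMeasure X (EuclideanSpace ℝ ι)}
    (hΓ : ∀ i A, MeasurableSet A → AEMeasurable (fun t => Γ t A i) m) :
    ∃ Γ' : ℝ → VectorMeasure X (EuclideanSpace ℝ ι), (∀ᵐ t ∂m, Γ t = Γ' t) ∧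
      ∀ i A, MeasurableSet A → Measurable fun t => Γ' t A i := by
  set 𝒜 := generateSetAlgebra (MeasurableSpace.countableGeneratingSet X) with h𝒜
  have hgen := (generateFrom_generateSetAlgebra_eq (𝒜 := MeasurableSpace.countableGeneratingSet X)).trans
    (MeasurableSpace.generateFrom_countableGeneratingSet)
  have hc : 𝒜.Countable :=
    countable_generateSetAlgebra MeasurableSpace.countable_countableGeneratingSet
  have hAm : ∀ A ∈ 𝒜, MeasurableSet A := fun A hA => by
    rw [← hgen]; exact MeasurableSpace.measurableSet_generateFrom hA
  have hct := hc.to_subtype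
  have hae : ∀ᵐ t ∂m, ∀ (B : 𝒜) (i : ι), Γ t B i = (hΓ i B (hAm B B.2)).mk _ t :=
    ae_all_iff.2 fun B => ae_all_iff.2 fun i => (hΓ i B (hAm B B.2)).ae_eq_mk
  -- On a countable algebra generating the σ-algebra, the exceptional sets of all measurable
  -- versions fit in one null set. The family is put to zero there, and the measurability spreads
  -- from the algebra to all sets by the π-λ theorem.
  set N := toMeasurable m {t | ¬ ∀ (B : 𝒜) (i : ι), Γ t B i = (hΓ i B (hAm B B.2)).mk _ t} with hN
  have hNm : MeasurableSet N := measurableSet_toMeasurable _ _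
  have hN0 : m N = 0 := by rw [hN, measure_toMeasurable]; exact hae
  classical
  set Γ' : ℝ → VectorMeasure X (EuclideanSpace ℝ ι) := fun t => if t ∈ N then 0 else Γ t with hΓ'
  refine ⟨Γ', ?_, fun i A hA => ?_⟩
  · have : ∀ᵐ t ∂m, t ∉ N := measure_eq_zero_iff_ae_notMem.1 hN0
    exact this.mono fun t ht => by simp [hΓ', ht]
  have base : ∀ B ∈ 𝒜, Measurable fun t => Γ' t B i := by
    intro B hB
    have : (fun t => Γ' t B i) = Nᶜ.indicator ((hΓ i B (hAm B hB)).mk _) := by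
      funext t
      by_cases ht : t ∈ N
      · simp [hΓ', ht]
      · have h1 : t ∉ {t | ¬ ∀ (B : 𝒜) (i : ι), Γ t B i = (hΓ i B (hAm B B.2)).mk _ t} :=
          fun h => ht (subset_toMeasurable _ _ h)
        have h2 := not_not.1 h1 ⟨B, hB⟩ i
        simpa [hΓ', ht] using h2
    rw [this]
    exact (AEMeasurable.measurable_mk _).indicator hNm.compl
  have hπ : IsPiSystem 𝒜 := isSetAlgebra_generateSetAlgebra.isSetRing.isSetSemiring.isPiSystem
  have hval : ∀ t B, MeasurableSet B → Γ' t Bᶜ i = Γ' t univ i - Γ' t B i := fun t B hB => by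
    have h := (component (Γ' t) i).of_add_of_sdiff hB MeasurableSet.univ (subset_univ B)
    simp only [component_apply, ← compl_eq_univ_sdiff] at h
    linarith
  refine MeasurableSpace.induction_on_inter (C := fun A _ => Measurable fun t => Γ' t A i)
    hgen.symm hπ ?_ base ?_ ?_ A hA
  · simp
  · intro B hB h
    simp_rw [hval _ B hB]
    exact (base _ isSetAlgebra_generateSetAlgebra.univ_mem).sub h
  · intro f hd hf h
    have hs : ∀ t, HasSum (fun n => Γ' t (f n) i) (Γ' t (⋃ n, f n) i) := fun t =>
      (component (Γ' t) i).m_iUnion hf hd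
    refine measurable_of_tendsto_metrizable
      (f := fun (n : ℕ) t => ∑ k ∈ Finset.range n, Γ' t (f k) i) (fun n => ?_)
      (tendsto_pi_nhds.2 fun t => (hs t).tendsto_sum_nat)
    exact Finset.measurable_fun_sum _ fun k _ => h k

/-- The Lebesgue decomposition at each time is integrated in time. The function `a` stands for the
pairing of the curve with `ψ`, which is only known at almost every time. -/
theorem exists_curve_density_of_measurable {T : ℝ} {Q : Set (E d)} (hQ : MeasurableSet Q)
    {Γ : ℝ → VectorMeasure (E d) (EuclideanSpace ℝ ι)}
    (hΓ : ∀ i A, MeasurableSet A → Measurable fun t => Γ t A i)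
    (hfin : ∫⁻ t in Ioo 0 T, (Γ t).variation univ < ⊤)
    (hconc : ∀ᵐ t ∂volume.restrict (Ioo 0 T), (Γ t).variation Qᶜ = 0) :
    IsFiniteMeasure (singTensorTime T Γ) ∧ singTensorTime T Γ (Q ×ˢ Ioo 0 T)ᶜ = 0 ∧
    ∃ g : ι → E d × ℝ → ℝ, (∀ i, Measurable (g i) ∧ IntegrableOn (g i) (Q ×ˢ Ioo 0 T)) ∧
      ∀ ψ : E d × ℝ → ℝ, BddMeas ψ → ∀ i (a : ℝ → ℝ), IntegrableOn a (Ioo 0 T) →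
      (∀ᵐ t ∂volume.restrict (Ioo 0 T), a t = (∫ᵛ x, ψ (x, t) ∂•(Γ t)) i) →
      ‖(∫ t in Ioo 0 T, a t) - ∫ z in Q ×ˢ Ioo 0 T, ψ z * g i z‖ₑ
        ≤ ∫⁻ z, ‖ψ z‖ₑ ∂(singTensorTime T Γ) := by
  obtain ⟨hm, hle, g, hgm, hg⟩ := exists_lebesgue_decomposition hΓ (volume : Measure (E d))
  have hlint : ∀ {f : E d × ℝ → ℝ≥0∞}, Measurable f → ∫⁻ z, f z ∂(singTensorTime T Γ)
      = ∫⁻ t in Ioo 0 T, ∫⁻ x, f (x, t) ∂(singularPart (Γ t) volume).variation :=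
    fun hf => lintegral_tensorTime hm hf
  have hcyl : MeasurableSet (Q ×ˢ Ioo 0 T) := hQ.prod measurableSet_Ioo
  have hle' : ∀ i t, ∫⁻ x, ‖g i (t, x)‖ₑ ≤ (Γ t).variation univ := fun i t => by
    refine le_trans ?_ ((hg t).2.2 univ)
    rw [withDensity_apply _ MeasurableSet.univ, Measure.restrict_univ]
    refine lintegral_mono fun x => ?_
    exact enorm_le_iff_norm_le.2 (by
      simpa using PiLp.norm_apply_le (WithLp.toLp 2 fun i => g i (t, x) : EuclideanSpace ℝ ι) i)
  have hres : (volume : Measure (E d × ℝ)).restrict (Q ×ˢ Ioo 0 T)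
      = (volume.restrict Q).prod (volume.restrict (Ioo 0 T)) := by
    rw [Measure.volume_eq_prod, Measure.prod_restrict]
  have hgm' : ∀ i, Measurable fun z : E d × ℝ => g i (z.2, z.1) := fun i =>
    (hgm i).comp measurable_swap
  have hgi : ∀ i, IntegrableOn (fun z : E d × ℝ => g i (z.2, z.1)) (Q ×ˢ Ioo 0 T) := fun i => by
    refine ⟨(hgm' i).aestronglyMeasurable, ?_⟩
    rw [hasFiniteIntegral_iff_enorm, hres, lintegral_prod_symm' _ (hgm' i).enorm]
    refine lt_of_le_of_lt (lintegral_mono fun t => ?_) hfin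
    exact (lintegral_mono' Measure.restrict_le_self le_rfl).trans (hle' i t)
  refine ⟨⟨?_⟩, ?_, fun i z => g i (z.2, z.1), fun i => ⟨hgm' i, hgi i⟩, ?_⟩
  · have := hlint (f := fun _ => 1) measurable_const
    rw [lintegral_one] at this
    rw [this]
    refine lt_of_le_of_lt (lintegral_mono fun t => ?_) hfin
    rw [lintegral_one]
    exact hle t univ
  · rw [← lintegral_indicator_one hcyl.compl, hlint (measurable_one.indicator hcyl.compl)]
    · refine (lintegral_congr_ae (g := fun _ => 0) ?_).trans lintegral_zero
      filter_upwards [hconc, ae_restrict_mem measurableSet_Ioo] with t ht ht'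
      have : ∀ x, (Q ×ˢ Ioo 0 T)ᶜ.indicator (1 : E d × ℝ → ℝ≥0∞) (x, t) = Qᶜ.indicator 1 x := by
        intro x
        by_cases hx : x ∈ Q
        · rw [indicator_of_notMem (not_not.2 ⟨hx, ht'⟩), indicator_of_notMem (not_not.2 hx)]
        · rw [indicator_of_mem (show (x, t) ∈ (Q ×ˢ Ioo 0 T)ᶜ from fun h => hx h.1),
            indicator_of_mem (show x ∈ Qᶜ from hx)]
          rfl
      change ∫⁻ x, (Q ×ˢ Ioo 0 T)ᶜ.indicator (1 : E d × ℝ → ℝ≥0∞) (x, t) ∂_ = 0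
      simp_rw [this]
      rw [lintegral_indicator_one hQ.compl]
      exact le_antisymm ((hle t _).trans ht.le) bot_le
  · intro ψ hψ i a ha hae
    obtain ⟨C, hC⟩ := hψ.bdd
    have hψt : ∀ t, BddMeas fun x => ψ (x, t) := fun t =>
      ⟨hψ.measurable.comp measurable_prodMk_right, ⟨C, fun x => hC (x, t)⟩⟩
    have hi : Integrable (fun z => ψ z * g i (z.2, z.1)) ((volume.restrict Q).prod (volume.restrict (Ioo 0 T))) := by
      rw [← hres]
      exact (hgi i).bdd_mul (c := C) hψ.measurable.aestronglyMeasurable (ae_of_all _ hC)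
    rw [hres, integral_prod_symm _ hi, ← integral_sub ha hi.integral_prod_right,
      hlint hψ.measurable.enorm]
    refine (enorm_integral_le_lintegral_enorm _).trans (lintegral_mono_ae ?_)
    filter_upwards [hae, hconc] with t ht hct
    rw [ht]
    have h1 := enorm_vectorIntegral_sub_le (integrable_toLp (hg t).1) (hg t).2.1 (hψt t)
    refine le_trans (le_of_eq_of_le ?_ (enorm_le_iff_norm_le.2 (PiLp.norm_apply_le
      (∫ᵛ x, ψ (x, t) ∂•(Γ t) - ∫ x, ψ (x, t) •
        (WithLp.toLp 2 fun i => g i (t, x) : EuclideanSpace ℝ ι)) i))) h1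
    congr 1
    have hbi : Integrable (fun x => ψ (x, t) •
        (WithLp.toLp 2 fun i => g i (t, x) : EuclideanSpace ℝ ι)) volume :=
      (integrable_toLp (hg t).1).bdd_smul C (hψt t).measurable.aestronglyMeasurable
        (ae_of_all _ fun x => hC (x, t))
    have h2 : (∫ x, ψ (x, t) • (WithLp.toLp 2 fun i => g i (t, x) : EuclideanSpace ℝ ι)) i
        = ∫ x, ψ (x, t) * g i (t, x) := by
      have := (EuclideanSpace.proj i : EuclideanSpace ℝ ι →L[ℝ] ℝ).integral_comp_comm hbi
      simpa using this.symm
    rw [PiLp.sub_apply, h2]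
    congr 1
    -- The absolutely continuous part is dominated by the variation, which is concentrated on `Q`;
    -- hence the density vanishes almost everywhere outside `Q`.
    refine setIntegral_eq_integral_of_ae_compl_eq_zero ?_
    have h3 : (volume.withDensity fun x =>
        ‖(WithLp.toLp 2 fun i => g i (t, x) : EuclideanSpace ℝ ι)‖ₑ) Qᶜ = 0 :=
      le_antisymm (((hg t).2.2 _).trans hct.le) bot_le
    have hGm : Measurable fun x => ‖(WithLp.toLp 2 fun i => g i (t, x) : EuclideanSpace ℝ ι)‖ₑ :=
      ((PiLp.continuous_toLp 2 fun _ : ι => ℝ).measurable.comp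
        (measurable_pi_iff.2 fun i => (hgm i).comp measurable_prodMk_left)).enorm
    rw [withDensity_apply _ hQ.compl, lintegral_eq_zero_iff hGm] at h3
    rw [EventuallyEq, ae_restrict_iff' hQ.compl] at h3
    filter_upwards [h3] with x hx hxQ
    have h4 : (WithLp.toLp 2 fun i => g i (t, x) : EuclideanSpace ℝ ι) = 0 := by
      simpa using hx hxQ
    have h5 := congrArg (fun v : EuclideanSpace ℝ ι => v i) h4
    simp only [PiLp.zero_apply] at h5
    rw [h5, mul_zero]

theorem exists_curve_density {T : ℝ} {Q : Set (E d)} (hQ : MeasurableSet Q)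
    {Γ : ℝ → VectorMeasure (E d) (EuclideanSpace ℝ ι)}
    (hΓ : ∀ i A, MeasurableSet A → AEMeasurable (fun t => Γ t A i) (volume.restrict (Ioo 0 T)))
    (hfin : ∫⁻ t in Ioo 0 T, (Γ t).variation univ < ⊤)
    (hconc : ∀ᵐ t ∂volume.restrict (Ioo 0 T), (Γ t).variation Qᶜ = 0) :
    IsFiniteMeasure (singTensorTime T Γ) ∧ singTensorTime T Γ (Q ×ˢ Ioo 0 T)ᶜ = 0 ∧
    ∃ g : ι → E d × ℝ → ℝ, (∀ i, Measurable (g i) ∧ IntegrableOn (g i) (Q ×ˢ Ioo 0 T)) ∧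
      ∀ ψ : E d × ℝ → ℝ, BddMeas ψ → ∀ i (a : ℝ → ℝ), IntegrableOn a (Ioo 0 T) →
      (∀ᵐ t ∂volume.restrict (Ioo 0 T), a t = (∫ᵛ x, ψ (x, t) ∂•(Γ t)) i) →
      ‖(∫ t in Ioo 0 T, a t) - ∫ z in Q ×ˢ Ioo 0 T, ψ z * g i z‖ₑ
        ≤ ∫⁻ z, ‖ψ z‖ₑ ∂(singTensorTime T Γ) := by
  obtain ⟨Γ', hae, hΓ'⟩ := exists_measurable_modification hΓ
  have e : singTensorTime T Γ = singTensorTime T Γ' :=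
    tensorTime_congr (hae.mono fun t ht => by simp only [ht])
  have hfin' : ∫⁻ t in Ioo 0 T, (Γ' t).variation univ < ⊤ := by
    refine lt_of_eq_of_lt (lintegral_congr_ae (hae.mono fun t ht => ?_)) hfin
    simp only [ht]
  obtain ⟨h1, h2, g, hg, h3⟩ := exists_curve_density_of_measurable hQ hΓ' hfin'
    (hconc.mp (hae.mono fun t ht h => by rwa [← ht]))
  rw [e]
  exact ⟨h1, h2, g, hg, fun ψ hψ i a ha haa => h3 ψ hψ i a ha
    (haa.mp (hae.mono fun t ht h => by rwa [← ht]))⟩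

end Curves

/-! ### Measurability in time of curves of distributional gradients -/

section TimeMeasurability

variable {d : ℕ} {ι : Type*} [Fintype ι]

theorem vectorMeasure_inter_eq {X : Type*} [MeasurableSpace X] {V : Type*} [NormedAddCommGroup V]
    {Γ : VectorMeasure X V} {Q : Set X} (hQ : MeasurableSet Q) (h : Γ.variation Qᶜ = 0)
    {A : Set X} (hA : MeasurableSet A) : Γ (A ∩ Q) = Γ A := by
  have h1 : Γ (A \ Q) = 0 := by
    have := VectorMeasure.enorm_measure_le_variation Γ (A \ Q)
    have h2 : Γ.variation (A \ Q) = 0 := measure_mono_null (fun x hx => hx.2) h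
    rw [h2] at this
    simpa using this
  have := Γ.of_add_of_sdiff (hA.inter hQ) hA inter_subset_left
  rw [sdiff_self_inter, h1, add_zero] at this
  exact this

/-- Test functions approximate the indicators of the sets `Ψ ⁻¹' V` with `V` open, and the π-λ
theorem extends the measurability to all preimages of Borel sets. Since `Ψ` is injective on `Q`,
these are all Borel subsets of `Q`. The map `Ψ` is there for the torus, whose test functions only
see points modulo the lattice. -/
theorem aemeasurable_apply_of_tests {m : Measure ℝ} {X Y : Type*} [MeasurableSpace X]
    [StandardBorelSpace X]
    [TopologicalSpace Y] [MeasurableSpace Y] [BorelSpace Y] [SecondCountableTopology Y] [T2Space Y]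
    {Q : Set X} (hQ : MeasurableSet Q) {Ψ : X → Y} (hΨ : Measurable Ψ) (hinj : InjOn Ψ Q)
    {Γ : ℝ → VectorMeasure X (EuclideanSpace ℝ ι)} (hconc : ∀ᵐ t ∂m, (Γ t).variation Qᶜ = 0)
    (htest : ∀ V, IsOpen V → ∃ φ : ℕ → X → ℝ, (∀ n, Measurable (φ n)) ∧ (∀ n x, |φ n x| ≤ 1) ∧
      (∀ x ∈ Q, Tendsto (fun n => φ n x) atTop (𝓝 ((Ψ ⁻¹' V).indicator (fun _ => 1) x))) ∧
      ∀ n i, AEMeasurable (fun t => (∫ᵛ x, φ n x ∂•(Γ t)) i) m)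
    (i : ι) (A : Set X) (hA : MeasurableSet A) : AEMeasurable (fun t => Γ t A i) m := by
  have base : ∀ V, IsOpen V → AEMeasurable (fun t => Γ t (Ψ ⁻¹' V ∩ Q) i) m := by
    intro V hV
    obtain ⟨φ, hφm, hφ1, hφ, hae⟩ := htest V hV
    refine aemeasurable_of_tendsto_metrizable_ae atTop (fun n => hae n i) ?_
    filter_upwards [hconc] with t ht
    have hVm : MeasurableSet (Ψ ⁻¹' V ∩ Q) := (hΨ hV.measurableSet).inter hQ
    have h1 : Tendsto (fun n => ∫ᵛ x, φ n x ∂•(Γ t)) atTop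
        (𝓝 (∫ᵛ x, (Ψ ⁻¹' V ∩ Q).indicator (fun _ => (1 : ℝ)) x ∂•(Γ t))) := by
      refine VectorMeasure.tendsto_integral_filter_of_norm_le_const
        (Eventually.of_forall fun n => (hφm n).aestronglyMeasurable)
        ⟨1, Eventually.of_forall fun n => ae_of_all _ (hφ1 n)⟩ ?_
      rw [← compl_mem_ae_iff, compl_compl] at ht
      filter_upwards [ht] with x hx
      have := hφ x hx
      rwa [show (Ψ ⁻¹' V ∩ Q).indicator (fun _ => (1 : ℝ)) x
        = (Ψ ⁻¹' V).indicator (fun _ => (1 : ℝ)) x from by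
          by_cases h : x ∈ Ψ ⁻¹' V
          · rw [indicator_of_mem h, indicator_of_mem (show x ∈ Ψ ⁻¹' V ∩ Q from ⟨h, hx⟩)]
          · rw [indicator_of_notMem h,
              indicator_of_notMem (show x ∉ Ψ ⁻¹' V ∩ Q from fun h' => h h'.1)]]
    rw [vectorIntegral_indicator _ hVm] at h1
    exact ((EuclideanSpace.proj i : EuclideanSpace ℝ ι →L[ℝ] ℝ).continuous.tendsto _).comp h1
  have main : ∀ B : Set Y, MeasurableSet B → AEMeasurable (fun t => Γ t (Ψ ⁻¹' B ∩ Q) i) m := by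
    intro B hB
    have hp : ∀ B, MeasurableSet B → MeasurableSet (Ψ ⁻¹' B ∩ Q) := fun B hB => (hΨ hB).inter hQ
    refine MeasurableSpace.induction_on_inter
      (C := fun B _ => AEMeasurable (fun t => Γ t (Ψ ⁻¹' B ∩ Q) i) m)
      BorelSpace.measurable_eq isPiSystem_isOpen ?_
      (fun V hV => base V hV) ?_ ?_ B hB
    · simp
    · intro B hB h
      have e : ∀ t, Γ t (Ψ ⁻¹' Bᶜ ∩ Q) i = Γ t (Ψ ⁻¹' univ ∩ Q) i - Γ t (Ψ ⁻¹' B ∩ Q) i := by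
        intro t
        have h := (component (Γ t) i).of_add_of_sdiff (hp B hB) (hp univ MeasurableSet.univ)
          (inter_subset_inter_left _ (preimage_mono (subset_univ B)))
        have h' : (Ψ ⁻¹' univ ∩ Q) \ (Ψ ⁻¹' B ∩ Q) = Ψ ⁻¹' Bᶜ ∩ Q := by
          ext x; simp only [preimage_univ, univ_inter, Set.mem_sdiff, mem_inter_iff, mem_preimage, mem_compl_iff]
          tauto
        rw [h'] at h
        simp only [component_apply] at h
        linarith
      simp_rw [e]
      exact (base univ isOpen_univ).sub h
    · intro f hd hf h
      have hs : ∀ t, HasSum (fun n => Γ t (Ψ ⁻¹' (f n) ∩ Q) i) (Γ t (Ψ ⁻¹' (⋃ n, f n) ∩ Q) i) := by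
        intro t
        rw [preimage_iUnion, iUnion_inter]
        exact (component (Γ t) i).m_iUnion (fun n => hp _ (hf n)) fun a b hab =>
          (Disjoint.preimage Ψ (hd hab)).mono inter_subset_left inter_subset_left
      refine aemeasurable_of_tendsto_metrizable_ae atTop
        (f := fun (n : ℕ) t => ∑ k ∈ Finset.range n, Γ t (Ψ ⁻¹' (f k) ∩ Q) i) (fun n => ?_)
        (ae_of_all _ fun t => (hs t).tendsto_sum_nat)
      exact Finset.aemeasurable_fun_sum _ fun k _ => h k
  -- Lusin-Souslin: the injective measurable image of a Borel set is Borel.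
  have hB : MeasurableSet (Ψ '' (A ∩ Q)) :=
    (hA.inter hQ).image_of_measurable_injOn hΨ (hinj.mono inter_subset_right)
  refine (main _ hB).congr (hconc.mono fun t ht => ?_)
  have e : Ψ ⁻¹' (Ψ '' (A ∩ Q)) ∩ Q = A ∩ Q := by
    ext x
    constructor
    · rintro ⟨⟨y, hy, hxy⟩, hx⟩
      rwa [← hinj hy.2 hx hxy]
    · exact fun hx => ⟨⟨x, hx, rfl⟩, hx.2⟩
  simp only [e, vectorMeasure_inter_eq hQ ht hA]

theorem FlowDomain.measurableSet_cell (𝒟 : FlowDomain d) : MeasurableSet 𝒟.cell := by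
  cases 𝒟 with
  | openSet Ω => exact Ω.isOpen.measurableSet
  | torus =>
    have : FlowDomain.cell (FlowDomain.torus : FlowDomain d)
        = ⋂ i, (fun x : E d => x i) ⁻¹' Ico 0 1 := by
      ext x; simp [FlowDomain.cell]
    rw [this]
    exact MeasurableSet.iInter fun i =>
      (EuclideanSpace.proj i : E d →L[ℝ] ℝ).continuous.measurable measurableSet_Ico

/-- A smooth nonnegative function `f` with support set exactly `V` is amplified and cut off: the
factor `smoothTransition ((n + 1) f - 1)` vanishes where `f < 1 / (n + 1)`, which keeps the
topological support inside `V`, and it eventually equals one at each point of `V`. The bumps give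
compact support. -/
theorem exists_smooth_tendsto_indicator {Y : Type*} [NormedAddCommGroup Y] [NormedSpace ℝ Y]
    [FiniteDimensional ℝ Y] {V : Set Y} (hV : IsOpen V) :
    ∃ φ : ℕ → Y → ℝ, (∀ n, ContDiff ℝ ∞ (φ n)) ∧ (∀ n y, |φ n y| ≤ 1) ∧
      (∀ n, HasCompactSupport (φ n)) ∧ (∀ n, tsupport (φ n) ⊆ V) ∧
      ∀ y, Tendsto (fun n => φ n y) atTop (𝓝 (V.indicator (fun _ => 1) y)) := by
  obtain ⟨f, hfs, hf, hfr⟩ := hV.exists_contDiff_support_eq (n := ⊤)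
  have hf' : ContDiff ℝ ∞ f := hf
  let b : ∀ n : ℕ, ContDiffBump (0 : Y) := fun n =>
    ⟨(n : ℝ) + 1, (n : ℝ) + 2, by positivity, by linarith⟩
  have hz : ∀ n y, (n + 1 : ℝ) * f y - 1 ≤ 0 → Real.smoothTransition ((n + 1) * f y - 1) = 0 :=
    fun n y h => Real.smoothTransition.zero_of_nonpos h
  refine ⟨fun n y => Real.smoothTransition ((n + 1) * f y - 1) * b n y, fun n => ?_, fun n y => ?_,
    fun n => ?_, fun n => ?_, fun y => ?_⟩
  · exact (Real.smoothTransition.contDiff.comp ((contDiff_const.mul hf').sub contDiff_const)).mul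
      (b n).contDiff
  · rw [abs_of_nonneg (mul_nonneg (Real.smoothTransition.nonneg _) (b n).nonneg)]
    exact mul_le_one₀ (Real.smoothTransition.le_one _) (b n).nonneg (b n).le_one
  · exact (b n).hasCompactSupport.mul_left
  · have hcl : IsClosed {y | 1 ≤ (n + 1 : ℝ) * f y} :=
      isClosed_le continuous_const (continuous_const.mul hf'.continuous)
    refine (closure_minimal (fun y hy => ?_) hcl).trans fun y hy => ?_
    · by_contra h
      rw [Set.mem_ofPred, not_le] at h
      exact hy (by simp only [hz n y (by linarith), zero_mul])
    · rw [← hfs, Function.mem_support]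
      intro h
      rw [Set.mem_ofPred, h] at hy
      norm_num at hy
  · have hb : Tendsto (fun n => b n y) atTop (𝓝 1) := by
      refine tendsto_const_nhds.congr' ?_
      obtain ⟨N, hN⟩ := exists_nat_ge ‖y‖
      filter_upwards [eventually_ge_atTop N] with n hn
      refine ((b n).one_of_mem_closedBall ?_).symm
      rw [mem_closedBall_zero_iff]
      have : (N : ℝ) ≤ n := by exact_mod_cast hn
      change ‖y‖ ≤ (n : ℝ) + 1
      linarith
    by_cases hy : y ∈ V
    · rw [indicator_of_mem hy]
      have hpos : 0 < |f y| := abs_pos.2 (by rw [← hfs] at hy; exact hy)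
      have hfy : 0 < f y := lt_of_le_of_ne (hfr ⟨y, rfl⟩).1 (abs_pos.1 hpos).symm
      have : Tendsto (fun n : ℕ => Real.smoothTransition ((n + 1) * f y - 1)) atTop (𝓝 1) := by
        refine tendsto_const_nhds.congr' ?_
        obtain ⟨N, hN⟩ := exists_nat_ge (2 / f y)
        filter_upwards [eventually_ge_atTop N] with n hn
        refine (Real.smoothTransition.one_of_one_le ?_).symm
        have h1 : (N : ℝ) ≤ n := by exact_mod_cast hn
        have h2 : 2 ≤ (n : ℝ) * f y := by
          rw [← div_le_iff₀ hfy]; linarith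
        linarith
      simpa using this.mul hb
    · rw [indicator_of_notMem hy]
      have : f y = 0 := by
        by_contra h
        exact hy (hfs ▸ h)
      refine tendsto_const_nhds.congr fun n => ?_
      beta_reduce
      rw [hz n y (by rw [this]; norm_num), zero_mul]

theorem FlowDomain.aemeasurable_apply {𝒟 : FlowDomain d} {m : Measure ℝ}
    {Γ : ℝ → VectorMeasure (E d) (EuclideanSpace ℝ ι)}
    (hconc : ∀ᵐ t ∂m, (Γ t).variation 𝒟.cellᶜ = 0)
    (h : ∀ φ, 𝒟.IsTest φ → ∀ i, AEMeasurable (fun t => (∫ᵛ x, φ x ∂•(Γ t)) i) m)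
    (i : ι) (A : Set (E d)) (hA : MeasurableSet A) : AEMeasurable (fun t => Γ t A i) m := by
  cases 𝒟 with
  | openSet Ω =>
    refine aemeasurable_apply_of_tests (Q := (Ω : Set (E d))) Ω.isOpen.measurableSet measurable_id
      (injOn_id _) hconc (fun V hV => ?_) i A hA
    obtain ⟨φ, h1, h2, h3, h4, h5⟩ := exists_smooth_tendsto_indicator (hV.inter Ω.isOpen)
    refine ⟨φ, fun n => (h1 n).continuous.measurable, h2, fun x hx => ?_,
      fun n => h _ ⟨h1 n, h3 n, (h4 n).trans inter_subset_right⟩⟩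
    have := h5 x
    by_cases hxV : x ∈ V
    · rw [indicator_of_mem (show x ∈ V ∩ Ω from ⟨hxV, hx⟩)] at this
      have e : (id ⁻¹' V).indicator (fun _ => (1 : ℝ)) x = 1 := indicator_of_mem (s := id ⁻¹' V) hxV _
      simpa only [e] using this
    · rw [indicator_of_notMem (fun h => hxV h.1)] at this
      have e : (id ⁻¹' V).indicator (fun _ => (1 : ℝ)) x = 0 :=
        indicator_of_notMem (s := id ⁻¹' V) hxV _
      simpa only [e] using this
  | torus =>
    -- The torus is embedded by its exponentials: functions of `Ψ` are automatically periodic, and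
    -- `Ψ` is injective on the half open cell.
    set Ψ : E d → Fin d → ℂ := fun x j => Complex.exp ((x j : ℂ) * (2 * Real.pi * Complex.I)) with hΨ
    have hΨc : ContDiff ℝ ∞ Ψ := by
      refine contDiff_pi.2 fun j => ?_
      have hj : ContDiff ℝ ∞ fun x : E d => ((x j : ℝ) : ℂ) :=
        Complex.ofRealCLM.contDiff.comp (EuclideanSpace.proj j : E d →L[ℝ] ℝ).contDiff
      exact (Complex.contDiff_exp (𝕜 := ℝ)).comp (hj.mul contDiff_const)
    have hper : ∀ x k, Ψ (x + unitVec k) = Ψ x := by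
      intro x k
      funext j
      by_cases hjk : j = k
      · subst hjk
        simp [hΨ, unitVec, add_mul, Complex.exp_add, Complex.exp_two_pi_mul_I]
      · simp [hΨ, unitVec, hjk]
    have hinj : InjOn Ψ (FlowDomain.torus : FlowDomain d).cell := by
      intro x hx y hy hxy
      ext j
      obtain ⟨n, hn⟩ := Complex.exp_eq_exp_iff_exists_int.1 (congrFun hxy j)
      rw [← add_mul] at hn
      have h2 := mul_right_cancel₀ Complex.two_pi_I_ne_zero hn
      have h3 : x j = y j + n := by exact_mod_cast h2
      have hx' := hx j
      have hy' := hy j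
      have h4 : (n : ℝ) < 1 := by linarith [hx'.2, hy'.1]
      have h5 : (-1 : ℝ) < n := by linarith [hx'.1, hy'.2]
      have h6 : n < 1 := by exact_mod_cast h4
      have h7 : -1 < n := by exact_mod_cast h5
      have h8 : n = 0 := by omega
      rw [h3, h8]; simp
    refine aemeasurable_apply_of_tests (FlowDomain.measurableSet_cell _) hΨc.continuous.measurable
      hinj hconc (fun V hV => ?_) i A hA
    obtain ⟨φ, h1, h2, -, -, h5⟩ := exists_smooth_tendsto_indicator hV
    refine ⟨fun n x => φ n (Ψ x), fun n => ((h1 n).continuous.comp hΨc.continuous).measurable,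
      fun n x => h2 n _, fun x _ => h5 (Ψ x),
      fun n => h _ ⟨(h1 n).comp hΨc, fun x k => by simp only [hper]⟩⟩

end TimeMeasurability

/-! ### Localization to bounded open sets -/

section Localize

variable {d : ℕ}

theorem FlowDomain.measurableSet_cyl (𝒟 : FlowDomain d) (T : ℝ) : MeasurableSet (𝒟.cyl T) :=
  𝒟.measurableSet_cell.prod measurableSet_Ioo

/-- On the region, `φ` and its derivative are the sums of the translates of `ψ` and of its
derivative. -/
def IsLift (C : Set (E d × ℝ)) (S : Finset (E d × ℝ)) (φ ψ : E d × ℝ → ℝ) : Prop :=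
  ∀ z ∈ C, φ z = ∑ k ∈ S, ψ (z + k) ∧ ∀ l, fderiv ℝ φ z l = ∑ k ∈ S, fderiv ℝ ψ (z + k) l

/-- A bounded open set that is tiled by translates of the region `Ω × (0,T)`, in such a way that
its test functions can be pushed to test functions of the region. -/
structure Localization (𝒟 : FlowDomain d) (T : ℝ) (O : Set (E d × ℝ)) (S : Finset (E d × ℝ)) :
    Prop where
  isOpen : IsOpen O
  volume_lt : volume O < ⊤
  tiling : ∀ z ∈ O, ∃ k ∈ S, z - k ∈ 𝒟.cyl T
  unique : ∀ z, ∀ k ∈ S, ∀ k' ∈ S, z - k ∈ 𝒟.cyl T → z - k' ∈ 𝒟.cyl T → k = k'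
  push : ∀ ψ, IsTestOn O ψ → ∃ φ, 𝒟.IsTimeTest T φ ∧ IsLift (𝒟.cyl T) S φ ψ

/-- The extension of a function on the region to a bounded open set by translations. -/
noncomputable def extend (C O : Set (E d × ℝ)) (S : Finset (E d × ℝ)) (F : E d × ℝ → ℝ) : E d × ℝ → ℝ :=
  O.indicator fun z => ∑ k ∈ S, C.indicator F (z - k)

/-- The sum of the translates of a measure on the region. -/
noncomputable def tileMeasure (C : Set (E d × ℝ)) (S : Finset (E d × ℝ)) (μ : Measure (E d × ℝ)) :
    Measure (E d × ℝ) := ∑ k ∈ S, (μ.restrict C).map fun z => z + k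

theorem lintegral_tileMeasure (C : Set (E d × ℝ)) (S : Finset (E d × ℝ)) (μ : Measure (E d × ℝ))
    {g : E d × ℝ → ℝ≥0∞} (hg : Measurable g) :
    ∫⁻ z, g z ∂(tileMeasure C S μ) = ∫⁻ z in C, ∑ k ∈ S, g (z + k) ∂μ := by
  rw [tileMeasure, lintegral_finsetSum_measure, lintegral_finsetSum S (f := fun k z => g (z + k)) fun k _ =>
    hg.comp (measurable_add_const k)]
  exact Finset.sum_congr rfl fun k _ => lintegral_map hg (measurable_add_const k)

instance (C : Set (E d × ℝ)) (S : Finset (E d × ℝ)) (μ : Measure (E d × ℝ)) [IsFiniteMeasure μ] :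
    IsFiniteMeasure (tileMeasure C S μ) := by
  unfold tileMeasure; infer_instance

namespace Localization

variable {𝒟 : FlowDomain d} {T : ℝ} {O : Set (E d × ℝ)} {S : Finset (E d × ℝ)}
  (hL : Localization 𝒟 T O S)
include hL

theorem exists_eq {z : E d × ℝ} (hz : z ∈ O) : ∃ k ∈ S, z - k ∈ 𝒟.cyl T ∧
    ∀ F, extend (𝒟.cyl T) O S F z = F (z - k) := by
  obtain ⟨k, hk, hzk⟩ := hL.tiling z hz
  refine ⟨k, hk, hzk, fun F => ?_⟩
  rw [extend, indicator_of_mem hz, Finset.sum_eq_single_of_mem k hk, indicator_of_mem hzk]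
  intro k' hk' hne
  exact indicator_of_notMem (fun h => hne (hL.unique z k' hk' k hk h hzk)) _

theorem extend_add {z k : E d × ℝ} (hz : z ∈ 𝒟.cyl T) (hk : k ∈ S) (hzk : z + k ∈ O)
    (F : E d × ℝ → ℝ) : extend (𝒟.cyl T) O S F (z + k) = F z := by
  obtain ⟨k', hk', h1, h2⟩ := hL.exists_eq hzk
  have : k' = k := hL.unique (z + k) k' hk' k hk h1 (by simpa using hz)
  rw [h2, this, add_sub_cancel_right]

theorem measurable_extend {F : E d × ℝ → ℝ} (hF : Measurable F) :
    Measurable (extend (𝒟.cyl T) O S F) :=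
  (Finset.measurable_fun_sum _ fun k _ => (hF.indicator (𝒟.measurableSet_cyl T)).comp
    (measurable_sub_const k)).indicator hL.isOpen.measurableSet

theorem abs_extend_le {F : E d × ℝ → ℝ} {B : ℝ} (hF : ∀ z, |F z| ≤ B) (z : E d × ℝ) :
    |extend (𝒟.cyl T) O S F z| ≤ B := by
  by_cases hz : z ∈ O
  · obtain ⟨k, -, -, h⟩ := hL.exists_eq hz
    rw [h]; exact hF _
  · rw [extend, indicator_of_notMem hz, abs_zero]
    exact (abs_nonneg _).trans (hF z)

theorem integrable_extend_of_le {F : E d × ℝ → ℝ} {B : ℝ} (hFm : Measurable F)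
    (hF : ∀ z, |F z| ≤ B) : Integrable (extend (𝒟.cyl T) O S F) := by
  have h1 : IntegrableOn (extend (𝒟.cyl T) O S F) O :=
    Measure.integrableOn_of_bounded hL.volume_lt.ne
      (hL.measurable_extend hFm).aestronglyMeasurable (ae_of_all _ (hL.abs_extend_le hF))
  refine (integrableOn_iff_integrable_of_support_subset ?_).1 h1
  exact support_indicator_subset

theorem integrable_extend {F : E d × ℝ → ℝ} (hF : IntegrableOn F (𝒟.cyl T)) :
    Integrable (extend (𝒟.cyl T) O S F) :=
  (integrable_finsetSum _ fun k _ =>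
    ((integrable_indicator_iff (𝒟.measurableSet_cyl T)).2 hF).comp_sub_right k).indicator
      hL.isOpen.measurableSet

theorem integral_eq {G : E d × ℝ → ℝ} (hG : Integrable G) (hGO : ∀ z, z ∉ O → G z = 0) :
    ∫ z, G z = ∫ z in 𝒟.cyl T, ∑ k ∈ S, G (z + k) := by
  have hm := 𝒟.measurableSet_cyl T
  have hk : ∀ k : E d × ℝ, Integrable ((𝒟.cyl T).indicator fun w => G (w + k)) := fun k =>
    (hG.comp_add_right k).indicator hm
  have e : ∀ z, G z = ∑ k ∈ S, (𝒟.cyl T).indicator (fun w => G (w + k)) (z - k) := by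
    intro z
    by_cases hz : z ∈ O
    · obtain ⟨k, hkS, hzk⟩ := hL.tiling z hz
      rw [Finset.sum_eq_single_of_mem k hkS, indicator_of_mem hzk, sub_add_cancel]
      intro k' hk' hne
      exact indicator_of_notMem (fun h => hne (hL.unique z k' hk' k hkS h hzk)) _
    · rw [hGO z hz]
      refine (Finset.sum_eq_zero fun k _ => ?_).symm
      by_cases h : z - k ∈ 𝒟.cyl T
      · rw [indicator_of_mem h, sub_add_cancel, hGO z hz]
      · exact indicator_of_notMem h _
  rw [integral_congr_ae (ae_of_all _ e), integral_finsetSum _ fun k _ => (hk k).comp_sub_right k,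
    integral_finsetSum _ fun k _ => (hG.comp_add_right k).integrableOn]
  refine Finset.sum_congr rfl fun k _ => ?_
  rw [integral_sub_right_eq_self (fun z => (𝒟.cyl T).indicator (fun w => G (w + k)) z) k,
    integral_indicator hm]

/-- Integration of a test function and its derivative against a translated field. -/
theorem integral_lift {φ ψ : E d × ℝ → ℝ} (hψ : IsTestOn O ψ) (hφ : IsLift (𝒟.cyl T) S φ ψ)
    {a a' : E d × ℝ → ℝ} {b b' : E d × ℝ → E d × ℝ}
    (ha : ∀ z ∈ 𝒟.cyl T, ∀ k ∈ S, z + k ∈ O → a' (z + k) = a z)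
    (hb : ∀ z ∈ 𝒟.cyl T, ∀ k ∈ S, z + k ∈ O → b' (z + k) = b z)
    (hint : Integrable fun z => a' z * ψ z + fderiv ℝ ψ z (b' z)) :
    ∫ z, (a' z * ψ z + fderiv ℝ ψ z (b' z))
      = ∫ z in 𝒟.cyl T, (a z * φ z + fderiv ℝ φ z (b z)) := by
  have h0 : ∀ z, z ∉ O → ψ z = 0 ∧ fderiv ℝ ψ z = 0 := fun z hz =>
    ⟨image_eq_zero_of_notMem_tsupport fun h => hz (hψ.2.2 h),
      image_eq_zero_of_notMem_tsupport fun h => hz (hψ.2.2 (tsupport_fderiv_subset ℝ h))⟩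
  rw [hL.integral_eq hint fun z hz => by simp [(h0 z hz).1, (h0 z hz).2]]
  refine setIntegral_congr_fun (𝒟.measurableSet_cyl T) fun z hz => ?_
  beta_reduce
  rw [(hφ z hz).1, (hφ z hz).2, Finset.mul_sum, ← Finset.sum_add_distrib]
  refine Finset.sum_congr rfl fun k hk => ?_
  by_cases hzk : z + k ∈ O
  · rw [ha z hz k hk hzk, hb z hz k hk hzk]
  · simp [(h0 _ hzk).1, (h0 _ hzk).2]

theorem lintegral_le {φ ψ : E d × ℝ → ℝ} (hψ : IsTestOn O ψ) (hφ : IsLift (𝒟.cyl T) S φ ψ)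
    {μ : Measure (E d × ℝ)} (hμ : μ (𝒟.cyl T)ᶜ = 0) :
    ∫⁻ z, ‖φ z‖ₑ ∂μ ≤ ∫⁻ z, ‖ψ z‖ₑ ∂(tileMeasure (𝒟.cyl T) S μ) := by
  have hm := 𝒟.measurableSet_cyl T
  rw [lintegral_tileMeasure _ _ _ hψ.1.continuous.measurable.enorm,
    ← lintegral_add_compl _ hm, Measure.restrict_eq_zero.2 hμ, lintegral_zero_measure, add_zero]
  refine setLIntegral_mono' hm fun z hz => ?_
  rw [(hφ z hz).1]
  exact enorm_sum_le _ _

end Localization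
end Localize

/-! ### From the region to bounded open sets -/

section CylinderSolutions

variable {d : ℕ}

theorem IsTestOn.integrable_fderiv_field {Z : Type*} [NormedAddCommGroup Z] [NormedSpace ℝ Z]
    [FiniteDimensional ℝ Z] [MeasureSpace Z] [BorelSpace Z]
    [(volume : Measure Z).IsAddHaarMeasure] {O : Set Z} {ψ : Z → ℝ} (hψ : IsTestOn O ψ)
    {ι : Type*} [Fintype ι] {e : ι → Z} {v : ι → Z → ℝ} (hv : ∀ i, BddMeas (v i)) :
    Integrable fun z => fderiv ℝ ψ z (field e v z) := by
  simp_rw [clm_field]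
  exact integrable_finsetSum _ fun i _ => (hv i).integrable_mul (hψ.fderiv_integrable _)

/-- Weak solutions on the region, given by functions that are defined and bounded everywhere. -/
structure CylinderSolution (𝒟 : FlowDomain d) (T c M : ℝ) (ρ p : E d × ℝ → ℝ)
    (v f : Fin d → E d × ℝ → ℝ) : Prop where
  c_pos : 0 < c
  density_measurable : Measurable ρ
  velocity_measurable : ∀ i, Measurable (v i)
  pressure_measurable : Measurable p
  force_measurable : ∀ i, Measurable (f i)
  density_mem : ∀ z, ρ z ∈ Icc c M
  velocity_le : ∀ i z, |v i z| ≤ M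
  pressure_le : ∀ z, |p z| ≤ M
  force_integrable : ∀ i, IntegrableOn (f i) (𝒟.cyl T)
  momentum : ∀ i (φ : E d × ℝ → ℝ), 𝒟.IsTimeTest T φ → ∫ z in 𝒟.cyl T, (f i z * φ z + fderiv ℝ φ z
    ((ρ z * v i z) • (field spaceDir v z + (0, 1)) + p z • spaceDir i)) = 0
  transport : ∀ φ : E d × ℝ → ℝ, 𝒟.IsTimeTest T φ → ∫ z in 𝒟.cyl T,
    fderiv ℝ φ z (ρ z • (field spaceDir v z + (0, 1))) = 0
  incompressible : ∀ φ : E d × ℝ → ℝ, 𝒟.IsTimeTest T φ →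
    ∫ z in 𝒟.cyl T, fderiv ℝ φ z (field spaceDir v z) = 0

/-- Twice the Duchon-Robert distribution on the region. -/
noncomputable def cylinderDefect (𝒟 : FlowDomain d) (T : ℝ) (ρ p : E d × ℝ → ℝ)
    (v f : Fin d → E d × ℝ → ℝ) (φ : E d × ℝ → ℝ) : ℝ :=
  ∫ z in 𝒟.cyl T, ((2 * ∑ i, f i z * v i z) * φ z + fderiv ℝ φ z
    ((∑ i, ρ z * v i z * v i z) • (field spaceDir v z + (0, 1)) + (2 * p z) • field spaceDir v z))

/-- Extension of a density by translations, and by the constant `c` off the open set. -/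
noncomputable def extendDensity (C O : Set (E d × ℝ)) (S : Finset (E d × ℝ)) (c : ℝ)
    (ρ : E d × ℝ → ℝ) (z : E d × ℝ) : ℝ := c + extend C O S (fun z => ρ z - c) z

/-- Equations and gradient bounds all have integrands of the form `a φ + Dφ(b)`; pushing a test
function of `O` to the region transfers an estimate for such a form. -/
theorem Localization.enorm_le {𝒟 : FlowDomain d} {T : ℝ} {O : Set (E d × ℝ)}
    {S : Finset (E d × ℝ)} (hL : Localization 𝒟 T O S)
    {a a' : E d × ℝ → ℝ} {b b' : E d × ℝ → E d × ℝ} {μ : Measure (E d × ℝ)}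
    (hμ : μ (𝒟.cyl T)ᶜ = 0)
    (h : ∀ φ : E d × ℝ → ℝ, 𝒟.IsTimeTest T φ →
      ‖∫ z in 𝒟.cyl T, (a z * φ z + fderiv ℝ φ z (b z))‖ₑ ≤ ∫⁻ z, ‖φ z‖ₑ ∂μ)
    (ha : ∀ z ∈ 𝒟.cyl T, ∀ k ∈ S, z + k ∈ O → a' (z + k) = a z)
    (hb : ∀ z ∈ 𝒟.cyl T, ∀ k ∈ S, z + k ∈ O → b' (z + k) = b z)
    {ψ : E d × ℝ → ℝ} (hψ : IsTestOn O ψ)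
    (hint : Integrable fun z => a' z * ψ z + fderiv ℝ ψ z (b' z)) :
    ‖∫ z, (a' z * ψ z + fderiv ℝ ψ z (b' z))‖ₑ
      ≤ ∫⁻ z, ‖ψ z‖ₑ ∂(tileMeasure (𝒟.cyl T) S μ) := by
  obtain ⟨φ, hφ, hφψ⟩ := hL.push ψ hψ
  rw [hL.integral_lift hψ hφψ ha hb hint]
  exact (h φ hφ).trans (hL.lintegral_le hψ hφψ hμ)

namespace CylinderSolution

variable {𝒟 : FlowDomain d} {T c M : ℝ} {ρ p : E d × ℝ → ℝ} {v f : Fin d → E d × ℝ → ℝ}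
  (h : CylinderSolution 𝒟 T c M ρ p v f) {O : Set (E d × ℝ)} {S : Finset (E d × ℝ)}
  (hL : Localization 𝒟 T O S)
include h

theorem le_bound : c ≤ M := (h.density_mem 0).1.trans (h.density_mem 0).2

theorem abs_density_sub_le (z : E d × ℝ) : |ρ z - c| ≤ M - c := by
  have := h.density_mem z
  rw [abs_of_nonneg (by linarith [this.1])]
  linarith [this.2]

include hL

theorem extendDensity_mem (z : E d × ℝ) :
    extendDensity (𝒟.cyl T) O S c ρ z ∈ Icc c M := by
  by_cases hz : z ∈ O
  · obtain ⟨k, -, -, hk⟩ := hL.exists_eq hz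
    rw [extendDensity, hk]
    simpa using h.density_mem (z - k)
  · rw [extendDensity, extend, indicator_of_notMem hz, add_zero]
    exact ⟨le_rfl, h.le_bound⟩

omit h in
theorem extendDensity_add {z k : E d × ℝ} (hz : z ∈ 𝒟.cyl T) (hk : k ∈ S) (hzk : z + k ∈ O) :
    extendDensity (𝒟.cyl T) O S c ρ (z + k) = ρ z := by
  rw [extendDensity, hL.extend_add hz hk hzk]; ring

omit h in
theorem field_extend_add {z k : E d × ℝ} (hz : z ∈ 𝒟.cyl T) (hk : k ∈ S) (hzk : z + k ∈ O) :
    field spaceDir (fun i => extend (𝒟.cyl T) O S (v i)) (z + k) = field spaceDir v z :=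
  Finset.sum_congr rfl fun j _ => congrArg (· • spaceDir j) (hL.extend_add hz hk hzk (v j))

theorem extendDensity_bddMeas : BddMeas (extendDensity (𝒟.cyl T) O S c ρ) :=
  ⟨measurable_const.add (hL.measurable_extend (h.density_measurable.sub_const c)), M, fun z => by
    have := h.extendDensity_mem hL z
    rw [abs_of_nonneg (h.c_pos.le.trans this.1)]
    exact this.2⟩

theorem velocity_bddMeas (i : Fin d) : BddMeas (extend (𝒟.cyl T) O S (v i)) :=
  ⟨hL.measurable_extend (h.velocity_measurable i), M, hL.abs_extend_le (h.velocity_le i)⟩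

theorem pressure_bddMeas : BddMeas (extend (𝒟.cyl T) O S p) :=
  ⟨hL.measurable_extend h.pressure_measurable, M, hL.abs_extend_le h.pressure_le⟩

theorem integrable_fderiv_field {ψ : E d × ℝ → ℝ} (hψ : IsTestOn O ψ) :
    Integrable fun z => fderiv ℝ ψ z (field spaceDir (fun i => extend (𝒟.cyl T) O S (v i)) z) :=
  hψ.integrable_fderiv_field (h.velocity_bddMeas hL)

theorem localSolution : LocalSolution O c M spaceDir (0, 1) (extendDensity (𝒟.cyl T) O S c ρ)
    (extend (𝒟.cyl T) O S p) (fun i => extend (𝒟.cyl T) O S (v i))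
    (fun i => extend (𝒟.cyl T) O S (f i)) where
  isOpen := hL.isOpen
  c_pos := h.c_pos
  density_measurable := (h.extendDensity_bddMeas hL).measurable
  velocity_measurable i := (h.velocity_bddMeas hL i).measurable
  pressure_measurable := (h.pressure_bddMeas hL).measurable
  force_measurable i := hL.measurable_extend (h.force_measurable i)
  density_mem := h.extendDensity_mem hL
  velocity_le i := hL.abs_extend_le (h.velocity_le i)
  pressure_le := hL.abs_extend_le h.pressure_le
  density_integrable := by
    simp only [extendDensity, add_sub_cancel_left]
    exact hL.integrable_extend_of_le (h.density_measurable.sub_const c) h.abs_density_sub_le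
  velocity_integrable i := hL.integrable_extend_of_le (h.velocity_measurable i) (h.velocity_le i)
  pressure_integrable := hL.integrable_extend_of_le h.pressure_measurable h.pressure_le
  force_integrable i := hL.integrable_extend (h.force_integrable i)
  momentum i ψ hψ := by
    obtain ⟨φ, hφ, hφψ⟩ := hL.push ψ hψ
    have i1 := hψ.bddMeas.integrable_mul (hL.integrable_extend (S := S) (h.force_integrable i))
    have i2 := ((h.extendDensity_bddMeas hL).mul (h.velocity_bddMeas hL i)).integrable_mul
      ((h.integrable_fderiv_field hL hψ).add (hψ.fderiv_integrable (0, 1)))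
    have i3 := (h.pressure_bddMeas hL).integrable_mul (hψ.fderiv_integrable (spaceDir i))
    have := hL.integral_lift hψ hφψ (a := f i) (a' := extend (𝒟.cyl T) O S (f i))
      (b := fun z => (ρ z * v i z) • (field spaceDir v z + (0, 1)) + p z • spaceDir i)
      (b' := fun z => (extendDensity (𝒟.cyl T) O S c ρ z * extend (𝒟.cyl T) O S (v i) z) •
        (field spaceDir (fun i => extend (𝒟.cyl T) O S (v i)) z + (0, 1))
        + extend (𝒟.cyl T) O S p z • spaceDir i) (fun z hz k hk hzk => hL.extend_add hz hk hzk _)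
      (fun z hz k hk hzk => by
        rw [extendDensity_add hL hz hk hzk, field_extend_add hL hz hk hzk, hL.extend_add hz hk hzk,
          hL.extend_add hz hk hzk]) ((i1.add (i2.add i3)).congr (ae_of_all _ fun z => by
        simp only [Pi.add_apply, map_add, map_smul, smul_eq_mul]
        ring))
    rw [h.momentum i φ hφ] at this
    rw [← this]
    refine integral_congr_ae (ae_of_all _ fun z => ?_)
    simp only [map_add, map_smul, smul_eq_mul]
    ring
  transport ψ hψ := by
    obtain ⟨φ, hφ, hφψ⟩ := hL.push ψ hψ
    have := hL.integral_lift hψ hφψ (a := 0) (a' := 0)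
      (b := fun z => ρ z • (field spaceDir v z + (0, 1)))
      (b' := fun z => extendDensity (𝒟.cyl T) O S c ρ z •
        (field spaceDir (fun i => extend (𝒟.cyl T) O S (v i)) z + (0, 1)))
      (fun z hz k hk hzk => rfl) (fun z hz k hk hzk => by
        rw [extendDensity_add hL hz hk hzk, field_extend_add hL hz hk hzk]) (by
        simp only [Pi.zero_apply, zero_mul, zero_add, map_smul, smul_eq_mul, map_add]
        exact (h.extendDensity_bddMeas hL).integrable_mul ((h.integrable_fderiv_field hL hψ).add
          (hψ.fderiv_integrable _)))
    simp only [Pi.zero_apply, zero_mul, zero_add] at this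
    rw [h.transport φ hφ] at this
    simpa only [map_smul, smul_eq_mul] using this
  incompressible ψ hψ := by
    obtain ⟨φ, hφ, hφψ⟩ := hL.push ψ hψ
    have := hL.integral_lift hψ hφψ (a := 0) (a' := 0)
      (b := fun z => field spaceDir v z)
      (b' := fun z => field spaceDir (fun i => extend (𝒟.cyl T) O S (v i)) z)
      (fun z hz k hk hzk => rfl) (fun z hz k hk hzk => field_extend_add hL hz hk hzk) (by
        simp only [Pi.zero_apply, zero_mul, zero_add]
        exact h.integrable_fderiv_field hL hψ)
    simp only [Pi.zero_apply, zero_mul, zero_add] at this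
    rw [this, h.incompressible φ hφ]

theorem energyDefect_eq {φ ψ : E d × ℝ → ℝ} (hψ : IsTestOn O ψ)
    (hφ : IsLift (𝒟.cyl T) S φ ψ) :
    energyDefect spaceDir (0, 1) (extendDensity (𝒟.cyl T) O S c ρ) (extend (𝒟.cyl T) O S p)
      (fun i => extend (𝒟.cyl T) O S (v i)) (fun i => extend (𝒟.cyl T) O S (f i)) ψ
      = cylinderDefect 𝒟 T ρ p v f φ := by
  have hD := h.integrable_fderiv_field hL hψ
  have i1 : ∀ i, Integrable fun z => (extendDensity (𝒟.cyl T) O S c ρ z * extend (𝒟.cyl T) O S (v i) z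
      * extend (𝒟.cyl T) O S (v i) z) * fderiv ℝ ψ z
        (field spaceDir (fun i => extend (𝒟.cyl T) O S (v i)) z + (0, 1)) := fun i => by
    simp only [map_add]
    exact (((h.extendDensity_bddMeas hL).mul (h.velocity_bddMeas hL i)).mul
      (h.velocity_bddMeas hL i)).integrable_mul (hD.add (hψ.fderiv_integrable _))
  have i2 := (h.pressure_bddMeas hL).integrable_mul hD
  have i3 : ∀ i, Integrable fun z => (ψ z * extend (𝒟.cyl T) O S (v i) z)
      * extend (𝒟.cyl T) O S (f i) z := fun i =>
    (hψ.bddMeas.mul (h.velocity_bddMeas hL i)).integrable_mul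
      (hL.integrable_extend (h.force_integrable i))
  have i1' := integrable_finsetSum Finset.univ fun i _ => i1 i
  have i3' := integrable_finsetSum Finset.univ fun i _ => i3 i
  have e : ∀ z, (∑ i, (extendDensity (𝒟.cyl T) O S c ρ z * extend (𝒟.cyl T) O S (v i) z
      * extend (𝒟.cyl T) O S (v i) z) * fderiv ℝ ψ z
        (field spaceDir (fun i => extend (𝒟.cyl T) O S (v i)) z + (0, 1)))
      + 2 * (extend (𝒟.cyl T) O S p z * fderiv ℝ ψ z
        (field spaceDir (fun i => extend (𝒟.cyl T) O S (v i)) z))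
      + 2 * (∑ i, (ψ z * extend (𝒟.cyl T) O S (v i) z) * extend (𝒟.cyl T) O S (f i) z)
      = (2 * ∑ i, extend (𝒟.cyl T) O S (f i) z * extend (𝒟.cyl T) O S (v i) z) * ψ z
        + fderiv ℝ ψ z ((∑ i, extendDensity (𝒟.cyl T) O S c ρ z * extend (𝒟.cyl T) O S (v i) z
            * extend (𝒟.cyl T) O S (v i) z) •
          (field spaceDir (fun i => extend (𝒟.cyl T) O S (v i)) z + (0, 1))
          + (2 * extend (𝒟.cyl T) O S p z) •
            field spaceDir (fun i => extend (𝒟.cyl T) O S (v i)) z) := by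
    intro z
    rw [← Finset.sum_mul]
    have : ∑ i, (ψ z * extend (𝒟.cyl T) O S (v i) z) * extend (𝒟.cyl T) O S (f i) z
        = (∑ i, extend (𝒟.cyl T) O S (f i) z * extend (𝒟.cyl T) O S (v i) z) * ψ z := by
      rw [Finset.sum_mul]
      exact Finset.sum_congr rfl fun i _ => by ring
    rw [this]
    simp only [map_add, map_smul, smul_eq_mul]
    ring
  have i12 := i1'.add (i2.const_mul 2)
  simp only [Pi.add_def] at i12
  have hint := (i12.add (i3'.const_mul 2)).congr (ae_of_all _ e)
  rw [energyDefect, cylinderDefect, ← integral_finsetSum _ fun i _ => i1 i,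
    ← integral_finsetSum _ fun i _ => i3 i, ← integral_const_mul, ← integral_const_mul,
    ← integral_add i1' (i2.const_mul 2), ← integral_add i12 (i3'.const_mul 2), integral_congr_ae (ae_of_all _ e)]
  refine hL.integral_lift hψ hφ (fun z hz k hk hzk => ?_) (fun z hz k hk hzk => ?_) hint
  · simp only [hL.extend_add hz hk hzk]
  · simp only [hL.extend_add hz hk hzk, extendDensity_add hL hz hk hzk,
      field_extend_add hL hz hk hzk]

/-- Transfer of the gradient of the density. -/
theorem isDerivUpTo_density {l : E d × ℝ} {g : E d × ℝ → ℝ} (hg : IntegrableOn g (𝒟.cyl T))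
    {μ : Measure (E d × ℝ)} (hμ : μ (𝒟.cyl T)ᶜ = 0)
    (hder : ∀ φ : E d × ℝ → ℝ, 𝒟.IsTimeTest T φ →
      ‖∫ z in 𝒟.cyl T, (g z * φ z + fderiv ℝ φ z (ρ z • l))‖ₑ
      ≤ ∫⁻ z, ‖φ z‖ₑ ∂μ) :
    IsDerivUpTo O (extendDensity (𝒟.cyl T) O S c ρ) l (extend (𝒟.cyl T) O S g)
      (tileMeasure (𝒟.cyl T) S μ) := by
  intro ψ hψ
  have h1 := (h.extendDensity_bddMeas hL).integrable_mul (hψ.fderiv_integrable l)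
  have h2 := hψ.bddMeas.integrable_mul (hL.integrable_extend hg)
  have e : ∀ z, extendDensity (𝒟.cyl T) O S c ρ z * fderiv ℝ ψ z l
      + ψ z * extend (𝒟.cyl T) O S g z = extend (𝒟.cyl T) O S g z * ψ z
        + fderiv ℝ ψ z (extendDensity (𝒟.cyl T) O S c ρ z • l) := fun z => by
    rw [map_smul, smul_eq_mul]; ring
  rw [← integral_add h1 h2, integral_congr_ae (ae_of_all _ e)]
  refine hL.enorm_le hμ hder (fun z hz k hk hzk => hL.extend_add hz hk hzk g)
    (fun z hz k hk hzk => ?_) hψ ((h1.add h2).congr (ae_of_all _ e))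
  rw [extendDensity_add hL hz hk hzk]

end CylinderSolution
end CylinderSolutions

/-! ### Existence of localizations -/

section Lifts

variable {d : ℕ}

theorem isLift_of_eventuallyEq {C : Set (E d × ℝ)} {S : Finset (E d × ℝ)} {φ ψ : E d × ℝ → ℝ}
    (hψ : Differentiable ℝ ψ) (h : ∀ z ∈ C, φ =ᶠ[𝓝 z] fun w => ∑ k ∈ S, ψ (w + k)) :
    IsLift C S φ ψ := by
  intro z hz
  refine ⟨(h z hz).eq_of_nhds, fun l => ?_⟩
  have hk : ∀ k ∈ S, DifferentiableAt ℝ (fun w => ψ (w + k)) z := fun k _ =>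
    (hψ (z + k)).comp z ((differentiable_id.add_const k) z)
  rw [(h z hz).fderiv_eq, fderiv_fun_sum hk]
  simp [fderiv_comp_add_right]

theorem FlowDomain.exists_localization_openSet {Ω : TopologicalSpace.Opens (E d)} {T : ℝ}
    {φ : E d × ℝ → ℝ} (hφ : (FlowDomain.openSet Ω).IsTimeTest T φ) :
    ∃ O S ψ, Localization (.openSet Ω) T O S ∧ IsTestOn O ψ ∧
      IsLift ((FlowDomain.openSet Ω).cyl T) S φ ψ ∧
      ∀ z ∈ (FlowDomain.openSet Ω).cyl T, ‖φ z‖ₑ = ∑ k ∈ S, ‖ψ (z + k)‖ₑ := by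
  obtain ⟨R, hR⟩ := hφ.2.1.isCompact.isBounded.subset_ball 0
  have hlift : ∀ {C : Set (E d × ℝ)} (ψ : E d × ℝ → ℝ), ContDiff ℝ ∞ ψ → IsLift C {0} ψ ψ :=
    fun ψ hψ => isLift_of_eventuallyEq (hψ.differentiable (by simp)) fun z _ => by simp
  refine ⟨((Ω : Set (E d)) ×ˢ Ioo 0 T) ∩ Metric.ball 0 R, {0}, φ, ?_,
    ⟨hφ.1, hφ.2.1, subset_inter hφ.2.2 hR⟩, hlift φ hφ.1, fun z _ => by simp⟩
  refine ⟨(Ω.isOpen.prod isOpen_Ioo).inter Metric.isOpen_ball,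
    (measure_mono inter_subset_right).trans_lt measure_ball_lt_top, fun z hz => ⟨0, by simp, ?_⟩,
    fun z k hk k' hk' _ _ => ?_, fun ψ hψ => ⟨ψ, ⟨hψ.1, hψ.2.1, hψ.2.2.trans inter_subset_left⟩,
      hlift ψ hψ.1⟩⟩
  · rw [sub_zero]; exact hz.1
  · rw [Finset.mem_singleton] at hk hk'
    rw [hk, hk']

/-- The integer translations of space. -/
noncomputable def latticeShift (d : ℕ) : (Fin d → ℤ) ↪ E d × ℝ where
  toFun n := (WithLp.toLp 2 fun i => (n i : ℝ), 0)
  inj' n m h := by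
    funext i
    have := congrArg (fun z : E d × ℝ => z.1 i) h
    simpa using this

@[simp] theorem latticeShift_fst (n : Fin d → ℤ) (i : Fin d) : (latticeShift d n).1 i = n i := rfl

@[simp] theorem latticeShift_snd (n : Fin d → ℤ) : (latticeShift d n).2 = 0 := rfl

/-- The open box that carries the lifts of the test functions of the torus. -/
def torusBox (d : ℕ) (T : ℝ) : Set (E d × ℝ) := {x | ∀ i, x i ∈ Ioo (-1 : ℝ) 3} ×ˢ Ioo 0 T

theorem mem_torusBox {T : ℝ} {z : E d × ℝ} :
    z ∈ torusBox d T ↔ (∀ i, z.1 i ∈ Ioo (-1 : ℝ) 3) ∧ z.2 ∈ Ioo 0 T := Iff.rfl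

theorem continuous_coord (i : Fin d) : Continuous fun x : E d => x i :=
  (EuclideanSpace.proj i : E d →L[ℝ] ℝ).continuous

theorem isOpen_torusBox (T : ℝ) : IsOpen (torusBox d T) := by
  refine IsOpen.prod ?_ isOpen_Ioo
  have : {x : E d | ∀ i, x i ∈ Ioo (-1 : ℝ) 3} = ⋂ i, (fun x : E d => x i) ⁻¹' Ioo (-1) 3 := by
    ext x; simp
  rw [this]
  exact isOpen_iInter_of_finite fun i => isOpen_Ioo.preimage (continuous_coord i)

theorem isCompact_box (a b : ℝ) : IsCompact {x : E d | ∀ i, x i ∈ Icc a b} := by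
  have h := (isCompact_univ_pi fun _ : Fin d => isCompact_Icc (a := a) (b := b)).image
    (PiLp.continuous_toLp 2 fun _ : Fin d => ℝ)
  convert h using 1
  ext x
  constructor
  · exact fun hx => ⟨x.ofLp, fun i _ => hx i, rfl⟩
  · rintro ⟨y, hy, rfl⟩ i
    exact hy i (mem_univ i)

/-- The finitely many translations that are used on the box. -/
noncomputable def torusShifts (d : ℕ) : Finset (E d × ℝ) :=
  (Fintype.piFinset fun _ : Fin d => Finset.Icc (-1 : ℤ) 3).map (latticeShift d)

theorem mem_cyl_torus {T : ℝ} {z : E d × ℝ} :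
    z ∈ (FlowDomain.torus : FlowDomain d).cyl T ↔ (∀ i, z.1 i ∈ Ico (0 : ℝ) 1) ∧ z.2 ∈ Ioo 0 T :=
  Iff.rfl

theorem periodic_latticeShift {φ : E d × ℝ → ℝ}
    (h : ∀ x t i, φ (x + unitVec i, t) = φ (x, t)) (n : Fin d → ℤ) (z : E d × ℝ) :
    φ (z + latticeShift d n) = φ z := by
  have h1 : ∀ i, Function.Periodic φ (unitVec i, 0) := fun i z => by
    change φ (z.1 + unitVec i, z.2 + 0) = φ (z.1, z.2)
    rw [add_zero, h]
  have h2 : ∀ s : Finset (Fin d), Function.Periodic φ (∑ i ∈ s, n i • ((unitVec i, 0) : E d × ℝ)) := by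
    classical
    intro s
    induction s using Finset.induction_on with
    | empty => intro z; simp
    | insert i s hi ih =>
      rw [Finset.sum_insert hi]
      exact ((h1 i).zsmul (n i)).add_period ih
  have h3 : ∑ i, n i • ((unitVec i, 0) : E d × ℝ) = latticeShift d n := by
    refine Prod.ext ?_ ?_
    · ext j
      simp [Prod.fst_sum, unitVec, Finset.sum_apply, Pi.single_apply]
    · simp [Prod.snd_sum]
  rw [← h3]
  exact h2 _ z

/-- The sum over all integer translations. -/
noncomputable def periodize (ψ : E d × ℝ → ℝ) (z : E d × ℝ) : ℝ :=
  ∑' n : Fin d → ℤ, ψ (z + latticeShift d n)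

theorem periodize_eventuallyEq {T : ℝ} {ψ : E d × ℝ → ℝ} (hψ : IsTestOn (torusBox d T) ψ)
    (z : E d × ℝ) : ∃ F : Finset (Fin d → ℤ),
      periodize ψ =ᶠ[𝓝 z] fun w => ∑ n ∈ F, ψ (w + latticeShift d n) := by
  refine ⟨Fintype.piFinset fun i => Finset.Icc ⌊-2 - z.1 i⌋ ⌈4 - z.1 i⌉, ?_⟩
  have hev : ∀ᶠ w : E d × ℝ in 𝓝 z, ∀ i, w.1 i ∈ Ioo (z.1 i - 1) (z.1 i + 1) :=
    eventually_all.2 fun i => ((continuous_coord i).comp continuous_fst).continuousAt.eventually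
      (Ioo_mem_nhds (by simp) (by simp))
  filter_upwards [hev] with w hw
  refine tsum_eq_sum fun n hn => hψ.eq_zero fun h => hn ?_
  rw [mem_torusBox] at h
  refine Fintype.mem_piFinset.2 fun i => ?_
  have h1 := h.1 i
  rw [Prod.fst_add, PiLp.add_apply, latticeShift_fst, mem_Ioo] at h1
  have h2 := hw i
  rw [mem_Ioo] at h2
  rw [Finset.mem_Icc]
  constructor
  · have : (⌊-2 - z.1 i⌋ : ℝ) ≤ n i := (Int.floor_le _).trans (by linarith)
    exact Int.cast_le.1 this
  · have : (n i : ℝ) ≤ ⌈4 - z.1 i⌉ := le_trans (by linarith) (Int.le_ceil _)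
    exact Int.cast_le.1 this

theorem contDiff_periodize {T : ℝ} {ψ : E d × ℝ → ℝ} (hψ : IsTestOn (torusBox d T) ψ) :
    ContDiff ℝ ∞ (periodize ψ) := by
  refine contDiff_iff_contDiffAt.2 fun z => ?_
  obtain ⟨F, hF⟩ := periodize_eventuallyEq hψ z
  refine ContDiffAt.congr_of_eventuallyEq ?_ hF
  exact ContDiffAt.sum fun n _ => (hψ.1.comp (contDiff_id.add contDiff_const)).contDiffAt

theorem periodize_isTimeTest {T : ℝ} {ψ : E d × ℝ → ℝ} (hψ : IsTestOn (torusBox d T) ψ) :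
    (FlowDomain.torus : FlowDomain d).IsTimeTest T (periodize ψ) := by
  refine ⟨contDiff_periodize hψ, fun x t i => ?_, ?_⟩
  · rw [periodize, periodize]
    conv_rhs => rw [← (Equiv.addRight (Pi.single i 1 : Fin d → ℤ)).tsum_eq]
    refine tsum_congr fun n => congrArg ψ ?_
    refine Prod.ext ?_ (by simp)
    ext j
    by_cases hj : j = i
    · subst hj; simp [unitVec]; ring
    · simp [unitVec, hj]
  · have hK := hψ.2.1.isCompact.image continuous_snd
    have hK' : Prod.snd '' tsupport ψ ⊆ Ioo 0 T := by
      rintro _ ⟨z, hz, rfl⟩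
      exact (hψ.2.2 hz).2
    have hex : ∃ a b : ℝ, 0 < a ∧ b < T ∧ Prod.snd '' tsupport ψ ⊆ Icc a b := by
      rcases (Prod.snd '' tsupport ψ).eq_empty_or_nonempty with h | h
      · exact ⟨1, T - 1, one_pos, by linarith, by rw [h]; exact empty_subset _⟩
      · exact ⟨sInf _, sSup _, (hK' (hK.sInf_mem h)).1, (hK' (hK.sSup_mem h)).2, fun t ht =>
          ⟨csInf_le hK.bddBelow ht, le_csSup hK.bddAbove ht⟩⟩
    obtain ⟨a, b, ha, hb, hab⟩ := hex
    refine ⟨a, b, ha, hb, fun x t ht => ?_⟩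
    rw [periodize]
    refine (tsum_congr fun n => ?_).trans tsum_zero
    refine image_eq_zero_of_notMem_tsupport fun h => ht (hab ⟨_, h, by simp⟩)

theorem isLift_periodize {T : ℝ} {ψ : E d × ℝ → ℝ} (hψ : IsTestOn (torusBox d T) ψ) :
    IsLift ((FlowDomain.torus : FlowDomain d).cyl T) (torusShifts d) (periodize ψ) ψ := by
  refine isLift_of_eventuallyEq (hψ.1.differentiable (by simp)) fun z hz => ?_
  have hev : ∀ᶠ w : E d × ℝ in 𝓝 z, ∀ i, w.1 i ∈ Ioo (-1 : ℝ) 1 :=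
    eventually_all.2 fun i => ((continuous_coord i).comp continuous_fst).continuousAt.eventually
      (Ioo_mem_nhds (by have := (hz.1 i).1; simp only [Function.comp]; linarith) (hz.1 i).2)
  filter_upwards [hev] with w hw
  rw [periodize, torusShifts, Finset.sum_map]
  refine tsum_eq_sum fun n hn => hψ.eq_zero fun h => hn ?_
  refine Fintype.mem_piFinset.2 fun i => ?_
  have h1 := h.1 i
  have h2 := hw i
  rw [Prod.fst_add, PiLp.add_apply, latticeShift_fst, mem_Ioo] at h1
  rw [mem_Ioo] at h2
  -- If `w i` lies in `(-1, 1)` and `w i + n i` in `(-1, 3)`, then `n i` lies strictly between `-2`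
  -- and `4`. This is why the shifts run from `-1` to `3`.
  have h3 : (-2 : ℝ) < n i := by linarith
  have h4 : (n i : ℝ) < 4 := by linarith
  have h5 : -2 < n i := by exact_mod_cast h3
  have h6 : n i < 4 := by exact_mod_cast h4
  rw [Finset.mem_Icc]
  omega

theorem localization_torus (T : ℝ) :
    Localization (FlowDomain.torus : FlowDomain d) T (torusBox d T) (torusShifts d) := by
  refine ⟨isOpen_torusBox T, ?_, fun z hz => ?_, fun z k hk k' hk' h h' => ?_, fun ψ hψ =>
    ⟨periodize ψ, periodize_isTimeTest hψ, isLift_periodize hψ⟩⟩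
  · refine (measure_mono ?_).trans_lt
      ((isCompact_box (d := d) (-1) 3).prod (isCompact_Icc (a := 0) (b := T))).measure_lt_top
    exact prod_mono (fun x hx i => Ioo_subset_Icc_self (hx i)) Ioo_subset_Icc_self
  · refine ⟨latticeShift d fun i => ⌊z.1 i⌋, Finset.mem_map_of_mem _ (Fintype.mem_piFinset.2
      fun i => ?_), mem_cyl_torus.2 ⟨fun i => ?_, ?_⟩⟩
    · have h1 := (mem_torusBox.1 hz).1 i
      rw [Finset.mem_Icc]
      refine ⟨Int.le_floor.2 (by push_cast; exact h1.1.le), ?_⟩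
      have : ⌊z.1 i⌋ < 4 := Int.floor_lt.2 (by push_cast; linarith [h1.2])
      omega
    · rw [Prod.fst_sub, PiLp.sub_apply, latticeShift_fst]
      exact ⟨by linarith [Int.floor_le (z.1 i)], by linarith [Int.lt_floor_add_one (z.1 i)]⟩
    · simpa using (mem_torusBox.1 hz).2
  · obtain ⟨n, -, rfl⟩ := Finset.mem_map.1 hk
    obtain ⟨m, -, rfl⟩ := Finset.mem_map.1 hk'
    congr 1
    funext i
    have h1 := (mem_cyl_torus.1 h).1 i
    have h2 := (mem_cyl_torus.1 h').1 i
    rw [Prod.fst_sub, PiLp.sub_apply, latticeShift_fst] at h1 h2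
    rw [show n i = ⌊z.1 i⌋ from (Int.floor_eq_iff.2 ⟨by linarith [h1.1], by linarith [h1.2]⟩).symm,
      show m i = ⌊z.1 i⌋ from (Int.floor_eq_iff.2 ⟨by linarith [h2.1], by linarith [h2.2]⟩).symm]

/-- The one-dimensional profile of the partition of unity. -/
noncomputable def unitStep (y : ℝ) : ℝ := Real.smoothTransition y - Real.smoothTransition (y - 1)

theorem unitStep_nonneg (y : ℝ) : 0 ≤ unitStep y := by
  rcases le_total y 1 with h | h
  · rw [unitStep, Real.smoothTransition.zero_of_nonpos (by linarith : y - 1 ≤ 0), sub_zero]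
    exact Real.smoothTransition.nonneg y
  · rw [unitStep, Real.smoothTransition.one_of_one_le h, sub_nonneg]
    exact Real.smoothTransition.le_one _

theorem unitStep_eq_zero {y : ℝ} (h : y ∉ Icc 0 2) : unitStep y = 0 := by
  rw [mem_Icc, not_and_or, not_le, not_le] at h
  rcases h with h | h
  · rw [unitStep, Real.smoothTransition.zero_of_nonpos h.le,
      Real.smoothTransition.zero_of_nonpos (by linarith : y - 1 ≤ 0), sub_zero]
  · rw [unitStep, Real.smoothTransition.one_of_one_le (by linarith),
      Real.smoothTransition.one_of_one_le (by linarith), sub_self]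

/-- The sum telescopes to the transition at `y + 3`, which is one, minus the transition at `y - 2`,
which is zero. An open interval of `y` around the cell is covered, so that the identity can be
differentiated on the cell. -/
theorem sum_unitStep {y : ℝ} (h : y ∈ Ioo (-1 : ℝ) 1) :
    ∑ n ∈ Finset.Icc (-1 : ℤ) 3, unitStep (y + n) = 1 := by
  have e : Finset.Icc (-1 : ℤ) 3 = {-1, 0, 1, 2, 3} := by decide
  rw [e]
  simp only [Finset.mem_insert, Finset.mem_singleton, Finset.sum_insert, Finset.sum_singleton,
    unitStep, Int.reduceNeg, reduceCtorEq, or_self, not_false_eq_true, Int.cast_neg, Int.cast_one,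
    Int.cast_zero, Int.cast_ofNat, neg_eq_zero, one_ne_zero, Int.reduceEq, zero_ne_one,
    OfNat.zero_ne_ofNat, OfNat.one_ne_ofNat]
  rw [show y + -1 = y - 1 by ring, show y + 0 - 1 = y - 1 by ring, show y + 1 - 1 = y + 0 by ring,
    show y + 2 - 1 = y + 1 by ring, show y + 3 - 1 = y + 2 by ring,
    Real.smoothTransition.one_of_one_le (by linarith [h.1] : 1 ≤ y + 3),
    Real.smoothTransition.zero_of_nonpos (by linarith [h.2] : y - 1 - 1 ≤ 0)]
  ring

/-- The lift is `ψ = χ φ` with `χ` a nonnegative function whose lattice translates sum to one.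
Nonnegativity gives equality in the triangle inequality, so no constant is lost when the estimate
for `ψ` is brought back to `φ`. -/
theorem FlowDomain.exists_localization_torus {T : ℝ} {φ : E d × ℝ → ℝ}
    (hφ : (FlowDomain.torus : FlowDomain d).IsTimeTest T φ) :
    ∃ O S ψ, Localization (FlowDomain.torus : FlowDomain d) T O S ∧ IsTestOn O ψ ∧
      IsLift ((FlowDomain.torus : FlowDomain d).cyl T) S φ ψ ∧
      ∀ z ∈ (FlowDomain.torus : FlowDomain d).cyl T, ‖φ z‖ₑ = ∑ k ∈ S, ‖ψ (z + k)‖ₑ := by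
  obtain ⟨hφs, hper, a, b, ha, hb, hab⟩ := hφ
  set χ : E d × ℝ → ℝ := fun z => ∏ i, unitStep (z.1 i) with hχ
  have hχs : ContDiff ℝ ∞ χ := by
    refine contDiff_prod fun i _ => ?_
    have hi : ContDiff ℝ ∞ fun z : E d × ℝ => z.1 i :=
      (EuclideanSpace.proj i : E d →L[ℝ] ℝ).contDiff.comp contDiff_fst
    exact (Real.smoothTransition.contDiff.comp hi).sub
      (Real.smoothTransition.contDiff.comp (hi.sub contDiff_const))
  have hχ0 : ∀ z, 0 ≤ χ z := fun z => Finset.prod_nonneg fun i _ => unitStep_nonneg _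
  have hsum : ∀ w : E d × ℝ, (∀ i, w.1 i ∈ Ioo (-1 : ℝ) 1) → ∑ k ∈ torusShifts d, χ (w + k) = 1 := by
    intro w hw
    rw [torusShifts, Finset.sum_map]
    simp only [hχ, Prod.fst_add, PiLp.add_apply, latticeShift_fst]
    rw [← Finset.prod_univ_sum (fun _ : Fin d => Finset.Icc (-1 : ℤ) 3)
      fun i n => unitStep (w.1 i + n)]
    exact Finset.prod_eq_one fun i _ => sum_unitStep (hw i)
  have hφk : ∀ z, ∀ k ∈ torusShifts d, φ (z + k) = φ z := by
    intro z k hk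
    obtain ⟨n, -, rfl⟩ := Finset.mem_map.1 hk
    exact periodic_latticeShift hper n z
  have hψs : ContDiff ℝ ∞ fun z => χ z * φ z := hχs.mul hφs
  have hsupp : Function.support (fun z => χ z * φ z) ⊆ {x : E d | ∀ i, x i ∈ Icc (0 : ℝ) 2} ×ˢ Icc a b := by
    intro z hz
    refine ⟨fun i => ?_, ?_⟩
    · by_contra h
      have h0 : χ z = 0 := Finset.prod_eq_zero (Finset.mem_univ i) (unitStep_eq_zero h)
      exact hz (by beta_reduce; rw [h0, zero_mul])
    · by_contra h
      exact hz (by beta_reduce; rw [show φ z = 0 from hab z.1 z.2 h, mul_zero])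
  have hcomp := (isCompact_box (d := d) 0 2).prod (isCompact_Icc (a := a) (b := b))
  have hts : tsupport (fun z => χ z * φ z) ⊆ {x : E d | ∀ i, x i ∈ Icc (0 : ℝ) 2} ×ˢ Icc a b :=
    closure_minimal hsupp hcomp.isClosed
  refine ⟨torusBox d T, torusShifts d, fun z => χ z * φ z, localization_torus T,
    ⟨hψs, HasCompactSupport.of_support_subset_isCompact hcomp hsupp, hts.trans (prod_mono
      (fun x hx i => ⟨by linarith [(hx i).1], by linarith [(hx i).2]⟩)
      fun t ht => ⟨ha.trans_le ht.1, ht.2.trans_lt hb⟩)⟩,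
    isLift_of_eventuallyEq (hψs.differentiable (by simp)) fun z hz => ?_, fun z hz => ?_⟩
  · have hev : ∀ᶠ w : E d × ℝ in 𝓝 z, ∀ i, w.1 i ∈ Ioo (-1 : ℝ) 1 :=
      eventually_all.2 fun i => ((continuous_coord i).comp continuous_fst).continuousAt.eventually
        (Ioo_mem_nhds (by have := (hz.1 i).1; simp only [Function.comp]; linarith) (hz.1 i).2)
    filter_upwards [hev] with w hw
    rw [Finset.sum_congr rfl fun k hk => by rw [hφk w k hk], ← Finset.sum_mul, hsum w hw, one_mul]
  · have hz1 := hsum z fun i => ⟨by linarith [(hz.1 i).1], (hz.1 i).2⟩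
    rw [Finset.sum_congr rfl fun k hk => by
        beta_reduce
        rw [hφk z k hk, enorm_mul, Real.enorm_of_nonneg (hχ0 _)],
      ← Finset.sum_mul, ← ENNReal.ofReal_sum_of_nonneg fun k _ => hχ0 _, hz1, ENNReal.ofReal_one,
      one_mul]

theorem FlowDomain.exists_localization {𝒟 : FlowDomain d} {T : ℝ} {φ : E d × ℝ → ℝ}
    (hφ : 𝒟.IsTimeTest T φ) : ∃ O S ψ, Localization 𝒟 T O S ∧ IsTestOn O ψ ∧
      IsLift (𝒟.cyl T) S φ ψ ∧ ∀ z ∈ 𝒟.cyl T, ‖φ z‖ₑ = ∑ k ∈ S, ‖ψ (z + k)‖ₑ := by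
  cases 𝒟 with
  | openSet Ω => exact exists_localization_openSet hφ
  | torus => exact exists_localization_torus hφ

end Lifts

/-! ### Test functions on space-time -/

section TimeTests

variable {d : ℕ} {𝒟 : FlowDomain d} {T : ℝ}

theorem bounded_of_periodic {g : E d × ℝ → ℝ} (hg : Continuous g)
    (hper : ∀ x t i, g (x + unitVec i, t) = g (x, t)) {a b : ℝ}
    (hab : ∀ x t, t ∉ Icc a b → g (x, t) = 0) : ∃ C, ∀ z, |g z| ≤ C := by
  obtain ⟨C, hC⟩ := ((isCompact_box (d := d) 0 1).prod (isCompact_Icc (a := a) (b := b))).exists_bound_of_continuousOn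
    hg.continuousOn
  refine ⟨max C 0, fun z => ?_⟩
  by_cases hz : z.2 ∈ Icc a b
  · rw [← periodic_latticeShift hper (fun i => -⌊z.1 i⌋) z]
    refine (hC _ ⟨fun i => ?_, by simpa using hz⟩).trans (le_max_left _ _)
    rw [Prod.fst_add, PiLp.add_apply, latticeShift_fst]
    push_cast
    exact ⟨by linarith [Int.floor_le (z.1 i)], by linarith [Int.lt_floor_add_one (z.1 i)]⟩
  · rw [show g z = 0 from hab z.1 z.2 hz, abs_zero]
    exact le_max_right _ _

theorem FlowDomain.volume_cyl_torus (T : ℝ) : volume ((FlowDomain.torus : FlowDomain d).cyl T) < ⊤ :=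
  (measure_mono (fun _ hz => ⟨fun i => Ico_subset_Icc_self (hz.1 i), Ioo_subset_Icc_self hz.2⟩ :
      (FlowDomain.torus : FlowDomain d).cyl T ⊆ {x | ∀ i, x i ∈ Icc 0 1} ×ˢ Icc 0 T)).trans_lt
    ((isCompact_box (d := d) 0 1).prod (isCompact_Icc (a := 0) (b := T))).measure_lt_top

theorem integrableOn_torus {g : E d × ℝ → ℝ} (hg : BddMeas g) :
    IntegrableOn g ((FlowDomain.torus : FlowDomain d).cyl T) := by
  obtain ⟨C, hC⟩ := hg.bdd
  exact Measure.integrableOn_of_bounded (FlowDomain.volume_cyl_torus T).ne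
    hg.measurable.aestronglyMeasurable (ae_of_all _ hC)

namespace FlowDomain.IsTimeTest

variable {φ ψ : E d × ℝ → ℝ}

theorem contDiff (h : 𝒟.IsTimeTest T φ) : ContDiff ℝ ∞ φ := by
  cases 𝒟 with
  | openSet Ω => exact h.1
  | torus => exact h.1

theorem bddMeas (h : 𝒟.IsTimeTest T φ) : BddMeas φ := by
  refine ⟨h.contDiff.continuous.measurable, ?_⟩
  cases 𝒟 with
  | openSet Ω => exact h.2.1.exists_bound_of_continuous h.1.continuous
  | torus =>
    obtain ⟨h1, h2, a, b, -, -, h3⟩ := h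
    exact bounded_of_periodic h1.continuous h2 h3

theorem fderiv_bddMeas (h : 𝒟.IsTimeTest T φ) (l : E d × ℝ) :
    BddMeas fun z => fderiv ℝ φ z l := by
  have hc : Continuous fun z => fderiv ℝ φ z l :=
    (h.contDiff.continuous_fderiv (by simp)).clm_apply continuous_const
  cases 𝒟 with
  | openSet Ω =>
    exact IsTestOn.fderiv_bddMeas (O := (Ω : Set (E d)) ×ˢ Ioo 0 T) h l
  | torus =>
    refine ⟨hc.measurable, ?_⟩
    obtain ⟨h1, h2, a, b, -, -, h3⟩ := h
    refine bounded_of_periodic hc (fun x t i => ?_) (a := a) (b := b) fun x t ht => ?_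
    · have e : (fun z : E d × ℝ => φ (z + (unitVec i, 0))) = φ := by
        funext z
        change φ (z.1 + unitVec i, z.2 + 0) = φ (z.1, z.2)
        rw [add_zero, h2]
      have := fderiv_comp_add_right (𝕜 := ℝ) (f := φ) (x := (x, t)) (unitVec i, 0)
      rw [e] at this
      rw [this, Prod.mk_add_mk, add_zero]
    · have : φ =ᶠ[𝓝 (x, t)] fun _ => 0 := by
        have ho : ∀ᶠ z : E d × ℝ in 𝓝 (x, t), z.2 ∈ (Icc a b)ᶜ :=
          continuous_snd.continuousAt.eventually (isClosed_Icc.isOpen_compl.mem_nhds ht)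
        filter_upwards [ho] with z hz using h3 z.1 z.2 hz
      rw [this.fderiv_eq]; simp

theorem fderiv_integrableOn (h : 𝒟.IsTimeTest T φ) (l : E d × ℝ) :
    IntegrableOn (fun z => fderiv ℝ φ z l) (𝒟.cyl T) := by
  cases 𝒟 with
  | openSet Ω =>
    exact (IsTestOn.fderiv_integrable (O := (Ω : Set (E d)) ×ˢ Ioo 0 T) h l).integrableOn
  | torus => exact integrableOn_torus (h.fderiv_bddMeas l)

theorem integrableOn_fderiv_field (h : 𝒟.IsTimeTest T φ) {ι : Type*} [Fintype ι]
    {e : ι → E d × ℝ} {v : ι → E d × ℝ → ℝ} (hv : ∀ i, BddMeas (v i)) :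
    IntegrableOn (fun z => fderiv ℝ φ z (field e v z)) (𝒟.cyl T) := by
  simp_rw [clm_field]
  exact integrable_finsetSum _ fun i _ => (hv i).integrable_mul (h.fderiv_integrableOn _)

theorem slice (h : 𝒟.IsTimeTest T φ) (t : ℝ) : 𝒟.IsTest fun x => φ (x, t) := by
  have hs : ContDiff ℝ ∞ fun x : E d => φ (x, t) :=
    h.contDiff.comp (contDiff_id.prodMk contDiff_const)
  cases 𝒟 with
  | openSet Ω =>
    have hcl : IsClosed {x : E d | (x, t) ∈ tsupport φ} :=
      (isClosed_tsupport φ).preimage (continuous_id.prodMk continuous_const)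
    have hsub : tsupport (fun x => φ (x, t)) ⊆ {x | (x, t) ∈ tsupport φ} :=
      closure_minimal (fun x hx => subset_tsupport φ hx) hcl
    refine ⟨hs, ?_, fun x hx => (h.2.2 (hsub hx)).1⟩
    refine (h.2.1.isCompact.image continuous_fst).of_isClosed_subset (isClosed_tsupport _) ?_
    exact fun x hx => ⟨_, hsub hx, rfl⟩
  | torus => exact ⟨hs, fun x i => h.2.1 x t i⟩

theorem fderiv_slice (h : 𝒟.IsTimeTest T φ) (x : E d) (t : ℝ) (w : E d) :
    fderiv ℝ (fun x => φ (x, t)) x w = fderiv ℝ φ (x, t) (w, 0) := by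
  have h1 : HasFDerivAt φ (fderiv ℝ φ (x, t)) (x, t) :=
    (h.contDiff.differentiable (by simp) _).hasFDerivAt
  have h2 := HasFDerivAt.comp (f := fun x : E d => (x, t)) x h1
    ((hasFDerivAt_id x).prodMk (hasFDerivAt_const t x))
  have h3 : fderiv ℝ (fun x => φ (x, t)) x = _ := h2.fderiv
  rw [h3]
  simp

theorem add (hφ : 𝒟.IsTimeTest T φ) (hψ : 𝒟.IsTimeTest T ψ) : 𝒟.IsTimeTest T (φ + ψ) := by
  cases 𝒟 with
  | openSet Ω => exact IsTestOn.add (O := (Ω : Set (E d)) ×ˢ Ioo 0 T) hφ hψ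
  | torus =>
    obtain ⟨h1, h2, a, b, ha, hb, h3⟩ := hφ
    obtain ⟨k1, k2, a', b', ha', hb', k3⟩ := hψ
    refine ⟨h1.add k1, fun x t i => by simp only [Pi.add_apply, h2, k2], min a a', max b b',
      lt_min ha ha', max_lt hb hb', fun x t ht => ?_⟩
    rw [Pi.add_apply, h3 x t fun h => ht (Icc_subset_Icc (min_le_left _ _) (le_max_left _ _) h),
      k3 x t fun h => ht (Icc_subset_Icc (min_le_right _ _) (le_max_right _ _) h), add_zero]

theorem smul (hφ : 𝒟.IsTimeTest T φ) (r : ℝ) : 𝒟.IsTimeTest T (r • φ) := by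
  cases 𝒟 with
  | openSet Ω => exact IsTestOn.smul (O := (Ω : Set (E d)) ×ˢ Ioo 0 T) hφ r
  | torus =>
    obtain ⟨h1, h2, a, b, ha, hb, h3⟩ := hφ
    exact ⟨h1.const_smul r, fun x t i => by simp only [Pi.smul_apply, h2], a, b, ha, hb,
      fun x t ht => by rw [Pi.smul_apply, h3 x t ht, smul_zero]⟩

theorem smul_const (hφ : 𝒟.IsTimeTest T φ) (w : E d) : 𝒟.IsTimeTest T fun z => φ z • w := by
  cases 𝒟 with
  | openSet Ω =>
    refine ⟨hφ.1.smul contDiff_const, hφ.2.1.smul_right, ?_⟩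
    exact (closure_mono fun z hz => left_ne_zero_of_smul hz).trans hφ.2.2
  | torus =>
    obtain ⟨h1, h2, a, b, ha, hb, h3⟩ := hφ
    exact ⟨h1.smul contDiff_const, fun x t i => by simp only [h2], a, b, ha, hb,
      fun x t ht => by beta_reduce; rw [h3 x t ht, zero_smul]⟩

end FlowDomain.IsTimeTest

/-! ### Curves of distributional derivatives -/

theorem FlowDomain.restrict_cyl (𝒟 : FlowDomain d) (T : ℝ) :
    (volume : Measure (E d × ℝ)).restrict (𝒟.cyl T)
      = (volume.restrict 𝒟.cell).prod (volume.restrict (Ioo 0 T)) := by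
  rw [FlowDomain.cyl, Measure.volume_eq_prod, Measure.prod_restrict]

theorem FlowDomain.ae_ae_of_ae_cyl {P : E d × ℝ → Prop}
    (h : ∀ᵐ z ∂volume.restrict (𝒟.cyl T), P z) :
    ∀ᵐ t ∂volume.restrict (Ioo 0 T), ∀ᵐ x ∂volume.restrict 𝒟.cell, P (x, t) := by
  rw [FlowDomain.restrict_cyl] at h
  have h' := (Measure.measurePreserving_swap (μ := (volume : Measure ℝ).restrict (Ioo 0 T))
    (ν := (volume : Measure (E d)).restrict 𝒟.cell)).quasiMeasurePreserving.ae h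
  exact Measure.ae_ae_of_ae_prod h'

/-- A curve of vector measures whose components are distributional derivatives of bounded fields
has, up to its singular part, a density on space-time. -/
theorem exists_density_of_curve {ι : Type*} [Fintype ι]
    {Γ : ℝ → VectorMeasure (E d) (EuclideanSpace ℝ ι)} {b : ι → Fin d → E d × ℝ → ℝ}
    (hb : ∀ i j, BddMeas (b i j))
    (hconc : ∀ᵐ t ∂volume.restrict (Ioo 0 T), (Γ t).variation 𝒟.cellᶜ = 0)
    (hweak : ∀ᵐ t ∂volume.restrict (Ioo 0 T), ∀ φ, 𝒟.IsTest φ → ∀ i,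
      (∫ᵛ x, φ x ∂•(Γ t)) i = -∫ x in 𝒟.cell, ∑ j, b i j (x, t) * fderiv ℝ φ x (unitVec j))
    (hfin : ∫⁻ t in Ioo 0 T, (Γ t).variation univ < ⊤) :
    IsFiniteMeasure (singTensorTime T Γ) ∧ singTensorTime T Γ (𝒟.cyl T)ᶜ = 0 ∧
    ∃ g : ι → E d × ℝ → ℝ, (∀ i, Measurable (g i) ∧ IntegrableOn (g i) (𝒟.cyl T)) ∧
      ∀ φ : E d × ℝ → ℝ, 𝒟.IsTimeTest T φ → ∀ i,
      ‖∫ z in 𝒟.cyl T, (g i z * φ z + fderiv ℝ φ z (field spaceDir (b i) z))‖ₑ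
        ≤ ∫⁻ z, ‖φ z‖ₑ ∂(singTensorTime T Γ) := by
  -- The curve of measures is arbitrary in time, but its pairing with a fixed test function equals
  -- almost everywhere an integral over the cell, which is measurable in time by Fubini.
  have hm : ∀ φ, 𝒟.IsTest φ → ∀ i,
      AEMeasurable (fun t => (∫ᵛ x, φ x ∂•(Γ t)) i) (volume.restrict (Ioo 0 T)) := by
    intro φ hφ i
    have hc : ContDiff ℝ ∞ φ := by
      cases 𝒟 with
      | openSet Ω => exact hφ.1
      | torus => exact hφ.1
    have hsm : StronglyMeasurable fun z : E d × ℝ =>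
        ∑ j, b i j z * fderiv ℝ φ z.1 (unitVec j) := by
      refine (Finset.measurable_fun_sum _ fun j _ => (hb i j).measurable.mul ?_).stronglyMeasurable
      exact ((hc.continuous_fderiv (by simp)).clm_apply continuous_const).measurable.comp
        measurable_fst
    have h2 := (hsm.integral_prod_left' (μ := volume.restrict 𝒟.cell)).neg.measurable
    exact h2.aemeasurable.congr (hweak.mono fun t ht => (ht φ hφ i).symm)
  obtain ⟨h1, h2, g, hg, h3⟩ := exists_curve_density 𝒟.measurableSet_cell
    (fun i A hA => FlowDomain.aemeasurable_apply hconc hm i A hA) hfin hconc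
  refine ⟨h1, h2, g, hg, fun φ hφ i => ?_⟩
  have hD := hφ.integrableOn_fderiv_field (e := spaceDir) (hb i)
  have hgφ : IntegrableOn (fun z => φ z * g i z) (𝒟.cyl T) := hφ.bddMeas.integrable_mul (hg i).2
  have hD' : Integrable (fun z => fderiv ℝ φ z (field spaceDir (b i) z))
      ((volume.restrict 𝒟.cell).prod (volume.restrict (Ioo 0 T))) := by
    rw [← FlowDomain.restrict_cyl]; exact hD
  have h4 := h3 φ hφ.bddMeas i
    (fun t => -∫ x in 𝒟.cell, fderiv ℝ φ (x, t) (field spaceDir (b i) (x, t)))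
    hD'.integral_prod_right.neg (hweak.mono fun t ht => by
      rw [ht _ (hφ.slice t) i]
      congr 1
      refine integral_congr_ae (ae_of_all _ fun x => ?_)
      beta_reduce
      rw [clm_field]
      exact Finset.sum_congr rfl fun j _ => by rw [hφ.fderiv_slice]; rfl)
  rw [integral_neg, ← integral_prod_symm _ hD', ← FlowDomain.restrict_cyl, ← enorm_neg] at h4
  refine le_of_eq_of_le ?_ h4
  rw [integral_add (hgφ.congr (ae_of_all _ fun z => mul_comm _ _)) hD]
  congr 1
  rw [neg_sub, sub_neg_eq_add]
  congr 1
  exact integral_congr_ae (ae_of_all _ fun z => mul_comm _ _)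

end TimeTests

/-! ### Weak solutions given by everywhere bounded functions -/

section WeakSolutions

variable {d : ℕ} {𝒟 : FlowDomain d} {T : ℝ}

/-- Truncation to the interval `[a, b]`. -/
def clamp (a b x : ℝ) : ℝ := max a (min x b)

theorem measurable_clamp (a b : ℝ) : Measurable (clamp a b) :=
  measurable_const.max (measurable_id.min measurable_const)

theorem clamp_mem {a b : ℝ} (h : a ≤ b) (x : ℝ) : clamp a b x ∈ Icc a b :=
  ⟨le_max_left _ _, max_le h (min_le_right _ _)⟩

theorem clamp_of_mem {a b x : ℝ} (h : x ∈ Icc a b) : clamp a b x = x := by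
  rw [clamp, min_eq_left h.2, max_eq_right h.1]

theorem ae_norm_le_of_eLpNorm_le {X F : Type*} [MeasurableSpace X] [NormedAddCommGroup F]
    {μ : Measure X} {g : X → F} {M : ℝ≥0} (h : eLpNorm g ⊤ μ ≤ M) : ∀ᵐ z ∂μ, ‖g z‖ ≤ M := by
  rw [eLpNorm_exponent_top] at h
  filter_upwards [enorm_ae_le_eLpNormEssSup g μ] with z hz
  have := hz.trans h
  rw [← enorm_norm, Real.enorm_of_nonneg (norm_nonneg _)] at this
  have h2 := (ENNReal.ofReal_le_iff_le_toReal ENNReal.coe_ne_top).1 this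
  simpa using h2

theorem field_spaceDir (w : Fin d → ℝ) : ∑ j, w j • (spaceDir j : E d × ℝ) = (WithLp.toLp 2 w, 0) := by
  refine Prod.ext ?_ (by simp [spaceDir, Prod.snd_sum])
  ext j
  simp [spaceDir, Prod.fst_sum, unitVec, Finset.sum_apply, Pi.single_apply]

theorem field_spaceDir_of_eq {v : Fin d → E d × ℝ → ℝ} {z : E d × ℝ} {w : E d}
    (h : ∀ i, v i z = w i) : field spaceDir v z = (w, 0) := by
  rw [field, Finset.sum_congr rfl fun j _ => by rw [h j], field_spaceDir]

/-- Measurable representatives are truncated to their essential bounds, so that the bounds hold at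
every point. No integral over the region changes. -/
theorem IsWeakSolution.exists_cylinderSolution {ρ p : E d × ℝ → ℝ} {u f : E d × ℝ → E d}
    (h : IsWeakSolution 𝒟 T ρ u p f) {c : ℝ} (hc : 0 < c) {M : ℝ≥0}
    (hρ : eLpNorm ρ ⊤ (volume.restrict (𝒟.cyl T)) ≤ M)
    (hu : eLpNorm u ⊤ (volume.restrict (𝒟.cyl T)) ≤ M)
    (hp : eLpNorm p ⊤ (volume.restrict (𝒟.cyl T)) ≤ M)
    (hvac : ∀ᵐ z ∂volume.restrict (𝒟.cyl T), c ≤ ρ z) :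
    ∃ (ρ' p' : E d × ℝ → ℝ) (v f' : Fin d → E d × ℝ → ℝ),
      CylinderSolution 𝒟 T c (max M c) ρ' p' v f' ∧
      (∀ᵐ z ∂volume.restrict (𝒟.cyl T), ρ' z = ρ z) ∧
      (∀ᵐ z ∂volume.restrict (𝒟.cyl T), ∀ i, v i z = u z i) ∧
      ∀ φ : E d × ℝ → ℝ, 𝒟.IsTimeTest T φ →
        cylinderDefect 𝒟 T ρ' p' v f' φ = 2 * duchonRobert 𝒟 T ρ u p f φ := by
  set m := volume.restrict (𝒟.cyl T) with hm
  -- The interval `[c, M']` must be nonempty even if `M` is smaller than `c`, which can happen when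
  -- the region is a null set.
  set M' : ℝ := max M c with hM'
  have hM0 : 0 ≤ M' := hc.le.trans (le_max_right _ _)
  have hMM : (M : ℝ) ≤ M' := le_max_left _ _
  obtain ⟨ρ₁, hρ₁, hρe⟩ := h.density_memLp.1
  obtain ⟨u₁, hu₁, hue⟩ := h.velocity_memLp.1
  obtain ⟨p₁, hp₁, hpe⟩ := h.pressure_memLp.1
  obtain ⟨f₁, hf₁, hfe⟩ := h.force_integrable.1
  have hcoord : ∀ i, Measurable fun x : E d => x i := fun i => (continuous_coord i).measurable
  set ρ' : E d × ℝ → ℝ := fun z => clamp c M' (ρ₁ z) with hρ'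
  set v : Fin d → E d × ℝ → ℝ := fun i z => clamp (-M') M' (u₁ z i) with hv
  set p' : E d × ℝ → ℝ := fun z => clamp (-M') M' (p₁ z) with hp'
  set f' : Fin d → E d × ℝ → ℝ := fun i z => f₁ z i with hf'
  have eρ : ∀ᵐ z ∂m, ρ' z = ρ z := by
    filter_upwards [hρe, ae_norm_le_of_eLpNorm_le hρ, hvac] with z h1 h2 h3
    simp only [hρ']
    rw [← h1]
    exact clamp_of_mem ⟨h3, (le_abs_self _).trans (h2.trans hMM)⟩
  have ev : ∀ᵐ z ∂m, ∀ i, v i z = u z i := by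
    filter_upwards [hue, ae_norm_le_of_eLpNorm_le hu] with z h1 h2 i
    simp only [hv]
    rw [← h1]
    have h3 : |u z i| ≤ M' := (PiLp.norm_apply_le (u z) i).trans (h2.trans hMM)
    exact clamp_of_mem (abs_le.1 h3)
  have ep : ∀ᵐ z ∂m, p' z = p z := by
    filter_upwards [hpe, ae_norm_le_of_eLpNorm_le hp] with z h1 h2
    simp only [hp']
    rw [← h1]
    exact clamp_of_mem (abs_le.1 (h2.trans hMM))
  have ef : ∀ᵐ z ∂m, ∀ i, f' i z = f z i := by
    filter_upwards [hfe] with z h1 i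
    simp only [hf']
    rw [h1]
  have hvm : ∀ i, Measurable (v i) := fun i =>
    (measurable_clamp _ _).comp ((hcoord i).comp hu₁.measurable)
  have hvb : ∀ i z, |v i z| ≤ M' := fun i z => abs_le.2 (clamp_mem (by linarith) _)
  have hinn : ∀ a b : E d, ⟪a, b⟫ = ∑ i, a i * b i := fun a b => by
    rw [PiLp.inner_apply]
    exact Finset.sum_congr rfl fun i _ => by simp [mul_comm]
  refine ⟨ρ', p', v, f', ?_, eρ, ev, fun φ hφ => ?_⟩
  · refine ⟨hc, (measurable_clamp _ _).comp hρ₁.measurable, hvm,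
      (measurable_clamp _ _).comp hp₁.measurable, fun i => (hcoord i).comp hf₁.measurable,
      fun z => clamp_mem (le_max_right _ _) _, hvb, fun z => abs_le.2 (clamp_mem (by linarith) _),
      fun i => ?_, fun i φ hφ => ?_, fun φ hφ => ?_, fun φ hφ => ?_⟩
    · have hi : Integrable (fun z => f z i) m :=
        (EuclideanSpace.proj i : E d →L[ℝ] ℝ).integrable_comp h.force_integrable
      exact hi.congr (ef.mono fun z hz => (hz i).symm)
    -- The vector equation is tested with `φ` times the `i`-th basis vector.
    · rw [← h.momentum _ (hφ.smul_const (unitVec i))]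
      refine integral_congr_ae ?_
      filter_upwards [eρ, ev, ep, ef] with z h1 h2 h3 h4
      have hd : ∀ l, fderiv ℝ (fun z => φ z • (unitVec i : E d)) z l = fderiv ℝ φ z l • unitVec i :=
        fun l => by
          rw [fderiv_smul_const (hφ.contDiff.differentiable (by simp) z)]
          rfl
      have hi : ∀ a : E d, ∀ r : ℝ, ⟪a, r • (unitVec i : E d)⟫ = r * a i := fun a r => by
        rw [inner_smul_right, unitVec, EuclideanSpace.inner_single_right]; simp
      have hs : ∀ (r : ℝ) j, (r • (unitVec i : E d)) j = if j = i then r else 0 := fun r j => by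
        simp [unitVec]
      simp only [hd, hi, hs, h1, h2, h3, h4, map_add, map_smul, smul_eq_mul, clm_field, mul_ite,
        mul_zero, Finset.sum_ite_eq', Finset.mem_univ, if_true]
      have : ∑ j, u z j * u z i * fderiv ℝ φ z (unitVec j, 0)
          = u z i * ∑ j, u z j * fderiv ℝ φ z (unitVec j, 0) := by
        rw [Finset.mul_sum]
        exact Finset.sum_congr rfl fun j _ => by ring
      rw [this]
      simp only [spaceDir]
      ring
    · rw [← h.transport φ hφ]
      refine integral_congr_ae ?_
      filter_upwards [eρ, ev] with z h1 h2
      rw [field_spaceDir_of_eq h2, h1, map_smul, smul_eq_mul, map_add, add_comm]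
    -- The constraint holds on time slices only; Fubini makes it a statement on space-time.
    · have hD : Integrable (fun z => fderiv ℝ φ z (field spaceDir v z)) m :=
        hφ.integrableOn_fderiv_field fun i => ⟨hvm i, M', hvb i⟩
      rw [hm, FlowDomain.restrict_cyl] at hD
      rw [FlowDomain.restrict_cyl, integral_prod_symm _ hD]
      refine (integral_congr_ae (g := fun _ => 0) ?_).trans (by simp)
      filter_upwards [h.incompressible, FlowDomain.ae_ae_of_ae_cyl ev] with t ht hx
      rw [← ht _ (hφ.slice t)]
      refine integral_congr_ae ?_
      filter_upwards [hx] with x hx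
      rw [hφ.fderiv_slice, field_spaceDir_of_eq hx]
  · rw [cylinderDefect, duchonRobert, ← integral_const_mul]
    refine integral_congr_ae ?_
    filter_upwards [eρ, ev, ep, ef] with z h1 h2 h3 h4
    have hn : ‖u z‖ ^ 2 = ∑ i, u z i * u z i := by
      rw [EuclideanSpace.real_norm_sq_eq]
      exact Finset.sum_congr rfl fun i _ => by ring
    have hs : ∑ i, ρ z * u z i * u z i = ρ z * ‖u z‖ ^ 2 := by
      rw [hn, Finset.mul_sum]
      exact Finset.sum_congr rfl fun i _ => by ring
    rw [field_spaceDir_of_eq h2]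
    simp only [h1, h2, h3, h4, hs, hinn, map_add, map_smul, smul_eq_mul]
    ring

end WeakSolutions

/-! ### Transfer of the hypotheses on the gradients -/

section Gradients

variable {d : ℕ} {𝒟 : FlowDomain d} {T : ℝ}

theorem IsGradientCurve.exists_density {F F' : E d × ℝ → ℝ}
    {Γ : ℝ → VectorMeasure (E d) (EuclideanSpace ℝ (Fin d))} (hΓ : IsGradientCurve 𝒟 T F Γ)
    (hF' : BddMeas F') (hFF' : ∀ᵐ z ∂volume.restrict (𝒟.cyl T), F' z = F z) :
    IsFiniteMeasure (singTensorTime T Γ) ∧ singTensorTime T Γ (𝒟.cyl T)ᶜ = 0 ∧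
    ∃ g : Fin d → E d × ℝ → ℝ, (∀ i, Measurable (g i) ∧ IntegrableOn (g i) (𝒟.cyl T)) ∧
      ∀ i, ∀ φ : E d × ℝ → ℝ, 𝒟.IsTimeTest T φ →
      ‖∫ z in 𝒟.cyl T, (g i z * φ z + fderiv ℝ φ z (F' z • spaceDir i))‖ₑ
        ≤ ∫⁻ z, ‖φ z‖ₑ ∂(singTensorTime T Γ) := by
  obtain ⟨h1, h2, g, hg, h3⟩ := exists_density_of_curve (𝒟 := 𝒟) (T := T) (Γ := Γ)
    (b := fun i j z => if j = i then F' z else 0)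
    (fun i j => by by_cases h : j = i <;> simp only [h, if_true, if_false]; exacts [hF', .const 0])
    (hΓ.gradient.mono fun t ht => ht.concentrated)
    (by
      filter_upwards [hΓ.gradient, FlowDomain.ae_ae_of_ae_cyl hFF'] with t ht hx φ hφ i
      rw [ht.weak_eq φ hφ i]
      congr 1
      refine integral_congr_ae ?_
      filter_upwards [hx] with x hx
      simp [hx]) hΓ.norm_integrable
  refine ⟨h1, h2, g, hg, fun i φ hφ => ?_⟩
  have := h3 φ hφ i
  simpa [field] using this

theorem IsSymGradientCurve.exists_density {u : E d × ℝ → E d} {v : Fin d → E d × ℝ → ℝ}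
    {Γ : ℝ → VectorMeasure (E d) (EuclideanSpace ℝ (Fin d × Fin d))}
    (hΓ : IsSymGradientCurve 𝒟 T u Γ)
    (hv : ∀ i, BddMeas (v i)) (huv : ∀ᵐ z ∂volume.restrict (𝒟.cyl T), ∀ i, v i z = u z i) :
    IsFiniteMeasure (singTensorTime T Γ) ∧ singTensorTime T Γ (𝒟.cyl T)ᶜ = 0 ∧
    ∃ g : Fin d → Fin d → E d × ℝ → ℝ,
      (∀ i j, Measurable (g i j) ∧ IntegrableOn (g i j) (𝒟.cyl T)) ∧
      ∀ i j, ∀ φ : E d × ℝ → ℝ, 𝒟.IsTimeTest T φ →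
      ‖∫ z in 𝒟.cyl T, (g i j z * φ z
          + fderiv ℝ φ z ((1 / 2 : ℝ) • (v j z • spaceDir i + v i z • spaceDir j)))‖ₑ
        ≤ ∫⁻ z, ‖φ z‖ₑ ∂(singTensorTime T Γ) := by
  have hb : ∀ (k i : Fin d) j, BddMeas fun z => if k = i then v j z else 0 := fun k i j => by
    by_cases h : k = i <;> simp only [h, if_true, if_false]
    exacts [hv j, .const 0]
  -- The symmetrized derivative with indices `q` is put in divergence form, as the pairing of the
  -- gradient of the test function with a field having at most two nonzero components.
  obtain ⟨h1, h2, g, hg, h3⟩ := exists_density_of_curve (𝒟 := 𝒟) (T := T) (Γ := Γ)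
    (b := fun q k z => (1 / 2) * ((if k = q.1 then v q.2 z else 0) + (if k = q.2 then v q.1 z else 0)))
    (fun q k => (BddMeas.const _).mul ((hb _ _ _).add (hb _ _ _)))
    (hΓ.symGradient.mono fun t ht => ht.concentrated)
    (by
      filter_upwards [hΓ.symGradient, FlowDomain.ae_ae_of_ae_cyl huv] with t ht hx φ hφ q
      rw [ht.weak_eq φ hφ q.1 q.2]
      congr 1
      refine integral_congr_ae ?_
      filter_upwards [hx] with x hx
      simp only [hx, mul_assoc, add_mul, ite_mul, zero_mul, Finset.sum_add_distrib, mul_add, mul_ite,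
        mul_zero, Finset.sum_ite_eq', Finset.mem_univ, if_true]
      ring) hΓ.norm_integrable
  refine ⟨h1, h2, fun i j => g (i, j), fun i j => hg (i, j), fun i j φ hφ => ?_⟩
  refine le_of_eq_of_le ?_ (h3 φ hφ (i, j))
  congr 1
  refine integral_congr_ae (ae_of_all _ fun z => ?_)
  simp only [clm_field, map_add, map_smul, smul_eq_mul, mul_assoc, add_mul, ite_mul, zero_mul,
    Finset.sum_add_distrib, mul_add, mul_ite, mul_zero, Finset.sum_ite_eq', Finset.mem_univ, if_true]

/-- A single measure on space-time is a family with a one point parameter space, so the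
decomposition of families applies directly and no measurability in time is at stake. -/
theorem IsSpaceTimeSymGradient.exists_density {u : E d × ℝ → E d}
    {K : VectorMeasure (E d × ℝ) (EuclideanSpace ℝ ((Fin d ⊕ Unit) × (Fin d ⊕ Unit)))}
    (hK : IsSpaceTimeSymGradient 𝒟 T u K) {U : Fin d ⊕ Unit → E d × ℝ → ℝ}
    (hU : ∀ a, BddMeas (U a))
    (hUu : ∀ᵐ z ∂volume.restrict (𝒟.cyl T), ∀ a, U a z = stField u z a) :
    (singularPart K volume).variation (𝒟.cyl T)ᶜ = 0 ∧
    ∃ g : Fin d ⊕ Unit → Fin d ⊕ Unit → E d × ℝ → ℝ,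
      (∀ a b, Measurable (g a b) ∧ IntegrableOn (g a b) (𝒟.cyl T)) ∧
      ∀ a b, ∀ φ : E d × ℝ → ℝ, 𝒟.IsTimeTest T φ →
      ‖∫ z in 𝒟.cyl T, (g a b z * φ z
          + fderiv ℝ φ z ((1 / 2 : ℝ) • (U b z • stVec a + U a z • stVec b)))‖ₑ
        ≤ ∫⁻ z, ‖φ z‖ₑ ∂(singularPart K volume).variation := by
  obtain ⟨-, hle, g, hgm, hg⟩ := exists_lebesgue_decomposition (α := Unit) (Γ := fun _ => K)
    (fun _ _ _ => measurable_const) volume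
  obtain ⟨hgi, hdec, hgle⟩ := hg ()
  have hcyl := 𝒟.measurableSet_cyl T
  have hgm' : ∀ q, Measurable fun z => g q ((), z) := fun q => (hgm q).comp measurable_prodMk_left
  have hoff : ∀ q, ∀ᵐ z ∂volume, z ∉ 𝒟.cyl T → g q ((), z) = 0 := by
    intro q
    have h3 := le_antisymm ((hgle (𝒟.cyl T)ᶜ).trans hK.symGradient.concentrated.le) bot_le
    have hGm : Measurable fun z =>
        ‖(WithLp.toLp 2 fun q => g q ((), z) : EuclideanSpace ℝ ((Fin d ⊕ Unit) × (Fin d ⊕ Unit)))‖ₑ :=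
      ((PiLp.continuous_toLp 2 fun _ : (Fin d ⊕ Unit) × (Fin d ⊕ Unit) => ℝ).measurable.comp
        (measurable_pi_iff.2 hgm')).enorm
    rw [withDensity_apply _ hcyl.compl, lintegral_eq_zero_iff hGm, EventuallyEq,
      ae_restrict_iff' hcyl.compl] at h3
    filter_upwards [h3] with z hz hzc
    have h4 : (WithLp.toLp 2 fun q => g q ((), z) :
        EuclideanSpace ℝ ((Fin d ⊕ Unit) × (Fin d ⊕ Unit))) = 0 := by
      simpa using hz hzc
    exact congrArg (fun w : EuclideanSpace ℝ ((Fin d ⊕ Unit) × (Fin d ⊕ Unit)) => w q) h4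
  refine ⟨le_antisymm ((hle () _).trans hK.symGradient.concentrated.le) bot_le,
    fun a b z => g (a, b) ((), z), fun a b => ⟨hgm' _, (hgi _).integrableOn⟩, fun a b φ hφ => ?_⟩
  have h1 := enorm_vectorIntegral_sub_le (integrable_toLp hgi) hdec hφ.bddMeas
  refine le_trans (le_of_eq_of_le ?_ (enorm_le_iff_norm_le.2 (PiLp.norm_apply_le
    (∫ᵛ z, φ z ∂•K - ∫ z, φ z • (WithLp.toLp 2 fun q => g q ((), z) :
      EuclideanSpace ℝ ((Fin d ⊕ Unit) × (Fin d ⊕ Unit)))) (a, b)))) h1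
  obtain ⟨C, hC⟩ := hφ.bddMeas.bdd
  have hbi : Integrable (fun z => φ z • (WithLp.toLp 2 fun q => g q ((), z) :
      EuclideanSpace ℝ ((Fin d ⊕ Unit) × (Fin d ⊕ Unit)))) volume :=
    (integrable_toLp hgi).bdd_smul C hφ.bddMeas.measurable.aestronglyMeasurable (ae_of_all _ hC)
  have h2 : (∫ z, φ z • (WithLp.toLp 2 fun q => g q ((), z) :
      EuclideanSpace ℝ ((Fin d ⊕ Unit) × (Fin d ⊕ Unit)))) (a, b)
      = ∫ z in 𝒟.cyl T, g (a, b) ((), z) * φ z := by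
    have := (EuclideanSpace.proj (a, b) :
      EuclideanSpace ℝ ((Fin d ⊕ Unit) × (Fin d ⊕ Unit)) →L[ℝ] ℝ).integral_comp_comm hbi
    rw [setIntegral_eq_integral_of_ae_compl_eq_zero
      ((hoff (a, b)).mono fun z hz hzc => by rw [hz hzc, zero_mul])]
    simpa [mul_comm] using this.symm
  have hD : ∀ a b, IntegrableOn (fun z => U a z * fderiv ℝ φ z (stVec b)) (𝒟.cyl T) := fun a b =>
    (hU a).integrable_mul (hφ.fderiv_integrableOn _)
  have e : ∀ z, fderiv ℝ φ z ((1 / 2 : ℝ) • (U b z • stVec a + U a z • stVec b))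
      = (U b z * fderiv ℝ φ z (stVec a) + U a z * fderiv ℝ φ z (stVec b)) / 2 := fun z => by
    simp only [map_add, map_smul, smul_eq_mul]; ring
  have hDs : IntegrableOn (fun z => (U b z * fderiv ℝ φ z (stVec a)
      + U a z * fderiv ℝ φ z (stVec b)) / 2) (𝒟.cyl T) := ((hD b a).add (hD a b)).div_const 2
  simp_rw [e]
  rw [PiLp.sub_apply, h2, hK.symGradient.weak_eq φ hφ a b,
    integral_add ((hφ.bddMeas.integrable_mul (hgi (a, b)).integrableOn).congr
      (ae_of_all _ fun z => mul_comm _ _)) hDs, ← enorm_neg]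
  congr 1
  have e2 : ∫ z in 𝒟.cyl T, (stField u z b * fderiv ℝ φ z (stVec a)
      + stField u z a * fderiv ℝ φ z (stVec b)) / 2
      = ∫ z in 𝒟.cyl T, (U b z * fderiv ℝ φ z (stVec a) + U a z * fderiv ℝ φ z (stVec b)) / 2 :=
    integral_congr_ae (hUu.mono fun z hz => by simp only [hz])
  rw [e2]; ring

theorem Localization.isSymDerivUpTo {O : Set (E d × ℝ)} {S : Finset (E d × ℝ)}
    (hL : Localization 𝒟 T O S) {ι : Type*} {dir : ι → E d × ℝ} {U U' : ι → E d × ℝ → ℝ}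
    (hU' : ∀ a, BddMeas (U' a))
    (hUU' : ∀ a, ∀ z ∈ 𝒟.cyl T, ∀ k ∈ S, z + k ∈ O → U' a (z + k) = U a z)
    {g : ι → ι → E d × ℝ → ℝ} (hg : ∀ a b, IntegrableOn (g a b) (𝒟.cyl T))
    {μ : Measure (E d × ℝ)} (hμ : μ (𝒟.cyl T)ᶜ = 0)
    (hder : ∀ a b, ∀ φ : E d × ℝ → ℝ, 𝒟.IsTimeTest T φ →
      ‖∫ z in 𝒟.cyl T, (g a b z * φ z
          + fderiv ℝ φ z ((1 / 2 : ℝ) • (U b z • dir a + U a z • dir b)))‖ₑ ≤ ∫⁻ z, ‖φ z‖ₑ ∂μ) :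
    IsSymDerivUpTo O dir U' (fun a b => extend (𝒟.cyl T) O S (g a b))
      (tileMeasure (𝒟.cyl T) S μ) := by
  intro ψ hψ a b
  have h1 : Integrable fun z => (U' b z * fderiv ℝ ψ z (dir a) + U' a z * fderiv ℝ ψ z (dir b)) / 2 :=
    (((hU' b).integrable_mul (hψ.fderiv_integrable _)).add
      ((hU' a).integrable_mul (hψ.fderiv_integrable _))).div_const 2
  have h2 := hψ.bddMeas.integrable_mul (hL.integrable_extend (S := S) (hg a b))
  have e : ∀ z, (U' b z * fderiv ℝ ψ z (dir a) + U' a z * fderiv ℝ ψ z (dir b)) / 2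
      + ψ z * extend (𝒟.cyl T) O S (g a b) z = extend (𝒟.cyl T) O S (g a b) z * ψ z
        + fderiv ℝ ψ z ((1 / 2 : ℝ) • (U' b z • dir a + U' a z • dir b)) := fun z => by
    simp only [map_add, map_smul, smul_eq_mul]; ring
  rw [← integral_add h1 h2, integral_congr_ae (ae_of_all _ e)]
  refine hL.enorm_le hμ (hder a b) (fun z hz k hk hzk => hL.extend_add hz hk hzk _)
    (fun z hz k hk hzk => ?_) hψ ((h1.add h2).congr (ae_of_all _ e))
  rw [hUU' a z hz k hk hzk, hUU' b z hz k hk hzk]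

end Gradients

/-! ### The estimates on the region -/

section Estimates

variable {d : ℕ} {𝒟 : FlowDomain d} {T : ℝ}

theorem integrableOn_cylinderDefect {c M : ℝ} {ρ p : E d × ℝ → ℝ} {v f : Fin d → E d × ℝ → ℝ}
    (h : CylinderSolution 𝒟 T c M ρ p v f) {φ : E d × ℝ → ℝ} (hφ : 𝒟.IsTimeTest T φ) :
    IntegrableOn (fun z => (2 * ∑ i, f i z * v i z) * φ z + fderiv ℝ φ z
      ((∑ i, ρ z * v i z * v i z) • (field spaceDir v z + (0, 1)) + (2 * p z) • field spaceDir v z))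
      (𝒟.cyl T) := by
  have hv : ∀ i, BddMeas (v i) := fun i => ⟨h.velocity_measurable i, M, h.velocity_le i⟩
  have hρ : BddMeas ρ := ⟨h.density_measurable, M, fun z => by
    have := h.density_mem z
    rw [abs_of_nonneg (h.c_pos.le.trans this.1)]
    exact this.2⟩
  have hp : BddMeas p := ⟨h.pressure_measurable, M, h.pressure_le⟩
  have hD := hφ.integrableOn_fderiv_field (e := spaceDir) hv
  have h1 : IntegrableOn (fun z => ∑ i, v i z * f i z) (𝒟.cyl T) :=
    integrable_finsetSum _ fun i _ => (hv i).integrable_mul (h.force_integrable i)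
  have h2 : BddMeas fun z => ∑ i, ρ z * v i z * v i z :=
    BddMeas.sum _ fun i => (hρ.mul (hv i)).mul (hv i)
  have h3 := h2.integrable_mul (hD.add (hφ.fderiv_integrableOn (0, 1)))
  have h4 := ((BddMeas.const 2).mul hp).integrable_mul hD
  have h5 := ((BddMeas.const 2).mul hφ.bddMeas).integrable_mul h1
  refine (h5.add (h3.add h4)).congr (ae_of_all _ fun z => ?_)
  have e : ∑ i, v i z * f i z = ∑ i, f i z * v i z :=
    Finset.sum_congr rfl fun i _ => mul_comm _ _
  simp only [Pi.add_apply, map_add, map_smul, smul_eq_mul, e]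
  ring

/-- A dominated Duchon-Robert distribution is a measure. -/
theorem CylinderSolution.exists_measure {c M : ℝ} {ρ p : E d × ℝ → ℝ}
    {v f : Fin d → E d × ℝ → ℝ} (h : CylinderSolution 𝒟 T c M ρ p v f)
    {D : (E d × ℝ → ℝ) → ℝ}
    (hD : ∀ φ : E d × ℝ → ℝ, 𝒟.IsTimeTest T φ → cylinderDefect 𝒟 T ρ p v f φ = 2 * D φ)
    {μ : Measure (E d × ℝ)} [IsFiniteMeasure μ] (hμ : μ (𝒟.cyl T)ᶜ = 0)
    (hle : ∀ φ : E d × ℝ → ℝ, 𝒟.IsTimeTest T φ →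
      ‖cylinderDefect 𝒟 T ρ p v f φ‖ₑ ≤ ∫⁻ z, ‖φ z‖ₑ ∂μ) :
    ∃ δ : SignedMeasure (E d × ℝ), IsRepresentedBy 𝒟 T D δ ∧ δ.variation ≤ μ := by
  have hDeq : ∀ φ : E d × ℝ → ℝ, 𝒟.IsTimeTest T φ → D φ = cylinderDefect 𝒟 T ρ p v f φ / 2 :=
    fun φ hφ => by rw [hD φ hφ]; ring
  have hdiff : ∀ {φ : E d × ℝ → ℝ}, 𝒟.IsTimeTest T φ → ∀ z, DifferentiableAt ℝ φ z :=
    fun hφ z => hφ.contDiff.differentiable (by simp) z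
  obtain ⟨θ, hθm, hθ1, hθ⟩ := exists_density_of_abs_le μ (fun φ : E d × ℝ → ℝ => 𝒟.IsTimeTest T φ) D
    (fun φ ψ hφ hψ => ⟨hφ.add hψ, by
      rw [hDeq _ (hφ.add hψ), hDeq _ hφ, hDeq _ hψ, ← add_div]
      congr 1
      rw [cylinderDefect, cylinderDefect, cylinderDefect,
        ← integral_add (integrableOn_cylinderDefect h hφ) (integrableOn_cylinderDefect h hψ)]
      refine integral_congr_ae (ae_of_all _ fun z => ?_)
      simp only [fderiv_add (hdiff hφ z) (hdiff hψ z), Pi.add_apply, _root_.add_apply]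
      ring⟩)
    (fun r φ hφ => ⟨hφ.smul r, by
      rw [hDeq _ (hφ.smul r), hDeq _ hφ, ← mul_div_assoc]
      congr 1
      rw [cylinderDefect, cylinderDefect, ← integral_const_mul]
      refine integral_congr_ae (ae_of_all _ fun z => ?_)
      simp only [fderiv_const_smul (hdiff hφ z), Pi.smul_apply, _root_.smul_apply, smul_eq_mul]
      ring⟩)
    (fun φ hφ => hφ.bddMeas.measurable) (fun φ hφ => hφ.bddMeas.bdd)
    (fun φ hφ => by
      have hi : Integrable φ μ := hφ.bddMeas.integrable μ
      have h2 := (enorm_le_lintegral_iff hi _).1 (hle φ hφ)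
      -- The defect is twice the distribution `D`; the factor two is discarded.
      rw [hD φ hφ, abs_mul, abs_two] at h2
      linarith [abs_nonneg (D φ)])
  have hθi : Integrable θ μ := Integrable.of_bound hθm.aestronglyMeasurable 1 (ae_of_all _ hθ1)
  have hvar : (μ.withDensityᵥ θ).variation ≤ μ := by
    rw [Measure.variation_withDensityᵥ hθi]
    refine (withDensity_mono (ae_of_all _ fun z => ?_)).trans_eq withDensity_one
    rw [Pi.one_apply, ← ofReal_norm, ← ENNReal.ofReal_one]
    exact ENNReal.ofReal_le_ofReal (hθ1 z)
  refine ⟨μ.withDensityᵥ θ, ⟨le_antisymm ((hvar _).trans hμ.le) bot_le, fun φ hφ => ?_⟩, hvar⟩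
  rw [hθ φ hφ, vectorIntegral_withDensity hθi hφ.bddMeas]
  rfl

/-- The translates of `|ψ|` sum exactly to `|φ|` on the region, so integration against the tiled
measure returns at most the original integral. -/
theorem lintegral_tileMeasure_le {S : Finset (E d × ℝ)} {φ ψ : E d × ℝ → ℝ} (hψ : Measurable ψ)
    (h : ∀ z ∈ 𝒟.cyl T, ‖φ z‖ₑ = ∑ k ∈ S, ‖ψ (z + k)‖ₑ) (μ : Measure (E d × ℝ)) :
    ∫⁻ z, ‖ψ z‖ₑ ∂(tileMeasure (𝒟.cyl T) S μ) ≤ ∫⁻ z, ‖φ z‖ₑ ∂μ := by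
  rw [lintegral_tileMeasure _ _ _ hψ.enorm]
  refine le_trans (le_of_eq ?_) (setLIntegral_le_lintegral (𝒟.cyl T) _)
  exact setLIntegral_congr_fun (𝒟.measurableSet_cyl T) fun z hz => (h z hz).symm

namespace CylinderSolution

variable {c M : ℝ} {ρ p : E d × ℝ → ℝ} {v f : Fin d → E d × ℝ → ℝ}
  (h : CylinderSolution 𝒟 T c M ρ p v f)
  {G : Fin d → E d × ℝ → ℝ} (hG : ∀ j, Measurable (G j) ∧ IntegrableOn (G j) (𝒟.cyl T))
  {μ : Measure (E d × ℝ)} [IsFiniteMeasure μ] (hμ : μ (𝒟.cyl T)ᶜ = 0)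
  (hder : ∀ j, ∀ φ : E d × ℝ → ℝ, 𝒟.IsTimeTest T φ →
    ‖∫ z in 𝒟.cyl T, (G j z * φ z + fderiv ℝ φ z (ρ z • spaceDir j))‖ₑ ≤ ∫⁻ z, ‖φ z‖ₑ ∂μ)
include h hG hμ hder

theorem enorm_cylinderDefect_le_of_gradient {ν : Fin d → Measure (E d × ℝ)}
    [∀ j, IsFiniteMeasure (ν j)] (hν : ∀ j, ν j (𝒟.cyl T)ᶜ = 0) {g : Fin d → Fin d → E d × ℝ → ℝ}
    (hg : ∀ j l, Measurable (g j l) ∧ IntegrableOn (g j l) (𝒟.cyl T))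
    (hgrad : ∀ j l, ∀ φ : E d × ℝ → ℝ, 𝒟.IsTimeTest T φ →
      ‖∫ z in 𝒟.cyl T, (g j l z * φ z + fderiv ℝ φ z (v j z • spaceDir l))‖ₑ
        ≤ ∫⁻ z, ‖φ z‖ₑ ∂(ν j))
    {φ : E d × ℝ → ℝ} (hφ : 𝒟.IsTimeTest T φ) :
    ‖cylinderDefect 𝒟 T ρ p v f φ‖ₑ
      ≤ (LocalSolution.chainConst d c M + LocalSolution.kernelConst d c M) * ∫⁻ z, ‖φ z‖ₑ ∂μ := by
  obtain ⟨O, S, ψ, hL, hψ, hlift, hnorm⟩ := FlowDomain.exists_localization hφ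
  have hgm : ∀ j l, Measurable fun z => ‖extend (𝒟.cyl T) O S (g j l) z‖ₑ := fun j l =>
    (hL.measurable_extend (hg j l).1).enorm
  have hgf : ∀ j l, IsFiniteMeasure
      ((volume : Measure (E d × ℝ)).withDensity fun z => ‖extend (𝒟.cyl T) O S (g j l) z‖ₑ) :=
    fun j l => isFiniteMeasure_withDensity (hL.integrable_extend (hg j l).2).2.ne
  rw [← h.energyDefect_eq hL hψ hlift]
  -- The dominating measure collects the singular parts and the absolutely continuous parts of all
  -- velocity gradients. Only its finiteness matters, since it does not appear in the conclusion.
  refine ((h.localSolution hL).enorm_energyDefect_le_of_gradient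
    (fun j => hL.measurable_extend (hG j).1) (fun j => hL.integrable_extend (hG j).2)
    (fun j => h.isDerivUpTo_density hL (hG j).2 hμ (hder j))
    (ν := ∑ j, ∑ l, (tileMeasure (𝒟.cyl T) S (ν j)
      + volume.withDensity fun z => ‖extend (𝒟.cyl T) O S (g j l) z‖ₑ))
    (fun j l χ hχ => ?_) hψ).trans
    (mul_le_mul' le_rfl (lintegral_tileMeasure_le hψ.1.continuous.measurable hnorm μ))
  have hDi := (h.velocity_bddMeas hL j).integrable_mul (hχ.fderiv_integrable (spaceDir l))
  have hgi := hχ.bddMeas.integrable_mul (hL.integrable_extend (S := S) (hg j l).2)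
  have e : ∀ z, extend (𝒟.cyl T) O S (g j l) z * χ z
      + fderiv ℝ χ z (extend (𝒟.cyl T) O S (v j) z • spaceDir l)
      = extend (𝒟.cyl T) O S (v j) z * fderiv ℝ χ z (spaceDir l)
        + χ z * extend (𝒟.cyl T) O S (g j l) z := fun z => by
    rw [map_smul, smul_eq_mul]; ring
  have h1 := hL.enorm_le (hν j) (hgrad j l) (a' := extend (𝒟.cyl T) O S (g j l))
    (b' := fun z => extend (𝒟.cyl T) O S (v j) z • spaceDir l)
    (fun z hz k hk hzk => hL.extend_add hz hk hzk _)
    (fun z hz k hk hzk => by rw [hL.extend_add hz hk hzk]) hχ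
    ((hDi.add hgi).congr (ae_of_all _ fun z => (e z).symm))
  rw [integral_congr_ae (ae_of_all _ e), integral_add hDi hgi] at h1
  have h2 : ‖∫ z, χ z * extend (𝒟.cyl T) O S (g j l) z‖ₑ
      ≤ ∫⁻ z, ‖χ z‖ₑ ∂(volume.withDensity fun z => ‖extend (𝒟.cyl T) O S (g j l) z‖ₑ) := by
    rw [lintegral_withDensity_eq_lintegral_mul _ (hgm j l) hχ.bddMeas.measurable.enorm]
    refine (enorm_integral_le_lintegral_enorm _).trans (le_of_eq (lintegral_congr fun z => ?_))
    rw [enorm_mul, Pi.mul_apply, mul_comm]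
  have h3 : tileMeasure (𝒟.cyl T) S (ν j)
      + volume.withDensity (fun z => ‖extend (𝒟.cyl T) O S (g j l) z‖ₑ)
      ≤ ∑ j, ∑ l, (tileMeasure (𝒟.cyl T) S (ν j)
        + volume.withDensity fun z => ‖extend (𝒟.cyl T) O S (g j l) z‖ₑ) := by
    refine Measure.le_iff.2 fun A _ => ?_
    simp only [Measure.finsetSum_apply]
    refine le_trans ?_ (Finset.single_le_sum (f := fun j => ∑ l, (tileMeasure (𝒟.cyl T) S (ν j)
        + volume.withDensity fun z => ‖extend (𝒟.cyl T) O S (g j l) z‖ₑ) A) (fun _ _ => zero_le)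
        (Finset.mem_univ j))
    exact Finset.single_le_sum (f := fun l => (tileMeasure (𝒟.cyl T) S (ν j)
        + volume.withDensity fun z => ‖extend (𝒟.cyl T) O S (g j l) z‖ₑ) A) (fun _ _ => zero_le)
        (Finset.mem_univ l)
  refine le_trans ?_ (lintegral_mono' h3 le_rfl)
  rw [lintegral_add_measure]
  refine le_trans ?_ (add_le_add h1 h2)
  refine le_trans (le_of_eq ?_) (enorm_sub_le (a := (∫ z, extend (𝒟.cyl T) O S (v j) z *
    fderiv ℝ χ z (spaceDir l)) + ∫ z, χ z * extend (𝒟.cyl T) O S (g j l) z)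
    (b := ∫ z, χ z * extend (𝒟.cyl T) O S (g j l) z))
  rw [add_sub_cancel_right]

theorem enorm_cylinderDefect_le_of_symGradient {ν : Measure (E d × ℝ)} [IsFiniteMeasure ν]
    (hν : ν (𝒟.cyl T)ᶜ = 0) {g : Fin d → Fin d → E d × ℝ → ℝ}
    (hg : ∀ i j, Measurable (g i j) ∧ IntegrableOn (g i j) (𝒟.cyl T))
    (hsym : ∀ i j, ∀ φ : E d × ℝ → ℝ, 𝒟.IsTimeTest T φ →
      ‖∫ z in 𝒟.cyl T, (g i j z * φ z
          + fderiv ℝ φ z ((1 / 2 : ℝ) • (v j z • spaceDir i + v i z • spaceDir j)))‖ₑ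
        ≤ ∫⁻ z, ‖φ z‖ₑ ∂ν)
    {φ : E d × ℝ → ℝ} (hφ : 𝒟.IsTimeTest T φ) :
    ‖cylinderDefect 𝒟 T ρ p v f φ‖ₑ
      ≤ (LocalSolution.chainConst d c M + LocalSolution.kernelConst d c M) * ∫⁻ z, ‖φ z‖ₑ ∂μ
        + commConst d c M * radialConst d * ∫⁻ z, ‖φ z‖ₑ ∂ν := by
  obtain ⟨O, S, ψ, hL, hψ, hlift, hnorm⟩ := FlowDomain.exists_localization hφ
  rw [← h.energyDefect_eq hL hψ hlift]
  have hloc := h.localSolution hL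
  -- Nothing is known about time derivatives of the velocity, so time is contracted faster than
  -- space.
  obtain ⟨A, ε, σ, hA⟩ := exists_anisotropic_rescaling hloc.velocity_integrable one_pos
  refine (hloc.enorm_energyDefect_le_of_isSymDerivUpTo hψ
    (fun j => hL.measurable_extend (hG j).1) (fun j => hL.integrable_extend (hG j).2)
    (fun j => h.isDerivUpTo_density hL (hG j).2 hμ (hder j)) (by simp)
    (h.velocity_bddMeas hL) (fun a b => hL.measurable_extend (hg a b).1)
    (fun a b => hL.integrable_extend (hg a b).2)
    (hL.isSymDerivUpTo (h.velocity_bddMeas hL) (fun a z hz k hk hzk => hL.extend_add hz hk hzk _)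
      (fun a b => (hg a b).2) hν hsym)
    (x := fun a w => w.1 a) (fun a w => (PiLp.norm_apply_le w.1 a).trans (norm_fst_le w))
    (fun w => ?_) (t := fun _ => 0) (fun w z => ?_) hA).trans
    (add_le_add (mul_le_mul' le_rfl (lintegral_tileMeasure_le hψ.1.continuous.measurable hnorm μ))
      (mul_le_mul' le_rfl (lintegral_tileMeasure_le hψ.1.continuous.measurable hnorm ν)))
  · rw [field_spaceDir]
    simp
  · rw [field, field_spaceDir]
    simp [PiLp.inner_apply, mul_comm]

theorem enorm_cylinderDefect_le_of_spaceTimeSymGradient {ν : Measure (E d × ℝ)}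
    [IsFiniteMeasure ν] (hν : ν (𝒟.cyl T)ᶜ = 0)
    {g : Fin d ⊕ Unit → Fin d ⊕ Unit → E d × ℝ → ℝ}
    (hg : ∀ a b, Measurable (g a b) ∧ IntegrableOn (g a b) (𝒟.cyl T))
    (hsym : ∀ a b, ∀ φ : E d × ℝ → ℝ, 𝒟.IsTimeTest T φ →
      ‖∫ z in 𝒟.cyl T, (g a b z * φ z + fderiv ℝ φ z ((1 / 2 : ℝ) •
          (Sum.elim (fun i => v i z) (fun _ => 1) b • stVec a
            + Sum.elim (fun i => v i z) (fun _ => 1) a • stVec b)))‖ₑ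
        ≤ ∫⁻ z, ‖φ z‖ₑ ∂ν)
    {φ : E d × ℝ → ℝ} (hφ : 𝒟.IsTimeTest T φ) :
    ‖cylinderDefect 𝒟 T ρ p v f φ‖ₑ
      ≤ (LocalSolution.chainConst d c M + LocalSolution.kernelConst d c M) * ∫⁻ z, ‖φ z‖ₑ ∂μ
        + commConst d c M * radialConst d * ∫⁻ z, ‖φ z‖ₑ ∂ν := by
  obtain ⟨O, S, ψ, hL, hψ, hlift, hnorm⟩ := FlowDomain.exists_localization hφ
  rw [← h.energyDefect_eq hL hψ hlift]
  have hloc := h.localSolution hL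
  -- Only the space-time deformation is a measure here, and it controls derivatives along full
  -- space-time displacements; hence the rescaling is isotropic.
  obtain ⟨A, ε, σ, hA⟩ := exists_isotropic_rescaling
    (v := fun i => extend (𝒟.cyl T) O S (v i)) 1
  set U : Fin d ⊕ Unit → E d × ℝ → ℝ := fun a z =>
    Sum.elim (fun i => extend (𝒟.cyl T) O S (v i) z) (fun _ => 1) a with hU
  have hUb : ∀ a, BddMeas (U a) := by
    rintro (i | i)
    · exact h.velocity_bddMeas hL i
    · exact .const 1
  refine (hloc.enorm_energyDefect_le_of_isSymDerivUpTo hψ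
    (fun j => hL.measurable_extend (hG j).1) (fun j => hL.integrable_extend (hG j).2)
    (fun j => h.isDerivUpTo_density hL (hG j).2 hμ (hder j)) (by simp)
    hUb (fun a b => hL.measurable_extend (hg a b).1)
    (fun a b => hL.integrable_extend (hg a b).2)
    (hL.isSymDerivUpTo hUb (U := fun a z => Sum.elim (fun i => v i z) (fun _ => 1) a)
      (fun a z hz k hk hzk => ?_) (fun a b => (hg a b).2) hν hsym)
    (x := fun a w => Sum.elim (fun i => w.1 i) (fun _ => w.2) a) (fun a w => ?_)
    -- The pairing of the displacement with `(u, 1)` exceeds the pairing with `(u, 0)` by the time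
    -- displacement.
    (fun w => ?_) (t := fun w => w.2) (fun w z => ?_) hA).trans
    (add_le_add (mul_le_mul' le_rfl (lintegral_tileMeasure_le hψ.1.continuous.measurable hnorm μ))
      (mul_le_mul' le_rfl (lintegral_tileMeasure_le hψ.1.continuous.measurable hnorm ν)))
  · rcases a with i | i
    · exact hL.extend_add hz hk hzk _
    · rfl
  · rcases a with i | i
    · exact (PiLp.norm_apply_le w.1 i).trans (norm_fst_le w)
    · exact norm_snd_le w
  · have hw := field_spaceDir fun i => w.1 i
    unfold spaceDir at hw
    simp only [Fintype.sum_sum_type, stVec, Sum.elim_inl, Sum.elim_inr, Finset.univ_unique,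
      Finset.sum_singleton, hw]
    simp
  · rw [field, field_spaceDir]
    simp [PiLp.inner_apply, mul_comm, hU, Fintype.sum_sum_type]

end CylinderSolution

/-- The constant of the estimates. -/
noncomputable def defectConst (d : ℕ) (c M : ℝ) : ℝ≥0 :=
  (LocalSolution.chainConst d c M + LocalSolution.kernelConst d c M
    + commConst d c M * radialConst d).toNNReal

theorem coe_defectConst (c M : ℝ) : (defectConst d c M : ℝ≥0∞) = LocalSolution.chainConst d c M
    + LocalSolution.kernelConst d c M + commConst d c M * radialConst d := by
  refine ENNReal.coe_toNNReal ?_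
  have := radialConst_ne_top (d := d)
  unfold LocalSolution.chainConst LocalSolution.kernelConst commConst
  finiteness

theorem lintegral_le_defectConst_smul (c M : ℝ) (μ : Measure (E d × ℝ)) (φ : E d × ℝ → ℝ≥0∞) :
    (LocalSolution.chainConst d c M + LocalSolution.kernelConst d c M) * ∫⁻ z, φ z ∂μ
      ≤ ∫⁻ z, φ z ∂(defectConst d c M • μ) := by
  rw [lintegral_smul_measure, ENNReal.smul_def, smul_eq_mul, coe_defectConst]
  exact mul_le_mul' le_self_add le_rfl

theorem add_lintegral_le_defectConst_smul (c M : ℝ) (μ ν : Measure (E d × ℝ))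
    (φ : E d × ℝ → ℝ≥0∞) :
    (LocalSolution.chainConst d c M + LocalSolution.kernelConst d c M) * ∫⁻ z, φ z ∂μ
        + commConst d c M * radialConst d * ∫⁻ z, φ z ∂ν
      ≤ ∫⁻ z, φ z ∂(defectConst d c M • (μ + ν)) := by
  rw [lintegral_smul_measure, ENNReal.smul_def, smul_eq_mul, coe_defectConst,
    lintegral_add_measure, mul_add]
  exact add_le_add (mul_le_mul' le_self_add le_rfl) (mul_le_mul' le_add_self le_rfl)

end Estimates

end InhomEuler

/-! ### The theorem -/

theorem theorem3p1 (d : ℕ) (hd : 1 ≤ d) (c : ℝ) (hc : 0 < c) (M : ℝ≥0) :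
    -- one constant, which depends only on `d`, the lower bound `c` of the density and the bound `M`
    ∃ C : ℝ≥0, ∀ (𝒟 : InhomEuler.FlowDomain d) (T : ℝ), 0 < T →
      ∀ (ρ : InhomEuler.E d × ℝ → ℝ) (u : InhomEuler.E d × ℝ → InhomEuler.E d)
        (p : InhomEuler.E d × ℝ → ℝ) (f : InhomEuler.E d × ℝ → InhomEuler.E d),
      InhomEuler.IsWeakSolution 𝒟 T ρ u p f →
      eLpNorm ρ ⊤ (volume.restrict (𝒟.cyl T)) ≤ M →
      eLpNorm u ⊤ (volume.restrict (𝒟.cyl T)) ≤ M →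
      eLpNorm p ⊤ (volume.restrict (𝒟.cyl T)) ≤ M →
      -- no vacuum
      (∀ᵐ z ∂volume.restrict (𝒟.cyl T), c ≤ ρ z) →
      -- the density has spatial gradient `G t = ∇ρ_t`
      ∀ G : ℝ → VectorMeasure (InhomEuler.E d) (EuclideanSpace ℝ (Fin d)),
      InhomEuler.IsGradientCurve 𝒟 T ρ G →
      -- (i) the velocity has bounded variation in space
      ((∀ i : Fin d, ∃ V : ℝ → VectorMeasure (InhomEuler.E d) (EuclideanSpace ℝ (Fin d)),
          InhomEuler.IsGradientCurve 𝒟 T (fun z => u z i) V) →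
        ∃ δ : SignedMeasure (InhomEuler.E d × ℝ),
          InhomEuler.IsRepresentedBy 𝒟 T (InhomEuler.duchonRobert 𝒟 T ρ u p f) δ ∧
          δ.variation ≤ C • InhomEuler.singTensorTime T G) ∧
      -- (ii) the velocity has bounded deformation in space, with `H t = E u_t`
      (∀ H : ℝ → VectorMeasure (InhomEuler.E d) (EuclideanSpace ℝ (Fin d × Fin d)),
        InhomEuler.IsSymGradientCurve 𝒟 T u H →
        ∃ δ : SignedMeasure (InhomEuler.E d × ℝ),
          InhomEuler.IsRepresentedBy 𝒟 T (InhomEuler.duchonRobert 𝒟 T ρ u p f) δ ∧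
          δ.variation ≤
            C • (InhomEuler.singTensorTime T G + InhomEuler.singTensorTime T H)) ∧
      -- (iii) the velocity has bounded deformation in space-time, with `K = E_{x,t}(u, 1)`
      (∀ K : VectorMeasure (InhomEuler.E d × ℝ)
          (EuclideanSpace ℝ ((Fin d ⊕ Unit) × (Fin d ⊕ Unit))),
        InhomEuler.IsSpaceTimeSymGradient 𝒟 T u K →
        ∃ δ : SignedMeasure (InhomEuler.E d × ℝ),
          InhomEuler.IsRepresentedBy 𝒟 T (InhomEuler.duchonRobert 𝒟 T ρ u p f) δ ∧
          δ.variation ≤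
            C • (InhomEuler.singTensorTime T G
              + (InhomEuler.singularPart K volume).variation)) := by
  -- The constant is that of the truncated solution, whose upper bound is `max M c`; one constant
  -- serves all three parts because the commutator contribution is simply added.
  refine ⟨InhomEuler.defectConst d c (max M c), fun 𝒟 T _ ρ u p f hw hρ hu hp hvac G hG => ?_⟩
  obtain ⟨ρ', p', v, f', h, hρ', hv', hD⟩ := hw.exists_cylinderSolution hc hρ hu hp hvac
  have hvb : ∀ i, InhomEuler.BddMeas (v i) := fun i => ⟨h.velocity_measurable i, _, h.velocity_le i⟩
  have hρb : InhomEuler.BddMeas ρ' := ⟨h.density_measurable, max M c, fun z => by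
    have := h.density_mem z
    rw [abs_of_nonneg (hc.le.trans this.1)]
    exact this.2⟩
  obtain ⟨hGf, hGc, g, hg, hder⟩ := hG.exists_density hρb hρ'
  refine ⟨fun hV => ?_, fun H hH => ?_, fun K hK => ?_⟩
  -- The gradients of the components of the velocity enter only as finite measures that dominate its
  -- derivatives.
  · choose V hV using hV
    choose hVf hVc k hk hgrad using fun j => (hV j).exists_density (hvb j)
      (hv'.mono fun z hz => hz j)
    refine h.exists_measure hD (by simp [hGc]) fun φ hφ => ?_
    exact (h.enorm_cylinderDefect_le_of_gradient hg hGc hder hVc hk hgrad hφ).trans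
      (InhomEuler.lintegral_le_defectConst_smul _ _ _ _)
  · obtain ⟨hHf, hHc, k, hk, hsym⟩ := hH.exists_density hvb hv'
    refine h.exists_measure hD (by simp [hGc, hHc]) fun φ hφ => ?_
    exact (h.enorm_cylinderDefect_le_of_symGradient hg hGc hder hHc hk hsym hφ).trans
      (InhomEuler.add_lintegral_le_defectConst_smul _ _ _ _ _)
  · obtain ⟨hKc, k, hk, hsym⟩ := hK.exists_density
      (U := fun a z => Sum.elim (fun i => v i z) (fun _ => 1) a)
      (by
        rintro (i | i)
        · exact hvb i
        · exact .const 1)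
      (by
        filter_upwards [hv'] with z hz
        rintro (i | i)
        · exact hz i
        · rfl)
    refine h.exists_measure hD (by simp [hGc, hKc]) fun φ hφ => ?_
    exact (h.enorm_cylinderDefect_le_of_spaceTimeSymGradient hg hGc hder hKc hk hsym hφ).trans
      (InhomEuler.add_lintegral_le_defectConst_smul _ _ _ _ _)
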